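/- Let $(\Omega,\mathcal F,\mathbb P)$ be a probability space; every $\sigma$-field generated by random variables below is completed with the $\mathbb P$-null sets. For each $n\ge 1$ let $(Z_n,\mathcal Z_n)$ be a standard Borel space with a non-atomic $\sigma$-finite measure $\mu_n$, and let $M_n=\{M_n(B):B\in\mathcal Z_n,\ \mu_n(B)<\infty\}$ be an independently scattered random measure on $\Omega$ with control $\mu_n$: $M_n(B)\in L^2(\mathbb P)$, the variables $M_n(B_1),\dots,M_n(B_k)$ are independent for disjoint $B_1,\dots,B_k$, and $\mathbb E[M_n(B)M_n(C)]=\mu_n(B\cap C)$. For $d\geq 1$ let $L^2_{s,0}(\mu_n^d)$ be the class of symmetric square integrable functions on $Z_n^d$ vanishing on diagonals (i.e. whenever two coordinates coincide), and let $I^{M_n}_d(f)$, $f\in L^2_{s,0}(\mu_n^d)$, be the multiple integral of order $d$: the linear, $L^2$-continuous extension of $\sum_{\sigma\in\mathfrak S_d}\prod_i\mathbf 1_{B_i}(z_{\sigma(i)})\mapsto d!\,M_n(B_1)\cdots M_n(B_d)$, $B_1,\dots,B_d$ disjoint of finite measure. Put $X_{M_n}(h)=I_1^{M_n}(h)$ for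 $h\in L^2(\mu_n)$. Let $Z_{n,t}$, $t\in[0,1]$, be measurable subsets of $Z_n$, increasing in $t$, with $Z_{n,0}=\varnothing$, $Z_{n,1}=Z_n$ and $\lim_{s\to t}\int_{Z_{n,s}}g\,d\mu_n=\int_{Z_{n,t}}g\,d\mu_n$ for all $g\in L^1(\mu_n)$ and $t\in[0,1]$. Put $\mathcal F^{(n)}_t=\sigma\{X_{M_n}(\mathbf 1_{Z_{n,t}}h):h\in L^2(\mu_n)\}$ and write $z\prec_n z'$ if $z\in Z_{n,q}$ and $z'\notin Z_{n,q}$ for some $q\in\mathbb Q\cap(0,1)$. Let $\sigma^2_{n}:Z_n\to[0,\infty)$ be measurable and let $\rho_{n}$ be a measurable kernel of Lévy measures with $\int x^2\rho_n(z,dx)<\infty$ for every $z$, such that for every $B$ of finite measure the Lévy-Khintchine pair (Gaussian variance, Lévy measure) of $M_n(B)$ is $\left(\int_B\sigma_n^2\,d\mu_n,\ \int_B\rho_n(z,\cdot)\,\mu_n(dz)\right)$ (such a pair exists and is unique up to $\mu_n$-null sets), and put $$K_{\mu_n}(r,z)=-\tfrac{r^2}{2}\sigma_n^2(z)+\int_{\mathbb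 R}(e^{irx}-1-irx)\,\rho_n(z,dx).$$ Let $d_n\ge1$ be integers and $f_n\in L^2_{s,0}(\mu_n^{d_n})$. If $d_n=1$ put $h_n=f_n$. If $d_n\ge2$ let $h_n$ be the jointly measurable version of the process $$h_n(z)=d_n\,I^{M_n}_{d_n-1}\Big(f_n(z,\cdot)\prod_{j=1}^{d_n-1}\mathbf 1(z_j\prec_n z)\Big),\qquad z\in Z_n .$$ Suppose there are $t_n\in[0,1]$ and $\sigma$-fields $\mathcal U_n$, $n\geq 1$, with $$\lim_{n\to\infty}d_n!\,\big\|f_n\mathbf 1_{Z_{n,t_n}^{d_n}}\big\|^2_{L^2(\mu_n^{d_n})}=0,\qquad \mathcal U_n\subseteq\mathcal U_{n+1}\cap\mathcal F^{(n)}_{t_n}\quad\text{for all }n .$$ Let $\mathcal U^*=\bigvee_n\mathcal U_n$. Let $\mu$ be a random probability measure on $\mathbb R$ (a map $\omega\mapsto\mu(\cdot,\omega)$ such that $\mu(C,\cdot)$ is a random variable for every Borel set $C$ and $\mu(\cdot,\omega)$ is a probability for a.e. $\omega$), and let $\phi:\mathbb R\times\Omega\to\mathbb C$ be measurable such that, for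 a.e. $\omega$, $\phi(\lambda,\omega)=\int e^{i\lambda x}\mu(dx,\omega)\neq0$ for all $\lambda\in\mathbb R$; assume that $\phi(\lambda)$ is $\mathcal U^*$-measurable for every $\lambda$. If, for every $\lambda\in\mathbb R$, in probability as $n\to\infty$, $$\exp\Big[\int_{Z_n}K_{\mu_n}\big(\lambda h_n(z),z\big)\,\mu_n(dz)\Big]\longrightarrow\phi(\lambda),$$ then, for every $\lambda\in\mathbb R$, in probability as $n\to\infty$, $$\mathbb E\big[\exp\big(i\lambda I^{M_n}_{d_n}(f_n)\big)\,\big|\,\mathcal F^{(n)}_{t_n}\big]\longrightarrow\phi(\lambda),$$ and $I^{M_n}_{d_n}(f_n)$ converges $\mathcal U^*$-stably to $\mathbb E\mu(\cdot)$, that is, for every $\lambda\in\mathbb R$ and every bounded $\mathcal U^*$-measurable random variable $Y$, $$\lim_{n\to\infty}\mathbb E\big[Y\exp\big(i\lambda I^{M_n}_{d_n}(f_n)\big)\big]=\mathbb E\Big[Y\int_{\mathbb R} e^{i\lambda x}\,\mu(dx,\cdot)\Big].$$ -/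

import Mathlib

open MeasureTheory ProbabilityTheory Filter Topology
open scoped NNReal ENNReal

noncomputable section

/-- Completion of the sub-σ-field `m`: the events that agree almost surely with an event of `m`
(all σ-fields generated by random variables are completed in this way). -/
@[reducible] def completedField {Ω : Type*} [mΩ : MeasurableSpace Ω] (P : Measure Ω)
    (m : MeasurableSpace Ω) : MeasurableSpace Ω where
  MeasurableSet' s := MeasurableSet[mΩ] s ∧ ∃ t, MeasurableSet[m] t ∧ s =ᵐ[P] t
  measurableSet_empty := ⟨@MeasurableSet.empty _ mΩ, ∅, @MeasurableSet.empty _ m, ae_eq_refl _⟩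
  measurableSet_compl := by
    rintro s ⟨hs, t, ht, hst⟩
    exact ⟨@MeasurableSet.compl _ _ mΩ hs, tᶜ, @MeasurableSet.compl _ _ m ht, hst.compl⟩
  measurableSet_iUnion := by
    intro s hs
    choose h1 t ht hst using hs
    exact ⟨@MeasurableSet.iUnion _ _ mΩ _ _ h1, ⋃ i, t i, @MeasurableSet.iUnion _ _ m _ _ ht,
      Filter.EventuallyEq.countable_iUnion hst⟩

/-- `M` is an independently scattered, square integrable random measure with control measure `μ`.
Only the values `M B` at measurable sets `B` of finite `μ`-measure matter. -/
structure IsIndependentlyScattered {Ω Z : Type*} [MeasurableSpace Ω] [MeasurableSpace Z]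
    (P : Measure Ω) (μ : Measure Z) (M : Set Z → Ω → ℝ) : Prop where
  measurable : ∀ B, MeasurableSet B → μ B < ∞ → Measurable (M B)
  memLp : ∀ B, MeasurableSet B → μ B < ∞ → MemLp (M B) 2 P
  indep : ∀ (k : ℕ) (B : Fin k → Set Z), (∀ i, MeasurableSet (B i)) → (∀ i, μ (B i) < ∞) →
    Pairwise (fun i j => Disjoint (B i) (B j)) → iIndepFun (fun i => M (B i)) P
  cov : ∀ B C, MeasurableSet B → μ B < ∞ → MeasurableSet C → μ C < ∞ →
    ∫ ω, M B ω * M C ω ∂P = (μ (C ∩ B)).toReal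

/-- The symmetrised indicator `∑_σ 1_{B_1}(z_{σ(1)}) ⋯ 1_{B_d}(z_{σ(d)})`. -/
def symIndicator {Z : Type*} {d : ℕ} (B : Fin d → Set Z) (z : Fin d → Z) : ℝ :=
  ∑ σ : Equiv.Perm (Fin d), ∏ i, (B i).indicator (fun _ => (1 : ℝ)) (z (σ i))

/-- The linear span of the pairs (kernel, integral) where the kernel is the symmetrised indicator of
pairwise disjoint sets `B_1, …, B_d` of finite measure and the integral is `d! M(B_1) ⋯ M(B_d)`. -/
def elementaryGraph {Ω Z : Type*} [MeasurableSpace Z]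
    (μ : Measure Z) (M : Set Z → Ω → ℝ) (d : ℕ) :
    Submodule ℝ (((Fin d → Z) → ℝ) × (Ω → ℝ)) :=
  Submodule.span ℝ {p | ∃ B : Fin d → Set Z, (∀ i, MeasurableSet (B i)) ∧ (∀ i, μ (B i) < ∞) ∧
    Pairwise (fun i j => Disjoint (B i) (B j)) ∧
    p = (symIndicator B, fun ω => (Nat.factorial d : ℝ) * ∏ i, M (B i) ω)}

/-- `F` is a version of the multiple integral of order `d` of `f`: there are elementary kernels
converging to `f` in `L²(μ^d)` whose integrals converge to `F` in `L²(P)`. -/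
def IsMultipleIntegral {Ω Z : Type*} [MeasurableSpace Ω] [MeasurableSpace Z]
    (P : Measure Ω) (μ : Measure Z) (M : Set Z → Ω → ℝ) (d : ℕ)
    (f : (Fin d → Z) → ℝ) (F : Ω → ℝ) : Prop :=
  Measurable F ∧ ∃ s : ℕ → ((Fin d → Z) → ℝ) × (Ω → ℝ),
    (∀ k, s k ∈ elementaryGraph μ M d) ∧
    Tendsto (fun k => eLpNorm (fun z => (s k).1 z - f z) 2 (Measure.pi fun _ => μ)) atTop (𝓝 0) ∧
    Tendsto (fun k => eLpNorm (fun ω => (s k).2 ω - F ω) 2 P) atTop (𝓝 0)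

open Classical in
/-- The multiple integral `I_d^M(f)`, the extension by `L²`-continuity of the elementary integral
(a random variable, determined up to a null set). -/
def multipleIntegral {Ω Z : Type*} [MeasurableSpace Ω] [MeasurableSpace Z]
    (P : Measure Ω) (μ : Measure Z) (M : Set Z → Ω → ℝ) (d : ℕ)
    (f : (Fin d → Z) → ℝ) : Ω → ℝ :=
  if h : ∃ F, IsMultipleIntegral P μ M d f F then h.choose else 0

/-- The isonormal field `X_M(h) = I_1^M(h)`, `h ∈ L²(μ)`. -/
def isoField {Ω Z : Type*} [MeasurableSpace Ω] [MeasurableSpace Z]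
    (P : Measure Ω) (μ : Measure Z) (M : Set Z → Ω → ℝ) (h : Z → ℝ) : Ω → ℝ :=
  multipleIntegral P μ M 1 (fun z => h (z 0))

/-- The class `L²_{s,0}(μ^d)` of square integrable symmetric kernels vanishing on diagonals. -/
structure IsSymmKernel {Z : Type*} [MeasurableSpace Z] (μ : Measure Z) {d : ℕ}
    (f : (Fin d → Z) → ℝ) : Prop where
  memLp : MemLp f 2 (Measure.pi fun _ => μ)
  symm : ∀ (σ : Equiv.Perm (Fin d)) (z : Fin d → Z), f (fun i => z (σ i)) = f z
  diag : ∀ z : Fin d → Z, ¬ Function.Injective z → f z = 0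

/-- A continuous increasing family `Z_t`, `t ∈ [0,1]`, of measurable sets from `∅` to the whole
space. -/
structure IsSetResolution {Z : Type*} [MeasurableSpace Z] (μ : Measure Z) (S : ℝ → Set Z) :
    Prop where
  measurable : ∀ t ∈ Set.Icc (0 : ℝ) 1, MeasurableSet (S t)
  zero : S 0 = ∅
  one : S 1 = Set.univ
  mono : MonotoneOn S (Set.Icc 0 1)
  cont : ∀ g : Z → ℝ, Integrable g μ → ∀ t ∈ Set.Icc (0 : ℝ) 1,
    Tendsto (fun s => ∫ z in S s, g z ∂μ) (𝓝[Set.Icc 0 1] t) (𝓝 (∫ z in S t, g z ∂μ))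

/-- The completed filtration `F_t^π(X_M) = σ{X_M(1_{Z_t} h) : h ∈ L²(μ)}`. -/
@[reducible] def resolutionField {Ω Z : Type*} [MeasurableSpace Ω] [MeasurableSpace Z]
    (P : Measure Ω) (μ : Measure Z) (M : Set Z → Ω → ℝ) (S : ℝ → Set Z) (t : ℝ) :
    MeasurableSpace Ω :=
  completedField P (⨆ (h : Z → ℝ) (_ : MemLp h 2 μ),
    MeasurableSpace.comap (isoField P μ M ((S t).indicator h)) inferInstance)

/-- The partial order `z ≺ z'`: some `Z_q`, `q ∈ ℚ ∩ (0,1)`, contains `z` and not `z'`. -/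
def Precedes {Z : Type*} (S : ℝ → Set Z) (z z' : Z) : Prop :=
  ∃ q : ℚ, 0 < q ∧ q < 1 ∧ z ∈ S (q : ℝ) ∧ z' ∉ S (q : ℝ)

open Classical in
/-- The kernel `(z_1, …, z_d) ↦ f(z, z_1, …, z_d) ∏_j 1(z_j ≺ z)`. -/
def projectedKernel {Z : Type*} (S : ℝ → Set Z) {d : ℕ} (f : (Fin (d + 1) → Z) → ℝ) (z : Z)
    (w : Fin d → Z) : ℝ :=
  f (Fin.cons z w) * ∏ j, (if Precedes S (w j) z then (1 : ℝ) else 0)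

/-- `H` is a jointly measurable version of the process
`z ↦ (d + 1) I_d^M(f(z, ·) 1(· ≺ z))`. -/
def IsAdaptedIntegrand {Ω Z : Type*} [MeasurableSpace Ω] [MeasurableSpace Z]
    (P : Measure Ω) (μ : Measure Z) (M : Set Z → Ω → ℝ) (S : ℝ → Set Z) (d : ℕ)
    (f : (Fin (d + 1) → Z) → ℝ) (H : Ω → Z → ℝ) : Prop :=
  Measurable (Function.uncurry H) ∧ ∀ᵐ z ∂μ,
    (fun ω => H ω z) =ᵐ[P]
      fun ω => ((d + 1 : ℕ) : ℝ) * multipleIntegral P μ M d (projectedKernel S f z) ω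

open Classical in
/-- The adapted integrand `h_π(f)` of a kernel `f` of order `m + 1`: it is `f` itself when the order
is one, and otherwise the (jointly measurable) process `z ↦ (m + 1) I_m^M(f(z, ·) 1(· ≺ z))`,
which is determined up to a `P ⊗ μ`-null set. -/
def adaptedIntegrand {Ω Z : Type*} [MeasurableSpace Ω] [MeasurableSpace Z]
    (P : Measure Ω) (μ : Measure Z) (M : Set Z → Ω → ℝ) (S : ℝ → Set Z) :
    (m : ℕ) → ((Fin (m + 1) → Z) → ℝ) → Ω → Z → ℝ
  | 0, f => fun _ z => f (fun _ => z)
  | m + 1, f => if h : ∃ H, IsAdaptedIntegrand P μ M S (m + 1) f H then h.choose else 0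

/-- `(c, ν)` is the Lévy–Khintchine pair (Gaussian variance, Lévy measure) of the centered, square
integrable random variable `Y`. -/
def IsLevyKhintchinePair {Ω : Type*} [MeasurableSpace Ω] (P : Measure Ω) (Y : Ω → ℝ)
    (c : ℝ≥0∞) (ν : Measure ℝ) : Prop :=
  c < ∞ ∧ ν {0} = 0 ∧ ∫⁻ x, ENNReal.ofReal (min (x ^ 2) 1) ∂ν < ∞ ∧
  ∫⁻ x in {x : ℝ | 1 ≤ |x|}, ENNReal.ofReal (x ^ 2) ∂ν < ∞ ∧
  ∀ r : ℝ, ∫ ω, Complex.exp (Complex.I * r * Y ω) ∂P =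
    Complex.exp (-((c.toReal : ℂ) * r ^ 2 / 2) +
      ∫ x : ℝ, (Complex.exp (Complex.I * r * x) - 1 - Complex.I * r * x) ∂ν)

/-- `(σ², ρ)` are the local characteristics of `M` with respect to `μ`: for every `B` of finite
measure, the Lévy–Khintchine pair of `M(B)` is `(∫_B σ²(z) μ(dz), ∫_B ρ(z, ·) μ(dz))`; and every
`ρ(z, ·)` is a Lévy measure with a finite second moment. -/
structure IsLocalCharacteristics {Ω Z : Type*} [MeasurableSpace Ω] [MeasurableSpace Z]
    (P : Measure Ω) (μ : Measure Z) (M : Set Z → Ω → ℝ) (σ2 : Z → ℝ≥0) (ρ : Kernel Z ℝ) :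
    Prop where
  measurable : Measurable σ2
  zero : ∀ z, ρ z {0} = 0
  sq : ∀ z, ∫⁻ x, ENNReal.ofReal (x ^ 2) ∂(ρ z) < ∞
  pair : ∀ B, MeasurableSet B → μ B < ∞ →
    IsLevyKhintchinePair P (M B) (∫⁻ z in B, (σ2 z : ℝ≥0∞) ∂μ) ((μ.restrict B).bind ρ)

open Classical in
/-- The local characteristics `(σ_μ², ρ_μ)` of `M`, determined up to a `μ`-null set. -/
def localCharacteristics {Ω Z : Type*} [MeasurableSpace Ω] [MeasurableSpace Z]
    (P : Measure Ω) (μ : Measure Z) (M : Set Z → Ω → ℝ) : (Z → ℝ≥0) × Kernel Z ℝ :=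
  if h : ∃ p : (Z → ℝ≥0) × Kernel Z ℝ, IsLocalCharacteristics P μ M p.1 p.2 then h.choose else 0

/-- The local exponent
`K_μ(r, z) = - r² σ_μ²(z) / 2 + ∫ (exp(i r x) - 1 - i r x) ρ_μ(z, dx)`. -/
def localExponent {Ω Z : Type*} [MeasurableSpace Ω] [MeasurableSpace Z]
    (P : Measure Ω) (μ : Measure Z) (M : Set Z → Ω → ℝ) (r : ℝ) (z : Z) : ℂ :=
  -((r : ℂ) ^ 2 / 2 * (((localCharacteristics P μ M).1 z : ℝ) : ℂ)) +
    ∫ x : ℝ, (Complex.exp (Complex.I * r * x) - 1 - Complex.I * r * x)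
      ∂((localCharacteristics P μ M).2 z)

/-- A random probability on `ℝ`. -/
def IsRandomProbability {Ω : Type*} [MeasurableSpace Ω] (P : Measure Ω) (ν : Ω → Measure ℝ) :
    Prop :=
  (∀ C, MeasurableSet C → Measurable fun ω => ν ω C) ∧ ∀ᵐ ω ∂P, IsProbabilityMeasure (ν ω)

/-- `φ` is an almost surely non-vanishing random characteristic function: the Fourier transform of
the random probability `ν`. -/
structure IsNonvanishingRandomCharFun {Ω : Type*} [MeasurableSpace Ω] (P : Measure Ω)
    (φ : ℝ → Ω → ℂ) (ν : Ω → Measure ℝ) : Prop where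
  measurable : Measurable (Function.uncurry φ)
  randomProbability : IsRandomProbability P ν
  eq_fourier : ∀ᵐ ω ∂P, ∀ r : ℝ, φ r ω = ∫ x : ℝ, Complex.exp (Complex.I * r * x) ∂(ν ω)
  ne_zero : ∀ᵐ ω ∂P, ∀ r : ℝ, φ r ω ≠ 0

/-- The sequence `X` converges `m`-stably to the mixture `E ν(·)` of the random probability `ν`. -/
def StablyConverges {Ω : Type*} [MeasurableSpace Ω] (P : Measure Ω) (m : MeasurableSpace Ω)
    (X : ℕ → Ω → ℝ) (ν : Ω → Measure ℝ) : Prop :=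
  ∀ (r : ℝ) (Y : Ω → ℝ), Measurable[m] Y → (∃ C : ℝ, ∀ ω, |Y ω| ≤ C) →
    Tendsto (fun n => ∫ ω, (Y ω : ℂ) * Complex.exp (Complex.I * r * X n ω) ∂P) atTop
      (𝓝 (∫ ω, (Y ω : ℂ) * (∫ x : ℝ, Complex.exp (Complex.I * r * x) ∂(ν ω)) ∂P))

end

/-! For the order given by the resolution almost every configuration of points has a last point. The
multiple integral of `f` is therefore the stochastic integral against `M` of the adapted integrand
h. If h is a finite sum of steps, condition successively on the field at the start of each time
slice: exp(iλI) is a product of factors u_j, exp ∫ K(λh) is the product of the a_j, and a_j is the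
conditional expectation of u_j given the past. The quotient ∏ u_j / ∏ a_j has conditional mean one
given the initial field. It may be unbounded, but |a_j| ≤ 1, so it can be frozen just before |∏ a_j|
falls below ε. The frozen quotient w is bounded by 1/ε, keeps its conditional mean and satisfies w R
= V wherever |R| ≥ ε, with V the Fourier factor and R its predictor (`exists_ratio_of_condExp`,
`exists_ratio_of_simple`).

The limit comes from this quotient. Let F be the field at time t_n and ψ = E[φ | U_n], which is
F-measurable because U_n lies in F. Then E[V | F] - ψ = E[V - ψ w | F], and V - ψ w = w (R - ψ)
where |R| ≥ ε, so the L¹ distance is at most 2 P(|R| < ε) + E|R - ψ| / ε. Here R tends to φ by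
hypothesis, ψ tends to φ by martingale convergence because the U_n increase, and P(|R| < ε) is small
because φ has no zeros (`integral_norm_condExp_sub_le`, `tendsto_integral_norm_condExp_sub_limit`).
Stable convergence follows on replacing Y by E[Y | U_n] (`tendsto_integral_mul_of_tendsto_condExp`).

General kernels are reached by density. A symmetric kernel vanishing on the power of Z_t is an L²
limit of symmetrised indicators of boxes with one set after t and after all the others
(`exists_adaptedGraph_eLpNorm_le`); the part of the kernel inside that power is negligible by
hypothesis. Isometries control the integral and the integrand together, and the Lipschitz bound for
K in its first argument carries the approximation over to the predictor
(`exists_ratio_approximation`).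

Integrals, adapted integrands and local characteristics are defined by choice with a default value,
so their existence has to be proved. Integrals and integrands come from isometry and completeness.
For the local characteristics, space is cut into fine cells, the laws of `M` on the cells with
density x² are put on a compactification of the line, and a weak limit is disintegrated over space:
the mass at the origin is the Gaussian part, the rest gives the Lévy measures
(`exists_isLocalCharacteristics`). -/

noncomputable section

set_option linter.unusedSectionVars false

/-! ### Common refinement of a finite family of sets. -/

section Atoms

/-- Every finite family of measurable sets is obtained by gluing pairwise disjoint, nonempty
measurable sets. -/
theorem exists_disjoint_atoms {Z : Type*} [MeasurableSpace Z] {ι : Type} [Fintype ι]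
    (C : ι → Set Z) (hC : ∀ i, MeasurableSet (C i)) :
    ∃ (κ : Type) (_ : Fintype κ) (_ : DecidableEq κ) (D : κ → Set Z) (T : ι → Finset κ),
      (∀ k, MeasurableSet (D k)) ∧ (Pairwise fun k l => Disjoint (D k) (D l)) ∧
      (∀ k, (D k).Nonempty) ∧ (∀ i, C i = ⋃ k ∈ T i, D k) ∧ (∀ k, ∃ i, k ∈ T i) := by
  classical
  -- Atoms are indexed by membership patterns. The empty pattern, the complement of the union, is
  -- dropped because its measure may be infinite; empty atoms are dropped so that the labels recover
  -- disjointness.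
  set atom : Finset ι → Set Z := fun s => {z | ∀ i, z ∈ C i ↔ i ∈ s} with hatom
  refine ⟨{s : Finset ι // s.Nonempty ∧ (atom s).Nonempty}, inferInstance, inferInstance,
    fun k => atom k.1, fun i => Finset.univ.filter fun k => i ∈ k.1, ?_, ?_, ?_, ?_, ?_⟩
  · intro k
    have : atom k.1 = ⋂ i, {z | z ∈ C i ↔ i ∈ k.1} := by ext z; simp [hatom]
    show MeasurableSet (atom k.1)
    rw [this]
    refine MeasurableSet.iInter fun i => ?_
    by_cases hi : i ∈ k.1
    · simpa [hi] using hC i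
    · have h : {z | z ∈ C i ↔ i ∈ k.1} = (C i)ᶜ := by ext z; simp [hi]
      rw [h]
      exact (hC i).compl
  · intro k l hkl
    rw [Set.disjoint_left]
    intro z hz hz'
    apply hkl
    ext i
    exact (hz i).symm.trans (hz' i)
  · exact fun k => k.2.2
  · intro i
    ext z
    simp only [Set.mem_iUnion, Finset.mem_filter, Finset.mem_univ, true_and, exists_prop,
      Subtype.exists]
    constructor
    · intro hz
      refine ⟨Finset.univ.filter fun j => z ∈ C j, ⟨⟨i, by simpa using hz⟩, z, ?_⟩, ?_, ?_⟩
      · simp [hatom]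
      · simpa using hz
      · simp [hatom]
    · rintro ⟨s, -, his, hz⟩
      exact (hz i).2 his
  · rintro ⟨s, ⟨i, hi⟩, hs⟩
    exact ⟨i, by simpa using hi⟩

theorem measure_atom_lt_top {Z : Type*} [MeasurableSpace Z] {μ : Measure Z} {ι κ : Type}
    {C : ι → Set Z} {D : κ → Set Z} {T : ι → Finset κ} (hC : ∀ i, μ (C i) < ∞)
    (h1 : ∀ i, C i = ⋃ k ∈ T i, D k) (h2 : ∀ k, ∃ i, k ∈ T i) (k : κ) : μ (D k) < ∞ := by
  obtain ⟨i, hi⟩ := h2 k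
  refine lt_of_le_of_lt (measure_mono ?_) (hC i)
  rw [h1 i]
  exact Set.subset_biUnion_of_mem (u := D) hi

theorem indicator_eq_sum_atoms {Z : Type*} {κ : Type*} {C : Set Z} {D : κ → Set Z}
    {T : Finset κ} (hd : Pairwise fun k l => Disjoint (D k) (D l))
    (h1 : C = ⋃ k ∈ T, D k) (z : Z) :
    C.indicator (fun _ => (1 : ℝ)) z = ∑ k ∈ T, (D k).indicator (fun _ => (1 : ℝ)) z := by
  rw [h1, Finset.indicator_biUnion_apply T D (fun i _ j _ hij => hd hij)]

end Atoms

/-! ### Additivity of the random measure. -/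

namespace IsIndependentlyScattered

variable {Ω Z : Type*} [MeasurableSpace Ω] [MeasurableSpace Z]
  {P : Measure Ω} [IsProbabilityMeasure P] {μ : Measure Z} {M : Set Z → Ω → ℝ}

theorem integrable_mul (hM : IsIndependentlyScattered P μ M) {B C : Set Z}
    (hB : MeasurableSet B) (hB' : μ B < ∞) (hC : MeasurableSet C) (hC' : μ C < ∞) :
    Integrable (fun ω => M B ω * M C ω) P :=
  (hM.memLp B hB hB').integrable_mul (hM.memLp C hC hC')

theorem integrable (hM : IsIndependentlyScattered P μ M) {B : Set Z}
    (hB : MeasurableSet B) (hB' : μ B < ∞) : Integrable (M B) P :=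
  (hM.memLp B hB hB').integrable (by norm_num)

/-- Additivity is not an axiom: it follows from the covariance alone. Expanding the second moment of
M(A ∪ B) - M(A) - M(B), the six terms cancel. -/
theorem ae_union (hM : IsIndependentlyScattered P μ M) {A B : Set Z}
    (hA : MeasurableSet A) (hA' : μ A < ∞) (hB : MeasurableSet B) (hB' : μ B < ∞)
    (hAB : Disjoint A B) : M (A ∪ B) =ᵐ[P] fun ω => M A ω + M B ω := by
  have hU := hA.union hB
  have hU' : μ (A ∪ B) < ∞ := measure_union_lt_top hA' hB'
  have i1 := hM.integrable_mul hU hU' hU hU'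
  have i2 := hM.integrable_mul hA hA' hA hA'
  have i3 := hM.integrable_mul hB hB' hB hB'
  have i4 := hM.integrable_mul hU hU' hA hA'
  have i5 := hM.integrable_mul hU hU' hB hB'
  have i6 := hM.integrable_mul hA hA' hB hB'
  have e : (fun ω => (M (A ∪ B) ω - M A ω - M B ω) ^ 2) = fun ω =>
      M (A ∪ B) ω * M (A ∪ B) ω + M A ω * M A ω + M B ω * M B ω
        - 2 * (M (A ∪ B) ω * M A ω) - 2 * (M (A ∪ B) ω * M B ω) + 2 * (M A ω * M B ω) := by
    ext ω; ring
  have hint : Integrable (fun ω => (M (A ∪ B) ω - M A ω - M B ω) ^ 2) P := by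
    rw [e]
    exact ((((i1.add i2).add i3).sub (i4.const_mul 2)).sub (i5.const_mul 2)).add (i6.const_mul 2)
  have h0 : ∫ ω, (M (A ∪ B) ω - M A ω - M B ω) ^ 2 ∂P = 0 := by
    have s1 : Integrable (fun ω => M (A ∪ B) ω * M (A ∪ B) ω + M A ω * M A ω) P := i1.add i2
    have s2 : Integrable (fun ω => M (A ∪ B) ω * M (A ∪ B) ω + M A ω * M A ω
      + M B ω * M B ω) P := s1.add i3
    have s3 : Integrable (fun ω => M (A ∪ B) ω * M (A ∪ B) ω + M A ω * M A ω
      + M B ω * M B ω - 2 * (M (A ∪ B) ω * M A ω)) P := s2.sub (i4.const_mul 2)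
    have s4 : Integrable (fun ω => M (A ∪ B) ω * M (A ∪ B) ω + M A ω * M A ω
      + M B ω * M B ω - 2 * (M (A ∪ B) ω * M A ω) - 2 * (M (A ∪ B) ω * M B ω)) P :=
      s3.sub (i5.const_mul 2)
    rw [e, integral_add s4 (i6.const_mul 2), integral_sub s3 (i5.const_mul 2),
      integral_sub s2 (i4.const_mul 2), integral_add s1 i3, integral_add i1 i2]
    simp only [integral_const_mul]
    rw [hM.cov _ _ hU hU' hU hU', hM.cov _ _ hA hA' hA hA', hM.cov _ _ hB hB' hB hB',
      hM.cov _ _ hU hU' hA hA', hM.cov _ _ hU hU' hB hB', hM.cov _ _ hA hA' hB hB']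
    have e1 : A ∩ (A ∪ B) = A := Set.inter_eq_left.2 Set.subset_union_left
    have e2 : B ∩ (A ∪ B) = B := Set.inter_eq_left.2 Set.subset_union_right
    have e3 : B ∩ A = ∅ := hAB.symm.inter_eq
    simp only [Set.inter_self, e1, e2, e3, measure_empty, ENNReal.toReal_zero]
    rw [measure_union hAB hB, ENNReal.toReal_add hA'.ne hB'.ne]
    ring
  rw [integral_eq_zero_iff_of_nonneg (fun ω => sq_nonneg _) hint] at h0
  filter_upwards [h0] with ω hω
  have : M (A ∪ B) ω - M A ω - M B ω = 0 := by simpa using hω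
  linarith

theorem ae_empty (hM : IsIndependentlyScattered P μ M) : M ∅ =ᵐ[P] fun _ => 0 := by
  have := hM.ae_union (A := ∅) (B := ∅) .empty (by simp) .empty (by simp) (by simp)
  filter_upwards [this] with ω hω
  simp only [Set.union_self] at hω
  linarith

theorem ae_biUnion (hM : IsIndependentlyScattered P μ M) {κ : Type*} {D : κ → Set Z}
    (hD : ∀ k, MeasurableSet (D k)) (hD' : ∀ k, μ (D k) < ∞)
    (hd : Pairwise fun k l => Disjoint (D k) (D l)) (T : Finset κ) :
    M (⋃ k ∈ T, D k) =ᵐ[P] fun ω => ∑ k ∈ T, M (D k) ω := by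
  classical
  induction T using Finset.induction_on with
  | empty => simpa using hM.ae_empty
  | insert a T ha ih =>
    have h := hM.ae_union (A := D a) (B := ⋃ k ∈ T, D k) (hD a) (hD' a)
      (T.measurableSet_biUnion fun k _ => hD k)
      (measure_biUnion_lt_top T.finite_toSet fun k _ => hD' k) (by
        rw [Set.disjoint_iUnion₂_right]
        intro k hk
        exact hd (by rintro rfl; exact ha hk))
    rw [Finset.set_biUnion_insert]
    filter_upwards [h, ih] with ω h1 h2
    rw [h1, h2, Finset.sum_insert ha]

theorem iIndepFun_of_disjoint (hM : IsIndependentlyScattered P μ M) {κ : Type*} [Fintype κ]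
    {D : κ → Set Z} (hD : ∀ k, MeasurableSet (D k)) (hD' : ∀ k, μ (D k) < ∞)
    (hd : Pairwise fun k l => Disjoint (D k) (D l)) : iIndepFun (fun k => M (D k)) P := by
  classical
  let e := Fintype.equivFin κ
  have h := hM.indep (Fintype.card κ) (fun i => D (e.symm i)) (fun i => hD _) (fun i => hD' _)
    (fun i j hij => hd (fun h => hij (e.symm.injective h)))
  have := h.precomp e.injective
  simpa [Function.comp_def] using this

theorem eLpNorm_sq (hM : IsIndependentlyScattered P μ M) {B : Set Z}
    (hB : MeasurableSet B) (hB' : μ B < ∞) : ∫ ω, M B ω ^ 2 ∂P = (μ B).toReal := by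
  have := hM.cov B B hB hB' hB hB'
  simpa [sq] using this

end IsIndependentlyScattered

/-! ### Binary cells and their vanishing mesh. -/

section Cells

variable {Z : Type*} [MeasurableSpace Z]

/-- The cell of level `n` with binary code `b`, for the standard countable generating family. -/
def binaryCell (Z : Type*) [MeasurableSpace Z] [MeasurableSpace.CountablyGenerated Z] (n : ℕ)
    (b : Fin n → Bool) : Set Z :=
  {z | ∀ i : Fin n, MeasurableSpace.mapNatBool Z z i = b i}

theorem measurableSet_binaryCell [MeasurableSpace.CountablyGenerated Z] (n : ℕ)
    (b : Fin n → Bool) : MeasurableSet (binaryCell Z n b) := by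
  have : binaryCell Z n b = ⋂ i : Fin n, {z | MeasurableSpace.mapNatBool Z z i = b i} := by
    ext z; simp [binaryCell]
  rw [this]
  refine MeasurableSet.iInter fun i => ?_
  exact (measurable_pi_apply (i : ℕ)).comp (MeasurableSpace.measurable_mapNatBool Z)
    (measurableSet_singleton (b i))

theorem disjoint_binaryCell [MeasurableSpace.CountablyGenerated Z] (n : ℕ) :
    Pairwise fun b c : Fin n → Bool => Disjoint (binaryCell Z n b) (binaryCell Z n c) := by
  intro b c hbc
  rw [Set.disjoint_left]
  intro z hz hz'
  exact hbc (funext fun i => (hz i).symm.trans (hz' i))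

theorem iUnion_binaryCell [MeasurableSpace.CountablyGenerated Z] (n : ℕ) :
    ⋃ b, binaryCell Z n b = Set.univ := by
  ext z
  simp only [Set.mem_iUnion, Set.mem_univ, iff_true]
  exact ⟨fun i => MeasurableSpace.mapNatBool Z z i, fun i => rfl⟩

/-- The mesh of the binary cells vanishes in the quadratic sense for a diffuse measure. -/
theorem tendsto_sum_sq_binaryCell [MeasurableSpace.CountablyGenerated Z]
    [MeasurableSpace.SeparatesPoints Z] (μ : Measure Z) [IsFiniteMeasure μ]
    [NullSingletonClass μ] :
    Tendsto (fun n => ∑ b : Fin n → Bool, μ (binaryCell Z n b) ^ 2) atTop (𝓝 0) := by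
  -- The sum of squares is the product measure of the pairs not separated at level n. These sets
  -- decrease to the diagonal, which is null by Fubini because points are null.
  set E : ℕ → Set (Z × Z) := fun n =>
    ⋃ b : Fin n → Bool, binaryCell Z n b ×ˢ binaryCell Z n b with hE
  have hEm : ∀ n, MeasurableSet (E n) := fun n => MeasurableSet.iUnion fun b =>
    (measurableSet_binaryCell n b).prod (measurableSet_binaryCell n b)
  have hmem : ∀ n p, p ∈ E n ↔ ∀ i : Fin n,
      MeasurableSpace.mapNatBool Z p.1 i = MeasurableSpace.mapNatBool Z p.2 i := by
    intro n p
    simp only [hE, Set.mem_iUnion, Set.mem_prod]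
    constructor
    · rintro ⟨b, h1, h2⟩ i
      rw [h1 i, h2 i]
    · intro h
      exact ⟨fun i => MeasurableSpace.mapNatBool Z p.1 i, fun i => rfl, fun i => (h i).symm⟩
  have hval : ∀ n, (μ.prod μ) (E n) = ∑ b : Fin n → Bool, μ (binaryCell Z n b) ^ 2 := by
    intro n
    rw [hE, measure_iUnion, tsum_fintype]
    · simp [Measure.prod_prod, sq]
    · intro b c hbc
      exact Set.Disjoint.set_prod_left (disjoint_binaryCell n hbc) _ _
    · exact fun b => (measurableSet_binaryCell n b).prod (measurableSet_binaryCell n b)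
  have hanti : Antitone E := by
    intro m n hmn p hp
    rw [hmem] at hp ⊢
    exact fun i => hp ⟨i, i.2.trans_le hmn⟩
  have hinter : ⋂ n, E n = Set.diagonal Z := by
    ext p
    simp only [Set.mem_iInter, hmem, Set.mem_diagonal_iff]
    constructor
    · intro h
      apply MeasurableSpace.injective_mapNatBool (α := Z)
      ext i
      rw [h (i + 1) ⟨i, Nat.lt_succ_self i⟩]
    · intro h n i
      rw [h]
  have hdiag : MeasurableSet (Set.diagonal Z) := hinter ▸ MeasurableSet.iInter hEm
  have hzero : (μ.prod μ) (Set.diagonal Z) = 0 := by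
    rw [Measure.prod_apply hdiag]
    have : ∀ x : Z, Prod.mk x ⁻¹' Set.diagonal Z = {x} := by
      intro x; ext y; simp [eq_comm]
    simp [this]
  have := tendsto_measure_iInter_atTop (μ := μ.prod μ) (fun n => (hEm n).nullMeasurableSet)
    hanti ⟨0, measure_ne_top _ _⟩
  rw [hinter, hzero] at this
  simpa [Function.comp_def, hval] using this

end Cells

/-! ### The random measure is centered. -/

namespace IsIndependentlyScattered

variable {Ω Z : Type*} [MeasurableSpace Ω] [MeasurableSpace Z]
  {P : Measure Ω} [IsProbabilityMeasure P] {μ : Measure Z} {M : Set Z → Ω → ℝ}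

theorem integral_sq_le (hM : IsIndependentlyScattered P μ M) {B : Set Z}
    (hB : MeasurableSet B) (hB' : μ B < ∞) : (∫ ω, M B ω ∂P) ^ 2 ≤ (μ B).toReal := by
  rw [← hM.eLpNorm_sq hB hB']
  have h := variance_nonneg (M B) P
  rw [variance_eq_sub (hM.memLp B hB hB')] at h
  simp only [Pi.pow_apply] at h
  linarith

/-- A square integrable independently scattered measure with diffuse control is centered. -/
theorem integral_eq_zero [MeasurableSpace.CountablyGenerated Z]
    [MeasurableSpace.SeparatesPoints Z] [NullSingletonClass μ]
    (hM : IsIndependentlyScattered P μ M) {B : Set Z}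
    (hB : MeasurableSet B) (hB' : μ B < ∞) : ∫ ω, M B ω ∂P = 0 := by
  have : IsFiniteMeasure (μ.restrict B) := ⟨by simpa using hB'⟩
  have hlim := tendsto_sum_sq_binaryCell (μ.restrict B)
  -- The fourth power appears because the squared mean over a cell is at most its measure, and it is
  -- the sum of the squared measures that tends to zero.
  have key : ∀ n, ENNReal.ofReal ((∫ ω, M B ω ∂P) ^ 4) ≤
      ∑ b : Fin n → Bool, (μ.restrict B) (binaryCell Z n b) ^ 2 := by
    intro n
    set A : (Fin n → Bool) → Set Z := fun b => binaryCell Z n b ∩ B with hA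
    have hAm : ∀ b, MeasurableSet (A b) := fun b => (measurableSet_binaryCell n b).inter hB
    have hAf : ∀ b, μ (A b) < ∞ := fun b =>
      lt_of_le_of_lt (measure_mono Set.inter_subset_right) hB'
    have hAd : Pairwise fun b c => Disjoint (A b) (A c) := fun b c hbc =>
      (disjoint_binaryCell n hbc).mono Set.inter_subset_left Set.inter_subset_left
    have hU : B = ⋃ b ∈ (Finset.univ : Finset (Fin n → Bool)), A b := by
      simp only [Finset.mem_univ, Set.iUnion_true, hA]
      rw [← Set.iUnion_inter, iUnion_binaryCell, Set.univ_inter]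
    have hsum : ∫ ω, M B ω ∂P = ∑ b, ∫ ω, M (A b) ω ∂P := by
      have h := hM.ae_biUnion hAm hAf hAd Finset.univ
      rw [← hU] at h
      rw [integral_congr_ae h, integral_finsetSum _ fun b _ => hM.integrable (hAm b) (hAf b)]
    set m : (Fin n → Bool) → ℝ := fun b => ∫ ω, M (A b) ω ∂P with hm
    -- The values on disjoint cells are independent and also orthogonal, so the product of their
    -- means is zero and at most one cell has a nonzero mean.
    have hmm : ∀ b c, b ≠ c → m b * m c = 0 := by
      intro b c hbc
      have hi : IndepFun (M (A b)) (M (A c)) P :=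
        (hM.iIndepFun_of_disjoint hAm hAf hAd).indepFun hbc
      have h1 := hi.integral_mul_eq_mul_integral (hM.measurable _ (hAm b) (hAf b)).aestronglyMeasurable
        (hM.measurable _ (hAm c) (hAf c)).aestronglyMeasurable
      have h2 := hM.cov _ _ (hAm b) (hAf b) (hAm c) (hAf c)
      rw [(hAd hbc).symm.inter_eq, measure_empty, ENNReal.toReal_zero] at h2
      simp only [hm]
      rw [← h1]
      exact h2
    have h4 : (∑ b, m b) ^ 4 = ∑ b, m b ^ 4 := by
      by_cases h : ∃ b, m b ≠ 0
      · obtain ⟨b, hb⟩ := h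
        have hz : ∀ c, c ≠ b → m c = 0 := fun c hc => by
          rcases mul_eq_zero.1 (hmm b c hc.symm) with h | h
          · exact absurd h hb
          · exact h
        rw [Finset.sum_eq_single b (fun c _ hc => hz c hc) (by simp),
          Finset.sum_eq_single b (fun c _ hc => by rw [hz c hc]; norm_num) (by simp)]
      · push Not at h
        simp [h]
    rw [hsum, h4, ENNReal.ofReal_sum_of_nonneg fun b _ => by positivity]
    refine Finset.sum_le_sum fun b _ => ?_
    rw [Measure.restrict_apply (measurableSet_binaryCell n b)]
    have h5 := hM.integral_sq_le (hAm b) (hAf b)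
    have h6 : m b ^ 4 ≤ (μ (A b)).toReal ^ 2 := by
      have : m b ^ 4 = (m b ^ 2) ^ 2 := by ring
      rw [this]
      exact pow_le_pow_left₀ (sq_nonneg _) h5 2
    calc ENNReal.ofReal (m b ^ 4) ≤ ENNReal.ofReal ((μ (A b)).toReal ^ 2) :=
          ENNReal.ofReal_le_ofReal h6
      _ = μ (A b) ^ 2 := by
          rw [ENNReal.ofReal_pow ENNReal.toReal_nonneg, ENNReal.ofReal_toReal (hAf b).ne]
  have := ge_of_tendsto' hlim key
  have h7 : (∫ ω, M B ω ∂P) ^ 4 ≤ 0 := by simpa using this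
  have h8 : (∫ ω, M B ω ∂P) ^ 4 = 0 := le_antisymm h7 (by positivity)
  exact pow_eq_zero_iff (by norm_num) |>.1 h8

end IsIndependentlyScattered

/-! ### Symmetrised indicators: multilinearity, products and integrals. -/

section SymIndicator

variable {Z : Type*}

theorem symIndicator_eq_sum_atoms {d : ℕ} {κ : Type*} [DecidableEq κ] {C : Fin d → Set Z}
    {D : κ → Set Z} {T : Fin d → Finset κ} (hd : Pairwise fun k l => Disjoint (D k) (D l))
    (h1 : ∀ i, C i = ⋃ k ∈ T i, D k) (z : Fin d → Z) :
    symIndicator C z = ∑ a ∈ Fintype.piFinset T, symIndicator (fun i => D (a i)) z := by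
  simp only [symIndicator]
  rw [Finset.sum_comm]
  refine Finset.sum_congr rfl fun σ _ => ?_
  rw [← Finset.prod_univ_sum (t := T)
    (f := fun i k => (D k).indicator (fun _ => (1 : ℝ)) (z (σ i)))]
  exact Finset.prod_congr rfl fun i _ => indicator_eq_sum_atoms hd (h1 i) _

/-- Where the summand σ of the first factor is nonzero, each z (σ i) lies in the cell a i. The
summand σρ of the second factor is then one or zero according to whether b = a ∘ ρ, so the second
factor counts such ρ. -/
theorem symIndicator_mul_symIndicator {d : ℕ} {κ : Type*} [DecidableEq κ]
    {D : κ → Set Z} (hd : Pairwise fun k l => Disjoint (D k) (D l)) (a b : Fin d → κ)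
    (z : Fin d → Z) :
    symIndicator (fun i => D (a i)) z * symIndicator (fun i => D (b i)) z =
      ((Finset.univ.filter fun ρ : Equiv.Perm (Fin d) => ∀ i, b i = a (ρ i)).card : ℝ) *
        symIndicator (fun i => D (a i)) z := by
  classical
  have hmem : ∀ k l, ∀ x ∈ D k, (D l).indicator (fun _ => (1 : ℝ)) x = if l = k then 1 else 0 := by
    intro k l x hx
    split_ifs with h
    · subst h
      exact Set.indicator_of_mem hx _
    · exact Set.indicator_of_notMem (fun hx' => Set.disjoint_left.1 (hd h) hx' hx) _
  conv_lhs => rw [symIndicator, Finset.sum_mul]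
  conv_rhs => rw [symIndicator, Finset.mul_sum]
  refine Finset.sum_congr rfl fun σ _ => ?_
  by_cases h : ∀ i, z (σ i) ∈ D (a i)
  · rw [mul_comm]
    congr 1
    rw [symIndicator, ← Equiv.sum_comp (Equiv.mulLeft σ)]
    rw [Finset.card_filter, Nat.cast_sum]
    refine Finset.sum_congr rfl fun ρ _ => ?_
    have : ∀ i, (D (b i)).indicator (fun _ => (1 : ℝ)) (z ((Equiv.mulLeft σ ρ) i)) =
        if b i = a (ρ i) then 1 else 0 := fun i => hmem _ _ _ (h (ρ i))
    rw [Finset.prod_congr rfl fun i _ => this i, Finset.prod_ite_zero]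
    simp
  · push Not at h
    obtain ⟨i, hi⟩ := h
    have : ∏ i, (D (a i)).indicator (fun _ => (1 : ℝ)) (z (σ i)) = 0 :=
      Finset.prod_eq_zero (Finset.mem_univ i) (Set.indicator_of_notMem hi _)
    rw [this, zero_mul, mul_zero]

variable [MeasurableSpace Z] {μ : Measure Z} [SigmaFinite μ]

theorem measurable_symIndicator {d : ℕ} {B : Fin d → Set Z} (hB : ∀ i, MeasurableSet (B i)) :
    Measurable (symIndicator B) := by
  unfold symIndicator
  refine Finset.measurable_sum _ fun σ _ => Finset.measurable_fun_prod _ fun i _ => ?_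
  exact (measurable_const.indicator (hB i)).comp (measurable_pi_apply (σ i))

theorem integrable_prod_indicator {d : ℕ} {B : Fin d → Set Z} (hB : ∀ i, MeasurableSet (B i))
    (hB' : ∀ i, μ (B i) < ∞) (σ : Equiv.Perm (Fin d)) :
    Integrable (fun z : Fin d → Z => ∏ i, (B i).indicator (fun _ => (1 : ℝ)) (z (σ i)))
      (Measure.pi fun _ => μ) := by
  have h : (fun z : Fin d → Z => ∏ i, (B i).indicator (fun _ => (1 : ℝ)) (z (σ i))) =
      fun z => ∏ i, (B (σ⁻¹ i)).indicator (fun _ => (1 : ℝ)) (z i) := by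
    ext z
    rw [← Equiv.prod_comp σ fun i => (B (σ⁻¹ i)).indicator (fun _ => (1 : ℝ)) (z i)]
    simp
  rw [h]
  exact Integrable.fintype_prod (f := fun i => (B (σ⁻¹ i)).indicator (fun _ => (1 : ℝ)))
    fun i => (integrable_indicator_iff (hB _)).2 (integrableOn_const (hB' _).ne)

theorem integral_prod_indicator {d : ℕ} {B : Fin d → Set Z} (hB : ∀ i, MeasurableSet (B i))
    (σ : Equiv.Perm (Fin d)) :
    ∫ z : Fin d → Z, ∏ i, (B i).indicator (fun _ => (1 : ℝ)) (z (σ i)) ∂(Measure.pi fun _ => μ) =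
      ∏ i, (μ (B i)).toReal := by
  have h : (fun z : Fin d → Z => ∏ i, (B i).indicator (fun _ => (1 : ℝ)) (z (σ i))) =
      fun z => ∏ i, (B (σ⁻¹ i)).indicator (fun _ => (1 : ℝ)) (z i) := by
    ext z
    rw [← Equiv.prod_comp σ fun i => (B (σ⁻¹ i)).indicator (fun _ => (1 : ℝ)) (z i)]
    simp
  rw [h, integral_fintype_prod_eq_prod (fun i => (B (σ⁻¹ i)).indicator (fun _ => (1 : ℝ))),
    ← Equiv.prod_comp σ fun i => ∫ x, (B (σ⁻¹ i)).indicator (fun _ => (1 : ℝ)) x ∂μ]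
  refine Finset.prod_congr rfl fun i _ => ?_
  rw [integral_indicator_const _ (hB _)]
  simp [measureReal_def]

theorem integrable_symIndicator {d : ℕ} {B : Fin d → Set Z} (hB : ∀ i, MeasurableSet (B i))
    (hB' : ∀ i, μ (B i) < ∞) : Integrable (symIndicator B) (Measure.pi fun _ => μ) :=
  integrable_finsetSum _ fun σ _ => integrable_prod_indicator hB hB' σ

theorem integral_symIndicator {d : ℕ} {B : Fin d → Set Z} (hB : ∀ i, MeasurableSet (B i))
    (hB' : ∀ i, μ (B i) < ∞) :
    ∫ z, symIndicator B z ∂(Measure.pi fun _ => μ) = d.factorial * ∏ i, (μ (B i)).toReal := by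
  unfold symIndicator
  rw [integral_finsetSum _ fun σ _ => integrable_prod_indicator hB hB' σ]
  rw [Finset.sum_congr rfl fun σ _ => integral_prod_indicator hB σ]
  simp [Fintype.card_perm]

/-- The values lie between 0 and d!, so the square is at most d! times the integrable function
itself. -/
theorem memLp_symIndicator {d : ℕ} {B : Fin d → Set Z} (hB : ∀ i, MeasurableSet (B i))
    (hB' : ∀ i, μ (B i) < ∞) : MemLp (symIndicator B) 2 (Measure.pi fun _ => μ) := by
  have hi := integrable_symIndicator (μ := μ) hB hB'
  rw [memLp_two_iff_integrable_sq hi.1]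
  refine Integrable.mono' (hi.const_mul (d.factorial : ℝ)) (hi.1.pow 2) (ae_of_all _ fun z => ?_)
  have h0 : 0 ≤ symIndicator B z := Finset.sum_nonneg fun σ _ => Finset.prod_nonneg fun i _ =>
    Set.indicator_nonneg (fun _ _ => zero_le_one) _
  have h1 : symIndicator B z ≤ d.factorial := by
    calc symIndicator B z ≤ ∑ σ : Equiv.Perm (Fin d), (1 : ℝ) := by
          refine Finset.sum_le_sum fun σ _ => Finset.prod_le_one
            (fun i _ => Set.indicator_nonneg (fun _ _ => zero_le_one) _) fun i _ => ?_
          exact Set.indicator_le_self' (fun _ _ => zero_le_one) _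
      _ = d.factorial := by simp [Fintype.card_perm]
  rw [Real.norm_of_nonneg (sq_nonneg _), sq]
  exact mul_le_mul_of_nonneg_right h1 h0

end SymIndicator

/-! ### Orthogonality of products of values of M. -/

namespace IsIndependentlyScattered

variable {Ω Z : Type*} [MeasurableSpace Ω] [MeasurableSpace Z]
  {P : Measure Ω} [IsProbabilityMeasure P] {μ : Measure Z} {M : Set Z → Ω → ℝ}

theorem measurable_prod (hM : IsIndependentlyScattered P μ M) {d : ℕ} {B : Fin d → Set Z}
    (hB : ∀ i, MeasurableSet (B i)) (hB' : ∀ i, μ (B i) < ∞) :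
    Measurable fun ω => ∏ i, M (B i) ω :=
  Finset.measurable_fun_prod _ fun i _ => hM.measurable _ (hB i) (hB' i)

theorem memLp_prod (hM : IsIndependentlyScattered P μ M) {d : ℕ} {B : Fin d → Set Z}
    (hB : ∀ i, MeasurableSet (B i)) (hB' : ∀ i, μ (B i) < ∞)
    (hd : Pairwise fun i j => Disjoint (B i) (B j)) :
    MemLp (fun ω => ∏ i, M (B i) ω) 2 P := by
  have hm := (hM.measurable_prod hB hB').aestronglyMeasurable (μ := P)
  rw [memLp_two_iff_integrable_sq hm]
  have hX := hM.iIndepFun_of_disjoint hB hB' hd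
  have mX : ∀ i, AEMeasurable (M (B i)) P := fun i => (hM.measurable _ (hB i) (hB' i)).aemeasurable
  have mX' : AEMeasurable (fun ω i => M (B i) ω) P := aemeasurable_pi_lambda _ mX
  have hp : ∀ i, IsProbabilityMeasure (P.map (M (B i))) :=
    fun i => Measure.isProbabilityMeasure_map (mX i)
  have h : Integrable (fun x : Fin d → ℝ => ∏ i, x i ^ 2)
      (P.map fun ω i => M (B i) ω) := by
    rw [hX.map_fun_eq_pi_map mX]
    refine Integrable.fintype_prod (f := fun _ x => x ^ 2) fun i => ?_
    rw [integrable_map_measure (by fun_prop) (mX i)]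
    exact (hM.memLp _ (hB i) (hB' i)).integrable_sq
  have hc : Continuous fun x : Fin d → ℝ => ∏ i, x i ^ 2 := by fun_prop
  rw [integrable_map_measure hc.aestronglyMeasurable mX'] at h
  simpa [Function.comp_def, Finset.prod_pow] using h

variable [MeasurableSpace.CountablyGenerated Z] [MeasurableSpace.SeparatesPoints Z]
  [NullSingletonClass μ]

/-- By independence the expectation factorises over the atoms. An atom used once contributes its
mean, which is zero; an atom used twice contributes its measure. -/
theorem integral_prod_mul_prod_finset (hM : IsIndependentlyScattered P μ M) {κ : Type*}
    [Fintype κ] [DecidableEq κ] {D : κ → Set Z} (hD : ∀ k, MeasurableSet (D k))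
    (hD' : ∀ k, μ (D k) < ∞) (hd : Pairwise fun k l => Disjoint (D k) (D l)) (s t : Finset κ) :
    ∫ ω, (∏ k ∈ s, M (D k) ω) * ∏ k ∈ t, M (D k) ω ∂P =
      if s = t then ∏ k ∈ s, (μ (D k)).toReal else 0 := by
  set g : κ → ℝ → ℝ := fun k x => (if k ∈ s then x else 1) * (if k ∈ t then x else 1) with hg
  have hgm : ∀ k, Measurable (g k) := by
    intro k
    simp only [hg]
    split_ifs <;> fun_prop
  have e : ∀ ω, (∏ k ∈ s, M (D k) ω) * ∏ k ∈ t, M (D k) ω = ∏ k, g k (M (D k) ω) := by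
    intro ω
    simp only [hg, Finset.prod_mul_distrib, Finset.prod_ite_mem, Finset.univ_inter]
  simp_rw [e]
  rw [(hM.iIndepFun_of_disjoint hD hD' hd).integral_fun_prod_comp
    (fun k => (hM.measurable _ (hD k) (hD' k)).aemeasurable)
    (fun k => (hgm k).aestronglyMeasurable)]
  split_ifs with hst
  · subst hst
    have : ∀ k, ∫ ω, g k (M (D k) ω) ∂P = if k ∈ s then (μ (D k)).toReal else 1 := by
      intro k
      by_cases hk : k ∈ s
      · simp only [hg, hk, if_true]
        rw [← hM.eLpNorm_sq (hD k) (hD' k)]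
        simp [sq]
      · simp [hg, hk]
    rw [Finset.prod_congr rfl fun k _ => this k, Finset.prod_ite_mem, Finset.univ_inter]
  · have : ∃ k, ¬ (k ∈ s ↔ k ∈ t) := by
      by_contra h
      push Not at h
      exact hst (Finset.ext h)
    obtain ⟨k, hk⟩ := this
    refine Finset.prod_eq_zero (Finset.mem_univ k) ?_
    have hz := hM.integral_eq_zero (hD k) (hD' k)
    by_cases h1 : k ∈ s
    · have h2 : k ∉ t := fun h => hk (by simp [h1, h])
      simpa [hg, h1, h2] using hz
    · have h2 : k ∈ t := by by_contra h; exact hk (by simp [h1, h])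
      simpa [hg, h1, h2] using hz

/-- For injective labels the number of permutations is one or zero according to whether the images
agree. Writing the result with this number makes it match `symIndicator_mul_symIndicator`. -/
theorem integral_prod_mul_prod_atoms (hM : IsIndependentlyScattered P μ M) {κ : Type*}
    [Fintype κ] [DecidableEq κ] {D : κ → Set Z} (hD : ∀ k, MeasurableSet (D k))
    (hD' : ∀ k, μ (D k) < ∞) (hd : Pairwise fun k l => Disjoint (D k) (D l)) {d : ℕ}
    {a b : Fin d → κ} (ha : Function.Injective a) (hb : Function.Injective b) :
    ∫ ω, (∏ i, M (D (a i)) ω) * ∏ i, M (D (b i)) ω ∂P =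
      ((Finset.univ.filter fun ρ : Equiv.Perm (Fin d) => ∀ i, b i = a (ρ i)).card : ℝ) *
        ∏ i, (μ (D (a i))).toReal := by
  have e : ∀ c : Fin d → κ, Function.Injective c → ∀ F : κ → ℝ,
      ∏ i, F (c i) = ∏ k ∈ Finset.univ.image c, F k := fun c hc F => by
    rw [Finset.prod_image fun i _ j _ h => hc h]
  have e1 : ∀ ω, (∏ i, M (D (a i)) ω) * ∏ i, M (D (b i)) ω =
      (∏ k ∈ Finset.univ.image a, M (D k) ω) * ∏ k ∈ Finset.univ.image b, M (D k) ω := fun ω => by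
    rw [e a ha fun k => M (D k) ω, e b hb fun k => M (D k) ω]
  simp_rw [e1]
  rw [hM.integral_prod_mul_prod_finset hD hD' hd, ← e a ha fun k => (μ (D k)).toReal]
  by_cases hab : Finset.univ.image a = Finset.univ.image b
  · rw [if_pos hab]
    have h1 : ∀ i, ∃ j, a j = b i := fun i => by
      have : b i ∈ Finset.univ.image a := hab ▸ Finset.mem_image_of_mem b (Finset.mem_univ i)
      simpa using this
    choose r hr using h1
    have hrinj : Function.Injective r := fun i j h => hb (by rw [← hr i, ← hr j, h])
    let ρ : Equiv.Perm (Fin d) := Equiv.ofBijective r (Finite.injective_iff_bijective.1 hrinj)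
    have : (Finset.univ.filter fun ρ : Equiv.Perm (Fin d) => ∀ i, b i = a (ρ i)) = {ρ} := by
      ext τ
      simp only [Finset.mem_filter, Finset.mem_univ, true_and, Finset.mem_singleton]
      constructor
      · intro h
        ext i : 1
        exact ha ((h i).symm.trans (hr i).symm)
      · rintro rfl i
        exact (hr i).symm
    rw [this]
    simp
  · rw [if_neg hab]
    have : (Finset.univ.filter fun ρ : Equiv.Perm (Fin d) => ∀ i, b i = a (ρ i)) = ∅ := by
      rw [Finset.filter_eq_empty_iff]
      intro ρ _ h
      apply hab
      ext k
      simp only [Finset.mem_image, Finset.mem_univ, true_and]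
      constructor
      · rintro ⟨i, rfl⟩
        exact ⟨ρ.symm i, by simp [h]⟩
      · rintro ⟨i, rfl⟩
        exact ⟨ρ i, (h i).symm⟩
    rw [this]
    simp

variable [SigmaFinite μ]

/-- Both sides are multilinear in the sets, so both families are cut into common atoms. For a pair
of label tuples the two sides then carry the same permutation count. -/
theorem integral_generators_mul (hM : IsIndependentlyScattered P μ M) {d : ℕ}
    {B C : Fin d → Set Z} (hB : ∀ i, MeasurableSet (B i)) (hB' : ∀ i, μ (B i) < ∞)
    (hBd : Pairwise fun i j => Disjoint (B i) (B j)) (hC : ∀ i, MeasurableSet (C i))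
    (hC' : ∀ i, μ (C i) < ∞) (hCd : Pairwise fun i j => Disjoint (C i) (C j)) :
    ∫ ω, ((d.factorial : ℝ) * ∏ i, M (B i) ω) * ((d.factorial : ℝ) * ∏ i, M (C i) ω) ∂P =
      d.factorial * ∫ z, symIndicator B z * symIndicator C z ∂(Measure.pi fun _ => μ) := by
  obtain ⟨κ, _, _, D, T, hD, hd, hne, hT, hcov⟩ := exists_disjoint_atoms (Sum.elim B C)
    (by rintro (i | i); exacts [hB i, hC i])
  have hD' : ∀ k, μ (D k) < ∞ := measure_atom_lt_top (by rintro (i | i); exacts [hB' i, hC' i])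
    hT hcov
  have hTB : ∀ i, B i = ⋃ k ∈ T (Sum.inl i), D k := fun i => hT (Sum.inl i)
  have hTC : ∀ i, C i = ⋃ k ∈ T (Sum.inr i), D k := fun i => hT (Sum.inr i)
  -- A repeated label would put the points of a nonempty atom into two disjoint sets.
  have hinj : ∀ (S : Fin d → Finset κ) (A : Fin d → Set Z), (∀ i, A i = ⋃ k ∈ S i, D k) →
      (Pairwise fun i j => Disjoint (A i) (A j)) → ∀ a ∈ Fintype.piFinset S,
      Function.Injective a := by
    intro S A hSA hA a ha i j hij
    by_contra hne'
    rw [Fintype.mem_piFinset] at ha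
    obtain ⟨z, hz⟩ := hne (a i)
    have h1 : z ∈ A i := by rw [hSA i]; exact Set.mem_biUnion (ha i) hz
    have h2 : z ∈ A j := by rw [hSA j]; exact Set.mem_biUnion (ha j) (hij ▸ hz)
    exact Set.disjoint_left.1 (hA hne') h1 h2
  have hprod : ∀ (S : Fin d → Finset κ) (A : Fin d → Set Z), (∀ i, A i = ⋃ k ∈ S i, D k) →
      (fun ω => ∏ i, M (A i) ω) =ᵐ[P] fun ω => ∑ a ∈ Fintype.piFinset S, ∏ i, M (D (a i)) ω := by
    intro S A hSA
    have h : ∀ i, M (A i) =ᵐ[P] fun ω => ∑ k ∈ S i, M (D k) ω := fun i => by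
      have := hM.ae_biUnion hD hD' hd (S i)
      rwa [← hSA i] at this
    filter_upwards [ae_all_iff.2 h] with ω hω
    rw [← Finset.prod_univ_sum (t := S) (f := fun _ k => M (D k) ω)]
    exact Finset.prod_congr rfl fun i _ => hω i
  have iP : ∀ a ∈ Fintype.piFinset (fun i => T (Sum.inl i)),
      ∀ b ∈ Fintype.piFinset (fun i => T (Sum.inr i)),
      Integrable (fun ω => (∏ i, M (D (a i)) ω) * ∏ i, M (D (b i)) ω) P := by
    intro a ha b hb
    exact (hM.memLp_prod (fun i => hD _) (fun i => hD' _)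
      (fun i j hij => hd fun h => hij (hinj _ B hTB hBd a ha h))).integrable_mul
      (hM.memLp_prod (fun i => hD _) (fun i => hD' _)
      (fun i j hij => hd fun h => hij (hinj _ C hTC hCd b hb h)))
  have iS : ∀ a b : Fin d → κ, Integrable (fun z => symIndicator (fun i => D (a i)) z *
      symIndicator (fun i => D (b i)) z) (Measure.pi fun _ => μ) := fun a b =>
    (memLp_symIndicator (fun i => hD _) (fun i => hD' _)).integrable_mul
      (memLp_symIndicator (fun i => hD _) (fun i => hD' _))
  have hL : ∫ ω, ((d.factorial : ℝ) * ∏ i, M (B i) ω) *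
      ((d.factorial : ℝ) * ∏ i, M (C i) ω) ∂P = (d.factorial : ℝ) ^ 2 *
      ∑ a ∈ Fintype.piFinset (fun i => T (Sum.inl i)),
        ∑ b ∈ Fintype.piFinset (fun i => T (Sum.inr i)),
        ∫ ω, (∏ i, M (D (a i)) ω) * ∏ i, M (D (b i)) ω ∂P := by
    have : (fun ω => ((d.factorial : ℝ) * ∏ i, M (B i) ω) *
        ((d.factorial : ℝ) * ∏ i, M (C i) ω)) =ᵐ[P] fun ω => (d.factorial : ℝ) ^ 2 *
        ∑ a ∈ Fintype.piFinset (fun i => T (Sum.inl i)),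
        ∑ b ∈ Fintype.piFinset (fun i => T (Sum.inr i)),
        (∏ i, M (D (a i)) ω) * ∏ i, M (D (b i)) ω := by
      filter_upwards [hprod _ B hTB, hprod _ C hTC] with ω h1 h2
      rw [h1, h2, ← Finset.sum_mul_sum]
      ring
    rw [integral_congr_ae this, integral_const_mul, integral_finsetSum _ fun a ha =>
      integrable_finsetSum _ fun b hb => iP a ha b hb]
    congr 1
    refine Finset.sum_congr rfl fun a ha => ?_
    rw [integral_finsetSum _ fun b hb => iP a ha b hb]
  have hR : ∫ z, symIndicator B z * symIndicator C z ∂(Measure.pi fun _ => μ) =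
      ∑ a ∈ Fintype.piFinset (fun i => T (Sum.inl i)),
        ∑ b ∈ Fintype.piFinset (fun i => T (Sum.inr i)),
        ∫ z, symIndicator (fun i => D (a i)) z * symIndicator (fun i => D (b i)) z
          ∂(Measure.pi fun _ => μ) := by
    have : ∀ z, symIndicator B z * symIndicator C z =
        ∑ a ∈ Fintype.piFinset (fun i => T (Sum.inl i)),
        ∑ b ∈ Fintype.piFinset (fun i => T (Sum.inr i)),
        symIndicator (fun i => D (a i)) z * symIndicator (fun i => D (b i)) z := by
      intro z
      rw [symIndicator_eq_sum_atoms hd hTB, symIndicator_eq_sum_atoms hd hTC, Finset.sum_mul_sum]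
    simp_rw [this]
    rw [integral_finsetSum _ fun a ha => integrable_finsetSum _ fun b hb => iS a b]
    refine Finset.sum_congr rfl fun a ha => ?_
    rw [integral_finsetSum _ fun b hb => iS a b]
  rw [hL, hR, sq, mul_assoc]
  congr 1
  rw [Finset.mul_sum]
  refine Finset.sum_congr rfl fun a ha => ?_
  rw [Finset.mul_sum]
  refine Finset.sum_congr rfl fun b hb => ?_
  rw [hM.integral_prod_mul_prod_atoms hD hD' hd (hinj _ B hTB hBd a ha) (hinj _ C hTC hCd b hb)]
  simp_rw [symIndicator_mul_symIndicator hd a b]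
  rw [integral_const_mul, integral_symIndicator (fun i => hD _) (fun i => hD' _)]
  ring

end IsIndependentlyScattered

theorem eLpNorm_two_sq_eq_ofReal_integral {α : Type*} [MeasurableSpace α] {ν : Measure α}
    {F : α → ℝ} (hF : MemLp F 2 ν) : eLpNorm F 2 ν ^ 2 = ENNReal.ofReal (∫ x, F x * F x ∂ν) := by
  have h1 := hF.eLpNorm_eq_integral_rpow_norm (by norm_num) (by norm_num)
  rw [h1, ← ENNReal.ofReal_pow (by positivity)]
  congr 1
  have h2 : 0 ≤ ∫ x, F x * F x ∂ν := integral_nonneg fun x => mul_self_nonneg _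
  simp only [ENNReal.toReal_ofNat, Real.rpow_ofNat, Real.norm_eq_abs, sq_abs]
  rw [← Real.rpow_natCast, ← Real.rpow_mul (integral_nonneg fun x => sq_nonneg _)]
  simp [sq]

/-! ### Isometry on the span of the elementary pairs. -/

section ElementaryGraph

variable {Ω Z : Type*} [MeasurableSpace Ω] [MeasurableSpace Z]
  {P : Measure Ω} [IsProbabilityMeasure P] {μ : Measure Z} [SigmaFinite μ] {M : Set Z → Ω → ℝ}
  {d : ℕ} {p q : ((Fin d → Z) → ℝ) × (Ω → ℝ)}

theorem elementaryGraph_properties (hM : IsIndependentlyScattered P μ M)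
    (hp : p ∈ elementaryGraph μ M d) :
    Measurable p.1 ∧ MemLp p.1 2 (Measure.pi fun _ => μ) ∧ Measurable p.2 ∧ MemLp p.2 2 P := by
  induction hp using Submodule.span_induction with
  | mem x hx =>
    obtain ⟨B, hB, hB', hd, rfl⟩ := hx
    exact ⟨measurable_symIndicator hB, memLp_symIndicator hB hB',
      (hM.measurable_prod hB hB').const_mul _, (hM.memLp_prod hB hB' hd).const_mul _⟩
  | zero => exact ⟨measurable_zero, MemLp.zero, measurable_zero, MemLp.zero⟩
  | add x y _ _ hx hy => exact ⟨hx.1.add hy.1, hx.2.1.add hy.2.1, hx.2.2.1.add hy.2.2.1,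
      hx.2.2.2.add hy.2.2.2⟩
  | smul a x _ hx => exact ⟨hx.1.const_smul a, hx.2.1.const_smul a, hx.2.2.1.const_smul a,
      hx.2.2.2.const_smul a⟩

variable [MeasurableSpace.CountablyGenerated Z] [MeasurableSpace.SeparatesPoints Z]
  [NullSingletonClass μ]

/-- The identity is bilinear, so generators suffice. It also shows that the relation between kernel
and integral is single-valued up to null sets, although it is only defined as a span. -/
theorem integral_elementaryGraph_mul (hM : IsIndependentlyScattered P μ M)
    (hp : p ∈ elementaryGraph μ M d) (hq : q ∈ elementaryGraph μ M d) :
    ∫ ω, p.2 ω * q.2 ω ∂P =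
      d.factorial * ∫ z, p.1 z * q.1 z ∂(Measure.pi fun _ => μ) := by
  have i1 : ∀ {x y : ((Fin d → Z) → ℝ) × (Ω → ℝ)}, x ∈ elementaryGraph μ M d →
      y ∈ elementaryGraph μ M d → Integrable (fun ω => x.2 ω * y.2 ω) P := fun hx hy =>
    (elementaryGraph_properties hM hx).2.2.2.integrable_mul
      (elementaryGraph_properties hM hy).2.2.2
  have i2 : ∀ {x y : ((Fin d → Z) → ℝ) × (Ω → ℝ)}, x ∈ elementaryGraph μ M d →
      y ∈ elementaryGraph μ M d →
      Integrable (fun z => x.1 z * y.1 z) (Measure.pi fun _ => μ) := fun hx hy =>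
    (elementaryGraph_properties hM hx).2.1.integrable_mul
      (elementaryGraph_properties hM hy).2.1
  induction hp, hq using Submodule.span_induction₂ with
  | mem_mem x y hx hy =>
    obtain ⟨B, hB, hB', hBd, rfl⟩ := hx
    obtain ⟨C, hC, hC', hCd, rfl⟩ := hy
    exact hM.integral_generators_mul hB hB' hBd hC hC' hCd
  | zero_left y hy => simp
  | zero_right x hx => simp
  | add_left x y z hx hy hz h1 h2 =>
    simp only [Prod.fst_add, Prod.snd_add, Pi.add_apply, add_mul]
    rw [integral_add (i1 hx hz) (i1 hy hz), integral_add (i2 hx hz) (i2 hy hz), h1, h2, mul_add]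
  | add_right x y z hx hy hz h1 h2 =>
    simp only [Prod.fst_add, Prod.snd_add, Pi.add_apply, mul_add]
    rw [integral_add (i1 hx hy) (i1 hx hz), integral_add (i2 hx hy) (i2 hx hz), h1, h2, mul_add]
  | smul_left r x y hx hy h =>
    simp only [Prod.smul_fst, Prod.smul_snd, Pi.smul_apply, smul_eq_mul, mul_assoc]
    rw [integral_const_mul, integral_const_mul, h]
    ring
  | smul_right r x y hx hy h =>
    simp only [Prod.smul_fst, Prod.smul_snd, Pi.smul_apply, smul_eq_mul, mul_left_comm _ r]
    rw [integral_const_mul, integral_const_mul, h]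
    ring

/-- The isometry property of elementary multiple integrals. -/
theorem eLpNorm_elementaryGraph (hM : IsIndependentlyScattered P μ M)
    (hp : p ∈ elementaryGraph μ M d) :
    eLpNorm p.2 2 P ^ 2 = d.factorial * eLpNorm p.1 2 (Measure.pi fun _ => μ) ^ 2 := by
  have hpp := elementaryGraph_properties hM hp
  have h := integral_elementaryGraph_mul hM hp hp
  rw [eLpNorm_two_sq_eq_ofReal_integral hpp.2.2.2, eLpNorm_two_sq_eq_ofReal_integral hpp.2.1, h,
    ENNReal.ofReal_mul (by positivity), ENNReal.ofReal_natCast]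

end ElementaryGraph

/-! ### Limits in L². -/

section LpLimits

variable {α : Type*} [MeasurableSpace α] {ν : Measure α}

theorem tendsto_eLpNorm_of_tendsto_sub {g : ℕ → α → ℝ} {f : α → ℝ}
    (hg : ∀ k, AEStronglyMeasurable (g k) ν) (hf : AEStronglyMeasurable f ν)
    (h : Tendsto (fun k => eLpNorm (fun x => g k x - f x) 2 ν) atTop (𝓝 0)) :
    Tendsto (fun k => eLpNorm (g k) 2 ν) atTop (𝓝 (eLpNorm f 2 ν)) := by
  have h1 : ∀ k, eLpNorm (g k) 2 ν ≤ eLpNorm f 2 ν + eLpNorm (fun x => g k x - f x) 2 ν := by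
    intro k
    have : g k = fun x => f x + (g k x - f x) := by ext x; ring
    conv_lhs => rw [this]
    exact eLpNorm_add_le hf ((hg k).sub hf) (by norm_num)
  have h2 : ∀ k, eLpNorm f 2 ν - eLpNorm (fun x => g k x - f x) 2 ν ≤ eLpNorm (g k) 2 ν := by
    intro k
    rw [tsub_le_iff_right]
    have : f = fun x => g k x - (g k x - f x) := by ext x; ring
    conv_lhs => rw [this]
    exact eLpNorm_sub_le (hg k) ((hg k).sub hf) (by norm_num)
  refine tendsto_of_tendsto_of_tendsto_of_le_of_le ?_ ?_ h2 h1
  · have := ENNReal.Tendsto.sub (tendsto_const_nhds (x := eLpNorm f 2 ν) (f := atTop)) h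
      (Or.inr (by simp))
    simpa using this
  · simpa using (tendsto_const_nhds (x := eLpNorm f 2 ν) (f := atTop)).add h

theorem exists_tendsto_eLpNorm_of_cauchy {g : ℕ → α → ℝ} (hg : ∀ k, MemLp (g k) 2 ν)
    {c : ℕ → ℝ≥0∞} (hc : Tendsto c atTop (𝓝 0))
    (h : ∀ k l, eLpNorm (fun x => g k x - g l x) 2 ν ≤ c k + c l) :
    ∃ G : α → ℝ, Measurable G ∧ MemLp G 2 ν ∧
      Tendsto (fun k => eLpNorm (fun x => g k x - G x) 2 ν) atTop (𝓝 0) := by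
  have hcs : CauchySeq fun k => (hg k).toLp := by
    rw [EMetric.cauchySeq_iff]
    intro ε hε
    obtain ⟨N, hN⟩ := eventually_atTop.1 ((tendsto_order.1 hc).2 (ε / 2) (ENNReal.half_pos hε.ne'))
    refine ⟨N, fun k hk l hl => ?_⟩
    rw [Lp.edist_toLp_toLp]
    refine lt_of_le_of_lt (h k l) ?_
    rw [← ENNReal.add_halves ε]
    exact ENNReal.add_lt_add (hN k hk) (hN l hl)
  obtain ⟨G, hG⟩ := cauchySeq_tendsto_of_complete hcs
  refine ⟨G, (Lp.stronglyMeasurable G).measurable, Lp.memLp G, ?_⟩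
  rw [Lp.tendsto_Lp_iff_tendsto_eLpNorm'] at hG
  refine hG.congr fun k => eLpNorm_congr_ae ?_
  filter_upwards [(hg k).coeFn_toLp] with x hx
  simp [hx]

theorem eq_of_eLpNorm_eq_zero {F G : α → ℝ} (hF : AEStronglyMeasurable F ν)
    (hG : AEStronglyMeasurable G ν) (h : eLpNorm (fun x => F x - G x) 2 ν = 0) : F =ᵐ[ν] G := by
  have h : eLpNorm (F - G) 2 ν = 0 := h
  rw [eLpNorm_eq_zero_iff (hF.sub hG) (by norm_num)] at h
  filter_upwards [h] with x hx
  simpa [sub_eq_zero] using hx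

end LpLimits

/-! ### Multiple integrals as L² limits: isometry, uniqueness, existence. -/

namespace IsMultipleIntegral

variable {Ω Z : Type*} [MeasurableSpace Ω] [MeasurableSpace Z]
  {P : Measure Ω} [IsProbabilityMeasure P] {μ : Measure Z} [SigmaFinite μ] {M : Set Z → Ω → ℝ}
  {d : ℕ} {f g : (Fin d → Z) → ℝ} {F G : Ω → ℝ}

theorem of_mem_elementaryGraph (hM : IsIndependentlyScattered P μ M)
    {p : ((Fin d → Z) → ℝ) × (Ω → ℝ)} (hp : p ∈ elementaryGraph μ M d) :
    IsMultipleIntegral P μ M d p.1 p.2 :=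
  ⟨(elementaryGraph_properties hM hp).2.2.1, fun _ => p, fun _ => hp, by simp, by simp⟩

theorem sub (hM : IsIndependentlyScattered P μ M) (hf : IsMultipleIntegral P μ M d f F)
    (hg : IsMultipleIntegral P μ M d g G)
    (hfm : AEStronglyMeasurable f (Measure.pi fun _ => μ))
    (hgm : AEStronglyMeasurable g (Measure.pi fun _ => μ)) :
    IsMultipleIntegral P μ M d (fun z => f z - g z) (fun ω => F ω - G ω) := by
  obtain ⟨hF, s, hs, h1, h2⟩ := hf
  obtain ⟨hG, t, ht, h3, h4⟩ := hg
  refine ⟨hF.sub hG, fun k => s k - t k, fun k => Submodule.sub_mem _ (hs k) (ht k), ?_, ?_⟩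
  · have h5 := h1.add h3
    rw [add_zero] at h5
    refine tendsto_of_tendsto_of_tendsto_of_le_of_le tendsto_const_nhds h5
      (fun _ => zero_le) fun k => ?_
    have : (fun z => (s k - t k).1 z - (f z - g z)) =
        (fun z => (s k).1 z - f z) - fun z => (t k).1 z - g z := by
      ext z; simp only [Prod.fst_sub, Pi.sub_apply]; ring
    simp only [this]
    exact eLpNorm_sub_le ((elementaryGraph_properties hM (hs k)).2.1.1.sub hfm)
      ((elementaryGraph_properties hM (ht k)).2.1.1.sub hgm) (by norm_num)
  · have h5 := h2.add h4
    rw [add_zero] at h5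
    refine tendsto_of_tendsto_of_tendsto_of_le_of_le tendsto_const_nhds h5
      (fun _ => zero_le) fun k => ?_
    have : (fun z => (s k - t k).2 z - (F z - G z)) =
        (fun z => (s k).2 z - F z) - fun z => (t k).2 z - G z := by
      ext z; simp only [Prod.snd_sub, Pi.sub_apply]; ring
    simp only [this]
    exact eLpNorm_sub_le ((elementaryGraph_properties hM (hs k)).2.2.2.1.sub
      hF.aestronglyMeasurable) ((elementaryGraph_properties hM (ht k)).2.2.2.1.sub
      hG.aestronglyMeasurable) (by norm_num)

variable [MeasurableSpace.CountablyGenerated Z] [MeasurableSpace.SeparatesPoints Z]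
  [NullSingletonClass μ]

theorem eLpNorm_sq (hM : IsIndependentlyScattered P μ M) (hf : IsMultipleIntegral P μ M d f F)
    (hfm : AEStronglyMeasurable f (Measure.pi fun _ => μ)) :
    eLpNorm F 2 P ^ 2 = d.factorial * eLpNorm f 2 (Measure.pi fun _ => μ) ^ 2 := by
  obtain ⟨hF, s, hs, h1, h2⟩ := hf
  have h3 := tendsto_eLpNorm_of_tendsto_sub
    (fun k => (elementaryGraph_properties hM (hs k)).2.1.1) hfm h1
  have h4 := tendsto_eLpNorm_of_tendsto_sub
    (fun k => (elementaryGraph_properties hM (hs k)).2.2.2.1) hF.aestronglyMeasurable h2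
  have h5 := ENNReal.Tendsto.const_mul (a := (d.factorial : ℝ≥0∞)) (ENNReal.Tendsto.pow h3 (n := 2))
    (Or.inr (ENNReal.natCast_ne_top _))
  refine tendsto_nhds_unique (ENNReal.Tendsto.pow h4 (n := 2)) (h5.congr fun k => ?_)
  rw [eLpNorm_elementaryGraph hM (hs k)]

theorem eLpNorm_sub_sq (hM : IsIndependentlyScattered P μ M)
    (hf : IsMultipleIntegral P μ M d f F) (hg : IsMultipleIntegral P μ M d g G)
    (hfm : AEStronglyMeasurable f (Measure.pi fun _ => μ))
    (hgm : AEStronglyMeasurable g (Measure.pi fun _ => μ)) :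
    eLpNorm (fun ω => F ω - G ω) 2 P ^ 2 =
      d.factorial * eLpNorm (fun z => f z - g z) 2 (Measure.pi fun _ => μ) ^ 2 :=
  (hf.sub hM hg hfm hgm).eLpNorm_sq hM (hfm.sub hgm)

/-- The isometry for the difference gives norm zero; hence the choice made in `multipleIntegral` is
immaterial. -/
theorem ae_eq (hM : IsIndependentlyScattered P μ M)
    (hf : IsMultipleIntegral P μ M d f F) (hg : IsMultipleIntegral P μ M d f G)
    (hfm : AEStronglyMeasurable f (Measure.pi fun _ => μ)) : F =ᵐ[P] G := by
  have h := hf.eLpNorm_sub_sq hM hg hfm hfm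
  simp only [sub_self, eLpNorm_zero', ne_eq, OfNat.ofNat_ne_zero, not_false_eq_true, zero_pow,
    mul_zero, pow_eq_zero_iff] at h
  exact eq_of_eLpNorm_eq_zero hf.1.aestronglyMeasurable hg.1.aestronglyMeasurable h

/-- Completeness: a kernel approximable by elementary kernels has a multiple integral. -/
theorem exists_of_tendsto (hM : IsIndependentlyScattered P μ M)
    (hfm : AEStronglyMeasurable f (Measure.pi fun _ => μ))
    {s : ℕ → ((Fin d → Z) → ℝ) × (Ω → ℝ)} (hs : ∀ k, s k ∈ elementaryGraph μ M d)
    (h : Tendsto (fun k => eLpNorm (fun z => (s k).1 z - f z) 2 (Measure.pi fun _ => μ))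
      atTop (𝓝 0)) : ∃ F, IsMultipleIntegral P μ M d f F := by
  set C : ℝ≥0∞ := (d.factorial : ℝ≥0∞) with hC
  have hC1 : 1 ≤ C := by
    rw [hC]; exact_mod_cast Nat.one_le_iff_ne_zero.2 (Nat.factorial_ne_zero d)
  have hC2 : C ≠ ∞ := ENNReal.natCast_ne_top _
  have hlim := ENNReal.Tendsto.const_mul (a := C) h (Or.inr hC2)
  rw [mul_zero] at hlim
  have hb : ∀ k l, eLpNorm (fun ω => (s k).2 ω - (s l).2 ω) 2 P ≤
      C * eLpNorm (fun z => (s k).1 z - f z) 2 (Measure.pi fun _ => μ) +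
      C * eLpNorm (fun z => (s l).1 z - f z) 2 (Measure.pi fun _ => μ) := by
    intro k l
    have h1 := eLpNorm_elementaryGraph hM (Submodule.sub_mem _ (hs k) (hs l))
    have h2 : eLpNorm ((s k).2 - (s l).2) 2 P ≤
        C * eLpNorm ((s k).1 - (s l).1) 2 (Measure.pi fun _ => μ) := by
      rw [← ENNReal.pow_le_pow_left_iff (two_ne_zero), mul_pow]
      change eLpNorm (s k - s l).2 2 P ^ 2 ≤
        C ^ 2 * eLpNorm (s k - s l).1 2 (Measure.pi fun _ => μ) ^ 2
      rw [h1]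
      gcongr
      calc C = C * 1 := (mul_one _).symm
        _ ≤ C ^ 2 := by rw [sq]; gcongr
    refine h2.trans ?_
    rw [← mul_add]
    gcongr
    have : (s k).1 - (s l).1 = (fun z => (s k).1 z - f z) - fun z => (s l).1 z - f z := by
      ext z; simp only [Pi.sub_apply]; ring
    rw [this]
    exact eLpNorm_sub_le ((elementaryGraph_properties hM (hs k)).2.1.1.sub hfm)
      ((elementaryGraph_properties hM (hs l)).2.1.1.sub hfm) (by norm_num)
  obtain ⟨G, hG, -, hG2⟩ := exists_tendsto_eLpNorm_of_cauchy
    (fun k => (elementaryGraph_properties hM (hs k)).2.2.2) hlim hb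
  exact ⟨G, hG, s, hs, h, hG2⟩

theorem multipleIntegral_of_exists (h : ∃ F, IsMultipleIntegral P μ M d f F) :
    IsMultipleIntegral P μ M d f (multipleIntegral P μ M d f) := by
  rw [multipleIntegral, dif_pos h]
  exact h.choose_spec

end IsMultipleIntegral

/-! ### The order induced by the resolution. -/

namespace IsSetResolution

variable {Z : Type*} [MeasurableSpace Z] {μ : Measure Z} {S : ℝ → Set Z}

theorem rat_mem_Icc {q : ℚ} (h0 : 0 < q) (h1 : q < 1) : (q : ℝ) ∈ Set.Icc (0 : ℝ) 1 :=
  ⟨by exact_mod_cast h0.le, by exact_mod_cast h1.le⟩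

theorem subset (hS : IsSetResolution μ S) {s t : ℝ} (hs : s ∈ Set.Icc (0 : ℝ) 1)
    (ht : t ∈ Set.Icc (0 : ℝ) 1) (h : s ≤ t) : S s ⊆ S t :=
  hS.mono hs ht h

theorem lt_of_mem_of_notMem (hS : IsSetResolution μ S) {s t : ℝ} (hs : s ∈ Set.Icc (0 : ℝ) 1)
    (ht : t ∈ Set.Icc (0 : ℝ) 1) {z : Z} (hz : z ∈ S t) (hz' : z ∉ S s) : s < t := by
  by_contra h
  exact hz' (hS.subset ht hs (not_lt.1 h) hz)

/-- Because the separating times are rational, the relation is a countable union of measurable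
rectangles. -/
theorem measurableSet_precedes (hS : IsSetResolution μ S) :
    MeasurableSet {p : Z × Z | Precedes S p.1 p.2} := by
  have : {p : Z × Z | Precedes S p.1 p.2} = ⋃ q : ℚ, {p : Z × Z | 0 < q ∧ q < 1 ∧
      p.1 ∈ S (q : ℝ) ∧ p.2 ∉ S (q : ℝ)} := by
    ext p; simp [Precedes]
  rw [this]
  refine MeasurableSet.iUnion fun q => ?_
  by_cases h : 0 < q ∧ q < 1
  · have hq := hS.measurable q (rat_mem_Icc h.1 h.2)
    have : {p : Z × Z | 0 < q ∧ q < 1 ∧ p.1 ∈ S (q : ℝ) ∧ p.2 ∉ S (q : ℝ)} =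
        S (q : ℝ) ×ˢ (S (q : ℝ))ᶜ := by
      ext p; simp [h.1, h.2]
    rw [this]
    exact hq.prod hq.compl
  · have : {p : Z × Z | 0 < q ∧ q < 1 ∧ p.1 ∈ S (q : ℝ) ∧ p.2 ∉ S (q : ℝ)} = ∅ := by
      ext p
      simp only [Set.mem_ofPred_eq, Set.mem_empty_iff_false, iff_false]
      exact fun h' => h ⟨h'.1, h'.2.1⟩
    rw [this]
    exact .empty

theorem precedes_trans (hS : IsSetResolution μ S) {x y z : Z} (hxy : Precedes S x y)
    (hyz : Precedes S y z) : Precedes S x z := by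
  obtain ⟨q, h0, h1, hx, hy⟩ := hxy
  obtain ⟨r, h0', h1', hy', hz⟩ := hyz
  exact ⟨r, h0', h1', hS.subset (rat_mem_Icc h0 h1) (rat_mem_Icc h0' h1')
    (hS.lt_of_mem_of_notMem (rat_mem_Icc h0 h1) (rat_mem_Icc h0' h1') hy' hy).le hx, hz⟩

theorem precedes_irrefl (S : ℝ → Set Z) (x : Z) : ¬ Precedes S x x :=
  fun ⟨_, _, _, h, h'⟩ => h' h

theorem precedes_asymm (hS : IsSetResolution μ S) {x y : Z} (hxy : Precedes S x y) :
    ¬ Precedes S y x := fun h => precedes_irrefl S x (hS.precedes_trans hxy h)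

/-- A point preceding a point of `S t` lies in `S t`. -/
theorem mem_of_precedes (hS : IsSetResolution μ S) {x y : Z} (hxy : Precedes S x y) {t : ℝ}
    (ht : t ∈ Set.Icc (0 : ℝ) 1) (hy : y ∈ S t) : x ∈ S t := by
  obtain ⟨q, h0, h1, hx, hy'⟩ := hxy
  exact hS.subset (rat_mem_Icc h0 h1) ht
    (hS.lt_of_mem_of_notMem (rat_mem_Icc h0 h1) ht hy hy').le hx

theorem continuousOn_measureReal (hS : IsSetResolution μ S) {A : Set Z} (hA : MeasurableSet A)
    (hA' : μ A < ∞) : ContinuousOn (fun t => (μ.restrict A).real (S t)) (Set.Icc 0 1) := by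
  intro t ht
  have h := hS.cont (A.indicator fun _ => 1)
    ((integrable_indicator_iff hA).2 (integrableOn_const hA'.ne)) t ht
  have e : ∀ s ∈ Set.Icc (0 : ℝ) 1, ∫ z in S s, A.indicator (fun _ => (1 : ℝ)) z ∂μ =
      (μ.restrict A).real (S s) := by
    intro s hs
    rw [setIntegral_indicator hA]
    simp [measureReal_def, Measure.restrict_apply (hS.measurable s hs)]
  rw [e t ht] at h
  exact h.congr' (eventually_nhdsWithin_of_forall e)

/-- The exceptional set is contained in S(1/(n + 2)) for every n, and by continuity at zero the mass
of these sets tends to that of the empty set. -/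
theorem restrict_null_forall_mem (hS : IsSetResolution μ S) {A : Set Z} (hA : MeasurableSet A)
    (hA' : μ A < ∞) :
    (μ.restrict A) {z | ∀ q : ℚ, 0 < q → q < 1 → z ∈ S (q : ℝ)} = 0 := by
  have : IsFiniteMeasure (μ.restrict A) := ⟨by simpa using hA'⟩
  set N := {z | ∀ q : ℚ, 0 < q → q < 1 → z ∈ S (q : ℝ)}
  have h := hS.continuousOn_measureReal hA hA' 0 (by simp)
  have hu : Tendsto (fun n : ℕ => (((1 / ((n : ℚ) + 2) : ℚ)) : ℝ)) atTop (𝓝 0) := by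
    have := (tendsto_const_div_atTop_nhds_zero_nat (1 : ℝ)).comp (tendsto_add_atTop_nat 2)
    refine this.congr fun n => ?_
    simp
  have hq : ∀ n : ℕ, 0 < (1 / ((n : ℚ) + 2)) ∧ (1 / ((n : ℚ) + 2)) < 1 := fun n => by
    refine ⟨by positivity, ?_⟩
    rw [div_lt_one (by positivity)]
    have : (0 : ℚ) ≤ n := by positivity
    linarith
  have hu' : Tendsto (fun n : ℕ => (((1 / ((n : ℚ) + 2) : ℚ)) : ℝ)) atTop
      (𝓝[Set.Icc 0 1] 0) := by
    rw [tendsto_nhdsWithin_iff]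
    exact ⟨hu, Eventually.of_forall fun n => rat_mem_Icc (hq n).1 (hq n).2⟩
  have h2 := h.tendsto.comp hu'
  rw [hS.zero] at h2
  simp only [measureReal_empty] at h2
  have h3 : (μ.restrict A).real N ≤ 0 := by
    refine ge_of_tendsto' h2 fun n => ?_
    exact measureReal_mono fun z hz => hz _ (hq n).1 (hq n).2
  have h4 := le_antisymm h3 measureReal_nonneg
  rwa [measureReal_eq_zero_iff] at h4

variable [SigmaFinite μ]

theorem ae_exists_notMem (hS : IsSetResolution μ S) :
    ∀ᵐ z ∂μ, ∃ q : ℚ, 0 < q ∧ q < 1 ∧ z ∉ S (q : ℝ) := by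
  rw [← Measure.restrict_univ (μ := μ), ← iUnion_spanningSets μ, ae_restrict_iUnion_iff]
  intro n
  have := hS.restrict_null_forall_mem (measurableSet_spanningSets μ n)
    (measure_spanningSets_lt_top μ n)
  rw [← compl_compl {z | _}, ← mem_ae_iff] at this
  filter_upwards [this] with z hz
  simp only [Set.mem_compl_iff, Set.mem_ofPred_eq] at hz
  push Not at hz
  exact hz

/-- The mass of S t is uniformly continuous in t, so the sets S(i/n) cut the space into slices of
mass at most ε. Points of different slices are ordered by a rational i/n, so unordered pairs lie in
the squares of the slices, of total mass at most ε times the total mass. -/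
theorem restrict_prod_null (hS : IsSetResolution μ S) {A : Set Z} (hA : MeasurableSet A)
    (hA' : μ A < ∞) :
    ((μ.restrict A).prod (μ.restrict A))
      {p : Z × Z | Precedes S p.1 p.2 ∨ Precedes S p.2 p.1}ᶜ = 0 := by
  have : IsFiniteMeasure (μ.restrict A) := ⟨by simpa using hA'⟩
  set l := μ.restrict A with hl
  set N := {p : Z × Z | Precedes S p.1 p.2 ∨ Precedes S p.2 p.1}ᶜ with hN
  have hc := isCompact_Icc.uniformContinuousOn_of_continuous (hS.continuousOn_measureReal hA hA')
  rw [Metric.uniformContinuousOn_iff] at hc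
  have key : ∀ ε : ℝ≥0, 0 < ε → (l.prod l) N ≤ ε * l Set.univ := by
    intro ε hε
    obtain ⟨δ, hδ, hδ'⟩ := hc ε (by exact_mod_cast hε)
    obtain ⟨n, hn⟩ := exists_nat_gt (1 / δ)
    have hn0 : (0 : ℝ) < n := lt_trans (by positivity) hn
    have hn0' : 0 < n := by exact_mod_cast hn0
    set u : ℕ → ℝ := fun i => (i : ℝ) / n with hu
    have huI : ∀ i ≤ n, u i ∈ Set.Icc (0 : ℝ) 1 := fun i hi =>
      ⟨by positivity, by rw [hu]; simp only; rw [div_le_one hn0]; exact_mod_cast hi⟩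
    have hum : Monotone u := fun i j hij => by
      simp only [hu]; gcongr
    set Δ : Fin n → Set Z := fun i => S (u (i + 1)) \ S (u i) with hΔ
    have hΔm : ∀ i, MeasurableSet (Δ i) := fun i =>
      (hS.measurable _ (huI _ i.2)).diff (hS.measurable _ (huI _ i.2.le))
    have hcell : ∀ z, ∃ i, z ∈ Δ i := by
      intro z
      have hex : ∃ k, k ≤ n ∧ z ∈ S (u k) := ⟨n, le_rfl, by
        have : u n = 1 := div_self hn0.ne'
        rw [this, hS.one]; trivial⟩
      classical
      set k := Nat.find hex with hk
      have hk1 := Nat.find_spec hex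
      have hk0 : k ≠ 0 := by
        intro h0
        rw [← hk, h0] at hk1
        have : u 0 = 0 := by simp [hu]
        rw [this, hS.zero] at hk1
        exact hk1.2
      obtain ⟨j, hj⟩ := Nat.exists_eq_succ_of_ne_zero hk0
      have hjn : j < n := by rw [← hk, hj] at hk1; exact hk1.1
      refine ⟨⟨j, hjn⟩, ?_, fun h => ?_⟩
      · have := hk1.2
        rw [← hk, hj] at this
        exact this
      · have := Nat.find_min hex (m := j) (by rw [← hk, hj]; exact Nat.lt_succ_self j)
        exact this ⟨hjn.le, h⟩
    have hlt : ∀ i j : Fin n, i < j → ∀ x ∈ Δ i, ∀ y ∈ Δ j, Precedes S x y := by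
      intro i j hij x hx y hy
      have hij' : (i : ℕ) + 1 ≤ j := hij
      -- The right end of the slice of x separates the points; it is below one because i + 1 ≤ j <
      -- n.
      refine ⟨((i + 1 : ℕ) : ℚ) / n, by positivity, ?_, ?_, ?_⟩
      · rw [div_lt_one (by exact_mod_cast hn0')]
        exact_mod_cast lt_of_le_of_lt hij' j.2
      · have := hx.1
        simpa [hu] using this
      · intro h
        have h' : y ∈ S (u (i + 1)) := by simpa [hu] using h
        exact hy.2 (hS.subset (huI _ i.2) (huI _ j.2.le) (hum hij') h')
    have hsub : N ⊆ ⋃ i, Δ i ×ˢ Δ i := by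
      rintro ⟨x, y⟩ hp
      obtain ⟨i, hi⟩ := hcell x
      obtain ⟨j, hj⟩ := hcell y
      rcases lt_trichotomy i j with h | h | h
      · exact absurd (Or.inl (hlt i j h x hi y hj)) hp
      · subst h; exact Set.mem_iUnion.2 ⟨i, hi, hj⟩
      · exact absurd (Or.inr (hlt j i h y hj x hi)) hp
    have hsmall : ∀ i, l (Δ i) ≤ ε := by
      intro i
      have h1 : l.real (Δ i) < ε := by
        have hss : S (u i) ⊆ S (u (i + 1)) :=
          hS.subset (huI _ i.2.le) (huI _ i.2) (hum (Nat.le_succ _))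
        rw [hΔ]
        simp only
        rw [measureReal_sdiff hss (hS.measurable _ (huI _ i.2.le))]
        have := hδ' (u (i + 1)) (huI _ i.2) (u i) (huI _ i.2.le) (by
          simp only [hu, Real.dist_eq]
          rw [← sub_div]
          push_cast
          rw [add_sub_cancel_left, abs_of_pos (by positivity)]
          rw [div_lt_iff₀ hδ] at hn
          rw [div_lt_iff₀ hn0]
          linarith)
        rw [Real.dist_eq] at this
        exact (abs_lt.1 this).2
      rw [← ENNReal.ofReal_coe_nnreal, ← ofReal_measureReal]
      exact ENNReal.ofReal_le_ofReal h1.le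
    have hdis : Pairwise (Function.onFun Disjoint Δ) := by
      intro i j hij
      rw [Function.onFun, Set.disjoint_left]
      intro z hz hz'
      rcases lt_or_gt_of_ne hij with h | h
      · exact precedes_irrefl S z (hlt i j h z hz z hz')
      · exact precedes_irrefl S z (hlt j i h z hz' z hz)
    calc (l.prod l) N ≤ ∑ i, (l.prod l) (Δ i ×ˢ Δ i) :=
          (measure_mono hsub).trans ((measure_iUnion_le _).trans (by rw [tsum_fintype]))
      _ = ∑ i, l (Δ i) * l (Δ i) := by simp [Measure.prod_prod]
      _ ≤ ∑ i, ε * l (Δ i) := Finset.sum_le_sum fun i _ => by gcongr; exact hsmall i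
      _ = ε * l (⋃ i, Δ i) := by rw [← Finset.mul_sum, measure_iUnion hdis hΔm, tsum_fintype]
      _ ≤ ε * l Set.univ := by gcongr; exact Set.subset_univ _
  have hlim : Tendsto (fun n : ℕ => ((1 / ((n : ℝ≥0) + 1) : ℝ≥0) : ℝ≥0∞) * l Set.univ) atTop
      (𝓝 0) := by
    have h1 : Tendsto (fun n : ℕ => ((1 / ((n : ℝ≥0) + 1) : ℝ≥0) : ℝ≥0∞)) atTop (𝓝 0) := by
      have := tendsto_one_div_add_atTop_nhds_zero_nat (𝕜 := ℝ≥0)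
      rw [← ENNReal.coe_zero]
      exact ENNReal.tendsto_coe.2 this
    have := ENNReal.Tendsto.mul_const (b := l Set.univ) h1 (Or.inr (measure_ne_top _ _))
    simpa using this
  exact le_antisymm (ge_of_tendsto' hlim fun n => key _ (by positivity)) zero_le

/-- The resolution orders almost all pairs of points. -/
theorem ae_ae_precedes (hS : IsSetResolution μ S) :
    ∀ᵐ x ∂μ, ∀ᵐ y ∂μ, Precedes S x y ∨ Precedes S y x := by
  have h1 : ∀ n, ∀ᵐ x ∂(μ.restrict (spanningSets μ n)),
      ∀ᵐ y ∂(μ.restrict (spanningSets μ n)), Precedes S x y ∨ Precedes S y x := by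
    intro n
    apply Measure.ae_ae_of_ae_prod
      (p := fun p : Z × Z => Precedes S p.1 p.2 ∨ Precedes S p.2 p.1)
    have := hS.restrict_prod_null (measurableSet_spanningSets μ n)
      (measure_spanningSets_lt_top μ n)
    rwa [← mem_ae_iff] at this
  have h2 : ∀ᵐ x ∂μ, ∀ n, x ∈ spanningSets μ n →
      ∀ᵐ y ∂(μ.restrict (spanningSets μ n)), Precedes S x y ∨ Precedes S y x := by
    rw [ae_all_iff]
    intro n
    exact (ae_restrict_iff' (measurableSet_spanningSets μ n)).1 (h1 n)
  filter_upwards [h2] with x hx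
  rw [← Measure.restrict_univ (μ := μ), ← iUnion_spanningSets μ, ae_restrict_iUnion_iff]
  intro n
  -- The almost sure statement holds only for x inside the spanning set used for y, so that set is
  -- enlarged until it contains x.
  set k := max n (spanningSetsIndex μ x)
  have hk := hx k (monotone_spanningSets μ (le_max_right _ _) (mem_spanningSetsIndex μ x))
  exact ae_mono (Measure.restrict_mono_set μ (monotone_spanningSets μ (le_max_left _ _))) hk

theorem ae_pi_precedes (hS : IsSetResolution μ S) {m : ℕ} :
    ∀ᵐ z ∂(Measure.pi fun _ : Fin (m + 1) => μ), ∀ i j, i ≠ j →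
      Precedes S (z i) (z j) ∨ Precedes S (z j) (z i) := by
  rw [ae_all_iff]
  intro i
  have hmp := measurePreserving_piFinSuccAbove (fun _ : Fin (m + 1) => μ) i
  have hmeas : MeasurableSet {p : Z × (Fin m → Z) |
      ∀ j, Precedes S p.1 (p.2 j) ∨ Precedes S (p.2 j) p.1} := by
    have : {p : Z × (Fin m → Z) | ∀ j, Precedes S p.1 (p.2 j) ∨ Precedes S (p.2 j) p.1} =
        ⋂ j, ((fun p : Z × (Fin m → Z) => (p.1, p.2 j)) ⁻¹' {p | Precedes S p.1 p.2} ∪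
          (fun p : Z × (Fin m → Z) => (p.2 j, p.1)) ⁻¹' {p | Precedes S p.1 p.2}) := by
      ext p; simp
    rw [this]
    refine MeasurableSet.iInter fun j => ?_
    exact (hS.measurableSet_precedes.preimage (by fun_prop)).union
      (hS.measurableSet_precedes.preimage (by fun_prop))
  have h : ∀ᵐ p ∂(μ.prod (Measure.pi fun _ : Fin m => μ)),
      ∀ j, Precedes S p.1 (p.2 j) ∨ Precedes S (p.2 j) p.1 := by
    rw [Measure.ae_prod_iff_ae_ae hmeas]
    filter_upwards [hS.ae_ae_precedes] with x hx
    rw [ae_all_iff]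
    intro j
    exact (Measure.tendsto_eval_ae_ae (μ := fun _ : Fin m => μ) (i := j)).eventually hx
  have h' := hmp.quasiMeasurePreserving.ae h
  filter_upwards [h'] with z hz j hij
  obtain ⟨k, rfl⟩ := Fin.exists_succAbove_eq hij.symm
  exact hz k

/-- Almost every configuration of points has a last point. -/
theorem ae_exists_last (hS : IsSetResolution μ S) {m : ℕ} :
    ∀ᵐ z ∂(Measure.pi fun _ : Fin (m + 1) => μ), Function.Injective z ∧
      ∃ j, ∃ q : ℚ, 0 < q ∧ q < 1 ∧ z j ∉ S (q : ℝ) ∧ ∀ i, i ≠ j → z i ∈ S (q : ℝ) := by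
  have h0 : ∀ᵐ z ∂(Measure.pi fun _ : Fin (m + 1) => μ), ∀ i,
      ∃ q : ℚ, 0 < q ∧ q < 1 ∧ z i ∉ S (q : ℝ) := by
    rw [ae_all_iff]
    intro i
    exact (Measure.tendsto_eval_ae_ae (μ := fun _ : Fin (m + 1) => μ) (i := i)).eventually
      hS.ae_exists_notMem
  filter_upwards [hS.ae_pi_precedes (m := m), h0] with z hz hz0
  refine ⟨fun i j hij => ?_, ?_⟩
  · by_contra hne
    rcases hz i j hne with h | h
    · rw [hij] at h; exact precedes_irrefl S _ h
    · rw [hij] at h; exact precedes_irrefl S _ h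
  -- The order is reversed, so that a minimal element of the finite index set is a last point.
  let r : Fin (m + 1) → Fin (m + 1) → Prop := fun i j => Precedes S (z j) (z i)
  have : IsTrans (Fin (m + 1)) r := ⟨fun i j k hij hjk => hS.precedes_trans hjk hij⟩
  have : Std.Irrefl r := ⟨fun i => precedes_irrefl S _⟩
  obtain ⟨j, -, hj⟩ := (Finite.wellFounded_of_trans_of_irrefl r).has_min Set.univ ⟨0, trivial⟩
  have hlast : ∀ i, i ≠ j → Precedes S (z i) (z j) := fun i hij =>
    (hz i j hij).resolve_right (hj i trivial)
  have hq : ∀ i, ∃ q : ℚ, 0 < q ∧ q < 1 ∧ z j ∉ S (q : ℝ) ∧ (i ≠ j → z i ∈ S (q : ℝ)) := by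
    intro i
    by_cases hij : i = j
    · obtain ⟨q, h0, h1, h2⟩ := hz0 j
      exact ⟨q, h0, h1, h2, fun h => absurd hij h⟩
    · obtain ⟨q, h0, h1, h2, h3⟩ := hlast i hij
      exact ⟨q, h0, h1, h3, fun _ => h2⟩
  choose q hq0 hq1 hq2 hq3 using hq
  -- The largest of the separating times serves all the other points at once.
  obtain ⟨k, -, hk⟩ := Finset.exists_max_image Finset.univ q ⟨0, Finset.mem_univ _⟩
  refine ⟨j, q k, hq0 k, hq1 k, hq2 k, fun i hij => ?_⟩
  exact hS.subset (rat_mem_Icc (hq0 i) (hq1 i)) (rat_mem_Icc (hq0 k) (hq1 k))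
    (by exact_mod_cast hk i (Finset.mem_univ i)) (hq3 i hij)

end IsSetResolution

/-! ### Invariance of the product measure under permutations. -/

section Permutations

variable {Z : Type*} [MeasurableSpace Z] {μ : Measure Z} [SigmaFinite μ]

theorem measurePreserving_comp_perm {d : ℕ} (σ : Equiv.Perm (Fin d)) :
    MeasurePreserving (fun (z : Fin d → Z) i => z (σ i)) (Measure.pi fun _ => μ)
      (Measure.pi fun _ => μ) := by
  have h := measurePreserving_piCongrLeft (fun _ : Fin d => μ) σ.symm
  refine (show (fun (z : Fin d → Z) i => z (σ i)) =
    MeasurableEquiv.piCongrLeft (fun _ => Z) σ.symm from ?_) ▸ h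
  ext z i
  rw [MeasurableEquiv.coe_piCongrLeft]
  have := Equiv.piCongrLeft_apply_apply (fun _ => Z) σ.symm z (σ i)
  simpa using this.symm

theorem measurableEmbedding_comp_perm {d : ℕ} (σ : Equiv.Perm (Fin d)) :
    MeasurableEmbedding (fun (z : Fin d → Z) i => z (σ i)) := by
  refine (show (fun (z : Fin d → Z) i => z (σ i)) =
    MeasurableEquiv.piCongrLeft (fun _ => Z) σ.symm from ?_) ▸ MeasurableEquiv.measurableEmbedding _
  ext z i
  rw [MeasurableEquiv.coe_piCongrLeft]
  have := Equiv.piCongrLeft_apply_apply (fun _ => Z) σ.symm z (σ i)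
  simpa using this.symm

theorem integral_comp_perm {d : ℕ} (σ : Equiv.Perm (Fin d)) (F : (Fin d → Z) → ℝ) :
    ∫ z, F (fun i => z (σ i)) ∂(Measure.pi fun _ => μ) = ∫ z, F z ∂(Measure.pi fun _ => μ) :=
  (measurePreserving_comp_perm σ).integral_comp (measurableEmbedding_comp_perm σ) F

end Permutations

/-- A function whose integral over every measurable sub-box of a box of finite measure vanishes is
almost everywhere zero on the box. -/
theorem ae_eq_zero_on_box {Z : Type*} [MeasurableSpace Z] {μ : Measure Z} [SigmaFinite μ] {d : ℕ}
    {g : (Fin d → Z) → ℝ} {B : Fin d → Set Z} (hB : ∀ i, MeasurableSet (B i))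
    (hg : IntegrableOn g (Set.univ.pi B) (Measure.pi fun _ => μ))
    (h : ∀ A : Fin d → Set Z, (∀ i, MeasurableSet (A i)) →
      ∫ z in Set.univ.pi fun i => A i ∩ B i, g z ∂(Measure.pi fun _ => μ) = 0) :
    ∀ᵐ z ∂(Measure.pi fun _ => μ), z ∈ Set.univ.pi B → g z = 0 := by
  set ν := (Measure.pi fun _ : Fin d => μ) with hν
  have hR : MeasurableSet (Set.univ.pi B) := MeasurableSet.univ_pi hB
  rw [← ae_restrict_iff' hR]
  -- Boxes form a generating π-system; the complement step uses that the integral over the whole box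
  -- vanishes, the case A = univ.
  have key : ∀ E, MeasurableSet E → ∫ z in E, g z ∂(ν.restrict (Set.univ.pi B)) = 0 := by
    intro E hE
    induction E, hE using MeasurableSpace.induction_on_inter
      (generateFrom_pi (α := fun _ : Fin d => Z)).symm isPiSystem_pi with
    | empty => simp
    | basic E hE =>
      obtain ⟨A, hA, rfl⟩ := hE
      have hA' : ∀ i, MeasurableSet (A i) := fun i => hA i trivial
      rw [Measure.restrict_restrict (MeasurableSet.univ_pi hA'), ← Set.pi_inter_distrib]
      exact h A hA'
    | compl E hE ih =>
      have h1 := integral_add_compl hE hg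
      have h2 := h (fun _ => Set.univ) fun _ => .univ
      simp only [Set.univ_inter] at h2
      rw [ih, zero_add, h2] at h1
      exact h1
    | iUnion E hd hE ih =>
      rw [integral_iUnion hE hd hg.integrableOn]
      simp [ih]
  exact Integrable.ae_eq_zero_of_forall_setIntegral_eq_zero hg fun E hE _ => key E hE

/-- The family `B` of disjoint sets of finite measure is adapted to the resolution `S` after time
`t`: the set `B 0` lies after `t` and after a rational time before which the other sets lie. -/
structure IsAdaptedBox {Z : Type*} [MeasurableSpace Z] (μ : Measure Z) (S : ℝ → Set Z) (t : ℝ)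
    {m : ℕ} (B : Fin (m + 1) → Set Z) : Prop where
  measurable : ∀ i, MeasurableSet (B i)
  lt_top : ∀ i, μ (B i) < ∞
  disjoint : Pairwise fun i j => Disjoint (B i) (B j)
  disjoint_zero : Disjoint (B 0) (S t)
  sep : ∃ q : ℚ, 0 < q ∧ q < 1 ∧ Disjoint (B 0) (S (q : ℝ)) ∧ ∀ i : Fin m, B i.succ ⊆ S (q : ℝ)

namespace IsAdaptedBox

variable {Z : Type*} [MeasurableSpace Z] {μ : Measure Z} {S : ℝ → Set Z} {t : ℝ} {m : ℕ}
  {B : Fin (m + 1) → Set Z}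

theorem inter (hB : IsAdaptedBox μ S t B) {A : Fin (m + 1) → Set Z}
    (hA : ∀ i, MeasurableSet (A i)) : IsAdaptedBox μ S t fun i => A i ∩ B i where
  measurable i := (hA i).inter (hB.measurable i)
  lt_top i := lt_of_le_of_lt (measure_mono Set.inter_subset_right) (hB.lt_top i)
  disjoint i j hij := (hB.disjoint hij).mono Set.inter_subset_right Set.inter_subset_right
  disjoint_zero := hB.disjoint_zero.mono_left Set.inter_subset_right
  sep := by
    obtain ⟨q, h0, h1, h2, h3⟩ := hB.sep
    exact ⟨q, h0, h1, h2.mono_left Set.inter_subset_right,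
      fun i => Set.inter_subset_right.trans (h3 i)⟩

end IsAdaptedBox

/-! ### Density of kernels carried by adapted boxes. -/

section Density

variable {Z : Type*} [MeasurableSpace Z] {μ : Measure Z} [SigmaFinite μ] {S : ℝ → Set Z} {t : ℝ}
  {m : ℕ}

/-- The configurations outside `S t ^ (m + 1)` are, up to order and null sets, covered by countably
many adapted boxes. -/
theorem ae_exists_perm_mem_adaptedBox [MeasurableSpace.CountablyGenerated Z]
    [MeasurableSpace.SeparatesPoints Z] (hS : IsSetResolution μ S)
    (ht : t ∈ Set.Icc (0 : ℝ) 1) :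
    ∃ R : ℕ → Fin (m + 1) → Set Z, (∀ k, IsAdaptedBox μ S t (R k)) ∧
      ∀ᵐ z ∂(Measure.pi fun _ : Fin (m + 1) => μ), z ∉ (Set.univ.pi fun _ => S t) →
        ∃ (σ : Equiv.Perm (Fin (m + 1))) (k : ℕ), (fun i => z (σ i)) ∈ Set.univ.pi (R k) := by
  -- A box is coded by a rational cut before the last point, distinct binary cells for the earlier
  -- points, and a spanning set that makes everything finite.
  set I := {q : ℚ // 0 < q ∧ q < 1} ×
    (Σ n : ℕ, {b : Fin m → Fin n → Bool // Function.Injective b}) × ℕ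
  set Q : I → Fin (m + 1) → Set Z := fun x => Fin.cons
    ((S t)ᶜ ∩ (S (x.1.1 : ℝ))ᶜ ∩ spanningSets μ x.2.2)
    (fun i => S (x.1.1 : ℝ) ∩ binaryCell Z x.2.1.1 (x.2.1.2.1 i) ∩ spanningSets μ x.2.2) with hQ
  have hQm : ∀ x, IsAdaptedBox μ S t (Q x) := by
    intro x
    have hq := hS.measurable _ (IsSetResolution.rat_mem_Icc x.1.2.1 x.1.2.2)
    have hsep : Disjoint (Q x 0) (S (x.1.1 : ℝ)) := by
      rw [Set.disjoint_left]
      exact fun z hz => hz.1.2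
    have hsub : ∀ i : Fin m, Q x i.succ ⊆ S (x.1.1 : ℝ) := fun i z hz => hz.1.1
    refine ⟨?_, ?_, ?_, ?_, x.1.1, x.1.2.1, x.1.2.2, hsep, hsub⟩
    · refine Fin.cases ?_ fun i => ?_
      · exact ((hS.measurable t ht).compl.inter hq.compl).inter (measurableSet_spanningSets μ _)
      · exact (hq.inter (measurableSet_binaryCell _ _)).inter (measurableSet_spanningSets μ _)
    · refine Fin.cases ?_ fun i => ?_
      · exact lt_of_le_of_lt (measure_mono Set.inter_subset_right) (measure_spanningSets_lt_top μ _)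
      · exact lt_of_le_of_lt (measure_mono Set.inter_subset_right) (measure_spanningSets_lt_top μ _)
    · intro i j hij
      induction i using Fin.cases with
      | zero =>
        induction j using Fin.cases with
        | zero => exact absurd rfl hij
        | succ j => exact hsep.mono_right (hsub j)
      | succ i =>
        induction j using Fin.cases with
        | zero => exact (hsep.mono_right (hsub i)).symm
        | succ j =>
          have hne : x.2.1.2.1 i ≠ x.2.1.2.1 j := fun h =>
            hij (congrArg Fin.succ (x.2.1.2.2 h))
          exact (disjoint_binaryCell _ hne).mono (fun z hz => hz.1.2) (fun z hz => hz.1.2)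
    · rw [Set.disjoint_left]
      exact fun z hz => hz.1.1
  -- At level m the m unit vectors are distinct codes.
  have : Nonempty I := ⟨⟨1 / 2, by norm_num, by norm_num⟩,
    ⟨m, fun i j => decide (i = j), fun i j h => by
      have := congrFun h i
      simpa [eq_comm] using this⟩, 0⟩
  obtain ⟨e, he⟩ := exists_surjective_nat I
  refine ⟨fun k => Q (e k), fun k => hQm _, ?_⟩
  filter_upwards [hS.ae_exists_last (m := m)] with z hz hzt
  obtain ⟨hinj, j, q, hq0, hq1, hqj, hqi⟩ := hz
  have hqI := IsSetResolution.rat_mem_Icc hq0 hq1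
  -- If the last point were in S t, then all the earlier points would be too.
  have hjt : z j ∉ S t := by
    intro hj
    apply hzt
    intro i _
    by_cases hij : i = j
    · rw [hij]; exact hj
    · exact hS.subset hqI ht (hS.lt_of_mem_of_notMem hqI ht hj hqj).le (hqi i hij)
  set σ : Equiv.Perm (Fin (m + 1)) := Equiv.swap 0 j
  have hσ0 : σ 0 = j := Equiv.swap_apply_left 0 j
  have hσi : ∀ i : Fin m, σ i.succ ≠ j := fun i h => by
    rw [← hσ0] at h
    exact Fin.succ_ne_zero i (σ.injective h)
  -- distinct points are separated by cells of a high enough level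
  have hsepn : ∀ a b : Fin m, a ≠ b → ∃ k, MeasurableSpace.mapNatBool Z (z (σ a.succ)) k ≠
      MeasurableSpace.mapNatBool Z (z (σ b.succ)) k := by
    intro a b hab
    by_contra! h
    have h1 := MeasurableSpace.injective_mapNatBool (α := Z) (funext h)
    exact hab (Fin.succ_injective m (σ.injective (hinj h1)))
  choose! lev hlev using hsepn
  obtain ⟨n, hn⟩ : ∃ n, ∀ a b : Fin m, lev a b < n :=
    ⟨(Finset.univ.sup fun p : Fin m × Fin m => lev p.1 p.2) + 1, fun a b =>
      Nat.lt_succ_of_le (Finset.le_sup (f := fun p : Fin m × Fin m => lev p.1 p.2)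
        (Finset.mem_univ (a, b)))⟩
  obtain ⟨N, hN⟩ : ∃ N, ∀ i, z i ∈ spanningSets μ N :=
    ⟨Finset.univ.sup fun i => spanningSetsIndex μ (z i), fun i =>
      monotone_spanningSets μ (Finset.le_sup (f := fun i => spanningSetsIndex μ (z i))
        (Finset.mem_univ i)) (mem_spanningSetsIndex μ (z i))⟩
  obtain ⟨k, hk⟩ := he (⟨q, hq0, hq1⟩, ⟨n, fun i (l : Fin n) =>
    MeasurableSpace.mapNatBool Z (z (σ i.succ)) l, fun a b hab => by
      by_contra hne
      exact hlev a b hne (congrFun hab ⟨lev a b, hn a b⟩)⟩, N)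
  refine ⟨σ, k, ?_⟩
  rw [hk]
  intro i _
  induction i using Fin.cases with
  | zero =>
    refine ⟨⟨?_, ?_⟩, hN _⟩
    · simpa [hσ0] using hjt
    · simpa [hσ0] using hqj
  | succ i => exact ⟨⟨hqi _ (hσi i), fun l => rfl⟩, hN _⟩

/-- A square integrable function orthogonal to the symmetrised indicators of adapted boxes has
vanishing symmetrisation outside `S t ^ (m + 1)`. -/
theorem ae_symmetrisation_eq_zero [MeasurableSpace.CountablyGenerated Z]
    [MeasurableSpace.SeparatesPoints Z] (hS : IsSetResolution μ S)
    (ht : t ∈ Set.Icc (0 : ℝ) 1) {g : (Fin (m + 1) → Z) → ℝ}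
    (hg : MemLp g 2 (Measure.pi fun _ => μ))
    (h : ∀ B : Fin (m + 1) → Set Z, IsAdaptedBox μ S t B →
      ∫ z, g z * symIndicator B z ∂(Measure.pi fun _ => μ) = 0) :
    ∀ᵐ z ∂(Measure.pi fun _ : Fin (m + 1) => μ), z ∉ (Set.univ.pi fun _ => S t) →
      ∑ σ : Equiv.Perm (Fin (m + 1)), g (fun i => z (σ i)) = 0 := by
  set ν := (Measure.pi fun _ : Fin (m + 1) => μ) with hν
  set G : (Fin (m + 1) → Z) → ℝ := fun z => ∑ σ : Equiv.Perm (Fin (m + 1)), g (fun i => z (σ i))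
    with hG
  have hgσ : ∀ σ : Equiv.Perm (Fin (m + 1)), MemLp (fun z => g fun i => z (σ i)) 2 ν :=
    fun σ => hg.comp_measurePreserving (measurePreserving_comp_perm σ)
  have hGσ : ∀ (σ : Equiv.Perm (Fin (m + 1))) z, G (fun i => z (σ i)) = G z := by
    intro σ z
    exact Equiv.sum_comp (Equiv.mulLeft σ) fun τ => g fun i => z (τ i)
  have hGL : MemLp G 2 ν := by
    have := memLp_finsetSum (Finset.univ : Finset (Equiv.Perm (Fin (m + 1)))) (p := 2) (μ := ν)
      (f := fun σ z => g fun i => z (σ i)) fun σ _ => hgσ σ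
    simpa [hG] using this
  -- Moving each permutation from the indicator to g by invariance of the measure turns
  -- orthogonality to the symmetrised indicator into a vanishing integral of the symmetrisation over
  -- the box.
  have hbox : ∀ B : Fin (m + 1) → Set Z, IsAdaptedBox μ S t B →
      ∫ z in Set.univ.pi B, G z ∂ν = 0 := by
    intro B hB
    have hBm := MeasurableSet.univ_pi hB.measurable
    have hI : ∀ z, ∏ i, (B i).indicator (fun _ => (1 : ℝ)) (z i) =
        (Set.univ.pi B).indicator (fun _ => (1 : ℝ)) z := by
      intro z
      by_cases hz : z ∈ Set.univ.pi B
      · rw [Set.indicator_of_mem hz]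
        exact Finset.prod_eq_one fun i _ => Set.indicator_of_mem (hz i trivial) _
      · rw [Set.indicator_of_notMem hz]
        simp only [Set.mem_pi, Set.mem_univ, true_implies, not_forall] at hz
        obtain ⟨i, hi⟩ := hz
        exact Finset.prod_eq_zero (Finset.mem_univ i) (Set.indicator_of_notMem hi _)
    have hIL : MemLp ((Set.univ.pi B).indicator fun _ => (1 : ℝ)) 2 ν :=
      memLp_indicator_const 2 hBm 1 (Or.inr (by
        rw [hν, Measure.pi_pi]
        exact (ENNReal.prod_lt_top fun i _ => hB.lt_top i).ne))
    have h1 := h B hB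
    have hint : ∀ σ : Equiv.Perm (Fin (m + 1)), Integrable (fun z => g z *
        ∏ i, (B i).indicator (fun _ => (1 : ℝ)) (z (σ i))) ν := by
      intro σ
      simp_rw [fun z : Fin (m + 1) → Z => hI fun i => z (σ i)]
      exact hg.integrable_mul (hIL.comp_measurePreserving (measurePreserving_comp_perm σ))
    simp only [symIndicator, Finset.mul_sum] at h1
    rw [integral_finsetSum _ fun σ _ => hint σ] at h1
    have h2 : ∀ σ : Equiv.Perm (Fin (m + 1)), ∫ z, g z *
        ∏ i, (B i).indicator (fun _ => (1 : ℝ)) (z (σ i)) ∂ν =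
        ∫ z, g (fun i => z (σ⁻¹ i)) * (Set.univ.pi B).indicator (fun _ => (1 : ℝ)) z ∂ν := by
      intro σ
      rw [← integral_comp_perm σ fun z => g (fun i => z (σ⁻¹ i)) *
        (Set.univ.pi B).indicator (fun _ => (1 : ℝ)) z]
      refine integral_congr_ae (ae_of_all _ fun z => ?_)
      simp only
      rw [← hI]
      simp
    have h2' : ∀ σ : Equiv.Perm (Fin (m + 1)), Integrable (fun z => g (fun i => z (σ⁻¹ i)) *
        (Set.univ.pi B).indicator (fun _ => (1 : ℝ)) z) ν := fun σ =>
      (hgσ σ⁻¹).integrable_mul hIL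
    rw [Finset.sum_congr rfl fun σ _ => h2 σ, ← integral_finsetSum _ fun σ _ => h2' σ] at h1
    rw [← integral_indicator hBm, ← h1]
    refine integral_congr_ae (ae_of_all _ fun z => ?_)
    simp only
    rw [← Finset.sum_mul]
    have h3 : ∑ σ : Equiv.Perm (Fin (m + 1)), g (fun i => z (σ⁻¹ i)) = G z := by
      exact Equiv.sum_comp (Equiv.inv (Equiv.Perm (Fin (m + 1)))) fun σ => g fun i => z (σ i)
    rw [h3]
    by_cases hz : z ∈ Set.univ.pi B
    · simp [Set.indicator_of_mem hz]
    · simp [Set.indicator_of_notMem hz]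
  obtain ⟨R, hR, hcov⟩ := ae_exists_perm_mem_adaptedBox (m := m) hS ht
  have hzero : ∀ k, ∀ᵐ z ∂ν, z ∈ Set.univ.pi (R k) → G z = 0 := by
    intro k
    refine ae_eq_zero_on_box (hR k).measurable ?_ fun A hA => hbox _ ((hR k).inter hA)
    have hfin : ν (Set.univ.pi (R k)) ≠ ∞ := by
      rw [hν, Measure.pi_pi]
      exact (ENNReal.prod_lt_top fun i _ => (hR k).lt_top i).ne
    have : IsFiniteMeasure (ν.restrict (Set.univ.pi (R k))) := ⟨by simpa using hfin.lt_top⟩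
    exact (hGL.restrict _).integrable (by norm_num)
  have hzero' : ∀ᵐ z ∂ν, ∀ (σ : Equiv.Perm (Fin (m + 1))) (k : ℕ),
      (fun i => z (σ i)) ∈ Set.univ.pi (R k) → G (fun i => z (σ i)) = 0 := by
    rw [ae_all_iff]
    intro σ
    rw [ae_all_iff]
    intro k
    exact (measurePreserving_comp_perm σ).quasiMeasurePreserving.ae (hzero k)
  -- The boxes cover configurations only after a reordering, which suffices because the
  -- symmetrisation is invariant.
  filter_upwards [hcov, hzero'] with z h1 h2 hzt
  obtain ⟨σ, k, hk⟩ := h1 hzt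
  change G z = 0
  rw [← hGσ σ z]
  exact h2 σ k hk

/-- The linear span of the triples (kernel, integral, adapted integrand) attached to the symmetrised
indicators of adapted boxes. -/
def adaptedGraph {Ω : Type*} (μ : Measure Z) (M : Set Z → Ω → ℝ) (S : ℝ → Set Z) (t : ℝ) (m : ℕ) :
    Submodule ℝ (((Fin (m + 1) → Z) → ℝ) × (Ω → ℝ) × (Ω → Z → ℝ)) :=
  Submodule.span ℝ {p | ∃ B : Fin (m + 1) → Set Z, IsAdaptedBox μ S t B ∧
    p = (symIndicator B, fun ω => ((m + 1).factorial : ℝ) * ∏ i, M (B i) ω,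
      fun ω z => (((m + 1).factorial : ℝ) * ∏ i : Fin m, M (B i.succ) ω) *
        (B 0).indicator (fun _ => (1 : ℝ)) z)}

/-- Symmetric kernels vanishing on `S t ^ (m + 1)` are limits of kernels of the adapted graph. -/
theorem exists_adaptedGraph_eLpNorm_le [MeasurableSpace.CountablyGenerated Z]
    [MeasurableSpace.SeparatesPoints Z] {Ω : Type*} (M : Set Z → Ω → ℝ)
    (hS : IsSetResolution μ S) (ht : t ∈ Set.Icc (0 : ℝ) 1)
    {f : (Fin (m + 1) → Z) → ℝ} (hf : MemLp f 2 (Measure.pi fun _ => μ))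
    (hsymm : ∀ (σ : Equiv.Perm (Fin (m + 1))) z, f (fun i => z (σ i)) = f z)
    (hzero : ∀ z ∈ (Set.univ.pi fun _ => S t), f z = 0) {ε : ℝ≥0∞} (hε : 0 < ε) :
    ∃ p ∈ adaptedGraph μ M S t m,
      eLpNorm (fun z => p.1 z - f z) 2 (Measure.pi fun _ => μ) < ε := by
  set ν := (Measure.pi fun _ : Fin (m + 1) => μ) with hν
  set K : Submodule ℝ (Lp ℝ 2 ν) := Submodule.span ℝ
    {u | ∃ B : Fin (m + 1) → Set Z, IsAdaptedBox μ S t B ∧ u =ᵐ[ν] symIndicator B} with hK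
  have hKgraph : ∀ u ∈ K, ∃ p ∈ adaptedGraph μ M S t m, u =ᵐ[ν] p.1 := by
    intro u hu
    induction hu using Submodule.span_induction with
    | mem u hu =>
      obtain ⟨B, hB, hu⟩ := hu
      exact ⟨_, Submodule.subset_span ⟨B, hB, rfl⟩, hu⟩
    | zero => exact ⟨0, Submodule.zero_mem _, Lp.coeFn_zero _ _ _⟩
    | add u v _ _ hu hv =>
      obtain ⟨p, hp, hup⟩ := hu
      obtain ⟨q, hq, hvq⟩ := hv
      exact ⟨p + q, Submodule.add_mem _ hp hq, (Lp.coeFn_add u v).trans (hup.add hvq)⟩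
    | smul a u _ hu =>
      obtain ⟨p, hp, hup⟩ := hu
      exact ⟨a • p, Submodule.smul_mem _ a hp, (Lp.coeFn_smul a u).trans (hup.const_smul a)⟩
  -- Density by duality: the double orthogonal is the closure.
  have hmem : hf.toLp ∈ Kᗮᗮ := by
    rw [Submodule.mem_orthogonal]
    intro g hg
    have hg2 : MemLp g 2 ν := Lp.memLp g
    have h1 : ∀ B : Fin (m + 1) → Set Z, IsAdaptedBox μ S t B →
        ∫ z, g z * symIndicator B z ∂ν = 0 := by
      intro B hB
      have hBL := memLp_symIndicator (μ := μ) hB.measurable hB.lt_top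
      have h2 := (Submodule.mem_orthogonal' K g).1 hg hBL.toLp
        (Submodule.subset_span ⟨B, hB, hBL.coeFn_toLp⟩)
      rw [L2.inner_def] at h2
      rw [← h2]
      refine integral_congr_ae ?_
      filter_upwards [hBL.coeFn_toLp] with z hz
      rw [hz]
      simp [mul_comm]
    have h2 := ae_symmetrisation_eq_zero hS ht hg2 h1
    rw [L2.inner_def]
    have h3 : ∫ z, inner ℝ (g z) (hf.toLp f z) ∂ν = ∫ z, g z * f z ∂ν := by
      refine integral_congr_ae ?_
      filter_upwards [hf.coeFn_toLp] with z hz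
      rw [hz]
      simp [mul_comm]
    rw [h3]
    -- As f is symmetric, g may be replaced by its permutations in the scalar product. The
    -- symmetrisation of g vanishes outside the power of S t and f vanishes inside it.
    have h4 : ∀ σ : Equiv.Perm (Fin (m + 1)),
        ∫ z, g (fun i => z (σ i)) * f z ∂ν = ∫ z, g z * f z ∂ν := by
      intro σ
      rw [← integral_comp_perm σ fun z => g z * f z]
      simp_rw [hsymm σ]
      rfl
    have h5 : ∑ σ : Equiv.Perm (Fin (m + 1)), ∫ z, g (fun i => z (σ i)) * f z ∂ν = 0 := by
      have hi : ∀ σ : Equiv.Perm (Fin (m + 1)),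
          Integrable (fun z => g (fun i => z (σ i)) * f z) ν := fun σ =>
        (hg2.comp_measurePreserving (measurePreserving_comp_perm σ)).integrable_mul hf
      rw [← integral_finsetSum _ fun σ _ => hi σ]
      rw [← integral_zero (Fin (m + 1) → Z) ℝ]
      refine integral_congr_ae ?_
      filter_upwards [h2] with z hz
      rw [← Finset.sum_mul]
      by_cases hzt : z ∈ (Set.univ.pi fun _ => S t)
      · rw [hzero z hzt, mul_zero]
      · rw [hz hzt, zero_mul]
    rw [Finset.sum_congr rfl fun σ _ => h4 σ] at h5
    simp only [Finset.sum_const, nsmul_eq_mul] at h5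
    refine (mul_eq_zero.1 h5).resolve_left ?_
    simp [Fintype.card_perm, Nat.factorial_ne_zero]
  rw [Submodule.orthogonal_orthogonal_eq_closure] at hmem
  have hmem' : hf.toLp ∈ closure (K : Set (Lp ℝ 2 ν)) := hmem
  obtain ⟨u, hu, hdist⟩ := EMetric.mem_closure_iff.1 hmem' ε hε
  obtain ⟨p, hp, hup⟩ := hKgraph u hu
  refine ⟨p, hp, ?_⟩
  rw [edist_comm, Lp.edist_def] at hdist
  refine lt_of_le_of_lt (le_of_eq (eLpNorm_congr_ae ?_)) hdist
  filter_upwards [hup, hf.coeFn_toLp] with z h1 h2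
  simp [h1, h2]

end Density

theorem eLpNorm_two_sq {α : Type*} [MeasurableSpace α] (ν : Measure α) (F : α → ℝ) :
    eLpNorm F 2 ν ^ 2 = ∫⁻ x, ‖F x‖ₑ ^ 2 ∂ν := by
  have h := eLpNorm_nnreal_pow_eq_lintegral (f := F) (μ := ν) (p := 2) two_ne_zero
  simpa using h

/-! ### Kernels projected on the configurations with a given last point. -/

section ProjectedKernel

variable {Z : Type*} {S : ℝ → Set Z} {m : ℕ}

theorem projectedKernel_add (f g : (Fin (m + 1) → Z) → ℝ) (z : Z) :
    projectedKernel S (f + g) z = projectedKernel S f z + projectedKernel S g z := by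
  ext w; simp [projectedKernel, add_mul]

theorem projectedKernel_sub (f g : (Fin (m + 1) → Z) → ℝ) (z : Z) :
    projectedKernel S (f - g) z = projectedKernel S f z - projectedKernel S g z := by
  ext w; simp [projectedKernel, sub_mul]

theorem projectedKernel_smul (a : ℝ) (f : (Fin (m + 1) → Z) → ℝ) (z : Z) :
    projectedKernel S (a • f) z = a • projectedKernel S f z := by
  ext w; simp [projectedKernel, mul_assoc]

theorem projectedKernel_zero (z : Z) :
    projectedKernel S (0 : (Fin (m + 1) → Z) → ℝ) z = 0 := by
  ext w; simp [projectedKernel]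

theorem projectedKernel_of_forall (f : (Fin (m + 1) → Z) → ℝ) {z : Z} {w : Fin m → Z}
    (h : ∀ j, Precedes S (w j) z) : projectedKernel S f z w = f (Fin.cons z w) := by
  simp [projectedKernel, h]

theorem projectedKernel_of_exists (f : (Fin (m + 1) → Z) → ℝ) {z : Z} {w : Fin m → Z}
    (h : ∃ j, ¬ Precedes S (w j) z) : projectedKernel S f z w = 0 := by
  classical
  obtain ⟨j, hj⟩ := h
  rw [projectedKernel, Finset.prod_eq_zero (Finset.mem_univ j) (by simp [hj]), mul_zero]

theorem enorm_projectedKernel_le (f : (Fin (m + 1) → Z) → ℝ) (z : Z) (w : Fin m → Z) :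
    ‖projectedKernel S f z w‖ₑ ≤ ‖f (Fin.cons z w)‖ₑ := by
  by_cases h : ∀ j, Precedes S (w j) z
  · rw [projectedKernel_of_forall f h]
  · push Not at h
    rw [projectedKernel_of_exists f h]
    simp

variable [MeasurableSpace Z] {μ : Measure Z}

/-- Only permutations fixing 0 survive. Otherwise some point w k lies in `B 0` while z lies in one
of the other sets, hence before the cut q; as w k precedes z it would also lie before q, and `B 0`
does not. -/
theorem IsAdaptedBox.projectedKernel_symIndicator {t : ℝ} {B : Fin (m + 1) → Set Z}
    (hB : IsAdaptedBox μ S t B) (hS : IsSetResolution μ S) (z : Z) (w : Fin m → Z) :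
    projectedKernel S (symIndicator B) z w =
      (B 0).indicator (fun _ => (1 : ℝ)) z * symIndicator (fun i => B i.succ) w := by
  classical
  obtain ⟨q, hq0, hq1, hd, hsub⟩ := hB.sep
  have hqI := IsSetResolution.rat_mem_Icc hq0 hq1
  have hsum : symIndicator B (Fin.cons z w) = ∑ p : Fin (m + 1), ∑ e : Equiv.Perm (Fin m),
      ∏ i, (B i).indicator (fun _ => (1 : ℝ))
        ((Fin.cons z w : Fin (m + 1) → Z) (Equiv.Perm.decomposeFin.symm (p, e) i)) := by
    rw [symIndicator, ← Equiv.sum_comp Equiv.Perm.decomposeFin.symm, Fintype.sum_prod_type]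
  rw [projectedKernel, hsum, Fin.sum_univ_succ, add_mul]
  have hrest : (∑ k : Fin m, ∑ e : Equiv.Perm (Fin m),
      ∏ i, (B i).indicator (fun _ => (1 : ℝ))
        ((Fin.cons z w : Fin (m + 1) → Z) (Equiv.Perm.decomposeFin.symm (k.succ, e) i))) *
      ∏ j, (if Precedes S (w j) z then (1 : ℝ) else 0) = 0 := by
    rw [Finset.sum_mul]
    refine Finset.sum_eq_zero fun k _ => ?_
    rw [Finset.sum_mul]
    refine Finset.sum_eq_zero fun e _ => ?_
    set σ := Equiv.Perm.decomposeFin.symm (k.succ, e) with hσ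
    have hσ0 : σ 0 = k.succ := by simp [hσ]
    by_cases h1 : w k ∈ B 0
    · by_cases h2 : Precedes S (w k) z
      · obtain ⟨i, hi⟩ := σ.surjective 0
        have hi0 : i ≠ 0 := by
          rintro rfl
          rw [hσ0] at hi
          exact Fin.succ_ne_zero k hi
        obtain ⟨j, rfl⟩ := Fin.exists_succ_eq.2 hi0
        have h3 : z ∉ B j.succ := fun hz =>
          Set.disjoint_left.1 hd h1 (hS.mem_of_precedes h2 hqI (hsub j hz))
        rw [Finset.prod_eq_zero (Finset.mem_univ j.succ), zero_mul]
        rw [hi]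
        exact Set.indicator_of_notMem h3 _
      · rw [Finset.prod_eq_zero (Finset.mem_univ k) (by simp [h2]), mul_zero]
    · rw [Finset.prod_eq_zero (Finset.mem_univ 0), zero_mul]
      rw [hσ0]
      exact Set.indicator_of_notMem h1 _
  rw [hrest, add_zero, symIndicator, Finset.sum_mul, Finset.mul_sum]
  refine Finset.sum_congr rfl fun e _ => ?_
  rw [Fin.prod_univ_succ]
  simp only [Equiv.Perm.decomposeFin_symm_apply_zero, Equiv.Perm.decomposeFin_symm_apply_succ,
    Equiv.swap_self, Equiv.refl_apply, Fin.cons_zero, Fin.cons_succ]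
  by_cases h1 : z ∈ B 0
  · by_cases h2 : ∀ i : Fin m, w (e i) ∈ B i.succ
    · have h3 : ∀ j, Precedes S (w j) z := by
        intro j
        have := hsub _ (h2 (e.symm j))
        rw [Equiv.apply_symm_apply] at this
        exact ⟨q, hq0, hq1, this, fun hz => Set.disjoint_left.1 hd h1 hz⟩
      simp [h3]
    · push Not at h2
      obtain ⟨i, hi⟩ := h2
      have : ∏ i : Fin m, (B i.succ).indicator (fun _ => (1 : ℝ)) (w (e i)) = 0 :=
        Finset.prod_eq_zero (Finset.mem_univ i) (Set.indicator_of_notMem hi _)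
      simp [this]
  · simp [Set.indicator_of_notMem h1]

theorem adaptedGraph_elementary {Ω : Type*} {M : Set Z → Ω → ℝ} {t : ℝ}
    {p : ((Fin (m + 1) → Z) → ℝ) × (Ω → ℝ) × (Ω → Z → ℝ)} (hp : p ∈ adaptedGraph μ M S t m) :
    (p.1, p.2.1) ∈ elementaryGraph μ M (m + 1) := by
  induction hp using Submodule.span_induction with
  | mem p hp =>
    obtain ⟨B, hB, rfl⟩ := hp
    exact Submodule.subset_span ⟨B, hB.measurable, hB.lt_top, hB.disjoint, rfl⟩
  | zero => exact Submodule.zero_mem _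
  | add p q _ _ hp hq => exact Submodule.add_mem _ hp hq
  | smul a p _ hp => exact Submodule.smul_mem _ a hp

/-- The third component of the graph is by design m + 1 times the integral of the projected kernel,
since (m + 1)! = (m + 1) m!. Its sections are thus controlled by the isometry of order m. -/
theorem adaptedGraph_projected {Ω : Type*} {M : Set Z → Ω → ℝ} {t : ℝ} (hS : IsSetResolution μ S)
    {p : ((Fin (m + 1) → Z) → ℝ) × (Ω → ℝ) × (Ω → Z → ℝ)} (hp : p ∈ adaptedGraph μ M S t m)
    (z : Z) : (projectedKernel S p.1 z, fun ω => p.2.2 ω z / ((m + 1 : ℕ) : ℝ)) ∈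
      elementaryGraph μ M m := by
  induction hp using Submodule.span_induction with
  | mem p hp =>
    obtain ⟨B, hB, rfl⟩ := hp
    have h : (symIndicator (fun i : Fin m => B i.succ),
        fun ω => (m.factorial : ℝ) * ∏ i : Fin m, M (B i.succ) ω) ∈ elementaryGraph μ M m :=
      Submodule.subset_span ⟨_, fun i => hB.measurable _, fun i => hB.lt_top _,
        fun i j hij => hB.disjoint fun h => hij (Fin.succ_injective m h), rfl⟩
    convert Submodule.smul_mem _ ((B 0).indicator (fun _ => (1 : ℝ)) z) h using 1
    refine Prod.ext ?_ ?_
    · ext w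
      simp [hB.projectedKernel_symIndicator hS]
    · ext ω
      have hm : ((m : ℝ) + 1) ≠ 0 := by positivity
      simp only [Prod.smul_snd, Pi.smul_apply, smul_eq_mul, Nat.factorial_succ]
      push_cast
      field_simp
  | zero =>
    convert Submodule.zero_mem _ using 1
    refine Prod.ext ?_ ?_
    · exact projectedKernel_zero z
    · ext ω; simp
  | add p q _ _ hp hq =>
    convert Submodule.add_mem _ hp hq using 1
    refine Prod.ext ?_ ?_
    · exact projectedKernel_add _ _ z
    · ext ω; simp [add_div]
  | smul a p _ hp =>
    convert Submodule.smul_mem _ a hp using 1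
    refine Prod.ext ?_ ?_
    · exact projectedKernel_smul _ _ z
    · ext ω; simp [mul_div_assoc]

theorem adaptedGraph_measurable {Ω : Type*} [MeasurableSpace Ω] {P : Measure Ω}
    {M : Set Z → Ω → ℝ} {t : ℝ}
    (hM : IsIndependentlyScattered P μ M)
    {p : ((Fin (m + 1) → Z) → ℝ) × (Ω → ℝ) × (Ω → Z → ℝ)} (hp : p ∈ adaptedGraph μ M S t m) :
    Measurable (Function.uncurry p.2.2) ∧ ∀ z ∈ S t, ∀ ω, p.2.2 ω z = 0 := by
  induction hp using Submodule.span_induction with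
  | mem p hp =>
    obtain ⟨B, hB, rfl⟩ := hp
    refine ⟨?_, fun z hz ω => ?_⟩
    · have h1 : Measurable fun ω => ((m + 1).factorial : ℝ) * ∏ i : Fin m, M (B i.succ) ω :=
        (Finset.measurable_fun_prod _ fun i _ =>
          hM.measurable _ (hB.measurable _) (hB.lt_top _)).const_mul _
      have h2 : Measurable ((B 0).indicator fun _ => (1 : ℝ)) :=
        measurable_const.indicator (hB.measurable 0)
      exact (h1.comp measurable_fst).mul (h2.comp measurable_snd)
    · simp [Set.indicator_of_notMem (Set.disjoint_right.1 hB.disjoint_zero hz)]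
  | zero => exact ⟨measurable_const, fun _ _ _ => rfl⟩
  | add p q _ _ hp hq =>
    exact ⟨hp.1.add hq.1, fun z hz ω => by simp [hp.2 z hz ω, hq.2 z hz ω]⟩
  | smul a p _ hp => exact ⟨hp.1.const_smul a, fun z hz ω => by simp [hp.2 z hz ω]⟩

end ProjectedKernel

/-! ### Fubini for the first coordinate of a kernel. -/

section Sections

variable {Z : Type*} [MeasurableSpace Z] {μ : Measure Z} [SigmaFinite μ] {m : ℕ}

theorem measurePreserving_cons :
    MeasurePreserving (fun x : Z × (Fin m → Z) => (Fin.cons x.1 x.2 : Fin (m + 1) → Z))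
      (μ.prod (Measure.pi fun _ => μ)) (Measure.pi fun _ => μ) := by
  have h := (measurePreserving_piFinSuccAbove (fun _ : Fin (m + 1) => μ) 0).symm
  refine (show (fun x : Z × (Fin m → Z) => (Fin.cons x.1 x.2 : Fin (m + 1) → Z)) =
    (MeasurableEquiv.piFinSuccAbove (fun _ : Fin (m + 1) => Z) 0).symm from ?_) ▸ h
  ext x i
  simp [MeasurableEquiv.piFinSuccAbove, Fin.insertNthEquiv]

theorem lintegral_cons {F : (Fin (m + 1) → Z) → ℝ≥0∞}
    (hF : AEMeasurable F (Measure.pi fun _ => μ)) :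
    ∫⁻ z, ∫⁻ w, F (Fin.cons z w) ∂(Measure.pi fun _ : Fin m => μ) ∂μ =
      ∫⁻ x, F x ∂(Measure.pi fun _ => μ) := by
  have h := measurePreserving_cons (μ := μ) (m := m)
  have hF' : AEMeasurable (fun x : Z × (Fin m → Z) => F (Fin.cons x.1 x.2))
      (μ.prod (Measure.pi fun _ => μ)) :=
    (hF.comp_quasiMeasurePreserving h.quasiMeasurePreserving)
  rw [← lintegral_prod (fun x : Z × (Fin m → Z) => F (Fin.cons x.1 x.2)) hF']
  rw [← h.map_eq, lintegral_map' (by rwa [h.map_eq]) h.measurable.aemeasurable]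

theorem ae_aestronglyMeasurable_cons {F : (Fin (m + 1) → Z) → ℝ}
    (hF : AEStronglyMeasurable F (Measure.pi fun _ => μ)) :
    ∀ᵐ z ∂μ, AEStronglyMeasurable (fun w : Fin m → Z => F (Fin.cons z w))
      (Measure.pi fun _ => μ) := by
  have h := measurePreserving_cons (μ := μ) (m := m)
  exact (hF.comp_quasiMeasurePreserving h.quasiMeasurePreserving).prodMk_left

theorem aestronglyMeasurable_projectedKernel {S : ℝ → Set Z} (hS : IsSetResolution μ S)
    {F : (Fin (m + 1) → Z) → ℝ} {z : Z}
    (hF : AEStronglyMeasurable (fun w : Fin m → Z => F (Fin.cons z w)) (Measure.pi fun _ => μ)) :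
    AEStronglyMeasurable (projectedKernel S F z) (Measure.pi fun _ => μ) := by
  classical
  refine hF.mul (Measurable.aestronglyMeasurable ?_)
  refine Finset.measurable_fun_prod _ fun j _ => Measurable.ite ?_ measurable_const measurable_const
  exact hS.measurableSet_precedes.preimage
    (f := fun w : Fin m → Z => (w j, z)) (by fun_prop)

theorem lintegral_eLpNorm_cons {F : (Fin (m + 1) → Z) → ℝ}
    (hF : AEStronglyMeasurable F (Measure.pi fun _ => μ)) :
    ∫⁻ z, eLpNorm (fun w : Fin m → Z => F (Fin.cons z w)) 2 (Measure.pi fun _ => μ) ^ 2 ∂μ =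
      eLpNorm F 2 (Measure.pi fun _ => μ) ^ 2 := by
  simp_rw [eLpNorm_two_sq]
  exact lintegral_cons (F := fun x => ‖F x‖ₑ ^ 2) (hF.enorm.pow_const 2)

theorem eLpNorm_projectedKernel_le {S : ℝ → Set Z} (F : (Fin (m + 1) → Z) → ℝ) (z : Z) :
    eLpNorm (projectedKernel S F z) 2 (Measure.pi fun _ => μ) ≤
      eLpNorm (fun w : Fin m → Z => F (Fin.cons z w)) 2 (Measure.pi fun _ => μ) :=
  eLpNorm_mono_enorm fun w => enorm_projectedKernel_le F z w

end Sections

/-! ### The share of the energy in which the first coordinate comes last. -/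

section LastPoint

variable {Z : Type*} [MeasurableSpace Z] {μ : Measure Z} [SigmaFinite μ] {m : ℕ} {S : ℝ → Set Z}

/-- By symmetry, the first coordinate is the last point with probability at most `1 / (m + 1)`. -/
theorem mul_lintegral_projectedKernel_le (hS : IsSetResolution μ S)
    {F : (Fin (m + 1) → Z) → ℝ} (hF : AEStronglyMeasurable F (Measure.pi fun _ => μ))
    (hsymm : ∀ (σ : Equiv.Perm (Fin (m + 1))) z, F (fun i => z (σ i)) = F z) :
    ((m + 1 : ℕ) : ℝ≥0∞) *
      ∫⁻ z, eLpNorm (projectedKernel S F z) 2 (Measure.pi fun _ => μ) ^ 2 ∂μ ≤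
      eLpNorm F 2 (Measure.pi fun _ => μ) ^ 2 := by
  classical
  -- The event that the point j is last. These events are exchanged by permutations and are pairwise
  -- disjoint, whence the factor m + 1.
  set L : Fin (m + 1) → (Fin (m + 1) → Z) → Prop :=
    fun j x => ∀ i, i ≠ j → Precedes S (x i) (x j) with hL
  have hLm : ∀ j, MeasurableSet {x | L j x} := by
    intro j
    have : {x | L j x} = ⋂ i, {x : Fin (m + 1) → Z | i ≠ j → Precedes S (x i) (x j)} := by
      ext x; simp [hL]
    rw [this]
    refine MeasurableSet.iInter fun i => ?_
    by_cases hij : i = j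
    · simp [hij]
    · simp only [ne_eq, hij, not_false_eq_true, forall_const]
      exact hS.measurableSet_precedes.preimage
        (f := fun x : Fin (m + 1) → Z => (x i, x j)) (by fun_prop)
  set G : Fin (m + 1) → (Fin (m + 1) → Z) → ℝ≥0∞ := fun j x =>
    {x | L j x}.indicator (fun x => ‖F x‖ₑ ^ 2) x with hG
  have hGm : ∀ j, AEMeasurable (G j) (Measure.pi fun _ => μ) := fun j =>
    (hF.enorm.pow_const 2).indicator (hLm j)
  have h0 : ∫⁻ z, eLpNorm (projectedKernel S F z) 2 (Measure.pi fun _ => μ) ^ 2 ∂μ =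
      ∫⁻ x, G 0 x ∂(Measure.pi fun _ => μ) := by
    rw [← lintegral_cons (hGm 0)]
    refine lintegral_congr fun z => ?_
    rw [eLpNorm_two_sq]
    refine lintegral_congr fun w => ?_
    by_cases h : ∀ j, Precedes S (w j) z
    · have : L 0 (Fin.cons z w) := by
        intro i hi
        obtain ⟨k, rfl⟩ := Fin.exists_succ_eq.2 hi
        simpa using h k
      rw [projectedKernel_of_forall F h, hG]
      simp only
      rw [Set.indicator_of_mem (by exact this)]
    · have : ¬ L 0 (Fin.cons z w) := fun h' => h fun j => by
        simpa using h' j.succ (Fin.succ_ne_zero j)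
      push Not at h
      rw [projectedKernel_of_exists F h, hG]
      simp only
      rw [Set.indicator_of_notMem (by exact this)]
      simp
  have hj : ∀ j, ∫⁻ x, G j x ∂(Measure.pi fun _ => μ) = ∫⁻ x, G 0 x ∂(Measure.pi fun _ => μ) := by
    intro j
    set σ : Equiv.Perm (Fin (m + 1)) := Equiv.swap 0 j
    have hmp := measurePreserving_comp_perm (μ := μ) σ
    rw [← hmp.lintegral_comp_emb (measurableEmbedding_comp_perm σ) (G 0)]
    refine lintegral_congr fun x => ?_
    have hiff : L j x ↔ L 0 (fun i => x (σ i)) := by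
      simp only [hL]
      have hσ0 : σ 0 = j := Equiv.swap_apply_left 0 j
      rw [hσ0]
      constructor
      · intro h i hi
        exact h (σ i) fun h' => hi (σ.injective (h'.trans hσ0.symm))
      · intro h i hi
        have := h (σ.symm i) fun h' => hi (by rw [← hσ0, ← h', Equiv.apply_symm_apply])
        rwa [Equiv.apply_symm_apply] at this
    by_cases h : L j x
    · simp only [hG]
      rw [Set.indicator_of_mem (by exact h), Set.indicator_of_mem (by exact hiff.1 h), hsymm]
    · simp only [hG]
      rw [Set.indicator_of_notMem (by exact h),
        Set.indicator_of_notMem (by exact fun h' => h (hiff.2 h'))]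
  have hsum : ∀ x, ∑ j, G j x ≤ ‖F x‖ₑ ^ 2 := by
    intro x
    by_cases h : ∃ j, L j x
    · obtain ⟨j, hj⟩ := h
      rw [Finset.sum_eq_single j]
      · exact Set.indicator_le_self _ _ _
      · intro k _ hk
        refine Set.indicator_of_notMem ?_ _
        exact fun hk' => hS.precedes_asymm (hj k hk) (hk' j hk.symm)
      · simp
    · push Not at h
      rw [Finset.sum_eq_zero]
      · exact zero_le
      · exact fun j _ => Set.indicator_of_notMem (by exact h j) _
  calc ((m + 1 : ℕ) : ℝ≥0∞) *
        ∫⁻ z, eLpNorm (projectedKernel S F z) 2 (Measure.pi fun _ => μ) ^ 2 ∂μ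
      = ∑ j : Fin (m + 1), ∫⁻ x, G j x ∂(Measure.pi fun _ => μ) := by
        rw [h0, Finset.sum_congr rfl fun j _ => hj j]
        simp
    _ = ∫⁻ x, ∑ j : Fin (m + 1), G j x ∂(Measure.pi fun _ => μ) :=
        (lintegral_finsetSum' _ fun j _ => hGm j).symm
    _ ≤ ∫⁻ x, ‖F x‖ₑ ^ 2 ∂(Measure.pi fun _ => μ) := lintegral_mono hsum
    _ = eLpNorm F 2 (Measure.pi fun _ => μ) ^ 2 := (eLpNorm_two_sq _ _).symm

end LastPoint

/-- Indices with integrals at most 2⁻ʲ make the series integrable, so its terms tend to zero almost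
everywhere. The indices need not increase. -/
theorem exists_seq_ae_tendsto_of_lintegral {α : Type*} [MeasurableSpace α] {ν : Measure α}
    {a : ℕ → α → ℝ≥0∞} (ha : ∀ k, AEMeasurable (a k) ν)
    (h : Tendsto (fun k => ∫⁻ x, a k x ∂ν) atTop (𝓝 0)) :
    ∃ φ : ℕ → ℕ, ∀ᵐ x ∂ν, Tendsto (fun j => a (φ j) x) atTop (𝓝 0) := by
  have h1 : ∀ j : ℕ, ∃ k, ∫⁻ x, a k x ∂ν ≤ (2⁻¹ : ℝ≥0∞) ^ j := fun j =>
    ((tendsto_order.1 h).2 ((2⁻¹ : ℝ≥0∞) ^ j)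
      (ENNReal.pow_pos (by simp) j)).exists.imp fun k hk => hk.le
  choose φ hφ using h1
  refine ⟨φ, ?_⟩
  have h2 : ∫⁻ x, ∑' j, a (φ j) x ∂ν ≠ ∞ := by
    rw [lintegral_tsum fun j => ha _]
    refine ne_top_of_le_ne_top ?_ (ENNReal.tsum_le_tsum hφ)
    rw [ENNReal.tsum_geometric]
    simp
  filter_upwards [ae_lt_top' (AEMeasurable.tsum fun j => ha (φ j)) h2] with x hx
  exact ENNReal.tendsto_atTop_zero_of_tsum_ne_top hx.ne

/-! ### The adapted integrand as a jointly measurable process. -/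

section AdaptedIntegrand

variable {Ω Z : Type*} [MeasurableSpace Ω] [MeasurableSpace Z]
  {P : Measure Ω} [IsProbabilityMeasure P] {μ : Measure Z} [SigmaFinite μ] {M : Set Z → Ω → ℝ}
  {S : ℝ → Set Z} {m : ℕ} {f : (Fin (m + 1) → Z) → ℝ}

theorem lintegral_eLpNorm_section {H : Ω → Z → ℝ}
    (hH : AEStronglyMeasurable (Function.uncurry H) (P.prod μ)) :
    ∫⁻ z, eLpNorm (fun ω => H ω z) 2 P ^ 2 ∂μ =
      eLpNorm (Function.uncurry H) 2 (P.prod μ) ^ 2 := by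
  simp_rw [eLpNorm_two_sq]
  rw [lintegral_prod_symm _ (hH.enorm.pow_const 2)]
  rfl

theorem aemeasurable_eLpNorm_section {H : Ω → Z → ℝ}
    (hH : AEStronglyMeasurable (Function.uncurry H) (P.prod μ)) :
    AEMeasurable (fun z => eLpNorm (fun ω => H ω z) 2 P ^ 2) μ := by
  simp_rw [eLpNorm_two_sq]
  exact (hH.enorm.pow_const 2).lintegral_prod_left'

theorem aemeasurable_eLpNorm_cons {F : (Fin (m + 1) → Z) → ℝ}
    (hF : AEStronglyMeasurable F (Measure.pi fun _ => μ)) :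
    AEMeasurable (fun z => eLpNorm (fun w : Fin m → Z => F (Fin.cons z w)) 2
      (Measure.pi fun _ => μ) ^ 2) μ := by
  simp_rw [eLpNorm_two_sq]
  have h := measurePreserving_cons (μ := μ) (m := m)
  exact ((hF.comp_quasiMeasurePreserving h.quasiMeasurePreserving).enorm.pow_const 2).lintegral_prod_right'

theorem eLpNorm_div_const (F : Ω → ℝ) (c : ℝ) (hc : 0 < c) :
    eLpNorm (fun ω => F ω / c) 2 P = ENNReal.ofReal c⁻¹ * eLpNorm F 2 P := by
  have : (fun ω => F ω / c) = c⁻¹ • F := by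
    ext ω; simp [div_eq_inv_mul]
  rw [this, eLpNorm_const_smul, Real.enorm_of_nonneg (by positivity)]

theorem eLpNorm_sq_eq_mul_div (F : Ω → ℝ) (n : ℕ) (hn : 0 < n) :
    eLpNorm F 2 P ^ 2 = (n : ℝ≥0∞) ^ 2 * eLpNorm (fun ω => F ω / (n : ℝ)) 2 P ^ 2 := by
  rw [eLpNorm_div_const F n (by exact_mod_cast hn), ← mul_pow, ← mul_assoc,
    ENNReal.ofReal_inv_of_pos (by exact_mod_cast hn), ENNReal.ofReal_natCast,
    ENNReal.mul_inv_cancel (by exact_mod_cast hn.ne') (ENNReal.natCast_ne_top n), one_mul]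

variable [MeasurableSpace.CountablyGenerated Z] [MeasurableSpace.SeparatesPoints Z]
  [NullSingletonClass μ]

/-- Isometry in each section, then the projection is simply dropped. The constant is not sharp, but
continuity is all that the Cauchy argument needs. -/
theorem eLpNorm_adaptedGraph_sq_le (hM : IsIndependentlyScattered P μ M)
    (hS : IsSetResolution μ S) {t : ℝ}
    {p : ((Fin (m + 1) → Z) → ℝ) × (Ω → ℝ) × (Ω → Z → ℝ)} (hp : p ∈ adaptedGraph μ M S t m) :
    eLpNorm (Function.uncurry p.2.2) 2 (P.prod μ) ^ 2 ≤
      (((m + 1 : ℕ) : ℝ≥0∞) ^ 2 * m.factorial) * eLpNorm p.1 2 (Measure.pi fun _ => μ) ^ 2 := by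
  have hpm := (adaptedGraph_measurable hM hp).1
  have hp1 := (elementaryGraph_properties hM (adaptedGraph_elementary hp)).2.1.1
  rw [← lintegral_eLpNorm_section hpm.aestronglyMeasurable, ← lintegral_eLpNorm_cons hp1,
    ← lintegral_const_mul'' _ (aemeasurable_eLpNorm_cons hp1)]
  refine lintegral_mono fun z => ?_
  rw [eLpNorm_sq_eq_mul_div _ (m + 1) m.succ_pos,
    eLpNorm_elementaryGraph hM (adaptedGraph_projected hS hp z), ← mul_assoc]
  gcongr
  exact eLpNorm_projectedKernel_le p.1 z

/-- The adapted integrand exists as a jointly measurable process, whose sections are multiple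
integrals. -/
theorem exists_isMultipleIntegral_projectedKernel (hM : IsIndependentlyScattered P μ M)
    (hS : IsSetResolution μ S) (hf : IsSymmKernel μ f) :
    ∃ H : Ω → Z → ℝ, Measurable (Function.uncurry H) ∧ ∀ᵐ z ∂μ,
      IsMultipleIntegral P μ M m (projectedKernel S f z)
        (fun ω => H ω z / ((m + 1 : ℕ) : ℝ)) := by
  have hzero : ∀ z ∈ (Set.univ.pi fun _ : Fin (m + 1) => S 0), f z = 0 := by
    intro z hz
    have := hz 0 trivial
    rw [hS.zero] at this
    exact absurd this (Set.notMem_empty _)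
  have hseq : ∀ k : ℕ, ∃ p ∈ adaptedGraph μ M S 0 m,
      eLpNorm (fun z => p.1 z - f z) 2 (Measure.pi fun _ => μ) < (2⁻¹ : ℝ≥0∞) ^ k := fun k =>
    exists_adaptedGraph_eLpNorm_le M hS (by simp) hf.memLp hf.symm hzero
      (ENNReal.pow_pos (by simp) k)
  choose p hp hpf using hseq
  have hp1 : ∀ k, AEStronglyMeasurable (p k).1 (Measure.pi fun _ => μ) := fun k =>
    (elementaryGraph_properties hM (adaptedGraph_elementary (hp k))).2.1.1
  have hp2 : ∀ k, MemLp (p k).1 2 (Measure.pi fun _ => μ) := fun k =>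
    (elementaryGraph_properties hM (adaptedGraph_elementary (hp k))).2.1
  have hHm : ∀ k, Measurable (Function.uncurry (p k).2.2) := fun k =>
    (adaptedGraph_measurable hM (hp k)).1
  have hpow : Tendsto (fun k : ℕ => (2⁻¹ : ℝ≥0∞) ^ k) atTop (𝓝 0) :=
    ENNReal.tendsto_pow_atTop_nhds_zero_of_lt_one (by simp)
  set C : ℝ≥0∞ := ((m + 1 : ℕ) : ℝ≥0∞) ^ 2 * m.factorial with hC
  have hCtop : C ≠ ∞ := ENNReal.mul_ne_top (ENNReal.pow_ne_top (ENNReal.natCast_ne_top _))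
    (ENNReal.natCast_ne_top _)
  have hC1 : 1 ≤ C := by
    have : 1 ≤ (m + 1) ^ 2 * m.factorial :=
      Nat.one_le_iff_ne_zero.2 (Nat.mul_ne_zero (by positivity) (Nat.factorial_ne_zero m))
    rw [hC]
    exact_mod_cast this
  have hbound : ∀ q ∈ adaptedGraph μ M S 0 m, eLpNorm (Function.uncurry q.2.2) 2 (P.prod μ) ≤
      C * eLpNorm q.1 2 (Measure.pi fun _ => μ) := by
    intro q hq
    rw [← ENNReal.pow_le_pow_left_iff two_ne_zero, mul_pow]
    refine (eLpNorm_adaptedGraph_sq_le hM hS hq).trans ?_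
    gcongr
    calc C = C * 1 := (mul_one C).symm
      _ ≤ C ^ 2 := by rw [sq]; gcongr
  have hLp : ∀ k, MemLp (Function.uncurry (p k).2.2) 2 (P.prod μ) := fun k =>
    ⟨(hHm k).aestronglyMeasurable, lt_of_le_of_lt (hbound _ (hp k))
      (ENNReal.mul_lt_top hCtop.lt_top (hp2 k).2)⟩
  have hlim := ENNReal.Tendsto.const_mul (a := C) hpow (Or.inr hCtop)
  rw [mul_zero] at hlim
  obtain ⟨G, hG, -, hGlim⟩ := exists_tendsto_eLpNorm_of_cauchy hLp hlim (by
    intro k l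
    have h1 := hbound _ (Submodule.sub_mem _ (hp k) (hp l))
    refine h1.trans ?_
    rw [← mul_add]
    gcongr
    have : (p k - p l).1 = (fun z => (p k).1 z - f z) - fun z => (p l).1 z - f z := by
      ext z; simp only [Prod.fst_sub, Pi.sub_apply]; ring
    rw [this]
    exact (eLpNorm_sub_le ((hp1 k).sub hf.memLp.1) ((hp1 l).sub hf.memLp.1) (by norm_num)).trans
      (add_le_add (hpf k).le (hpf l).le))
  refine ⟨fun ω z => G (ω, z), hG, ?_⟩
  -- Convergence in the product space only gives convergence of sections on average over z. One
  -- subsequence makes the integrands and the kernels converge together for almost every z.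
  set A : ℕ → Z → ℝ≥0∞ := fun k z => eLpNorm (fun ω => (p k).2.2 ω z - G (ω, z)) 2 P ^ 2
  set B : ℕ → Z → ℝ≥0∞ := fun k z => eLpNorm (fun w : Fin m → Z =>
    (p k).1 (Fin.cons z w) - f (Fin.cons z w)) 2 (Measure.pi fun _ => μ) ^ 2
  have hmA : ∀ k, AEStronglyMeasurable (Function.uncurry fun ω z => (p k).2.2 ω z - G (ω, z))
      (P.prod μ) := fun k => ((hHm k).sub hG).aestronglyMeasurable
  have hA : ∀ k, AEMeasurable (A k) μ := fun k => aemeasurable_eLpNorm_section (hmA k)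
  have hB : ∀ k, AEMeasurable (B k) μ := fun k => aemeasurable_eLpNorm_cons
    (F := fun x => (p k).1 x - f x) ((hp1 k).sub hf.memLp.1)
  have hAB : Tendsto (fun k => ∫⁻ z, A k z + B k z ∂μ) atTop (𝓝 0) := by
    have e : ∀ k, ∫⁻ z, A k z + B k z ∂μ =
        eLpNorm (fun x => Function.uncurry (p k).2.2 x - G x) 2 (P.prod μ) ^ 2 +
        eLpNorm (fun z => (p k).1 z - f z) 2 (Measure.pi fun _ => μ) ^ 2 := by
      intro k
      rw [lintegral_add_left' (hA k), lintegral_eLpNorm_section (hmA k),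
        lintegral_eLpNorm_cons (F := fun x => (p k).1 x - f x) ((hp1 k).sub hf.memLp.1)]
      rfl
    simp_rw [e]
    have h1 : Tendsto (fun k => eLpNorm (fun z => (p k).1 z - f z) 2 (Measure.pi fun _ => μ))
        atTop (𝓝 0) := tendsto_of_tendsto_of_tendsto_of_le_of_le tendsto_const_nhds hpow
          (fun _ => zero_le) fun k => (hpf k).le
    simpa using (ENNReal.Tendsto.pow hGlim (n := 2)).add (ENNReal.Tendsto.pow h1 (n := 2))
  obtain ⟨φ, hφ⟩ := exists_seq_ae_tendsto_of_lintegral (fun k => (hA k).add (hB k)) hAB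
  have hsq : ∀ {a : ℕ → ℝ≥0∞}, Tendsto (fun j => a j ^ 2) atTop (𝓝 0) →
      Tendsto a atTop (𝓝 0) := by
    intro a ha
    have := (ENNReal.continuous_rpow_const (y := (1 / 2 : ℝ))).tendsto 0 |>.comp ha
    simp only [one_div, Function.comp_def] at this
    rw [ENNReal.zero_rpow_of_pos (by norm_num)] at this
    refine this.congr fun j => ?_
    rw [← ENNReal.rpow_natCast, ← ENNReal.rpow_mul]
    simp
  filter_upwards [hφ] with z hz
  have hAz : Tendsto (fun j => A (φ j) z) atTop (𝓝 0) :=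
    tendsto_of_tendsto_of_tendsto_of_le_of_le tendsto_const_nhds hz (fun _ => zero_le)
      fun j => le_self_add
  have hBz : Tendsto (fun j => B (φ j) z) atTop (𝓝 0) :=
    tendsto_of_tendsto_of_tendsto_of_le_of_le tendsto_const_nhds hz (fun _ => zero_le)
      fun j => le_add_self
  refine ⟨(hG.comp measurable_prodMk_right).div_const _, fun j =>
    (projectedKernel S (p (φ j)).1 z, fun ω => (p (φ j)).2.2 ω z / ((m + 1 : ℕ) : ℝ)),
    fun j => adaptedGraph_projected hS (hp _) z, ?_, ?_⟩
  · refine tendsto_of_tendsto_of_tendsto_of_le_of_le tendsto_const_nhds (hsq hBz)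
      (fun _ => zero_le) fun j => ?_
    have := eLpNorm_projectedKernel_le (μ := μ) (S := S) ((p (φ j)).1 - f) z
    rw [projectedKernel_sub] at this
    exact this
  · have h1 := ENNReal.Tendsto.const_mul (a := ENNReal.ofReal (((m + 1 : ℕ) : ℝ))⁻¹) (hsq hAz)
      (Or.inr ENNReal.ofReal_ne_top)
    rw [mul_zero] at h1
    refine h1.congr fun j => ?_
    rw [← eLpNorm_div_const _ _ (by positivity)]
    congr 1
    ext ω
    simp only
    rw [sub_div]

/-- The defining property of the adapted integrand. -/
theorem adaptedIntegrand_spec (hM : IsIndependentlyScattered P μ M)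
    (hS : IsSetResolution μ S) (hf : IsSymmKernel μ f) :
    AEMeasurable (Function.uncurry (adaptedIntegrand P μ M S m f)) (P.prod μ) ∧ ∀ᵐ z ∂μ,
      AEStronglyMeasurable (fun w : Fin m → Z => f (Fin.cons z w)) (Measure.pi fun _ => μ) ∧
      IsMultipleIntegral P μ M m (projectedKernel S f z)
        (fun ω => adaptedIntegrand P μ M S m f ω z / ((m + 1 : ℕ) : ℝ)) := by
  have hsec := ae_aestronglyMeasurable_cons hf.memLp.1
  cases m with
  | zero =>
    refine ⟨?_, ?_⟩
    · have h1 : MeasurePreserving (fun z : Z => fun _ : Fin 1 => z) μ (Measure.pi fun _ => μ) :=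
        (measurePreserving_funUnique μ (Fin 1)).symm
      have h2 := (hf.memLp.1.aemeasurable.comp_quasiMeasurePreserving h1.quasiMeasurePreserving)
      exact h2.comp_quasiMeasurePreserving (Measure.quasiMeasurePreserving_snd (μ := P) (ν := μ))
    · filter_upwards [hsec] with z hz
      refine ⟨hz, ?_⟩
      -- In order zero the only generator is the pair of constants (1, 1), so every constant kernel
      -- is its own integral.
      have h1 : (symIndicator (Fin.elim0 : Fin 0 → Set Z),
          fun ω => ((0 : ℕ).factorial : ℝ) * ∏ i : Fin 0, M (Fin.elim0 i) ω) ∈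
          elementaryGraph μ M 0 :=
        Submodule.subset_span ⟨Fin.elim0, fun i => i.elim0, fun i => i.elim0,
          fun i => i.elim0, by congr 1⟩
      have h2 := IsMultipleIntegral.of_mem_elementaryGraph hM
        (Submodule.smul_mem _ (f fun _ => z) h1)
      convert h2 using 1
      · ext w
        have : (Fin.cons z w : Fin 1 → Z) = fun _ => z := by
          ext i
          obtain rfl : i = 0 := Fin.fin_one_eq_zero i
          rfl
        simp [projectedKernel, symIndicator, this]
      · ext ω
        simp [adaptedIntegrand]
  | succ m =>
    obtain ⟨H, hH, hHI⟩ := exists_isMultipleIntegral_projectedKernel hM hS hf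
    -- This rules out the default value zero in `adaptedIntegrand`; the chosen process agrees with
    -- the constructed one in almost every section.
    have hex : ∃ H, IsAdaptedIntegrand P μ M S (m + 1) f H := by
      refine ⟨H, hH, ?_⟩
      filter_upwards [hHI, hsec] with z hz hzm
      have h1 := hz.ae_eq hM (IsMultipleIntegral.multipleIntegral_of_exists ⟨_, hz⟩)
        (aestronglyMeasurable_projectedKernel hS hzm)
      filter_upwards [h1] with ω hω
      rw [← hω]
      field_simp
    have hspec : IsAdaptedIntegrand P μ M S (m + 1) f (adaptedIntegrand P μ M S (m + 1) f) := by
      rw [adaptedIntegrand, dif_pos hex]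
      exact hex.choose_spec
    refine ⟨hspec.1.aemeasurable, ?_⟩
    filter_upwards [hsec, hspec.2, hHI] with z hz1 hz2 hz3
    refine ⟨hz1, ?_⟩
    obtain ⟨h1, s, hs, h2, h3⟩ := IsMultipleIntegral.multipleIntegral_of_exists ⟨_, hz3⟩
    refine ⟨(hspec.1.comp measurable_prodMk_right).div_const _, s, hs, h2, h3.congr fun k => ?_⟩
    refine eLpNorm_congr_ae ?_
    filter_upwards [hz2] with ω hω
    rw [hω]
    congr 1
    field_simp

end AdaptedIntegrand

/-! ### Approximation by simple integrands living after a given time. -/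

section Approximation

variable {Ω Z : Type*} [MeasurableSpace Ω] [MeasurableSpace Z]
  {P : Measure Ω} [IsProbabilityMeasure P] {μ : Measure Z} [SigmaFinite μ] {M : Set Z → Ω → ℝ}
  {S : ℝ → Set Z} {m : ℕ} {f : (Fin (m + 1) → Z) → ℝ}
  [MeasurableSpace.CountablyGenerated Z] [MeasurableSpace.SeparatesPoints Z]
  [NullSingletonClass μ]

/-- The adapted graph started at time 0 is dense among symmetric kernels because S 0 is empty;
diagonals are null and play no part. -/
theorem isMultipleIntegral_multipleIntegral_of_symm (hM : IsIndependentlyScattered P μ M)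
    (hS : IsSetResolution μ S) (hf : MemLp f 2 (Measure.pi fun _ => μ))
    (hsymm : ∀ (σ : Equiv.Perm (Fin (m + 1))) z, f (fun i => z (σ i)) = f z) :
    IsMultipleIntegral P μ M (m + 1) f (multipleIntegral P μ M (m + 1) f) := by
  have hzero : ∀ z ∈ (Set.univ.pi fun _ : Fin (m + 1) => S 0), f z = 0 := by
    intro z hz
    have := hz 0 trivial
    rw [hS.zero] at this
    exact absurd this (Set.notMem_empty _)
  have hseq : ∀ k : ℕ, ∃ p ∈ adaptedGraph μ M S 0 m,
      eLpNorm (fun z => p.1 z - f z) 2 (Measure.pi fun _ => μ) < (2⁻¹ : ℝ≥0∞) ^ k := fun k =>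
    exists_adaptedGraph_eLpNorm_le M hS (by simp) hf hsymm hzero (ENNReal.pow_pos (by simp) k)
  choose p hp hpf using hseq
  apply IsMultipleIntegral.multipleIntegral_of_exists
  refine IsMultipleIntegral.exists_of_tendsto hM hf.1 (s := fun k => ((p k).1, (p k).2.1))
    (fun k => adaptedGraph_elementary (hp k)) ?_
  exact tendsto_of_tendsto_of_tendsto_of_le_of_le tendsto_const_nhds
    (ENNReal.tendsto_pow_atTop_nhds_zero_of_lt_one (by simp)) (fun _ => zero_le)
    fun k => (hpf k).le

/-- The energy of the adapted integrand before time `t`. -/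
theorem setLIntegral_adaptedIntegrand_le (hM : IsIndependentlyScattered P μ M)
    (hS : IsSetResolution μ S) (hf : IsSymmKernel μ f) {t : ℝ} (ht : t ∈ Set.Icc (0 : ℝ) 1) :
    ∫⁻ z in S t, eLpNorm (fun ω => adaptedIntegrand P μ M S m f ω z) 2 P ^ 2 ∂μ ≤
      (m + 1).factorial *
        eLpNorm ((Set.univ.pi fun _ => S t).indicator f) 2 (Measure.pi fun _ => μ) ^ 2 := by
  set F := (Set.univ.pi fun _ : Fin (m + 1) => S t).indicator f with hF
  have hbox : MeasurableSet (Set.univ.pi fun _ : Fin (m + 1) => S t) :=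
    MeasurableSet.univ_pi fun _ => hS.measurable t ht
  have hFm : AEStronglyMeasurable F (Measure.pi fun _ => μ) := hf.memLp.1.indicator hbox
  have hFs : ∀ (σ : Equiv.Perm (Fin (m + 1))) z, F (fun i => z (σ i)) = F z := by
    intro σ z
    have hiff : (fun i => z (σ i)) ∈ (Set.univ.pi fun _ : Fin (m + 1) => S t) ↔
        z ∈ (Set.univ.pi fun _ : Fin (m + 1) => S t) := by
      simp only [Set.mem_pi, Set.mem_univ, true_implies]
      exact ⟨fun h i => by simpa using h (σ.symm i), fun h i => h _⟩
    by_cases hz : z ∈ (Set.univ.pi fun _ : Fin (m + 1) => S t)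
    · rw [hF, Set.indicator_of_mem hz, Set.indicator_of_mem (hiff.2 hz), hf.symm]
    · rw [hF, Set.indicator_of_notMem hz, Set.indicator_of_notMem fun h => hz (hiff.1 h)]
  -- The points that precede a point of S t lie in S t, so truncating the kernel to the power of S t
  -- changes nothing here.
  have hproj : ∀ z ∈ S t, projectedKernel S f z = projectedKernel S F z := by
    intro z hz
    ext w
    by_cases h : ∀ j, Precedes S (w j) z
    · rw [projectedKernel_of_forall _ h, projectedKernel_of_forall _ h, hF, Set.indicator_of_mem]
      intro i _
      induction i using Fin.cases with
      | zero => exact hz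
      | succ i => exact hS.mem_of_precedes (h i) ht hz
    · push Not at h
      rw [projectedKernel_of_exists _ h, projectedKernel_of_exists _ h]
  have hle := mul_lintegral_projectedKernel_le hS hFm hFs
  have hspec := (adaptedIntegrand_spec hM hS hf).2
  calc ∫⁻ z in S t, eLpNorm (fun ω => adaptedIntegrand P μ M S m f ω z) 2 P ^ 2 ∂μ
      ≤ ∫⁻ z in S t, (((m + 1 : ℕ) : ℝ≥0∞) ^ 2 * m.factorial) *
          eLpNorm (projectedKernel S F z) 2 (Measure.pi fun _ => μ) ^ 2 ∂μ := by
        refine lintegral_mono_ae ?_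
        rw [ae_restrict_iff' (hS.measurable t ht)]
        filter_upwards [hspec] with z hz hzt
        rw [eLpNorm_sq_eq_mul_div _ (m + 1) m.succ_pos, hz.2.eLpNorm_sq hM
          (aestronglyMeasurable_projectedKernel hS hz.1), ← mul_assoc, hproj z hzt]
    _ ≤ ∫⁻ z, (((m + 1 : ℕ) : ℝ≥0∞) ^ 2 * m.factorial) *
          eLpNorm (projectedKernel S F z) 2 (Measure.pi fun _ => μ) ^ 2 ∂μ :=
        setLIntegral_le_lintegral _ _
    _ = (((m + 1 : ℕ) : ℝ≥0∞) ^ 2 * m.factorial) *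
          ∫⁻ z, eLpNorm (projectedKernel S F z) 2 (Measure.pi fun _ => μ) ^ 2 ∂μ :=
        lintegral_const_mul' _ _ (ENNReal.mul_ne_top (ENNReal.pow_ne_top (ENNReal.natCast_ne_top _))
          (ENNReal.natCast_ne_top _))
    _ = (m + 1).factorial * (((m + 1 : ℕ) : ℝ≥0∞) *
          ∫⁻ z, eLpNorm (projectedKernel S F z) 2 (Measure.pi fun _ => μ) ^ 2 ∂μ) := by
        rw [Nat.factorial_succ]
        push_cast
        ring
    _ ≤ _ := by gcongr

/-- A configuration with one point outside S t is outside the power of S t, so on the sections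
considered f equals its truncation; the rest is the isometry of order m. -/
theorem setLIntegral_adaptedIntegrand_sub_le (hM : IsIndependentlyScattered P μ M)
    (hS : IsSetResolution μ S) (hf : IsSymmKernel μ f) {t : ℝ} (ht : t ∈ Set.Icc (0 : ℝ) 1)
    {p : ((Fin (m + 1) → Z) → ℝ) × (Ω → ℝ) × (Ω → Z → ℝ)} (hp : p ∈ adaptedGraph μ M S t m) :
    ∫⁻ z in (S t)ᶜ, eLpNorm (fun ω => adaptedIntegrand P μ M S m f ω z - p.2.2 ω z) 2 P ^ 2 ∂μ ≤
      (((m + 1 : ℕ) : ℝ≥0∞) ^ 2 * m.factorial) *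
        eLpNorm (fun z => p.1 z - (Set.univ.pi fun _ => S t)ᶜ.indicator f z) 2
          (Measure.pi fun _ => μ) ^ 2 := by
  set F := (Set.univ.pi fun _ : Fin (m + 1) => S t)ᶜ.indicator f with hF
  have hbox : MeasurableSet (Set.univ.pi fun _ : Fin (m + 1) => S t) :=
    MeasurableSet.univ_pi fun _ => hS.measurable t ht
  have hFm : AEStronglyMeasurable F (Measure.pi fun _ => μ) := hf.memLp.1.indicator hbox.compl
  have hpm := (elementaryGraph_properties hM (adaptedGraph_elementary hp)).2.1.1
  have hcons : ∀ z ∉ S t, ∀ w : Fin m → Z, F (Fin.cons z w) = f (Fin.cons z w) := by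
    intro z hz w
    rw [hF, Set.indicator_of_mem]
    exact fun h => hz (h 0 trivial)
  have hsec := (adaptedIntegrand_spec hM hS hf).2
  rw [← lintegral_eLpNorm_cons (F := fun x => p.1 x - F x) (hpm.sub hFm),
    ← lintegral_const_mul'' _ (aemeasurable_eLpNorm_cons (F := fun x => p.1 x - F x)
      (hpm.sub hFm))]
  refine (lintegral_mono_ae ?_).trans (setLIntegral_le_lintegral (S t)ᶜ _)
  rw [ae_restrict_iff' (hS.measurable t ht).compl]
  filter_upwards [hsec, ae_aestronglyMeasurable_cons hpm] with z hz hpz hzt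
  have h1 := hz.2.eLpNorm_sub_sq hM (IsMultipleIntegral.of_mem_elementaryGraph hM
    (adaptedGraph_projected hS hp z)) (aestronglyMeasurable_projectedKernel hS hz.1)
    (aestronglyMeasurable_projectedKernel hS hpz)
  rw [eLpNorm_sq_eq_mul_div _ (m + 1) m.succ_pos]
  simp_rw [sub_div]
  rw [h1, ← mul_assoc]
  gcongr
  refine eLpNorm_mono_enorm fun w => ?_
  have h2 := enorm_projectedKernel_le (S := S) (f - p.1) z w
  rw [projectedKernel_sub] at h2
  refine h2.trans (le_of_eq ?_)
  rw [Pi.sub_apply, ← hcons z hzt w, ← enorm_neg, neg_sub]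

theorem lintegral_adaptedIntegrand_lt_top (hM : IsIndependentlyScattered P μ M)
    (hS : IsSetResolution μ S) (hf : IsSymmKernel μ f) :
    ∫⁻ z, eLpNorm (fun ω => adaptedIntegrand P μ M S m f ω z) 2 P ^ 2 ∂μ < ∞ := by
  -- The comparison with the zero element of the graph at time 0 is already an energy bound.
  have h := setLIntegral_adaptedIntegrand_sub_le hM hS hf (t := 0) (by simp)
    (Submodule.zero_mem (adaptedGraph μ M S 0 m))
  rw [hS.zero, Set.compl_empty, Measure.restrict_univ] at h
  simp only [Prod.snd_zero, Prod.fst_zero, Pi.zero_apply, sub_zero, zero_sub] at h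
  refine lt_of_le_of_lt h (ENNReal.mul_lt_top (ENNReal.mul_lt_top (ENNReal.pow_lt_top
    (ENNReal.natCast_lt_top _)) (ENNReal.natCast_lt_top _)) (ENNReal.pow_lt_top ?_))
  have hbox : MeasurableSet (Set.univ.pi fun _ : Fin (m + 1) => (∅ : Set Z)) :=
    MeasurableSet.univ_pi fun _ => .empty
  exact (hf.memLp.indicator hbox.compl).neg.2

/-- Multiple integrals and their adapted integrands are approximated by simple ones, living after
time `t`, up to the part of the kernel before time `t`. -/
theorem exists_adaptedGraph_approximation (hM : IsIndependentlyScattered P μ M)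
    (hS : IsSetResolution μ S) (hf : IsSymmKernel μ f) {t : ℝ} (ht : t ∈ Set.Icc (0 : ℝ) 1)
    {δ : ℝ≥0∞} (hδ : 0 < δ) :
    ∃ p ∈ adaptedGraph μ M S t m,
      eLpNorm (fun ω => multipleIntegral P μ M (m + 1) f ω - p.2.1 ω) 2 P ≤
        ((m + 1).factorial * eLpNorm ((Set.univ.pi fun _ => S t).indicator f) 2
          (Measure.pi fun _ => μ) ^ 2) ^ (1 / 2 : ℝ) + δ ∧
      ∫⁻ z in (S t)ᶜ,
        eLpNorm (fun ω => adaptedIntegrand P μ M S m f ω z - p.2.2 ω z) 2 P ^ 2 ∂μ ≤ δ ^ 2 := by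
  set box := (Set.univ.pi fun _ : Fin (m + 1) => S t) with hboxdef
  have hbox : MeasurableSet box := MeasurableSet.univ_pi fun _ => hS.measurable t ht
  have hiff : ∀ (σ : Equiv.Perm (Fin (m + 1))) z, (fun i => z (σ i)) ∈ box ↔ z ∈ box := by
    intro σ z
    simp only [hboxdef, Set.mem_pi, Set.mem_univ, true_implies]
    exact ⟨fun h i => by simpa using h (σ.symm i), fun h i => h _⟩
  have hsymm : ∀ (σ : Equiv.Perm (Fin (m + 1))) z,
      boxᶜ.indicator f (fun i => z (σ i)) = boxᶜ.indicator f z := by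
    intro σ z
    by_cases hz : z ∈ box
    · rw [Set.indicator_of_notMem (Set.notMem_compl_iff.2 ((hiff σ z).2 hz)),
        Set.indicator_of_notMem (Set.notMem_compl_iff.2 hz)]
    · rw [Set.indicator_of_mem (by exact fun h => hz ((hiff σ z).1 h)),
        Set.indicator_of_mem (by exact hz), hf.symm]
  have hFL : MemLp (boxᶜ.indicator f) 2 (Measure.pi fun _ => μ) := hf.memLp.indicator hbox.compl
  -- One constant dominating both isometry factors. As C ≥ 1, kernel accuracy δ / C gives C a² ≤ (C
  -- a)² ≤ δ².
  set C : ℝ≥0∞ := ((m + 1 : ℕ) : ℝ≥0∞) ^ 2 * (m + 1).factorial with hC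
  have hCtop : C ≠ ∞ := ENNReal.mul_ne_top (ENNReal.pow_ne_top (ENNReal.natCast_ne_top _))
    (ENNReal.natCast_ne_top _)
  have hC1 : 1 ≤ C := by
    have : 1 ≤ (m + 1) ^ 2 * (m + 1).factorial :=
      Nat.one_le_iff_ne_zero.2 (Nat.mul_ne_zero (by positivity) (Nat.factorial_ne_zero _))
    rw [hC]
    exact_mod_cast this
  have hC0 : C ≠ 0 := fun h => by simp [h] at hC1
  obtain ⟨p, hp, hpf⟩ := exists_adaptedGraph_eLpNorm_le M hS ht hFL hsymm
    (fun z hz => Set.indicator_of_notMem (Set.notMem_compl_iff.2 hz) _)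
    (ENNReal.div_pos hδ.ne' hCtop)
  have hCd : C * (δ / C) = δ := ENNReal.mul_div_cancel hC0 hCtop
  set a := eLpNorm (fun z => p.1 z - boxᶜ.indicator f z) 2 (Measure.pi fun _ => μ) with ha
  have hCa : C * a ≤ δ := by rw [← hCd]; gcongr
  have hCa2 : C * a ^ 2 ≤ δ ^ 2 := by
    calc C * a ^ 2 ≤ (C * C) * a ^ 2 := by
          gcongr
          calc C = C * 1 := (mul_one C).symm
            _ ≤ C * C := by gcongr
      _ = (C * a) ^ 2 := by ring
      _ ≤ δ ^ 2 := by gcongr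
  refine ⟨p, hp, ?_, ?_⟩
  · have hIf := isMultipleIntegral_multipleIntegral_of_symm hM hS hf.memLp hf.symm
    have hpI := IsMultipleIntegral.of_mem_elementaryGraph hM (adaptedGraph_elementary hp)
    have hpm := (elementaryGraph_properties hM (adaptedGraph_elementary hp)).2.1.1
    have hbI := isMultipleIntegral_multipleIntegral_of_symm hM hS hFL hsymm
    set G := multipleIntegral P μ M (m + 1) (boxᶜ.indicator f)
    have h1 := hIf.eLpNorm_sub_sq hM hbI hf.memLp.1 hFL.1
    have h2 := hpI.eLpNorm_sub_sq hM hbI hpm hFL.1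
    -- The graph only reaches the truncated kernel; the removed part accounts for the first term of
    -- the bound.
    have e1 : (fun z => f z - boxᶜ.indicator f z) = box.indicator f := by
      ext z
      by_cases hz : z ∈ box
      · rw [Set.indicator_of_notMem (by simpa using hz), Set.indicator_of_mem hz, sub_zero]
      · rw [Set.indicator_of_mem (by exact hz), Set.indicator_of_notMem hz, sub_self]
    rw [e1] at h1
    have h3 : eLpNorm (fun ω => p.2.1 ω - G ω) 2 P ≤ δ := by
      rw [← ENNReal.pow_le_pow_left_iff two_ne_zero, h2]
      refine le_trans ?_ hCa2
      rw [ha]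
      gcongr
      rw [hC]
      calc ((m + 1).factorial : ℝ≥0∞) = 1 * (m + 1).factorial := (one_mul _).symm
        _ ≤ _ := by
          gcongr
          exact_mod_cast Nat.one_le_pow _ _ m.succ_pos
    rw [← h1]
    have e2 : ∀ x : ℝ≥0∞, (x ^ 2) ^ (1 / 2 : ℝ) = x := by
      intro x
      rw [← ENNReal.rpow_natCast, ← ENNReal.rpow_mul]
      simp
    rw [e2]
    have e3 : (fun ω => multipleIntegral P μ M (m + 1) f ω - p.2.1 ω) =
        (fun ω => multipleIntegral P μ M (m + 1) f ω - G ω) - fun ω => p.2.1 ω - G ω := by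
      ext ω; simp only [Pi.sub_apply]; ring
    rw [e3]
    exact (eLpNorm_sub_le (hIf.1.sub hbI.1).aestronglyMeasurable
      (hpI.1.sub hbI.1).aestronglyMeasurable (by norm_num)).trans (add_le_add le_rfl h3)
  · refine (setLIntegral_adaptedIntegrand_sub_le hM hS hf ht hp).trans (le_trans ?_ hCa2)
    rw [← hboxdef, ← ha, hC]
    gcongr
    exact Nat.le_succ m

end Approximation

/-! ### Completed σ-fields. -/

section CompletedField

variable {Ω : Type*} {m m' : MeasurableSpace Ω} [mΩ : MeasurableSpace Ω] {P : Measure Ω}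

theorem completedField_le : completedField P m ≤ mΩ := fun _ hs => hs.1

theorem le_completedField (h : m ≤ mΩ) : m ≤ completedField P m :=
  fun s hs => ⟨h s hs, s, hs, ae_eq_refl _⟩

theorem completedField_mono (h : m ≤ m') : completedField P m ≤ completedField P m' :=
  fun _ ⟨h1, t, ht, hst⟩ => ⟨h1, t, h t ht, hst⟩

theorem completedField_completedField :
    completedField P (completedField P m) ≤ completedField P m :=
  fun _ ⟨h1, _, ⟨_, t, ht, hst⟩, hs⟩ => ⟨h1, t, ht, hs.trans hst⟩

theorem measurable_completedField_of_ae_eq {β : Type*} [MeasurableSpace β] {f g : Ω → β}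
    (hf : Measurable f) (hg : Measurable[completedField P m] g) (h : f =ᵐ[P] g) :
    Measurable[completedField P m] f := by
  intro s hs
  obtain ⟨_, t, ht, hst⟩ := hg hs
  exact ⟨hf hs, t, ht, (h.preimage s).trans hst⟩

theorem condExp_completedField {E : Type*} [NormedAddCommGroup E] [NormedSpace ℝ E]
    [CompleteSpace E] [IsFiniteMeasure P] (hm : m ≤ mΩ) (f : Ω → E) :
    P[f | m] =ᵐ[P] P[f | completedField P m] := by
  by_cases hf : Integrable f P
  · refine ae_eq_condExp_of_forall_setIntegral_eq completedField_le hf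
      (fun s _ _ => integrable_condExp.integrableOn) ?_
      (stronglyMeasurable_condExp.mono (le_completedField hm)).aestronglyMeasurable
    rintro s ⟨hs, t, ht, hst⟩ -
    rw [setIntegral_congr_set hst, setIntegral_congr_set hst, setIntegral_condExp hm hf ht]
  · rw [condExp_of_not_integrable hf, condExp_of_not_integrable hf]

end CompletedField

/-! ### The frozen quotient of Fourier factors and conditional characteristic functions. -/

section RatioMartingale

variable {Ω : Type*} {m : MeasurableSpace Ω} [mΩ : MeasurableSpace Ω] {P : Measure Ω}
  [IsProbabilityMeasure P]

theorem condExp_mul_left_complex {f g : Ω → ℂ}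
    (hf : StronglyMeasurable[m] f) (hfg : Integrable (fun ω => f ω * g ω) P)
    (hg : Integrable g P) :
    P[fun ω => f ω * g ω | m] =ᵐ[P] fun ω => f ω * (P[g | m]) ω :=
  condExp_bilin_of_stronglyMeasurable_left (ContinuousLinearMap.mul ℝ ℂ) hf hfg hg

/-- The partial quotient is updated by u_N / a_N as long as the new product of the a's is at least ε
in modulus, and is kept unchanged otherwise. That decision is known at time N, before u_N is
revealed, so the one-step conditional mean is the old value. Since |u| = 1, the modulus is at most
1/ε at every update. -/
theorem exists_ratio_of_condExp (L : ℕ) (𝓕 : ℕ → MeasurableSpace Ω) (hmono : Monotone 𝓕)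
    (hle : ∀ j, 𝓕 j ≤ mΩ) (u a : ℕ → Ω → ℂ) (hu : ∀ j, StronglyMeasurable[𝓕 (j + 1)] (u j))
    (ha : ∀ j, StronglyMeasurable[𝓕 j] (a j)) (hu1 : ∀ j ω, ‖u j ω‖ = 1)
    (ha0 : ∀ j ω, a j ω ≠ 0) (ha1 : ∀ j ω, ‖a j ω‖ ≤ 1)
    (hc : ∀ j, P[u j | 𝓕 j] =ᵐ[P] a j) {ε : ℝ} (hε : 0 < ε) (hε1 : ε ≤ 1) :
    ∃ w : Ω → ℂ, Measurable w ∧ (∀ ω, ‖w ω‖ ≤ 1 / ε) ∧ P[w | 𝓕 0] =ᵐ[P] (fun _ => 1) ∧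
      ∀ ω, ε ≤ ‖∏ i ∈ Finset.range L, a i ω‖ →
        w ω * ∏ i ∈ Finset.range L, a i ω = ∏ i ∈ Finset.range L, u i ω := by
  suffices H : ∃ w : Ω → ℂ, StronglyMeasurable[𝓕 L] w ∧ (∀ ω, ‖w ω‖ ≤ 1 / ε) ∧
      P[w | 𝓕 0] =ᵐ[P] (fun _ => 1) ∧
      ∀ ω, ε ≤ ‖∏ i ∈ Finset.range L, a i ω‖ →
        w ω * ∏ i ∈ Finset.range L, a i ω = ∏ i ∈ Finset.range L, u i ω by
    obtain ⟨w, h1, h2⟩ := H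
    exact ⟨w, (h1.mono (hle L)).measurable, h2⟩
  induction L with
  | zero =>
    refine ⟨fun _ => 1, stronglyMeasurable_const, fun ω => ?_, ?_, fun ω _ => by simp⟩
    · simpa using (one_le_inv₀ hε).2 hε1
    · rw [condExp_const (hle 0)]
  | succ N ih =>
    obtain ⟨w, hwm, hwb, hwc, hw⟩ := ih
    have hprodm : StronglyMeasurable[𝓕 N] fun ω => ∏ i ∈ Finset.range (N + 1), a i ω :=
      Finset.stronglyMeasurable_fun_prod _ fun i hi =>
        (ha i).mono (hmono (Nat.lt_succ_iff.1 (Finset.mem_range.1 hi)))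
    -- The event includes the factor of index N, which is already known at time N.
    set G : Set Ω := {ω | ε ≤ ‖∏ i ∈ Finset.range (N + 1), a i ω‖} with hG
    have hGm : MeasurableSet[𝓕 N] G := stronglyMeasurable_const.measurableSet_le hprodm.norm
    set b : Ω → ℂ := G.indicator fun ω => w ω * (a N ω)⁻¹ with hb
    set c : Ω → ℂ := Gᶜ.indicator w with hcdef
    have hbm : StronglyMeasurable[𝓕 N] b :=
      StronglyMeasurable.indicator (hwm.mul (ha N).inv₀) hGm
    have hcm : StronglyMeasurable[𝓕 N] c := StronglyMeasurable.indicator hwm hGm.compl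
    -- As |a| ≤ 1 the products decrease in modulus, so an update now means that every earlier step
    -- was an update.
    have hprev : ∀ ω ∈ G, ε ≤ ‖∏ i ∈ Finset.range N, a i ω‖ := by
      intro ω hω
      refine le_trans hω ?_
      rw [Finset.prod_range_succ, norm_mul]
      exact mul_le_of_le_one_right (norm_nonneg _) (ha1 N ω)
    have hkey : ∀ ω ∈ G, b ω * u N ω * ∏ i ∈ Finset.range (N + 1), a i ω =
        ∏ i ∈ Finset.range (N + 1), u i ω := by
      intro ω hω
      rw [hb, Set.indicator_of_mem hω, Finset.prod_range_succ, Finset.prod_range_succ,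
        ← hw ω (hprev ω hω)]
      field_simp [ha0 N ω]
    have hbb : ∀ ω, ‖b ω‖ ≤ 1 / ε := by
      intro ω
      by_cases hω : ω ∈ G
      · have h1 := congrArg norm (hkey ω hω)
        rw [norm_mul, norm_mul, hu1, mul_one, norm_prod (Finset.range (N+1)) (fun i => u i ω)] at h1
        simp only [hu1, Finset.prod_const_one] at h1
        rw [le_div_iff₀ hε, ← h1]
        exact mul_le_mul_of_nonneg_left hω (norm_nonneg _)
      · rw [hb, Set.indicator_of_notMem hω, norm_zero]
        positivity
    have hcb : ∀ ω, ‖c ω‖ ≤ 1 / ε := fun ω => (norm_indicator_le_norm_self _ _).trans (hwb ω)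
    have hum : StronglyMeasurable (u N) := (hu N).mono (hle _)
    have hui : Integrable (u N) P :=
      .of_bound hum.aestronglyMeasurable 1 (.of_forall fun ω => (hu1 N ω).le)
    have hbui : Integrable (fun ω => b ω * u N ω) P :=
      .of_bound ((hbm.mono (hle _)).mul hum).aestronglyMeasurable (1 / ε)
        (.of_forall fun ω => by rw [norm_mul, hu1, mul_one]; exact hbb ω)
    have hci : Integrable c P :=
      .of_bound (hcm.mono (hle _)).aestronglyMeasurable (1 / ε) (.of_forall hcb)
    refine ⟨fun ω => b ω * u N ω + c ω, ((hbm.mono (hmono N.le_succ)).mul (hu N)).add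
      (hcm.mono (hmono N.le_succ)), fun ω => ?_, ?_, fun ω hω => ?_⟩
    · by_cases hω : ω ∈ G
      · simp only [hcdef, Set.indicator_of_notMem (Set.notMem_compl_iff.2 hω), add_zero, norm_mul,
          hu1, mul_one]
        exact hbb ω
      · simp only [hb, Set.indicator_of_notMem hω, zero_mul, zero_add]
        exact hcb ω
    · have h1 : P[fun ω => b ω * u N ω + c ω | 𝓕 N] =ᵐ[P] w := by
        have hadd := condExp_add hbui hci (𝓕 N)
        have hbu := condExp_mul_left_complex hbm hbui hui
        have hcc : P[c | 𝓕 N] = c := condExp_of_stronglyMeasurable (hle N) hcm hci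
        filter_upwards [hadd, hbu, hc N] with ω h1 h2 h3
        refine h1.trans ?_
        rw [Pi.add_apply, hcc, h2, h3]
        by_cases hω : ω ∈ G
        · simp only [hb, hcdef, Set.indicator_of_mem hω,
            Set.indicator_of_notMem (Set.notMem_compl_iff.2 hω)]
          field_simp [ha0 N ω]
          simp
        · simp only [hb, hcdef, Set.indicator_of_notMem hω, Set.indicator_of_mem
            (Set.mem_compl hω)]
          simp
      refine (condExp_condExp_of_le (hmono (Nat.zero_le N)) (hle N)).symm.trans ?_
      exact (condExp_congr_ae h1).trans hwc
    · have hc0 : c ω = 0 := Set.indicator_of_notMem (fun h : ω ∈ Gᶜ => h hω) _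
      show (b ω * u N ω + c ω) * _ = _
      rw [hc0, add_zero]
      exact hkey ω hω

end RatioMartingale

/-! ### From the predictor to the conditional Fourier transform. -/

section LimitPrinciple

variable {Ω : Type*} {m : MeasurableSpace Ω} [mΩ : MeasurableSpace Ω] {P : Measure Ω}
  [IsProbabilityMeasure P]

theorem tendsto_integral_norm_sub_of_tendstoInMeasure {E : Type*} [NormedAddCommGroup E]
    {f : ℕ → Ω → E} {g : Ω → E} {C : ℝ}
    (hf : ∀ n, AEStronglyMeasurable (f n) P) (hg : AEStronglyMeasurable g P)
    (hfC : ∀ n, ∀ᵐ ω ∂P, ‖f n ω‖ ≤ C) (hgC : ∀ᵐ ω ∂P, ‖g ω‖ ≤ C)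
    (h : TendstoInMeasure P f atTop g) :
    Tendsto (fun n => ∫ ω, ‖f n ω - g ω‖ ∂P) atTop (𝓝 0) := by
  refine tendsto_of_subseq_tendsto fun ns hns => ?_
  obtain ⟨ms, _, hms⟩ := TendstoInMeasure.exists_seq_tendsto_ae fun ε hε => (h ε hε).comp hns
  refine ⟨ms, ?_⟩
  rw [← integral_zero Ω ℝ]
  refine tendsto_integral_of_dominated_convergence (fun _ => C + C)
    (fun n => ((hf _).sub hg).norm) (integrable_const _) (fun n => ?_) ?_
  · filter_upwards [hfC (ns (ms n)), hgC] with ω h1 h2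
    rw [norm_norm]
    exact (norm_sub_le _ _).trans (add_le_add h1 h2)
  · filter_upwards [hms] with ω hω
    have := (hω.sub_const (g ω)).norm
    simpa using this

theorem integral_norm_sub_le_add {E : Type*} [NormedAddCommGroup E] {f g h : Ω → E}
    (hf : Integrable f P) (hg : Integrable g P) (hh : Integrable h P) :
    ∫ ω, ‖f ω - h ω‖ ∂P ≤ ∫ ω, ‖f ω - g ω‖ ∂P + ∫ ω, ‖g ω - h ω‖ ∂P := by
  have h1 : Integrable (fun ω => ‖f ω - h ω‖) P := (hf.sub hh).norm
  have h2 : Integrable (fun ω => ‖f ω - g ω‖) P := (hf.sub hg).norm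
  have h3 : Integrable (fun ω => ‖g ω - h ω‖) P := (hg.sub hh).norm
  rw [← integral_add h2 h3]
  exact integral_mono h1 (h2.add h3) fun ω => norm_sub_le_norm_sub_add_norm_sub _ _ _

/-- Because w has conditional mean one and ψ is known, E[V | m] - ψ is the conditional expectation
of V - ψ w. Where |R| ≥ ε this variable equals w (R - ψ). -/
theorem integral_norm_condExp_sub_le {V R w ψ : Ω → ℂ}
    {ε : ℝ} (hε : 0 < ε)
    (hV : Measurable V) (hV1 : ∀ ω, ‖V ω‖ ≤ 1) (hR : Measurable R) (hR1 : ∀ ω, ‖R ω‖ ≤ 1)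
    (hw : Measurable w) (hwb : ∀ ω, ‖w ω‖ ≤ 1 / ε) (hwc : P[w | m] =ᵐ[P] fun _ => 1)
    (hwV : ∀ ω, ε ≤ ‖R ω‖ → w ω * R ω = V ω)
    (hψ : StronglyMeasurable[m] ψ) (hψi : Integrable ψ P) :
    ∫ ω, ‖(P[V | m]) ω - ψ ω‖ ∂P ≤
      2 * P.real {ω | ‖R ω‖ < ε} + 1 / ε * ∫ ω, ‖R ω - ψ ω‖ ∂P := by
  have hVi : Integrable V P := .of_bound hV.aestronglyMeasurable 1 (.of_forall hV1)
  have hRi : Integrable R P := .of_bound hR.aestronglyMeasurable 1 (.of_forall hR1)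
  have hwi : Integrable w P := .of_bound hw.aestronglyMeasurable _ (.of_forall hwb)
  have hψw : Integrable (fun ω => ψ ω * w ω) P :=
    hψi.mul_bdd (c := 1 / ε) hw.aestronglyMeasurable (.of_forall hwb)
  have h1 : (fun ω => (P[V | m]) ω - ψ ω) =ᵐ[P] P[fun ω => V ω - ψ ω * w ω | m] := by
    filter_upwards [condExp_sub hVi hψw m, condExp_mul_left_complex hψ hψw hwi, hwc]
      with ω h2 h3 h4
    refine Eq.trans ?_ h2.symm
    rw [Pi.sub_apply, h3, h4, mul_one]
  rw [show ∫ ω, ‖(P[V | m]) ω - ψ ω‖ ∂P = ∫ ω, ‖(P[fun ω => V ω - ψ ω * w ω | m]) ω‖ ∂P from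
    integral_congr_ae (h1.fun_comp norm)]
  have hs : MeasurableSet {ω | ‖R ω‖ < ε} := measurableSet_lt hR.norm measurable_const
  have hb : Integrable (fun ω => {ω | ‖R ω‖ < ε}.indicator (fun _ => (2 : ℝ)) ω +
      1 / ε * ‖R ω - ψ ω‖) P :=
    ((integrable_const _).indicator hs).add ((hRi.sub hψi).norm.const_mul _)
  calc ∫ ω, ‖(P[fun ω => V ω - ψ ω * w ω | m]) ω‖ ∂P
      ≤ ∫ ω, ‖V ω - ψ ω * w ω‖ ∂P := integral_norm_condExp_le _
    _ ≤ ∫ ω, ({ω | ‖R ω‖ < ε}.indicator (fun _ => (2 : ℝ)) ω + 1 / ε * ‖R ω - ψ ω‖) ∂P := by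
        refine integral_mono (hVi.sub hψw).norm hb fun ω => ?_
        by_cases hω : ‖R ω‖ < ε
        · rw [Set.indicator_of_mem (show ω ∈ {ω | ‖R ω‖ < ε} from hω)]
          have h3 : ‖ψ ω‖ ≤ ε + ‖R ω - ψ ω‖ := by
            have := norm_sub_norm_le (ψ ω) (R ω)
            rw [norm_sub_rev] at this
            linarith
          -- On |R| < ε no identity is available: |V| gives 1, and |ψ| |w| gives another 1 plus |R -
          -- ψ| / ε.
          calc ‖V ω - ψ ω * w ω‖ ≤ ‖V ω‖ + ‖ψ ω‖ * ‖w ω‖ := by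
                rw [← norm_mul]; exact norm_sub_le _ _
            _ ≤ 1 + (ε + ‖R ω - ψ ω‖) * (1 / ε) := by
                gcongr
                · exact hV1 ω
                · exact hwb ω
            _ = 2 + 1 / ε * ‖R ω - ψ ω‖ := by field_simp; ring
        · rw [Set.indicator_of_notMem (show ω ∉ {ω | ‖R ω‖ < ε} from hω), zero_add,
            ← hwV ω (not_lt.1 hω), mul_comm (ψ ω), ← mul_sub, norm_mul]
          gcongr
          exact hwb ω
    _ = _ := by
        have hj1 : Integrable (fun ω => {ω | ‖R ω‖ < ε}.indicator (fun _ => (2 : ℝ)) ω) P :=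
          (integrable_const _).indicator hs
        have hj2 : Integrable (fun ω => 1 / ε * ‖R ω - ψ ω‖) P := (hRi.sub hψi).norm.const_mul _
        rw [integral_add hj1 hj2,
          integral_const_mul, integral_indicator_const _ hs, smul_eq_mul, mul_comm (P.real _)]

/-- Lévy's upward theorem, applied to real and imaginary parts; completing the limit field does not
change the conditional expectation. -/
theorem tendsto_integral_norm_condExp_sub {U : ℕ → MeasurableSpace Ω} (hU : Monotone U)
    (hUm : ∀ n, U n ≤ mΩ) {g : Ω → ℂ} (hg : Integrable g P)
    (hgU : Measurable[completedField P (⨆ n, U n)] g) :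
    Tendsto (fun n => ∫ ω, ‖(P[g | U n]) ω - g ω‖ ∂P) atTop (𝓝 0) := by
  have hsup : (⨆ n, U n) ≤ mΩ := iSup_le hUm
  let 𝓖 : Filtration ℕ mΩ := ⟨U, hU, hUm⟩
  have key : ∀ T : ℂ →L[ℝ] ℝ,
      Tendsto (fun n => ∫ ω, |T ((P[g | U n]) ω - g ω)| ∂P) atTop (𝓝 0) := by
    intro T
    have hTg : Integrable (fun ω => T (g ω)) P := T.integrable_comp hg
    have hTU : StronglyMeasurable[completedField P (⨆ n, U n)] fun ω => T (g ω) :=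
      (T.continuous.measurable.comp hgU).stronglyMeasurable
    have h1 : P[fun ω => T (g ω) | ⨆ n, U n] =ᵐ[P] fun ω => T (g ω) := by
      refine (condExp_completedField hsup _).trans ?_
      rw [condExp_of_stronglyMeasurable completedField_le hTU hTg]
    have h2 := (ENNReal.tendsto_toReal ENNReal.zero_ne_top).comp
      (tendsto_eLpNorm_condExp (μ := P) (ℱ := 𝓖) fun ω => T (g ω))
    refine h2.congr fun n => ?_
    have hT : P[fun ω => T (g ω) | U n] =ᵐ[P] fun ω => T ((P[g | U n]) ω) :=
      (T.comp_condExp_comm hg).symm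
    rw [Function.comp_apply, toReal_eLpNorm (integrable_condExp.sub
      integrable_condExp).aestronglyMeasurable] 
    rw [lpNorm_one_eq_integral_norm (integrable_condExp.sub
      integrable_condExp).aestronglyMeasurable]
    refine integral_congr_ae ?_
    filter_upwards [hT, h1] with ω h3 h4
    show ‖(P[fun ω => T (g ω) | U n] - P[fun ω => T (g ω) | ⨆ n, U n]) ω‖ = _
    rw [Pi.sub_apply, h3, h4, map_sub, Real.norm_eq_abs]
  have hsum := (key Complex.reCLM).add (key Complex.imCLM)
  rw [add_zero] at hsum
  have hi : ∀ n, Integrable (fun ω => (P[g | U n]) ω - g ω) P := fun n => integrable_condExp.sub hg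
  refine squeeze_zero (fun n => integral_nonneg fun _ => norm_nonneg _) (fun n => ?_) hsum
  rw [← integral_add ((Complex.reCLM.integrable_comp (hi n)).abs)
    ((Complex.imCLM.integrable_comp (hi n)).abs)]
  exact integral_mono (hi n).norm (((Complex.reCLM.integrable_comp (hi n)).abs).add
    ((Complex.imCLM.integrable_comp (hi n)).abs)) fun ω => Complex.norm_le_abs_re_add_abs_im _

/-- First ε is fixed so that |g| < 2ε is unlikely, which is possible because g has no zeros; then n
tends to infinity with the constants 1/ε frozen. Nesting of the U n makes a variable known at time
n, namely E[g | U n], close to g. -/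
theorem tendsto_integral_norm_condExp_sub_limit {U F : ℕ → MeasurableSpace Ω} (hU : Monotone U)
    (hUF : ∀ n, U n ≤ F n) (hF : ∀ n, F n ≤ mΩ) {g : Ω → ℂ} (hg : Measurable g)
    (hgU : Measurable[completedField P (⨆ n, U n)] g) (hg1 : ∀ᵐ ω ∂P, ‖g ω‖ ≤ 1)
    (hg0 : ∀ᵐ ω ∂P, g ω ≠ 0) {V R : ℕ → Ω → ℂ}
    (hV : ∀ n, Measurable (V n)) (hV1 : ∀ n ω, ‖V n ω‖ ≤ 1)
    (hR : ∀ n, Measurable (R n)) (hR1 : ∀ n ω, ‖R n ω‖ ≤ 1)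
    (hw : ∀ n (ε : ℝ), 0 < ε → ε ≤ 1 → ∃ w : Ω → ℂ, Measurable w ∧ (∀ ω, ‖w ω‖ ≤ 1 / ε) ∧
      P[w | F n] =ᵐ[P] (fun _ => 1) ∧ ∀ ω, ε ≤ ‖R n ω‖ → w ω * R n ω = V n ω)
    (hRg : TendstoInMeasure P R atTop g) :
    Tendsto (fun n => ∫ ω, ‖(P[V n | F n]) ω - g ω‖ ∂P) atTop (𝓝 0) := by
  have hgi : Integrable g P := .of_bound hg.aestronglyMeasurable 1 hg1
  have hRi : ∀ n, Integrable (R n) P := fun n =>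
    .of_bound (hR n).aestronglyMeasurable 1 (.of_forall (hR1 n))
  have hψ := tendsto_integral_norm_condExp_sub hU (fun n => (hUF n).trans (hF n)) hgi hgU
  have hRL := tendsto_integral_norm_sub_of_tendstoInMeasure
    (fun n => (hR n).aestronglyMeasurable) hg.aestronglyMeasurable
    (fun n => .of_forall (hR1 n)) hg1 hRg
  have hsmall : Tendsto (fun k : ℕ => P.real {ω | ‖g ω‖ < 2 * (1 / ((k : ℝ) + 1))}) atTop
      (𝓝 0) := by
    have hanti : Antitone fun k : ℕ => {ω | ‖g ω‖ < 2 * (1 / ((k : ℝ) + 1))} := by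
      intro j k hjk ω hω
      have hjk' : (j : ℝ) ≤ k := by exact_mod_cast hjk
      have h1 : 1 / ((k : ℝ) + 1) ≤ 1 / ((j : ℝ) + 1) :=
        one_div_le_one_div_of_le (by positivity) (by linarith)
      have h2 : ‖g ω‖ < 2 * (1 / ((k : ℝ) + 1)) := hω
      show ‖g ω‖ < 2 * (1 / ((j : ℝ) + 1))
      linarith
    have h1 := tendsto_measure_iInter_atTop (μ := P)
      (s := fun k : ℕ => {ω | ‖g ω‖ < 2 * (1 / ((k : ℝ) + 1))})
      (fun k => (measurableSet_lt hg.norm measurable_const).nullMeasurableSet) hanti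
      ⟨0, measure_ne_top _ _⟩
    have h2 : P (⋂ k : ℕ, {ω | ‖g ω‖ < 2 * (1 / ((k : ℝ) + 1))}) = 0 := by
      refine measure_mono_null (fun ω hω => ?_) (ae_iff.1 hg0)
      have h3 : Tendsto (fun k : ℕ => 2 * (1 / ((k : ℝ) + 1))) atTop (𝓝 (2 * 0)) :=
        tendsto_one_div_add_atTop_nhds_zero_nat.const_mul 2
      rw [mul_zero] at h3
      have h4 : ‖g ω‖ ≤ 0 := ge_of_tendsto' h3 fun k => (Set.mem_iInter.1 hω k).le
      simpa using h4
    rw [h2] at h1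
    exact (ENNReal.tendsto_toReal ENNReal.zero_ne_top).comp h1
  rw [Metric.tendsto_atTop]
  intro δ hδ
  obtain ⟨k, hk⟩ := ((tendsto_order.1 hsmall).2 (δ / 4) (by positivity)).exists
  set ε : ℝ := 1 / ((k : ℝ) + 1) with hε
  have hε0 : 0 < ε := by positivity
  have hε1 : ε ≤ 1 := by
    rw [hε, div_le_one (by positivity)]
    have : (0 : ℝ) ≤ k := k.cast_nonneg
    linarith
  -- The 3 counts the distance of R to g once through the triangle inequality and twice through
  -- Markov's inequality for P(|R| < ε).
  have hlim : Tendsto (fun n => (3 / ε) * ∫ ω, ‖R n ω - g ω‖ ∂P +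
      (1 / ε + 1) * ∫ ω, ‖(P[g | U n]) ω - g ω‖ ∂P) atTop (𝓝 ((3 / ε) * 0 + (1 / ε + 1) * 0)) :=
    (hRL.const_mul _).add (hψ.const_mul _)
  rw [mul_zero, mul_zero, add_zero] at hlim
  obtain ⟨N, hN⟩ := eventually_atTop.1 ((tendsto_order.1 hlim).2 (δ / 2) (by positivity))
  refine ⟨N, fun n hn => ?_⟩
  rw [Real.dist_eq, sub_zero, abs_of_nonneg (integral_nonneg fun _ => norm_nonneg _)]
  obtain ⟨w, hwm, hwb, hwc, hwV⟩ := hw n ε hε0 hε1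
  have hψi : Integrable (P[g | U n]) P := integrable_condExp
  have hmain := integral_norm_condExp_sub_le hε0 (hV n) (hV1 n) (hR n) (hR1 n) hwm hwb hwc
    hwV (stronglyMeasurable_condExp.mono (hUF n)) hψi
  have hVi : Integrable (P[V n | F n]) P := integrable_condExp
  have htri1 := integral_norm_sub_le_add hVi hψi hgi
  have htri2 := integral_norm_sub_le_add (hRi n) hgi hψi
  simp only [norm_sub_rev (g _) ((P[g | U n]) _)] at htri2
  have hprob : P.real {ω | ‖R n ω‖ < ε} ≤
      P.real {ω | ‖g ω‖ < 2 * ε} + 1 / ε * ∫ ω, ‖R n ω - g ω‖ ∂P := by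
    have hmark := mul_meas_ge_le_integral_of_nonneg (μ := P)
      (.of_forall fun ω => norm_nonneg (R n ω - g ω)) ((hRi n).sub hgi).norm ε
    have h1 : P.real {ω | ‖R n ω‖ < ε} ≤
        P.real {ω | ‖g ω‖ < 2 * ε} + P.real {ω | ε ≤ ‖R n ω - g ω‖} := by
      refine (measureReal_mono (fun ω hω => ?_) (measure_ne_top _ _)).trans
        (measureReal_union_le _ _)
      by_contra hcon
      rw [Set.mem_union, not_or] at hcon
      simp only [Set.mem_ofPred_eq, not_lt, not_le] at hcon hω
      have := norm_sub_norm_le (g ω) (R n ω)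
      rw [norm_sub_rev] at this
      linarith [hcon.1, hcon.2]
    have h2 : P.real {ω | ε ≤ ‖R n ω - g ω‖} ≤ 1 / ε * ∫ ω, ‖R n ω - g ω‖ ∂P := by
      rw [one_div, ← div_eq_inv_mul, le_div_iff₀ hε0, mul_comm]
      exact hmark
    linarith
  have hNn := hN n hn
  have h5 : 1 / ε * ∫ ω, ‖R n ω - (P[g | U n]) ω‖ ∂P ≤
      1 / ε * (∫ ω, ‖R n ω - g ω‖ ∂P + ∫ ω, ‖(P[g | U n]) ω - g ω‖ ∂P) :=
    mul_le_mul_of_nonneg_left htri2 (by positivity)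
  have h6 : 3 / ε = 3 * (1 / ε) := by ring
  rw [h6] at hNn
  nlinarith

/-- Y is close in L¹ to ψ = E[Y | U n], which is F n-measurable; against ψ the variable V may be
replaced by its conditional expectation, and then ψ by Y again. -/
theorem tendsto_integral_mul_of_tendsto_condExp {U F : ℕ → MeasurableSpace Ω} (hU : Monotone U)
    (hUF : ∀ n, U n ≤ F n) (hF : ∀ n, F n ≤ mΩ) {g : Ω → ℂ} (hg : Integrable g P) {V : ℕ → Ω → ℂ}
    (hV : ∀ n, Measurable (V n)) (hV1 : ∀ n ω, ‖V n ω‖ ≤ 1)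
    (hVg : Tendsto (fun n => ∫ ω, ‖(P[V n | F n]) ω - g ω‖ ∂P) atTop (𝓝 0))
    {Y : Ω → ℂ} (hY : Measurable[completedField P (⨆ n, U n)] Y) {C : ℝ}
    (hYC : ∀ ω, ‖Y ω‖ ≤ C) :
    Tendsto (fun n => ∫ ω, Y ω * V n ω ∂P) atTop (𝓝 (∫ ω, Y ω * g ω ∂P)) := by
  have hYm : Measurable Y := hY.mono completedField_le le_rfl
  have hYi : Integrable Y P := .of_bound hYm.aestronglyMeasurable C (.of_forall hYC)
  have hVi : ∀ n, Integrable (V n) P := fun n =>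
    .of_bound (hV n).aestronglyMeasurable 1 (.of_forall (hV1 n))
  have hψ := tendsto_integral_norm_condExp_sub hU (fun n => (hUF n).trans (hF n)) hYi hY
  rw [tendsto_iff_norm_sub_tendsto_zero]
  have hlim := (hψ.const_mul 2).add (hVg.const_mul C)
  rw [mul_zero, mul_zero, add_zero] at hlim
  refine squeeze_zero (fun n => norm_nonneg _) (fun n => ?_) hlim
  set ψ := P[Y | U n] with hψdef
  set Q := P[V n | F n] with hQdef
  have hψi : Integrable ψ P := integrable_condExp
  have hQi : Integrable Q P := integrable_condExp
  have hψm : StronglyMeasurable[F n] ψ := stronglyMeasurable_condExp.mono (hUF n)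
  have hQ1 : ∀ᵐ ω ∂P, ‖Q ω‖ ≤ 1 := by
    have h2 : P[fun ω => ‖V n ω‖ | F n] ≤ᵐ[P] P[fun _ => (1 : ℝ) | F n] :=
      condExp_mono (hVi n).norm (integrable_const _) (.of_forall (hV1 n))
    rw [condExp_const (hF n)] at h2
    filter_upwards [norm_condExp_le (μ := P) (m := F n) (V n), h2] with ω h3 h4
    exact h3.trans h4
  have hψV : Integrable (fun ω => ψ ω * V n ω) P :=
    hψi.mul_bdd (c := 1) (hV n).aestronglyMeasurable (.of_forall (hV1 n))
  have hψQ : Integrable (fun ω => ψ ω * Q ω) P := hψi.mul_bdd (c := 1) hQi.aestronglyMeasurable hQ1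
  have hYV : Integrable (fun ω => Y ω * V n ω) P :=
    hYi.mul_bdd (c := 1) (hV n).aestronglyMeasurable (.of_forall (hV1 n))
  have hYQ : Integrable (fun ω => Y ω * Q ω) P := hYi.mul_bdd (c := 1) hQi.aestronglyMeasurable hQ1
  have hYg : Integrable (fun ω => Y ω * g ω) P :=
    hg.bdd_mul (c := C) hYm.aestronglyMeasurable (.of_forall hYC)
  have hswap : ∫ ω, ψ ω * V n ω ∂P = ∫ ω, ψ ω * Q ω ∂P := by
    rw [← integral_condExp (hF n) (f := fun ω => ψ ω * V n ω)]
    exact integral_congr_ae (condExp_mul_left_complex hψm hψV (hVi n))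
  have hsplit : ∫ ω, Y ω * V n ω ∂P - ∫ ω, Y ω * g ω ∂P =
      ∫ ω, ((Y ω - ψ ω) * V n ω + (ψ ω - Y ω) * Q ω + Y ω * (Q ω - g ω)) ∂P := by
    have h1 : ∀ ω, (Y ω - ψ ω) * V n ω + (ψ ω - Y ω) * Q ω + Y ω * (Q ω - g ω) =
        (Y ω * V n ω - Y ω * g ω) - (ψ ω * V n ω - ψ ω * Q ω) := fun ω => by ring
    simp only [h1]
    have hi1 : Integrable (fun ω => Y ω * V n ω - Y ω * g ω) P := hYV.sub hYg
    have hi2 : Integrable (fun ω => ψ ω * V n ω - ψ ω * Q ω) P := hψV.sub hψQ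
    rw [integral_sub hi1 hi2, integral_sub hYV hYg, integral_sub hψV hψQ,
      hswap, sub_self, sub_zero]
  have hj1 : Integrable (fun ω => 2 * ‖ψ ω - Y ω‖) P := (hψi.sub hYi).norm.const_mul 2
  have hj2 : Integrable (fun ω => C * ‖Q ω - g ω‖) P := (hQi.sub hg).norm.const_mul C
  rw [hsplit, ← integral_const_mul, ← integral_const_mul, ← integral_add hj1 hj2]
  refine (norm_integral_le_integral_norm _).trans ?_
  have hi : Integrable (fun ω => (Y ω - ψ ω) * V n ω + (ψ ω - Y ω) * Q ω + Y ω * (Q ω - g ω)) P :=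
    ((((hYi.sub hψi).mul_bdd (c := 1) (hV n).aestronglyMeasurable (.of_forall (hV1 n)))).add
      ((hψi.sub hYi).mul_bdd (c := 1) hQi.aestronglyMeasurable hQ1)).add
      ((hQi.sub hg).bdd_mul (c := C) hYm.aestronglyMeasurable (.of_forall hYC))
  refine integral_mono_ae hi.norm (hj1.add hj2) ?_
  filter_upwards [hQ1] with ω hω
  have h1 : ‖(Y ω - ψ ω) * V n ω‖ ≤ ‖ψ ω - Y ω‖ := by
    rw [norm_mul, norm_sub_rev]
    exact mul_le_of_le_one_right (norm_nonneg _) (hV1 n ω)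
  have h2 : ‖(ψ ω - Y ω) * Q ω‖ ≤ ‖ψ ω - Y ω‖ := by
    rw [norm_mul]
    exact mul_le_of_le_one_right (norm_nonneg _) hω
  have h3 : ‖Y ω * (Q ω - g ω)‖ ≤ C * ‖Q ω - g ω‖ := by
    rw [norm_mul]
    exact mul_le_mul_of_nonneg_right (hYC ω) (norm_nonneg _)
  have h4 := norm_add₃_le (a := (Y ω - ψ ω) * V n ω) (b := (ψ ω - Y ω) * Q ω)
    (c := Y ω * (Q ω - g ω))
  show ‖(Y ω - ψ ω) * V n ω + (ψ ω - Y ω) * Q ω + Y ω * (Q ω - g ω)‖ ≤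
    2 * ‖ψ ω - Y ω‖ + C * ‖Q ω - g ω‖
  linarith

end LimitPrinciple

/-! ### The compensated exponential and its extension to a compactified line. -/

section LevyFun

/-- The compensated exponential `exp(i r x) - 1 - i r x`. -/
def levyFun (r x : ℝ) : ℂ := Complex.exp (Complex.I * r * x) - 1 - Complex.I * r * x

theorem continuous_levyFun : Continuous (Function.uncurry levyFun) := by
  unfold levyFun Function.uncurry
  fun_prop

theorem measurable_levyFun (r : ℝ) : Measurable (levyFun r) :=
  (continuous_levyFun.comp (Continuous.prodMk_right r)).measurable

@[simp] theorem levyFun_zero_left (x : ℝ) : levyFun 0 x = 0 := by simp [levyFun]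

@[simp] theorem levyFun_zero_right (r : ℝ) : levyFun r 0 = 0 := by simp [levyFun]

theorem norm_exp_I_mul_mul (r x : ℝ) : ‖Complex.exp (Complex.I * r * x)‖ = 1 := by
  rw [mul_assoc, ← Complex.ofReal_mul, mul_comm, Complex.norm_exp_ofReal_mul_I]

theorem norm_exp_I_sub_one_le (r x : ℝ) : ‖Complex.exp (Complex.I * r * x) - 1‖ ≤ |r| * |x| := by
  have := Real.norm_exp_I_mul_ofReal_sub_one_le (x := r * x)
  rw [Complex.ofReal_mul, ← mul_assoc, Real.norm_eq_abs, abs_mul] at this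
  exact this

theorem norm_levyFun_sub_le (r s x : ℝ) :
    ‖levyFun r x - levyFun s x‖ ≤ max |r| |s| * |r - s| * x ^ 2 := by
  -- Mean value inequality in the frequency: the derivative is at most |u| x² in modulus.
  have hder : ∀ u : ℝ, HasDerivAt (fun u : ℝ => levyFun u x)
      (Complex.I * x * (Complex.exp (Complex.I * u * x) - 1)) u := by
    intro u
    have h1 : HasDerivAt (fun u : ℝ => Complex.I * (u : ℂ) * x) (Complex.I * x) u := by
      have := ((Complex.ofRealCLM.hasDerivAt (x := u)).const_mul Complex.I).mul_const (x : ℂ)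
      simpa using this
    have h2 := (h1.cexp.sub_const 1).sub h1
    refine h2.congr_deriv ?_
    ring
  have h := Convex.norm_image_sub_le_of_norm_hasDerivWithin_le (s := Set.uIcc s r)
    (C := max |r| |s| * x ^ 2) (fun u _ => (hder u).hasDerivWithinAt) (fun u hu => ?_)
    (convex_uIcc s r) Set.left_mem_uIcc Set.right_mem_uIcc
  · refine h.trans (le_of_eq ?_)
    rw [Real.norm_eq_abs]; ring
  · have hu' : |u| ≤ max |r| |s| := by
      rcases Set.mem_uIcc.1 hu with h | h
      · rw [max_comm]; exact abs_le_max_abs_abs h.1 h.2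
      · exact abs_le_max_abs_abs h.1 h.2
    rw [norm_mul, norm_mul, Complex.norm_I, one_mul, Complex.norm_real, Real.norm_eq_abs]
    calc |x| * ‖Complex.exp (Complex.I * u * x) - 1‖ ≤ |x| * (|u| * |x|) := by
          gcongr
          exact norm_exp_I_sub_one_le u x
      _ ≤ |x| * (max |r| |s| * |x|) := by gcongr
      _ = max |r| |s| * x ^ 2 := by rw [← sq_abs x]; ring

theorem norm_levyFun_le (r x : ℝ) : ‖levyFun r x‖ ≤ r ^ 2 * x ^ 2 := by
  have := norm_levyFun_sub_le r 0 x
  simp only [levyFun_zero_left, sub_zero, abs_zero, abs_nonneg, sup_of_le_left] at this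
  rwa [← sq, sq_abs] at this

theorem norm_levyFun_le_abs (r x : ℝ) : ‖levyFun r x‖ ≤ 2 * (|r| * |x|) := by
  have h1 := norm_exp_I_sub_one_le r x
  have h2 : ‖Complex.I * r * x‖ = |r| * |x| := by
    simp [Complex.norm_real]
  calc ‖levyFun r x‖ ≤ ‖Complex.exp (Complex.I * r * x) - 1‖ + ‖Complex.I * r * x‖ := norm_sub_le _ _
    _ ≤ _ := by rw [h2]; linarith

theorem levyFun_re_nonpos (r x : ℝ) : (levyFun r x).re ≤ 0 := by
  have h1 : (Complex.exp (Complex.I * r * x)).re ≤ 1 :=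
    (Complex.re_le_norm _).trans (norm_exp_I_mul_mul r x).le
  have h2 : (Complex.I * r * x).re = 0 := by simp
  simp only [levyFun, Complex.sub_re, Complex.one_re, h2]
  linarith

/-- The quotient `(exp(i r x) - 1 - i r x) / x²`, extended continuously to the origin. -/
def levyQuotient (r x : ℝ) : ℂ := if x = 0 then -((r : ℂ) ^ 2 / 2) else levyFun r x / (x : ℂ) ^ 2

theorem sq_mul_levyQuotient (r x : ℝ) : ((x ^ 2 : ℝ) : ℂ) * levyQuotient r x = levyFun r x := by
  unfold levyQuotient
  split_ifs with h
  · simp [h]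
  · have : (x : ℂ) ≠ 0 := by exact_mod_cast h
    push_cast
    field_simp

theorem norm_levyQuotient_le (r x : ℝ) : ‖levyQuotient r x‖ ≤ r ^ 2 := by
  unfold levyQuotient
  split_ifs with h
  · rw [norm_neg, norm_div, norm_pow, Complex.norm_real, Real.norm_eq_abs, sq_abs]
    norm_num
    nlinarith [sq_nonneg r]
  · rw [norm_div, norm_pow, Complex.norm_real, Real.norm_eq_abs, sq_abs,
      div_le_iff₀ (by positivity)]
    exact norm_levyFun_le r x

/-- For large x the compensated exponential grows only linearly, so the quotient decays like 1/|x|.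
This lets it extend by zero to the points at infinity. -/
theorem norm_levyQuotient_le_div (r x : ℝ) :
    ‖levyQuotient r x‖ ≤ (2 * r ^ 2 + 4 * |r|) / (1 + |x|) := by
  rw [le_div_iff₀ (by positivity)]
  rcases le_total |x| 1 with h | h
  · have := norm_levyQuotient_le r x
    nlinarith [abs_nonneg r, abs_nonneg x, norm_nonneg (levyQuotient r x)]
  · have hx : x ≠ 0 := by rintro rfl; norm_num at h
    have hx0 : 0 < |x| := by positivity
    have h1 : ‖levyQuotient r x‖ ≤ 2 * |r| / |x| := by
      rw [levyQuotient, if_neg hx, norm_div, norm_pow, Complex.norm_real, Real.norm_eq_abs,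
        div_le_div_iff₀ (by positivity) hx0]
      have := norm_levyFun_le_abs r x
      nlinarith
    calc ‖levyQuotient r x‖ * (1 + |x|) ≤ 2 * |r| / |x| * (|x| + |x|) := by gcongr
      _ = 4 * |r| := by field_simp; ring
      _ ≤ _ := by nlinarith [sq_nonneg r]

theorem continuous_levyQuotient (r : ℝ) : Continuous (levyQuotient r) := by
  rw [continuous_iff_continuousAt]
  intro x
  by_cases hx : x = 0
  · subst hx
    have hval : levyQuotient r 0 = -((r : ℂ) ^ 2 / 2) := if_pos rfl
    have hbound : ∀ᶠ x : ℝ in 𝓝 0,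
        ‖levyQuotient r x - levyQuotient r 0‖ ≤ |r| ^ 3 * |x| := by
      have h1 : ∀ᶠ x : ℝ in 𝓝 0, |r * x| < 1 := by
        have : Tendsto (fun x : ℝ => |r * x|) (𝓝 0) (𝓝 |r * 0|) :=
          Continuous.tendsto (by fun_prop) 0
        rw [mul_zero, abs_zero] at this
        exact (tendsto_order.1 this).2 1 one_pos
      filter_upwards [h1] with x hx
      by_cases hx0 : x = 0
      · subst hx0; simp
      have hxc : (x : ℂ) ≠ 0 := by exact_mod_cast hx0
      have hn : ‖Complex.I * r * x‖ = |r| * |x| := by simp [Complex.norm_real]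
      -- Taylor expansion with the quadratic term kept: the remainder is cubic, hence still small
      -- after division by x².
      have h2 := Complex.exp_bound (x := Complex.I * r * x)
        (by rw [hn, ← abs_mul]; exact hx.le) (n := 3) (by norm_num)
      have h3 : levyQuotient r x - levyQuotient r 0 =
          (Complex.exp (Complex.I * r * x) - ∑ m ∈ Finset.range 3,
            (Complex.I * r * x) ^ m / m.factorial) / (x : ℂ) ^ 2 := by
        rw [hval, levyQuotient, if_neg hx0, levyFun]
        simp only [Finset.sum_range_succ, Finset.sum_range_zero]
        field_simp
        norm_num [Nat.factorial]
        ring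
      rw [h3, norm_div, norm_pow, Complex.norm_real, Real.norm_eq_abs, div_le_iff₀ (by positivity)]
      refine h2.trans ?_
      rw [hn]
      have h4 : ((Nat.succ 3 : ℕ) : ℝ) * ((Nat.factorial 3 : ℝ) * (3 : ℕ))⁻¹ ≤ 1 := by
        norm_num [Nat.factorial]
      calc (|r| * |x|) ^ 3 * (((Nat.succ 3 : ℕ) : ℝ) * ((Nat.factorial 3 : ℝ) * (3 : ℕ))⁻¹)
          ≤ (|r| * |x|) ^ 3 * 1 := by gcongr
        _ = |r| ^ 3 * |x| * |x| ^ 2 := by ring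
    rw [ContinuousAt, tendsto_iff_norm_sub_tendsto_zero]
    have h5 : Tendsto (fun x : ℝ => |r| ^ 3 * |x|) (𝓝 0) (𝓝 (|r| ^ 3 * |(0 : ℝ)|)) :=
      Continuous.tendsto (by fun_prop) 0
    rw [abs_zero, mul_zero] at h5
    exact squeeze_zero' (.of_forall fun _ => norm_nonneg _) hbound h5
  · have h1 : levyQuotient r =ᶠ[𝓝 x] fun x => levyFun r x / (x : ℂ) ^ 2 := by
      filter_upwards [isOpen_ne.mem_nhds hx] with y hy
      exact if_neg hy
    refine ContinuousAt.congr ?_ h1.symm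
    have hxc : (x : ℂ) ^ 2 ≠ 0 := pow_ne_zero _ (by exact_mod_cast hx)
    exact ((continuous_levyFun.comp (Continuous.prodMk_right r)).continuousAt).div
      (by fun_prop) hxc

/-- The compact interval used as a compactification of the line. -/
abbrev CompactLine : Type := Set.Icc (-1 : ℝ) 1

/-- The embedding `x ↦ x / (1 + |x|)` of the line in its compactification. -/
def toCompactLine (x : ℝ) : CompactLine :=
  ⟨x / (1 + |x|), by
    have h : 0 < 1 + |x| := by positivity
    constructor
    · rw [le_div_iff₀ h]; linarith [neg_abs_le x]
    · rw [div_le_iff₀ h]; linarith [le_abs_self x]⟩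

/-- The inverse `k ↦ k / (1 - |k|)` of the embedding of the line in its compactification. -/
def ofCompactLine (k : CompactLine) : ℝ := k.1 / (1 - |k.1|)

theorem measurable_toCompactLine : Measurable toCompactLine := by
  refine Measurable.subtype_mk ?_
  fun_prop

theorem measurable_ofCompactLine : Measurable ofCompactLine := by
  unfold ofCompactLine
  fun_prop

theorem abs_toCompactLine_lt (x : ℝ) : |(toCompactLine x).1| < 1 := by
  have h : 0 < 1 + |x| := by positivity
  show |x / (1 + |x|)| < 1
  rw [abs_div, abs_of_pos h, div_lt_one h]
  linarith

theorem ofCompactLine_toCompactLine (x : ℝ) : ofCompactLine (toCompactLine x) = x := by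
  have h : 0 < 1 + |x| := by positivity
  show x / (1 + |x|) / (1 - |x / (1 + |x|)|) = x
  rw [abs_div, abs_of_pos h]
  field_simp
  ring_nf

/-- The continuous function on the compactified line that represents `levyQuotient`. -/
def compactLevyQuotient (r : ℝ) (k : CompactLine) : ℂ :=
  if |k.1| < 1 then levyQuotient r (ofCompactLine k) else 0

theorem compactLevyQuotient_toCompactLine (r x : ℝ) :
    compactLevyQuotient r (toCompactLine x) = levyQuotient r x := by
  rw [compactLevyQuotient, if_pos (abs_toCompactLine_lt x), ofCompactLine_toCompactLine]

theorem norm_compactLevyQuotient_le_sub (r : ℝ) (k : CompactLine) :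
    ‖compactLevyQuotient r k‖ ≤ (2 * r ^ 2 + 4 * |r|) * (1 - |k.1|) := by
  unfold compactLevyQuotient
  split_ifs with h
  · refine (norm_levyQuotient_le_div r _).trans (le_of_eq ?_)
    have h1 : 0 < 1 - |k.1| := by linarith
    rw [ofCompactLine, abs_div, abs_of_pos h1]
    field_simp
    ring_nf
  · have : |k.1| ≤ 1 := abs_le.2 ⟨k.2.1, k.2.2⟩
    rw [norm_zero]
    exact mul_nonneg (by positivity) (by linarith)

theorem norm_compactLevyQuotient_le (r : ℝ) (k : CompactLine) :
    ‖compactLevyQuotient r k‖ ≤ r ^ 2 := by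
  unfold compactLevyQuotient
  split_ifs with h
  · exact norm_levyQuotient_le r _
  · rw [norm_zero]; positivity

theorem continuous_compactLevyQuotient (r : ℝ) : Continuous (compactLevyQuotient r) := by
  rw [continuous_iff_continuousAt]
  intro k
  by_cases hk : |k.1| < 1
  · have hopen : IsOpen {k : CompactLine | |k.1| < 1} :=
      isOpen_lt (by fun_prop) continuous_const
    have h1 : compactLevyQuotient r =ᶠ[𝓝 k] fun k => levyQuotient r (ofCompactLine k) := by
      filter_upwards [hopen.mem_nhds hk] with l hl
      exact if_pos hl
    refine ContinuousAt.congr ?_ h1.symm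
    refine (continuous_levyQuotient r).continuousAt.comp ?_
    unfold ofCompactLine
    exact ContinuousAt.div (by fun_prop) (by fun_prop) (by linarith)
  · have hk1 : |k.1| = 1 := le_antisymm (abs_le.2 ⟨k.2.1, k.2.2⟩) (not_lt.1 hk)
    have hval : compactLevyQuotient r k = 0 := if_neg hk
    rw [ContinuousAt, hval, tendsto_zero_iff_norm_tendsto_zero]
    have h5 : Tendsto (fun l : CompactLine => (2 * r ^ 2 + 4 * |r|) * (1 - |l.1|)) (𝓝 k)
        (𝓝 ((2 * r ^ 2 + 4 * |r|) * (1 - |k.1|))) := Continuous.tendsto (by fun_prop) k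
    rw [hk1, sub_self, mul_zero] at h5
    exact squeeze_zero (fun _ => norm_nonneg _) (norm_compactLevyQuotient_le_sub r) h5

end LevyFun

/-! ### Products of numbers close to one. -/

section Products

theorem norm_prod_sub_prod_le {ι : Type*} (s : Finset ι) (a b : ι → ℂ) (ha : ∀ i, ‖a i‖ ≤ 1)
    (hb : ∀ i, ‖b i‖ ≤ 1) : ‖∏ i ∈ s, a i - ∏ i ∈ s, b i‖ ≤ ∑ i ∈ s, ‖a i - b i‖ := by
  classical
  induction s using Finset.induction_on with
  | empty => simp
  | insert i s hi ih =>
    rw [Finset.prod_insert hi, Finset.prod_insert hi, Finset.sum_insert hi]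
    have h1 : a i * ∏ j ∈ s, a j - b i * ∏ j ∈ s, b j =
        (a i - b i) * ∏ j ∈ s, a j + b i * (∏ j ∈ s, a j - ∏ j ∈ s, b j) := by ring
    have h2 : ‖∏ j ∈ s, a j‖ ≤ 1 := by
      rw [norm_prod]
      exact Finset.prod_le_one (fun _ _ => norm_nonneg _) fun j _ => ha j
    rw [h1]
    refine (norm_add_le _ _).trans (add_le_add ?_ ?_)
    · rw [norm_mul]; exact mul_le_of_le_one_right (norm_nonneg _) h2
    · rw [norm_mul]; exact (mul_le_of_le_one_left (norm_nonneg _) (hb i)).trans ih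

theorem norm_exp_le_one_of_re_nonpos {w : ℂ} (hw : w.re ≤ 0) : ‖Complex.exp w‖ ≤ 1 := by
  rw [Complex.norm_exp]; exact Real.exp_le_one_iff.2 hw

/-- The Taylor bound applies for |w| ≤ 1; beyond that, |exp w| ≤ 1 gives at most 2 + |w| ≤ 3 |w|².
The half-plane makes a bound for all w possible. -/
theorem norm_exp_sub_one_sub_le {w : ℂ} (hw : w.re ≤ 0) :
    ‖Complex.exp w - 1 - w‖ ≤ 4 * ‖w‖ ^ 2 := by
  rcases le_total ‖w‖ 1 with h | h
  · exact (Complex.norm_exp_sub_one_sub_id_le h).trans (by nlinarith [sq_nonneg ‖w‖])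
  · have h1 : ‖Complex.exp w - 1 - w‖ ≤ ‖Complex.exp w‖ + ‖(1 : ℂ)‖ + ‖w‖ :=
      (norm_sub_le _ _).trans (add_le_add_left (norm_sub_le _ _) _)
    have h2 := norm_exp_le_one_of_re_nonpos hw
    rw [norm_one] at h1
    nlinarith

/-- The Poisson approximation of an infinitesimal array: each a i is compared with exp(a i - 1). -/
theorem norm_prod_sub_exp_sum_le {ι : Type*} (s : Finset ι) (a : ι → ℂ) (ha : ∀ i, ‖a i‖ ≤ 1) :
    ‖∏ i ∈ s, a i - Complex.exp (∑ i ∈ s, (a i - 1))‖ ≤ 4 * ∑ i ∈ s, ‖a i - 1‖ ^ 2 := by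
  have hre : ∀ i, (a i - 1).re ≤ 0 := fun i => by
    have := (Complex.re_le_norm (a i)).trans (ha i)
    simpa using this
  rw [Complex.exp_sum, Finset.mul_sum]
  refine (norm_prod_sub_prod_le s a _ ha fun i => norm_exp_le_one_of_re_nonpos (hre i)).trans
    (Finset.sum_le_sum fun i _ => ?_)
  have h := norm_exp_sub_one_sub_le (hre i)
  rw [norm_sub_rev]
  refine le_trans (le_of_eq ?_) h
  congr 1
  ring

end Products

/-! ### Characteristic functions of random variables. -/

section CharInt

/-- The characteristic function of the random variable `Y`. -/
def charInt {Ω : Type*} [MeasurableSpace Ω] (P : Measure Ω) (Y : Ω → ℝ) (r : ℝ) : ℂ :=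
  ∫ ω, Complex.exp (Complex.I * r * Y ω) ∂P

variable {Ω : Type*} [MeasurableSpace Ω] {P : Measure Ω} [IsProbabilityMeasure P]

theorem integrable_exp_I_mul {Y : Ω → ℝ} (hY : Measurable Y) (r : ℝ) :
    Integrable (fun ω => Complex.exp (Complex.I * r * Y ω)) P :=
  .of_bound (Measurable.aestronglyMeasurable (by fun_prop)) 1
    (.of_forall fun _ => (norm_exp_I_mul_mul _ _).le)

theorem norm_charInt_le_one (Y : Ω → ℝ) (r : ℝ) : ‖charInt P Y r‖ ≤ 1 := by
  refine (norm_integral_le_of_norm_le_const (C := 1)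
    (.of_forall fun _ => (norm_exp_I_mul_mul _ _).le)).trans ?_
  simp

@[simp] theorem charInt_zero (Y : Ω → ℝ) : charInt P Y 0 = 1 := by simp [charInt]

theorem charInt_congr {Y Y' : Ω → ℝ} (h : Y =ᵐ[P] Y') (r : ℝ) : charInt P Y r = charInt P Y' r :=
  integral_congr_ae (h.mono fun ω hω => by simp only [hω])

theorem norm_charInt_sub_le {Y Y' : Ω → ℝ} (hY : MemLp Y 2 P) (hY' : MemLp Y' 2 P)
    (hYm : Measurable Y) (hYm' : Measurable Y') (r : ℝ) :
    ‖charInt P Y r - charInt P Y' r‖ ≤ |r| * √(∫ ω, (Y ω - Y' ω) ^ 2 ∂P) := by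
  have h1 : ∀ ω, ‖Complex.exp (Complex.I * r * Y ω) - Complex.exp (Complex.I * r * Y' ω)‖ ≤
      |r| * |Y ω - Y' ω| := by
    intro ω
    have h2 : Complex.exp (Complex.I * r * Y ω) - Complex.exp (Complex.I * r * Y' ω) =
        Complex.exp (Complex.I * r * Y' ω) *
          (Complex.exp (Complex.I * r * ((Y ω - Y' ω : ℝ) : ℂ)) - 1) := by
      rw [mul_sub, ← Complex.exp_add, mul_one]
      push_cast
      ring_nf
    rw [h2, norm_mul, norm_exp_I_mul_mul, one_mul]
    exact norm_exp_I_sub_one_le _ _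
  have hd : MemLp (fun ω => Y ω - Y' ω) 2 P := hY.sub hY'
  have hi : Integrable (fun ω => |Y ω - Y' ω|) P := (hd.integrable (by norm_num)).abs
  rw [charInt, charInt, ← integral_sub (integrable_exp_I_mul hYm r) (integrable_exp_I_mul hYm' r)]
  refine (norm_integral_le_of_norm_le (hi.const_mul |r|) (.of_forall h1)).trans ?_
  rw [integral_const_mul]
  gcongr
  refine Real.le_sqrt_of_sq_le ?_
  have hv := variance_nonneg (fun ω => |Y ω - Y' ω|) P
  have hda : MemLp (fun ω => |Y ω - Y' ω|) 2 P := hd.abs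
  rw [variance_eq_sub hda] at hv
  simp only [Pi.pow_apply, sq_abs] at hv
  linarith

end CharInt

/-! ### Characteristic functions of the values of M. -/

namespace IsIndependentlyScattered

variable {Ω Z : Type*} [MeasurableSpace Ω] [MeasurableSpace Z]
  {P : Measure Ω} [IsProbabilityMeasure P] {μ : Measure Z} {M : Set Z → Ω → ℝ}

theorem integral_exp_sum (hM : IsIndependentlyScattered P μ M) {κ : Type*} [Fintype κ]
    {D : κ → Set Z} (hD : ∀ k, MeasurableSet (D k)) (hD' : ∀ k, μ (D k) < ∞)
    (hd : Pairwise fun k l => Disjoint (D k) (D l)) (a : κ → ℝ) :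
    ∫ ω, Complex.exp (Complex.I * ((∑ k, a k * M (D k) ω : ℝ) : ℂ)) ∂P =
      ∏ k, charInt P (M (D k)) (a k) := by
  have h := (hM.iIndepFun_of_disjoint hD hD' hd).integral_fun_prod_comp
    (f := fun k x => Complex.exp (Complex.I * a k * (x : ℝ)))
    (fun k => (hM.measurable _ (hD k) (hD' k)).aemeasurable)
    (fun k => Measurable.aestronglyMeasurable (by fun_prop))
  refine Eq.trans (integral_congr_ae (.of_forall fun ω => ?_)) h
  simp only
  rw [← Complex.exp_sum]
  push_cast
  rw [Finset.mul_sum]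
  simp only [mul_assoc]

theorem charInt_biUnion (hM : IsIndependentlyScattered P μ M) {κ : Type*} [Fintype κ]
    {D : κ → Set Z} (hD : ∀ k, MeasurableSet (D k)) (hD' : ∀ k, μ (D k) < ∞)
    (hd : Pairwise fun k l => Disjoint (D k) (D l)) (T : Finset κ) (r : ℝ) :
    charInt P (M (⋃ k ∈ T, D k)) r = ∏ k ∈ T, charInt P (M (D k)) r := by
  classical
  have h := hM.integral_exp_sum hD hD' hd fun k => if k ∈ T then r else 0
  have h1 : ∏ k, charInt P (M (D k)) (if k ∈ T then r else 0) =
      ∏ k ∈ T, charInt P (M (D k)) r := by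
    rw [← Finset.prod_filter_mul_prod_filter_not Finset.univ (· ∈ T)]
    rw [Finset.prod_congr rfl (g := fun k => charInt P (M (D k)) r) (fun k hk => by
      rw [if_pos (Finset.mem_filter.1 hk).2])]
    rw [Finset.prod_congr (s₁ := Finset.univ.filter (· ∉ T)) rfl (g := fun _ => 1) (fun k hk => by
      rw [if_neg (Finset.mem_filter.1 hk).2, charInt_zero])]
    simp
  rw [← h1, ← h, charInt]
  refine integral_congr_ae ?_
  filter_upwards [hM.ae_biUnion hD hD' hd T] with ω hω
  rw [hω]
  congr 1
  rw [mul_assoc]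
  congr 1
  rw [← Complex.ofReal_mul, Finset.mul_sum]
  congr 1
  simp

theorem charInt_union (hM : IsIndependentlyScattered P μ M) {A B : Set Z}
    (hA : MeasurableSet A) (hA' : μ A < ∞) (hB : MeasurableSet B) (hB' : μ B < ∞)
    (hAB : Disjoint A B) (r : ℝ) :
    charInt P (M (A ∪ B)) r = charInt P (M A) r * charInt P (M B) r := by
  have h := hM.charInt_biUnion (D := fun b : Bool => if b then A else B)
    (fun b => by cases b <;> simp [hA, hB]) (fun b => by cases b <;> simp [hA', hB'])
    (fun b c hbc => by cases b <;> cases c <;> simp_all [hAB.symm]) Finset.univ r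
  have h1 : ⋃ k ∈ (Finset.univ : Finset Bool), (if k then A else B) = A ∪ B := by
    ext z; simp [or_comm]
  rw [h1] at h
  rw [h]
  simp

variable [MeasurableSpace.CountablyGenerated Z] [MeasurableSpace.SeparatesPoints Z]
  [NullSingletonClass μ]

/-- Since M B is centered, the compensator can be inserted for free, which makes the difference
quadratic in r. -/
theorem charInt_sub_one (hM : IsIndependentlyScattered P μ M) {B : Set Z}
    (hB : MeasurableSet B) (hB' : μ B < ∞) (r : ℝ) :
    charInt P (M B) r - 1 = ∫ ω, levyFun r (M B ω) ∂P := by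
  have hi := hM.integrable hB hB'
  have hic : Integrable (fun ω => Complex.I * r * (M B ω : ℂ)) P := hi.ofReal.const_mul _
  have he := integrable_exp_I_mul (P := P) (hM.measurable B hB hB') r
  have he1 : Integrable (fun ω => Complex.exp (Complex.I * r * M B ω) - 1) P :=
    he.sub (integrable_const _)
  unfold levyFun
  rw [integral_sub he1 hic, integral_sub he (integrable_const _), integral_const_mul,
    integral_complex_ofReal, hM.integral_eq_zero hB hB', charInt]
  simp

theorem norm_charInt_sub_one_le (hM : IsIndependentlyScattered P μ M) {B : Set Z}
    (hB : MeasurableSet B) (hB' : μ B < ∞) (r : ℝ) :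
    ‖charInt P (M B) r - 1‖ ≤ r ^ 2 * (μ B).toReal := by
  rw [hM.charInt_sub_one hB hB', ← hM.eLpNorm_sq hB hB', ← integral_const_mul]
  exact norm_integral_le_of_norm_le ((hM.memLp B hB hB').integrable_sq.const_mul (r ^ 2))
    (.of_forall fun _ => norm_levyFun_le _ _)

end IsIndependentlyScattered

/-! ### Cylinders of the Cantor space and their trace on Z. -/

section Cylinders

/-- The extension of a finite binary word by `false`. -/
def extendCode {N : ℕ} (c : Fin N → Bool) (i : ℕ) : Bool := if h : i < N then c ⟨i, h⟩ else false

/-- The cylinder set of the Cantor space determined by a finite binary word. -/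
def binaryCylinder {n : ℕ} (b : Fin n → Bool) : Set (ℕ → Bool) := {x | ∀ i : Fin n, x i = b i}

theorem isClopen_binaryCylinder {n : ℕ} (b : Fin n → Bool) : IsClopen (binaryCylinder b) := by
  have : binaryCylinder b = ⋂ i : Fin n, (fun x : ℕ → Bool => x i) ⁻¹' {b i} := by
    ext x; simp [binaryCylinder]
  rw [this]
  exact isClopen_iInter_of_finite fun i =>
    (isClopen_discrete {b i}).preimage (continuous_apply (i : ℕ))

theorem isPiSystem_binaryCylinder :
    IsPiSystem {s : Set (ℕ → Bool) | ∃ (n : ℕ) (b : Fin n → Bool), s = binaryCylinder b} := by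
  rintro _ ⟨n, b, rfl⟩ _ ⟨k, c, rfl⟩ ⟨x, hxb, hxc⟩
  refine ⟨max n k, fun i => x i, ?_⟩
  ext y
  constructor
  · rintro ⟨h1, h2⟩ i
    rcases lt_or_ge (i : ℕ) n with h | h
    · exact (h1 ⟨i, h⟩).trans (hxb ⟨i, h⟩).symm
    · have hk : (i : ℕ) < k := by
        rcases lt_max_iff.1 i.2 with h' | h'
        · omega
        · exact h'
      exact (h2 ⟨i, hk⟩).trans (hxc ⟨i, hk⟩).symm
  · intro h
    exact ⟨fun i => (h ⟨i, lt_max_of_lt_left i.2⟩).trans (hxb i),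
      fun i => (h ⟨i, lt_max_of_lt_right i.2⟩).trans (hxc i)⟩

theorem generateFrom_binaryCylinder :
    (inferInstance : MeasurableSpace (ℕ → Bool)) =
      MeasurableSpace.generateFrom
        {s : Set (ℕ → Bool) | ∃ (n : ℕ) (b : Fin n → Bool), s = binaryCylinder b} := by
  apply le_antisymm
  · refine iSup_le fun i => ?_
    rw [← measurable_iff_comap_le]
    refine @measurable_to_bool _ (MeasurableSpace.generateFrom _) _ ?_
    have : (fun x : ℕ → Bool => x i) ⁻¹' {true} =
        ⋃ b ∈ {b : Fin (i + 1) → Bool | b (Fin.last i) = true}, binaryCylinder b := by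
      ext x
      simp only [Set.mem_preimage, Set.mem_singleton_iff, Set.mem_iUnion]
      constructor
      · intro h
        exact ⟨fun j => x j, h, fun j => rfl⟩
      · rintro ⟨b, hb, hx⟩
        have := hx (Fin.last i)
        rw [Fin.val_last] at this
        rw [this]
        exact hb
    rw [this]
    exact MeasurableSet.biUnion (Set.to_countable _) fun b _ =>
      MeasurableSpace.measurableSet_generateFrom ⟨_, b, rfl⟩
  · refine MeasurableSpace.generateFrom_le ?_
    rintro _ ⟨n, b, rfl⟩
    exact (isClopen_binaryCylinder b).isOpen.measurableSet

variable {Z : Type*} [mZ : MeasurableSpace Z] [MeasurableSpace.CountablyGenerated Z]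

theorem binaryCell_eq_preimage {n : ℕ} (b : Fin n → Bool) :
    binaryCell Z n b = MeasurableSpace.mapNatBool Z ⁻¹' binaryCylinder b := rfl

theorem isPiSystem_binaryCell :
    IsPiSystem {s : Set Z | ∃ (n : ℕ) (b : Fin n → Bool), s = binaryCell Z n b} := by
  rintro _ ⟨n, b, rfl⟩ _ ⟨k, c, rfl⟩ ⟨x, hxb, hxc⟩
  obtain ⟨l, d, h⟩ := isPiSystem_binaryCylinder _ ⟨n, b, rfl⟩ _ ⟨k, c, rfl⟩
    ⟨MeasurableSpace.mapNatBool Z x, hxb, hxc⟩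
  exact ⟨l, d, by
    rw [binaryCell_eq_preimage, binaryCell_eq_preimage, binaryCell_eq_preimage, ← h,
      Set.preimage_inter]⟩

theorem generateFrom_binaryCell :
    mZ = MeasurableSpace.generateFrom
      {s : Set Z | ∃ (n : ℕ) (b : Fin n → Bool), s = binaryCell Z n b} := by
  apply le_antisymm
  · have h1 : MeasurableSpace.comap (MeasurableSpace.mapNatBool Z) inferInstance ≤
        MeasurableSpace.generateFrom
          {s : Set Z | ∃ (n : ℕ) (b : Fin n → Bool), s = binaryCell Z n b} := by
      rw [generateFrom_binaryCylinder, MeasurableSpace.comap_generateFrom]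
      refine MeasurableSpace.generateFrom_mono ?_
      rintro _ ⟨_, ⟨n, b, rfl⟩, rfl⟩
      exact ⟨n, b, rfl⟩
    refine le_trans ?_ h1
    conv_lhs => rw [← MeasurableSpace.generateFrom_natGeneratingSequence Z]
    refine MeasurableSpace.generateFrom_le ?_
    rintro _ ⟨n, rfl⟩
    refine ⟨(fun x : ℕ → Bool => x n) ⁻¹' {true},
      measurable_pi_apply n (measurableSet_singleton true), ?_⟩
    ext z
    simp [MeasurableSpace.mapNatBool]
  · refine MeasurableSpace.generateFrom_le ?_
    rintro _ ⟨n, b, rfl⟩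
    exact measurableSet_binaryCell n b

open Classical in
theorem binaryCell_eq_biUnion {n N : ℕ} (hn : n ≤ N) (b : Fin n → Bool) :
    binaryCell Z n b =
      ⋃ c ∈ Finset.univ.filter fun c : Fin N → Bool => extendCode c ∈ binaryCylinder b,
        binaryCell Z N c := by
  ext z
  simp only [Set.mem_iUnion, Finset.mem_filter, Finset.mem_univ, true_and, exists_prop]
  constructor
  · intro hz
    refine ⟨fun i => MeasurableSpace.mapNatBool Z z i, fun i => ?_, fun i => rfl⟩
    rw [extendCode, dif_pos (lt_of_lt_of_le i.2 hn)]
    exact hz i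
  · rintro ⟨c, hc, hz⟩ i
    have h1 := hc i
    rw [extendCode, dif_pos (lt_of_lt_of_le i.2 hn)] at h1
    exact (hz ⟨i, lt_of_lt_of_le i.2 hn⟩).trans h1

end Cylinders

/-! ### Weak limits of the quadratic cell measures. -/

section CellMeasure

variable {Ω Z : Type*} [MeasurableSpace Ω] [MeasurableSpace Z]
  [MeasurableSpace.CountablyGenerated Z]
  {P : Measure Ω} [IsProbabilityMeasure P] {μ : Measure Z} {M : Set Z → Ω → ℝ}

/-- The sum over the binary cells `A` of level `N` of the law of `M(D ∩ A)` with the density `x²`,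
carried by the compactified line and marked by the code of the cell. -/
def cellMeasure (P : Measure Ω) (M : Set Z → Ω → ℝ) (D : Set Z) (N : ℕ) :
    Measure ((ℕ → Bool) × CompactLine) :=
  ∑ c : Fin N → Bool, (P.withDensity fun ω =>
    ((Real.toNNReal (M (D ∩ binaryCell Z N c) ω ^ 2) : ℝ≥0) : ℝ≥0∞)).map
      fun ω => (extendCode c, toCompactLine (M (D ∩ binaryCell Z N c) ω))

theorem measure_inter_binaryCell_lt_top {D : Set Z} (hD' : μ D < ∞) (N : ℕ) (c : Fin N → Bool) :
    μ (D ∩ binaryCell Z N c) < ∞ := (measure_mono Set.inter_subset_left).trans_lt hD'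

theorem pairwise_disjoint_inter_binaryCell (D : Set Z) (N : ℕ) :
    Pairwise fun b c : Fin N → Bool =>
      Disjoint (D ∩ binaryCell Z N b) (D ∩ binaryCell Z N c) := fun _ _ hbc =>
  (disjoint_binaryCell N hbc).mono Set.inter_subset_right Set.inter_subset_right

open Classical in
theorem inter_binaryCell_eq_biUnion (D : Set Z) {n N : ℕ} (hn : n ≤ N) (b : Fin n → Bool) :
    D ∩ binaryCell Z n b =
      ⋃ c ∈ Finset.univ.filter fun c : Fin N → Bool => extendCode c ∈ binaryCylinder b,
        D ∩ binaryCell Z N c := by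
  rw [binaryCell_eq_biUnion hn b, Set.inter_iUnion₂]

namespace IsIndependentlyScattered

theorem isFiniteMeasure_withDensity_sq (hM : IsIndependentlyScattered P μ M) {B : Set Z}
    (hB : MeasurableSet B) (hB' : μ B < ∞) :
    IsFiniteMeasure (P.withDensity fun ω => ((Real.toNNReal (M B ω ^ 2) : ℝ≥0) : ℝ≥0∞)) :=
  isFiniteMeasure_withDensity_ofReal (hM.memLp B hB hB').integrable_sq.2

theorem isFiniteMeasure_cellMeasure (hM : IsIndependentlyScattered P μ M) {D : Set Z}
    (hD : MeasurableSet D) (hD' : μ D < ∞) (N : ℕ) : IsFiniteMeasure (cellMeasure P M D N) := by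
  have : ∀ c : Fin N → Bool, IsFiniteMeasure ((P.withDensity fun ω =>
      ((Real.toNNReal (M (D ∩ binaryCell Z N c) ω ^ 2) : ℝ≥0) : ℝ≥0∞)).map
        fun ω => (extendCode c, toCompactLine (M (D ∩ binaryCell Z N c) ω))) := fun c => by
    have := hM.isFiniteMeasure_withDensity_sq (hD.inter (measurableSet_binaryCell N c))
      (measure_inter_binaryCell_lt_top hD' N c)
    infer_instance
  unfold cellMeasure
  infer_instance

open BoundedContinuousFunction in
theorem integral_cellMeasure (hM : IsIndependentlyScattered P μ M) {D : Set Z}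
    (hD : MeasurableSet D) (hD' : μ D < ∞) (N : ℕ) (F : ((ℕ → Bool) × CompactLine) →ᵇ ℂ) :
    ∫ x, F x ∂(cellMeasure P M D N) = ∑ c : Fin N → Bool,
      ∫ ω, ((M (D ∩ binaryCell Z N c) ω ^ 2 : ℝ) : ℂ) *
        F (extendCode c, toCompactLine (M (D ∩ binaryCell Z N c) ω)) ∂P := by
  unfold cellMeasure
  rw [integral_finsetSum_measure]
  · refine Finset.sum_congr rfl fun c _ => ?_
    have hm := hM.measurable _ (hD.inter (measurableSet_binaryCell N c))
      (measure_inter_binaryCell_lt_top hD' N c)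
    have hm' : Measurable fun ω =>
        ((extendCode c : ℕ → Bool), toCompactLine (M (D ∩ binaryCell Z N c) ω)) :=
      measurable_const.prodMk (measurable_toCompactLine.comp hm)
    rw [integral_map hm'.aemeasurable
      F.continuous.aestronglyMeasurable,
      integral_withDensity_eq_integral_smul (hm.pow_const 2).real_toNNReal]
    refine integral_congr_ae (.of_forall fun ω => ?_)
    simp only [NNReal.smul_def, Real.coe_toNNReal _ (sq_nonneg _), Complex.real_smul]
  · intro c _
    have := hM.isFiniteMeasure_withDensity_sq (hD.inter (measurableSet_binaryCell N c))
      (measure_inter_binaryCell_lt_top hD' N c)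
    exact F.integrable _

/-- The function `(x, k) ↦ 1(x ∈ C) G(k)` attached to a cylinder set `C`. -/
def _root_.cylinderTest {n : ℕ} (b : Fin n → Bool) (G : C(CompactLine, ℂ)) :
    BoundedContinuousFunction ((ℕ → Bool) × CompactLine) ℂ :=
  BoundedContinuousFunction.mkOfCompact
    ⟨fun x => (binaryCylinder b).indicator (fun _ => (1 : ℂ)) x.1 * G x.2, by
      refine Continuous.mul ?_ (by fun_prop)
      exact ((isClopen_binaryCylinder b).continuous_indicator continuous_const).comp continuous_fst⟩

theorem _root_.cylinderTest_apply {n : ℕ} (b : Fin n → Bool) (G : C(CompactLine, ℂ))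
    (x : (ℕ → Bool) × CompactLine) :
    cylinderTest b G x = (binaryCylinder b).indicator (fun _ => (1 : ℂ)) x.1 * G x.2 := rfl

open Classical in
theorem integral_cellMeasure_cylinderTest (hM : IsIndependentlyScattered P μ M) {D : Set Z}
    (hD : MeasurableSet D) (hD' : μ D < ∞) (N : ℕ) {n : ℕ} (b : Fin n → Bool)
    (G : C(CompactLine, ℂ)) :
    ∫ x, cylinderTest b G x ∂(cellMeasure P M D N) =
      ∑ c ∈ Finset.univ.filter fun c : Fin N → Bool => extendCode c ∈ binaryCylinder b,
        ∫ ω, ((M (D ∩ binaryCell Z N c) ω ^ 2 : ℝ) : ℂ) *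
          G (toCompactLine (M (D ∩ binaryCell Z N c) ω)) ∂P := by
  rw [hM.integral_cellMeasure hD hD', Finset.sum_filter]
  refine Finset.sum_congr rfl fun c _ => ?_
  split_ifs with h
  · simp [cylinderTest_apply, h]
  · simp [cylinderTest_apply, h]

/-- The second moments over the subcells add up to the control measure, whatever the level N ≥ n.
This fixes the total mass and the first marginal of any weak limit. -/
theorem integral_cellMeasure_cylinderTest_one (hM : IsIndependentlyScattered P μ M) {D : Set Z}
    (hD : MeasurableSet D) (hD' : μ D < ∞) {n N : ℕ} (hn : n ≤ N) (b : Fin n → Bool) :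
    ∫ x, cylinderTest b 1 x ∂(cellMeasure P M D N) =
      ((μ (D ∩ binaryCell Z n b)).toReal : ℂ) := by
  classical
  rw [hM.integral_cellMeasure_cylinderTest hD hD', inter_binaryCell_eq_biUnion D hn b,
    measure_biUnion_finset (fun c _ c' _ h => pairwise_disjoint_inter_binaryCell D N h)
      (fun c _ => hD.inter (measurableSet_binaryCell N c)),
    ENNReal.toReal_sum fun c _ => (measure_inter_binaryCell_lt_top hD' N c).ne, Complex.ofReal_sum]
  refine Finset.sum_congr rfl fun c _ => ?_
  rw [← hM.eLpNorm_sq (hD.inter (measurableSet_binaryCell N c))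
    (measure_inter_binaryCell_lt_top hD' N c), ← integral_complex_ofReal]
  simp

variable [MeasurableSpace.SeparatesPoints Z] [NullSingletonClass μ]

/-- The continuous function on the compactified line attached to the Lévy quotient. -/
def _root_.levyTest (r : ℝ) : C(CompactLine, ℂ) :=
  ⟨compactLevyQuotient r, continuous_compactLevyQuotient r⟩

open Classical in
theorem integral_cellMeasure_cylinderTest_levyTest (hM : IsIndependentlyScattered P μ M)
    {D : Set Z} (hD : MeasurableSet D) (hD' : μ D < ∞) (N : ℕ) {n : ℕ} (b : Fin n → Bool)
    (r : ℝ) :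
    ∫ x, cylinderTest b (levyTest r) x ∂(cellMeasure P M D N) =
      ∑ c ∈ Finset.univ.filter fun c : Fin N → Bool => extendCode c ∈ binaryCylinder b,
        (charInt P (M (D ∩ binaryCell Z N c)) r - 1) := by
  rw [hM.integral_cellMeasure_cylinderTest hD hD']
  refine Finset.sum_congr rfl fun c _ => ?_
  rw [hM.charInt_sub_one (hD.inter (measurableSet_binaryCell N c))
    (measure_inter_binaryCell_lt_top hD' N c)]
  refine integral_congr_ae (.of_forall fun ω => ?_)
  simp only [levyTest, ContinuousMap.coe_mk, compactLevyQuotient_toCompactLine,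
    sq_mul_levyQuotient]

/-- The characteristic function of a cell is the product over its subcells, and the integral is the
sum of the corresponding differences from one. By the Poisson approximation the error is at most 4
r⁴ times the sum of the squared subcell measures. -/
theorem tendsto_exp_integral_cellMeasure (hM : IsIndependentlyScattered P μ M)
    {D : Set Z} (hD : MeasurableSet D) (hD' : μ D < ∞) {n : ℕ} (b : Fin n → Bool) (r : ℝ) :
    Tendsto (fun N => Complex.exp (∫ x, cylinderTest b (levyTest r) x ∂(cellMeasure P M D N)))
      atTop (𝓝 (charInt P (M (D ∩ binaryCell Z n b)) r)) := by
  classical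
  have hfin : IsFiniteMeasure (μ.restrict D) := ⟨by simpa using hD'⟩
  have hnull : NullSingletonClass (μ.restrict D) := inferInstance
  have h0 := ENNReal.tendsto_toReal (ENNReal.zero_ne_top)
  have hsq : Tendsto (fun N => ∑ c : Fin N → Bool, (μ (D ∩ binaryCell Z N c)).toReal ^ 2) atTop
      (𝓝 0) := by
    have h1 := h0.comp (tendsto_sum_sq_binaryCell (μ.restrict D))
    refine h1.congr fun N => ?_
    rw [Function.comp_apply, ENNReal.toReal_sum fun c _ => by finiteness]
    refine Finset.sum_congr rfl fun c _ => ?_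
    rw [ENNReal.toReal_pow, Measure.restrict_apply (measurableSet_binaryCell N c), Set.inter_comm]
  have hlim := hsq.const_mul (4 * r ^ 4)
  rw [mul_zero] at hlim
  rw [tendsto_iff_norm_sub_tendsto_zero]
  refine squeeze_zero' (.of_forall fun _ => norm_nonneg _) ?_ hlim
  filter_upwards [eventually_ge_atTop n] with N hN
  rw [hM.integral_cellMeasure_cylinderTest_levyTest hD hD', inter_binaryCell_eq_biUnion D hN b,
    hM.charInt_biUnion (fun c => hD.inter (measurableSet_binaryCell N c))
      (measure_inter_binaryCell_lt_top hD' N) (pairwise_disjoint_inter_binaryCell D N),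
    norm_sub_rev]
  refine (norm_prod_sub_exp_sum_le _ _ fun c => norm_charInt_le_one _ _).trans ?_
  rw [mul_assoc]
  refine mul_le_mul_of_nonneg_left ?_ (by norm_num)
  rw [Finset.mul_sum]
  refine (Finset.sum_le_sum_of_subset_of_nonneg (Finset.filter_subset _ _)
    fun _ _ _ => sq_nonneg _).trans (Finset.sum_le_sum fun c _ => ?_)
  have := hM.norm_charInt_sub_one_le (hD.inter (measurableSet_binaryCell N c))
    (measure_inter_binaryCell_lt_top hD' N c) r
  calc _ ≤ (r ^ 2 * (μ (D ∩ binaryCell Z N c)).toReal) ^ 2 := by gcongr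
    _ = _ := by ring

/-- The cell measures have constant mass on a compact space, so they converge along an ultrafilter.
Cylinder tests are continuous because cylinders are clopen; this is why space is coded in the Cantor
space. -/
theorem exists_limit_measure (hM : IsIndependentlyScattered P μ M)
    {D : Set Z} (hD : MeasurableSet D) (hD' : μ D < ∞) :
    ∃ q : FiniteMeasure ((ℕ → Bool) × CompactLine), ∀ (n : ℕ) (b : Fin n → Bool),
      ∫ x, cylinderTest b 1 x ∂(q : Measure ((ℕ → Bool) × CompactLine)) =
        ((μ (D ∩ binaryCell Z n b)).toReal : ℂ) ∧
      ∀ r, Complex.exp (∫ x, cylinderTest b (levyTest r) x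
        ∂(q : Measure ((ℕ → Bool) × CompactLine))) =
          charInt P (M (D ∩ binaryCell Z n b)) r := by
  let Q : ℕ → FiniteMeasure ((ℕ → Bool) × CompactLine) := fun N =>
    ⟨cellMeasure P M D N, hM.isFiniteMeasure_cellMeasure hD hD' N⟩
  have hone : ∀ (n N : ℕ) (b : Fin n → Bool), n ≤ N →
      ∫ x, cylinderTest b 1 x ∂(Q N : Measure ((ℕ → Bool) × CompactLine)) =
        ((μ (D ∩ binaryCell Z n b)).toReal : ℂ) := fun n N b hn =>
    hM.integral_cellMeasure_cylinderTest_one hD hD' hn b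
  have hmass : ∀ N, (Q N).mass = (μ D).toNNReal := by
    intro N
    have h := hone 0 N (fun i => i.elim0) (Nat.zero_le N)
    have h1 : ∀ x : (ℕ → Bool) × CompactLine,
        cylinderTest (fun i : Fin 0 => i.elim0) 1 x = 1 := by
      intro x
      rw [cylinderTest_apply, Set.indicator_of_mem (fun i => i.elim0)]
      simp
    have h2 : binaryCell Z 0 (fun i => i.elim0) = Set.univ :=
      Set.eq_univ_of_forall fun z i => i.elim0
    simp only [h1, h2, Set.inter_univ, integral_const, mul_one,
      Complex.real_smul] at h
    have h3 : ((Q N : Measure ((ℕ → Bool) × CompactLine)).real Set.univ) = (μ D).toReal := by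
      exact_mod_cast h
    apply NNReal.coe_injective
    exact h3
  have hcomp := isCompact_setOfPred_finiteMeasure_eq_of_compactSpace ((ℕ → Bool) × CompactLine)
    (μ D).toNNReal
  obtain ⟨q, -, hq⟩ := hcomp.ultrafilter_le_nhds ((hyperfilter ℕ).map Q) (by
    rw [le_principal_iff]
    exact Filter.mem_map.2 (Filter.univ_mem' hmass))
  have hq' : Tendsto Q (hyperfilter ℕ) (𝓝 q) := hq
  have hlim := (FiniteMeasure.tendsto_iff_forall_integral_rclike_tendsto ℂ).1 hq'
  have hle : (hyperfilter ℕ : Filter ℕ) ≤ atTop := by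
    rw [← Nat.cofinite_eq_atTop]; exact hyperfilter_le_cofinite
  refine ⟨q, fun n b => ⟨?_, fun r => ?_⟩⟩
  · refine tendsto_nhds_unique (hlim (cylinderTest b 1)) ?_
    refine tendsto_const_nhds.congr' ?_
    filter_upwards [hle (eventually_ge_atTop n)] with N hN
    exact (hone n N b hN).symm
  · refine tendsto_nhds_unique ((Complex.continuous_exp.tendsto _).comp
      (hlim (cylinderTest b (levyTest r)))) ?_
    exact (hM.tendsto_exp_integral_cellMeasure hD hD' b r).mono_left hle

/-- The first marginal of the limit is the image of the control measure under the coding map;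
disintegrating over it and pulling the conditional laws back gives the kernel. -/
theorem exists_limit_kernel (hM : IsIndependentlyScattered P μ M)
    {D : Set Z} (hD : MeasurableSet D) (hD' : μ D < ∞) :
    ∃ κ : Kernel Z CompactLine, IsMarkovKernel κ ∧ ∀ (n : ℕ) (b : Fin n → Bool) (r : ℝ),
      charInt P (M (D ∩ binaryCell Z n b)) r =
        Complex.exp (∫ z in D ∩ binaryCell Z n b, ∫ k, compactLevyQuotient r k ∂(κ z) ∂μ) := by
  obtain ⟨q, hq⟩ := hM.exists_limit_measure hD hD'
  have hfin : IsFiniteMeasure (μ.restrict D) := ⟨by simpa using hD'⟩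
  set Q : Measure ((ℕ → Bool) × CompactLine) := (q : Measure ((ℕ → Bool) × CompactLine)) with hQ
  have hne : Nonempty CompactLine := ⟨toCompactLine 0⟩
  have hmeas := MeasurableSpace.measurable_mapNatBool Z
  have hcyl : ∀ {n : ℕ} (b : Fin n → Bool), MeasurableSet (binaryCylinder b) := fun b =>
    (isClopen_binaryCylinder b).isOpen.measurableSet
  have hset : ∀ {n : ℕ} (b : Fin n → Bool) (G : C(CompactLine, ℂ)),
      ∫ x, cylinderTest b G x ∂Q = ∫ x in binaryCylinder b ×ˢ Set.univ, G x.2 ∂Q := by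
    intro n b G
    rw [← integral_indicator ((hcyl b).prod .univ)]
    refine integral_congr_ae (.of_forall fun x => ?_)
    by_cases h : x.1 ∈ binaryCylinder b
    · have h' : x ∈ binaryCylinder b ×ˢ (Set.univ : Set CompactLine) := ⟨h, trivial⟩
      simp [cylinderTest_apply, Set.indicator_of_mem h, Set.indicator_of_mem h']
    · have h' : x ∉ binaryCylinder b ×ˢ (Set.univ : Set CompactLine) := fun h1 => h h1.1
      simp [cylinderTest_apply, Set.indicator_of_notMem h, Set.indicator_of_notMem h']
  have hfst_cyl : ∀ {n : ℕ} (b : Fin n → Bool),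
      Q.fst (binaryCylinder b) = ((μ.restrict D).map (MeasurableSpace.mapNatBool Z))
        (binaryCylinder b) := by
    intro n b
    have h := (hq n b).1
    rw [hset] at h
    simp only [ContinuousMap.one_apply, integral_const, measureReal_restrict_apply_univ,
      Complex.real_smul, mul_one] at h
    have h1 : Q.real (binaryCylinder b ×ˢ Set.univ) = (μ (D ∩ binaryCell Z n b)).toReal := by
      exact_mod_cast h
    rw [Measure.fst_apply (hcyl b), Measure.map_apply hmeas (hcyl b), ← binaryCell_eq_preimage,
      Measure.restrict_apply (measurableSet_binaryCell n b), Set.inter_comm,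
      ← ENNReal.toReal_eq_toReal_iff' (measure_ne_top _ _)
        (measure_inter_binaryCell_lt_top hD' n b).ne, ← h1, Set.prod_univ]
    rfl
  have hfst : Q.fst = (μ.restrict D).map (MeasurableSpace.mapNatBool Z) := by
    refine ext_of_generate_finite _ generateFrom_binaryCylinder isPiSystem_binaryCylinder ?_ ?_
    · rintro _ ⟨n, b, rfl⟩
      exact hfst_cyl b
    · have h2 : (Set.univ : Set (ℕ → Bool)) = binaryCylinder (fun i : Fin 0 => i.elim0) :=
        (Set.eq_univ_of_forall fun z i => i.elim0).symm
      rw [h2]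
      exact hfst_cyl _
  refine ⟨Q.condKernel.comap _ hmeas, inferInstance, fun n b r => ?_⟩
  rw [← (hq n b).2 r, hset]
  congr 1
  have hint : Integrable (fun x : (ℕ → Bool) × CompactLine => levyTest r x.2) Q :=
    .of_bound ((levyTest r).continuous.comp continuous_snd).aestronglyMeasurable (r ^ 2)
      (.of_forall fun x => norm_compactLevyQuotient_le r x.2)
  rw [← Measure.setIntegral_condKernel_univ_right (hcyl b) hint.integrableOn, hfst,
    setIntegral_map (hcyl b) ?_ hmeas.aemeasurable, ← binaryCell_eq_preimage,
    Measure.restrict_restrict (measurableSet_binaryCell n b), Set.inter_comm]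
  · rfl
  · rw [← hfst]
    exact hint.aestronglyMeasurable.integral_condKernel

end IsIndependentlyScattered

end CellMeasure

/-! ### The Lévy exponent. -/

section Exponent

variable {Z : Type*} [MeasurableSpace Z] {μ : Measure Z} {σ2 : Z → ℝ≥0} {ρ : Kernel Z ℝ}

/-- The exponent `-r² σ²(z) / 2 + ∫ (exp(i r x) - 1 - i r x) ρ(z, dx)`. -/
def levyExponent (σ2 : Z → ℝ≥0) (ρ : Kernel Z ℝ) (r : ℝ) (z : Z) : ℂ :=
  -((r : ℂ) ^ 2 / 2 * ((σ2 z : ℝ) : ℂ)) + ∫ x : ℝ, levyFun r x ∂(ρ z)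

theorem measurable_levyExponent_left (hσ : Measurable σ2) (r : ℝ) :
    Measurable (levyExponent σ2 ρ r) := by
  have h1 : StronglyMeasurable fun z => ∫ x : ℝ, levyFun r x ∂(ρ z) :=
    (measurable_levyFun r).stronglyMeasurable.integral_kernel
  exact (Measurable.neg (by fun_prop)).add h1.measurable

theorem ofReal_sq_eq_enorm_sq (x : ℝ) : ENNReal.ofReal (x ^ 2) = ‖x ^ 2‖ₑ := by
  rw [Real.enorm_of_nonneg (sq_nonneg x)]

theorem integrable_sq_of_lintegral_lt_top {ν : Measure ℝ}
    (h : ∫⁻ x, ENNReal.ofReal (x ^ 2) ∂ν < ∞) : Integrable (fun x : ℝ => x ^ 2) ν := by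
  refine ⟨by fun_prop, ?_⟩
  rw [HasFiniteIntegral]
  simpa only [ofReal_sq_eq_enorm_sq] using h

theorem integrable_levyFun_of_lintegral_lt_top {ν : Measure ℝ}
    (h : ∫⁻ x, ENNReal.ofReal (x ^ 2) ∂ν < ∞) (r : ℝ) : Integrable (levyFun r) ν :=
  ((integrable_sq_of_lintegral_lt_top h).const_mul (r ^ 2)).mono'
    (measurable_levyFun r).aestronglyMeasurable (.of_forall fun _ => norm_levyFun_le _ _)

theorem integral_levyExponent (hσ : Measurable σ2) (hσB : ∫⁻ z, (σ2 z : ℝ≥0∞) ∂μ < ∞)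
    (hρ : ∫⁻ x, ENNReal.ofReal (x ^ 2) ∂(μ.bind ρ) < ∞) (r : ℝ) :
    Integrable (levyExponent σ2 ρ r) μ ∧
    ∫ z, levyExponent σ2 ρ r z ∂μ =
      -(((∫⁻ z, (σ2 z : ℝ≥0∞) ∂μ).toReal : ℂ) * r ^ 2 / 2) + ∫ x, levyFun r x ∂(μ.bind ρ) := by
  have hi := integrable_levyFun_of_lintegral_lt_top hρ r
  rw [Measure.comp_eq_comp_const_apply] at hi
  have hi2 : Integrable (fun z => ∫ x, levyFun r x ∂(ρ z)) μ := hi.integral_comp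
  have hσi : Integrable (fun z => (σ2 z : ℝ)) μ := by
    refine ⟨by fun_prop, ?_⟩
    rw [HasFiniteIntegral]
    simpa using hσB
  have hσi2 : Integrable (fun z => -((r : ℂ) ^ 2 / 2 * ((σ2 z : ℝ) : ℂ))) μ :=
    (hσi.ofReal.const_mul _).neg
  refine ⟨hσi2.add hi2, ?_⟩
  unfold levyExponent
  rw [integral_add hσi2 hi2, integral_neg, integral_const_mul, integral_complex_ofReal,
    Measure.comp_eq_comp_const_apply, Kernel.integral_comp hi, Kernel.const_apply]
  congr 2
  have : ∫ z, (σ2 z : ℝ) ∂μ = (∫⁻ z, (σ2 z : ℝ≥0∞) ∂μ).toReal := by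
    rw [integral_eq_lintegral_of_nonneg_ae (.of_forall fun z => (σ2 z).coe_nonneg) hσi.1]
    simp
  rw [this]
  ring

end Exponent

/-! ### From kernels on the compactified line to local characteristics. -/

section CompactKernel

variable {Z : Type*} [MeasurableSpace Z] {μ : Measure Z} (κ : Kernel Z CompactLine)
  [IsMarkovKernel κ]

/-- The part of the compactified line that corresponds to the punctured line. -/
def puncturedLine : Set CompactLine := {k | k.1 ≠ 0 ∧ |k.1| < 1}

theorem measurableSet_puncturedLine : MeasurableSet puncturedLine := by
  have h1 : MeasurableSet {k : CompactLine | k.1 ≠ 0} :=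
    (isOpen_ne_fun continuous_subtype_val continuous_const).measurableSet
  have h2 : MeasurableSet {k : CompactLine | |k.1| < 1} :=
    measurableSet_lt (by fun_prop) measurable_const
  exact h1.inter h2

theorem measurableSet_zeroCompactLine : MeasurableSet {k : CompactLine | k.1 = 0} :=
  (isClosed_eq continuous_subtype_val continuous_const).measurableSet

/-- The Gaussian variance carried by the origin of the compactified line. -/
def compactVariance (z : Z) : ℝ≥0 := (κ z {k : CompactLine | k.1 = 0}).toNNReal

/-- The Lévy measures with density `x⁻²` with respect to the trace on the punctured line. -/
def compactLevyKernel : Kernel Z ℝ :=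
  ((κ.restrict measurableSet_puncturedLine).map ofCompactLine).withDensity
    fun _ x => ((Real.toNNReal (x ^ 2)⁻¹ : ℝ≥0) : ℝ≥0∞)

theorem measurable_compactVariance : Measurable (compactVariance κ) :=
  (κ.measurable_coe measurableSet_zeroCompactLine).ennreal_toNNReal

theorem lintegral_compactLevyKernel {g : ℝ → ℝ≥0∞} (hg : Measurable g) (z : Z) :
    ∫⁻ x, g x ∂(compactLevyKernel κ z) = ∫⁻ k in puncturedLine,
      ((Real.toNNReal (ofCompactLine k ^ 2)⁻¹ : ℝ≥0) : ℝ≥0∞) * g (ofCompactLine k) ∂(κ z) := by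
  have hm : Measurable fun x : ℝ => ((Real.toNNReal (x ^ 2)⁻¹ : ℝ≥0) : ℝ≥0∞) := by fun_prop
  have hu : Measurable (Function.uncurry fun (_ : Z) (x : ℝ) =>
      ((Real.toNNReal (x ^ 2)⁻¹ : ℝ≥0) : ℝ≥0∞)) := hm.comp measurable_snd
  rw [compactLevyKernel, Kernel.lintegral_withDensity _ hu z hg,
    Kernel.map_apply _ measurable_ofCompactLine, Kernel.restrict_apply,
    lintegral_map (f := fun x => ((Real.toNNReal (x ^ 2)⁻¹ : ℝ≥0) : ℝ≥0∞) * g x) (hm.mul hg)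
      measurable_ofCompactLine]

theorem ofCompactLine_ne_zero {k : CompactLine} (hk : k ∈ puncturedLine) :
    ofCompactLine k ≠ 0 := div_ne_zero hk.1 (by have := hk.2; linarith)

theorem lintegral_sq_compactLevyKernel_le (z : Z) :
    ∫⁻ x, ENNReal.ofReal (x ^ 2) ∂(compactLevyKernel κ z) ≤ 1 := by
  rw [lintegral_compactLevyKernel κ (by fun_prop)]
  calc _ = ∫⁻ k in puncturedLine, 1 ∂(κ z) := by
        refine setLIntegral_congr_fun measurableSet_puncturedLine fun k hk => ?_
        have h1 : (ofCompactLine k) ^ 2 ≠ 0 := pow_ne_zero _ (ofCompactLine_ne_zero hk)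
        show ENNReal.ofReal _ * ENNReal.ofReal _ = 1
        rw [← ENNReal.ofReal_mul (by positivity), inv_mul_cancel₀ h1, ENNReal.ofReal_one]
    _ ≤ 1 := by
        rw [setLIntegral_one]
        exact prob_le_one

theorem compactLevyKernel_zero (z : Z) : compactLevyKernel κ z {0} = 0 := by
  rw [← lintegral_indicator_one (measurableSet_singleton (0 : ℝ)),
    lintegral_compactLevyKernel κ (measurable_one.indicator (measurableSet_singleton 0))]
  refine (setLIntegral_congr_fun (g := 0) measurableSet_puncturedLine fun k hk => ?_).trans (by simp)
  simp [ofCompactLine_ne_zero hk]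

theorem compactVariance_le_one (z : Z) : (compactVariance κ z : ℝ≥0∞) ≤ 1 := by
  rw [compactVariance, ENNReal.coe_toNNReal (measure_ne_top _ _)]
  exact prob_le_one

/-- At the origin the quotient is -r²/2, giving the Gaussian part; on the punctured line the density
x⁻² restores the compensated exponential; the two points at infinity contribute nothing because the
quotient vanishes there. -/
theorem levyExponent_compact (r : ℝ) (z : Z) :
    levyExponent (compactVariance κ) (compactLevyKernel κ) r z =
      ∫ k, compactLevyQuotient r k ∂(κ z) := by
  have hsplit : ∀ k : CompactLine, compactLevyQuotient r k =
      {k : CompactLine | k.1 = 0}.indicator (fun _ => -((r : ℂ) ^ 2 / 2)) k +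
        puncturedLine.indicator (fun k => levyQuotient r (ofCompactLine k)) k := by
    intro k
    by_cases h0 : k.1 = 0
    · have h1 : k ∉ puncturedLine := fun h => h.1 h0
      rw [Set.indicator_of_mem (show k ∈ {k : CompactLine | k.1 = 0} from h0),
        Set.indicator_of_notMem h1, compactLevyQuotient, if_pos (by simp [h0]), ofCompactLine, h0,
        zero_div, levyQuotient, if_pos rfl, add_zero]
    · rw [Set.indicator_of_notMem (show k ∉ {k : CompactLine | k.1 = 0} from h0), zero_add,
        compactLevyQuotient]
      by_cases h1 : |k.1| < 1
      · rw [if_pos h1, Set.indicator_of_mem (show k ∈ puncturedLine from ⟨h0, h1⟩)]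
      · rw [if_neg h1, Set.indicator_of_notMem fun h : k ∈ puncturedLine => h1 h.2]
  have hm : Measurable fun k : CompactLine => levyQuotient r (ofCompactLine k) :=
    (continuous_levyQuotient r).measurable.comp measurable_ofCompactLine
  have hi1 : Integrable (fun k => {k : CompactLine | k.1 = 0}.indicator
      (fun _ => -((r : ℂ) ^ 2 / 2)) k) (κ z) :=
    (integrable_const _).indicator measurableSet_zeroCompactLine
  have hi2 : Integrable (fun k => puncturedLine.indicator
      (fun k => levyQuotient r (ofCompactLine k)) k) (κ z) :=
    Integrable.indicator (.of_bound hm.aestronglyMeasurable (r ^ 2)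
      (.of_forall fun k => norm_levyQuotient_le r _)) measurableSet_puncturedLine
  simp only [hsplit]
  rw [integral_add hi1 hi2, integral_indicator_const _ measurableSet_zeroCompactLine,
    integral_indicator measurableSet_puncturedLine, levyExponent]
  congr 1
  · rw [compactVariance, Measure.real, Complex.real_smul]
    have : ((κ z {k : CompactLine | k.1 = 0}).toNNReal : ℝ) =
      (κ z {k : CompactLine | k.1 = 0}).toReal := rfl
    rw [this]
    ring
  · rw [compactLevyKernel, Kernel.integral_withDensity (g := fun _ x => Real.toNNReal (x ^ 2)⁻¹)
      (by unfold Function.uncurry; fun_prop), Kernel.map_apply _ measurable_ofCompactLine,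
      Kernel.restrict_apply, integral_map measurable_ofCompactLine.aemeasurable
      (Measurable.aestronglyMeasurable (by have := measurable_levyFun r; fun_prop))]
    refine setIntegral_congr_fun measurableSet_puncturedLine fun k hk => ?_
    have h1 := ofCompactLine_ne_zero hk
    have h2 : (ofCompactLine k : ℂ) ≠ 0 := by exact_mod_cast h1
    simp only [NNReal.smul_def, Complex.real_smul]
    rw [Real.coe_toNNReal _ (by positivity), levyQuotient, if_neg h1]
    push_cast
    field_simp

end CompactKernel

/-! ### Extension from cells to all sets of finite measure. -/

namespace IsIndependentlyScattered

variable {Ω Z : Type*} [MeasurableSpace Ω] [mZ : MeasurableSpace Z]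
  {P : Measure Ω} [IsProbabilityMeasure P] {μ : Measure Z} {M : Set Z → Ω → ℝ}

theorem integral_sub_sq (hM : IsIndependentlyScattered P μ M) {A B : Set Z}
    (hA : MeasurableSet A) (hB : MeasurableSet B) (hB' : μ B < ∞) (hAB : A ⊆ B) :
    ∫ ω, (M B ω - M A ω) ^ 2 ∂P = (μ (B \ A)).toReal := by
  have hA' : μ A < ∞ := (measure_mono hAB).trans_lt hB'
  have hd : μ (B \ A) < ∞ := (measure_mono Set.sdiff_subset).trans_lt hB'
  rw [← hM.eLpNorm_sq (hB.diff hA) hd]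
  have h := hM.ae_union hA hA' (hB.diff hA) hd Set.disjoint_sdiff_right
  rw [Set.union_sdiff_cancel hAB] at h
  refine integral_congr_ae ?_
  filter_upwards [h] with ω hω
  rw [hω]
  ring

theorem norm_charInt_sub_le (hM : IsIndependentlyScattered P μ M) {A B : Set Z}
    (hA : MeasurableSet A) (hB : MeasurableSet B) (hB' : μ B < ∞) (hAB : A ⊆ B) (r : ℝ) :
    ‖charInt P (M B) r - charInt P (M A) r‖ ≤ |r| * √(μ (B \ A)).toReal := by
  have hA' : μ A < ∞ := (measure_mono hAB).trans_lt hB'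
  rw [← hM.integral_sub_sq hA hB hB' hAB]
  exact _root_.norm_charInt_sub_le (hM.memLp B hB hB') (hM.memLp A hA hA')
    (hM.measurable B hB hB') (hM.measurable A hA hA') r

/-- Finite unions are handled by independence. For the limit, the L² distance between M of the union
and of a partial union is the root of the missing measure. -/
theorem charInt_iUnion (hM : IsIndependentlyScattered P μ M) {A : ℕ → Set Z}
    (hA : ∀ i, MeasurableSet (A i)) (hd : Pairwise fun i j => Disjoint (A i) (A j))
    (hU : μ (⋃ i, A i) < ∞) {G : Z → ℂ} (hG : IntegrableOn G (⋃ i, A i) μ) (r : ℝ)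
    (h : ∀ i, charInt P (M (A i)) r = Complex.exp (∫ z in A i, G z ∂μ)) :
    charInt P (M (⋃ i, A i)) r = Complex.exp (∫ z in ⋃ i, A i, G z ∂μ) := by
  set S : ℕ → Set Z := fun N => ⋃ i ∈ Finset.range N, A i with hS
  have hsub : ∀ N, S N ⊆ ⋃ i, A i := fun N =>
    Set.iUnion₂_subset fun i _ => Set.subset_iUnion A i
  have hSm : ∀ N, MeasurableSet (S N) := fun N =>
    Finset.measurableSet_biUnion _ fun i _ => hA i
  have hfin : ∀ i, μ (A i) < ∞ := fun i => (measure_mono (Set.subset_iUnion A i)).trans_lt hU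
  have hSfin : ∀ N, μ (S N) < ∞ := fun N => (measure_mono (hsub N)).trans_lt hU
  have hmono : Monotone S := fun N K hNK => Set.biUnion_subset_biUnion_left fun i hi =>
    Finset.mem_range.2 ((Finset.mem_range.1 hi).trans_le hNK)
  have hSU : ⋃ N, S N = ⋃ i, A i := by
    refine Set.Subset.antisymm (Set.iUnion_subset hsub) (Set.iUnion_subset fun i => ?_)
    exact Set.subset_iUnion_of_subset (i + 1)
      (Set.subset_biUnion_of_mem (u := A) (Finset.mem_coe.2 (Finset.mem_range.2 i.lt_succ_self)))
  have hgood : ∀ N, charInt P (M (S N)) r = Complex.exp (∫ z in S N, G z ∂μ) := by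
    intro N
    induction N with
    | zero =>
      have h0 : S 0 = ∅ := by simp [hS]
      rw [h0, charInt_congr hM.ae_empty]
      simp [charInt]
    | succ N ih =>
      have hsucc : S (N + 1) = S N ∪ A N := by
        simp only [hS, Finset.range_add_one, Finset.set_biUnion_insert]
        rw [Set.union_comm]
      have hdis : Disjoint (S N) (A N) := by
        simp only [hS, Set.disjoint_iUnion_left]
        exact fun i hi => hd (Finset.mem_range.1 hi).ne
      rw [hsucc, hM.charInt_union (hSm N) (hSfin N) (hA N) (hfin N) hdis, ih, h N,
        ← Complex.exp_add, setIntegral_union hdis (hA N) (hG.mono_set (hsub N))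
          (hG.mono_set (Set.subset_iUnion A N))]
  have h1 : Tendsto (fun N => charInt P (M (S N)) r) atTop (𝓝 (charInt P (M (⋃ i, A i)) r)) := by
    rw [tendsto_iff_norm_sub_tendsto_zero]
    have h2 : Tendsto (fun N => μ ((⋃ i, A i) \ S N)) atTop (𝓝 0) := by
      have h3 := tendsto_measure_iInter_atTop (μ := μ) (s := fun N => (⋃ i, A i) \ S N)
        (fun N => ((MeasurableSet.iUnion hA).diff (hSm N)).nullMeasurableSet)
        (fun N K hNK => Set.sdiff_subset_sdiff_right (hmono hNK))
        ⟨0, ((measure_mono Set.sdiff_subset).trans_lt hU).ne⟩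
      have h4 : ⋂ N, (⋃ i, A i) \ S N = ∅ := by
        rw [← Set.sdiff_iUnion, hSU, Set.sdiff_self]
      rwa [h4, measure_empty] at h3
    have h5 : Tendsto (fun N => |r| * √(μ ((⋃ i, A i) \ S N)).toReal) atTop (𝓝 (|r| * √0)) :=
      ((Real.continuous_sqrt.tendsto 0).comp
        ((ENNReal.tendsto_toReal ENNReal.zero_ne_top).comp h2)).const_mul _
    rw [Real.sqrt_zero, mul_zero] at h5
    refine squeeze_zero (fun _ => norm_nonneg _) (fun N => ?_) h5
    rw [norm_sub_rev]
    exact hM.norm_charInt_sub_le (hSm N) (MeasurableSet.iUnion hA) hU (hsub N) r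
  have h6 := tendsto_setIntegral_of_monotone (μ := μ) (f := G) hSm hmono (by rwa [hSU])
  rw [hSU] at h6
  refine tendsto_nhds_unique h1 (((Complex.continuous_exp.tendsto _).comp h6).congr fun N => ?_)
  exact (hgood N).symm

variable [MeasurableSpace.CountablyGenerated Z] [MeasurableSpace.SeparatesPoints Z]
  [NullSingletonClass μ]

/-- A π-λ argument. The complement step divides by an exponential, which is never zero. -/
theorem charInt_inter_of_binaryCell (hM : IsIndependentlyScattered P μ M) {D : Set Z}
    (hD : MeasurableSet D) (hD' : μ D < ∞) {G : Z → ℂ} (hG : IntegrableOn G D μ) (r : ℝ)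
    (h : ∀ (n : ℕ) (b : Fin n → Bool), charInt P (M (D ∩ binaryCell Z n b)) r =
      Complex.exp (∫ z in D ∩ binaryCell Z n b, G z ∂μ)) {B : Set Z} (hB : MeasurableSet B) :
    charInt P (M (D ∩ B)) r = Complex.exp (∫ z in D ∩ B, G z ∂μ) := by
  have hfin : ∀ B, μ (D ∩ B) < ∞ := fun B => (measure_mono Set.inter_subset_left).trans_lt hD'
  refine MeasurableSpace.induction_on_inter (C := fun B _ => charInt P (M (D ∩ B)) r =
    Complex.exp (∫ z in D ∩ B, G z ∂μ)) generateFrom_binaryCell isPiSystem_binaryCell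
    ?_ ?_ ?_ ?_ B hB
  · rw [Set.inter_empty, charInt_congr hM.ae_empty]
    simp [charInt]
  · rintro B ⟨n, b, rfl⟩
    exact h n b
  · intro B hB ih
    have h0 : charInt P (M D) r = Complex.exp (∫ z in D, G z ∂μ) := by
      have h1 := h 0 fun i => i.elim0
      rwa [show binaryCell Z 0 (fun i => i.elim0) = Set.univ from
        Set.eq_univ_of_forall fun z i => i.elim0, Set.inter_univ] at h1
    have hdis : Disjoint (D ∩ B) (D ∩ Bᶜ) :=
      (disjoint_compl_right).mono Set.inter_subset_right Set.inter_subset_right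
    have hun : D ∩ B ∪ D ∩ Bᶜ = D := by rw [← Set.inter_union_distrib_left]; simp
    have h2 := hM.charInt_union (hD.inter hB) (hfin B) (hD.inter hB.compl) (hfin Bᶜ) hdis r
    have h3 := setIntegral_union hdis (hD.inter hB.compl) (hG.mono_set Set.inter_subset_left)
      (hG.mono_set Set.inter_subset_left)
    rw [hun] at h2 h3
    rw [h0, ih, h3, Complex.exp_add] at h2
    exact (mul_left_cancel₀ (Complex.exp_ne_zero _) h2).symm
  · intro f hd hf ih
    rw [Set.inter_iUnion]
    refine hM.charInt_iUnion (fun i => hD.inter (hf i)) (fun i j hij => ?_) ?_ ?_ r ih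
    · exact (hd hij).mono Set.inter_subset_right Set.inter_subset_right
    · rw [← Set.inter_iUnion]; exact hfin _
    · rw [← Set.inter_iUnion]; exact hG.mono_set Set.inter_subset_left

/-- Countably many disjoint pieces of finite measure each have a kernel; the kernel used at z is
that of the piece containing z. -/
theorem exists_compact_kernel [SigmaFinite μ] (hM : IsIndependentlyScattered P μ M) :
    ∃ κ : Kernel Z CompactLine, IsMarkovKernel κ ∧ ∀ B, MeasurableSet B → μ B < ∞ → ∀ r,
      charInt P (M B) r = Complex.exp (∫ z in B, ∫ k, compactLevyQuotient r k ∂(κ z) ∂μ) := by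
  set D : ℕ → Set Z := fun j => spanningSetsIndex μ ⁻¹' {j} with hDdef
  have hDm : ∀ j, MeasurableSet (D j) := fun j =>
    measurableSet_spanningSetsIndex μ (measurableSet_singleton j)
  have hDfin : ∀ j, μ (D j) < ∞ := fun j => by
    simp only [hDdef, preimage_spanningSetsIndex_singleton]
    exact (measure_mono (disjointed_subset _ _)).trans_lt (measure_spanningSets_lt_top μ j)
  choose κ hκ hκc using fun j => hM.exists_limit_kernel (hDm j) (hDfin j)
  have hmeas : Measurable fun z => κ (spanningSetsIndex μ z) z := by
    have h1 : Measurable fun p : Z × ℕ => κ p.2 p.1 :=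
      measurable_from_prod_countable_left fun j => (κ j).measurable
    exact h1.comp (measurable_id.prodMk (measurableSet_spanningSetsIndex μ))
  refine ⟨⟨fun z => κ (spanningSetsIndex μ z) z, hmeas⟩,
    ⟨fun z => (hκ (spanningSetsIndex μ z)).isProbabilityMeasure z⟩, fun B hB hB' r => ?_⟩
  set κ' : Kernel Z CompactLine := ⟨fun z => κ (spanningSetsIndex μ z) z, hmeas⟩ with hκ'
  have hbound : ∀ (η : Kernel Z CompactLine), IsMarkovKernel η → ∀ z,
      ‖∫ k, compactLevyQuotient r k ∂(η z)‖ ≤ r ^ 2 := fun η hη z => by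
    refine (norm_integral_le_of_norm_le_const (C := r ^ 2)
      (.of_forall fun k => norm_compactLevyQuotient_le r k)).trans ?_
    simp
  have hGm : ∀ η : Kernel Z CompactLine,
      StronglyMeasurable fun z => ∫ k, compactLevyQuotient r k ∂(η z) := fun η =>
    (continuous_compactLevyQuotient r).stronglyMeasurable.integral_kernel
  have hint : ∀ (η : Kernel Z CompactLine), IsMarkovKernel η → ∀ C, μ C < ∞ →
      IntegrableOn (fun z => ∫ k, compactLevyQuotient r k ∂(η z)) C μ := fun η hη C hC =>
    Measure.integrableOn_of_bounded hC.ne (hGm η).aestronglyMeasurable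
      (.of_forall fun z => hbound η hη z)
  have hκm : IsMarkovKernel κ' := ⟨fun z => (hκ (spanningSetsIndex μ z)).isProbabilityMeasure z⟩
  have hBU : B = ⋃ j, D j ∩ B := by
    rw [← Set.iUnion_inter]
    have : ⋃ j, D j = Set.univ := Set.eq_univ_of_forall fun z => Set.mem_iUnion.2 ⟨_, rfl⟩
    rw [this, Set.univ_inter]
  have hgoal := hM.charInt_iUnion (A := fun j => D j ∩ B)
    (G := fun z => ∫ k, compactLevyQuotient r k ∂(κ' z)) (fun j => (hDm j).inter hB)
    (fun i j hij => ?_) (by rwa [← hBU]) (by rw [← hBU]; exact hint κ' hκm B hB') r fun j => ?_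
  · rwa [← hBU] at hgoal
  · refine Set.disjoint_left.2 fun z hz hz' => hij ?_
    exact hz.1.symm.trans hz'.1
  · rw [hM.charInt_inter_of_binaryCell (hDm j) (hDfin j)
      (hint (κ j) (hκ j) (D j) (hDfin j)) r (fun n b => hκc j n b r) hB]
    congr 1
    refine setIntegral_congr_fun ((hDm j).inter hB) fun z hz => ?_
    have hz1 : spanningSetsIndex μ z = j := hz.1
    simp only [hκ', Kernel.coe_mk, hz1]

/-- This rules out the default value in `localCharacteristics`. All integrability conditions follow
from the kernel being a probability, which bounds the variance and the second moment by one. -/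
theorem exists_isLocalCharacteristics [SigmaFinite μ] (hM : IsIndependentlyScattered P μ M) :
    ∃ p : (Z → ℝ≥0) × Kernel Z ℝ, IsLocalCharacteristics P μ M p.1 p.2 := by
  obtain ⟨κ, hκ, hκc⟩ := hM.exists_compact_kernel
  refine ⟨(compactVariance κ, compactLevyKernel κ), measurable_compactVariance κ,
    compactLevyKernel_zero κ,
    fun z => (lintegral_sq_compactLevyKernel_le κ z).trans_lt ENNReal.one_lt_top,
    fun B hB hB' => ?_⟩
  have hvar : ∫⁻ z in B, (compactVariance κ z : ℝ≥0∞) ∂μ < ∞ := by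
    refine (lintegral_mono fun z => compactVariance_le_one κ z).trans_lt ?_
    rwa [setLIntegral_one]
  have hsq : ∫⁻ x, ENNReal.ofReal (x ^ 2) ∂((μ.restrict B).bind (compactLevyKernel κ)) < ∞ := by
    rw [Measure.lintegral_bind (Kernel.aemeasurable _) (by fun_prop)]
    refine (lintegral_mono fun z => lintegral_sq_compactLevyKernel_le κ z).trans_lt ?_
    rwa [setLIntegral_one]
  refine ⟨hvar, ?_, ?_, (setLIntegral_le_lintegral _ _).trans_lt hsq, fun r => ?_⟩
  · rw [Measure.bind_apply (measurableSet_singleton 0) (Kernel.aemeasurable _)]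
    simp [compactLevyKernel_zero]
  · exact (lintegral_mono fun x => ENNReal.ofReal_le_ofReal (min_le_left _ _)).trans_lt hsq
  · refine (hκc B hB hB' r).trans ?_
    congr 1
    rw [← (integral_congr_ae (.of_forall fun z => levyExponent_compact κ r z)),
      (integral_levyExponent (measurable_compactVariance κ) hvar hsq r).2]
    rfl

end IsIndependentlyScattered

/-- With the roles exchanged, `levyQuotient` describes division by the squared frequency near
frequency zero. -/
theorem levyFun_comm (r x : ℝ) : levyFun r x = levyFun x r := by
  simp only [levyFun, mul_assoc, mul_comm (r : ℂ)]

/-! ### Bounds for the Lévy exponent by its second moment. -/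

section ExponentBounds

variable {Z : Type*} [MeasurableSpace Z] {μ : Measure Z} {σ2 : Z → ℝ≥0} {ρ : Kernel Z ℝ}

/-- The total second moment `σ²(z) + ∫ x² ρ(z, dx)`. -/
def levyVariance (σ2 : Z → ℝ≥0) (ρ : Kernel Z ℝ) (z : Z) : ℝ≥0∞ :=
  σ2 z + ∫⁻ x, ENNReal.ofReal (x ^ 2) ∂(ρ z)

theorem measurable_levyVariance (hσ : Measurable σ2) : Measurable (levyVariance σ2 ρ) :=
  hσ.coe_nnreal_ennreal.add (Measurable.lintegral_kernel (by fun_prop))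

theorem levyExponent_re_nonpos (r : ℝ) (z : Z) : (levyExponent σ2 ρ r z).re ≤ 0 := by
  have h1 : (∫ x : ℝ, levyFun r x ∂(ρ z)).re ≤ 0 := by
    by_cases hi : Integrable (levyFun r) (ρ z)
    · have h2 := integral_re hi
      rw [show (∫ x : ℝ, levyFun r x ∂(ρ z)).re = RCLike.re (∫ x : ℝ, levyFun r x ∂(ρ z)) from rfl,
        ← h2]
      exact integral_nonpos fun x => levyFun_re_nonpos r x
    · rw [integral_undef hi]; simp
  have h3 : (-((r : ℂ) ^ 2 / 2 * ((σ2 z : ℝ) : ℂ))).re = -(r ^ 2 / 2 * (σ2 z : ℝ)) := by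
    rw [show -((r : ℂ) ^ 2 / 2 * ((σ2 z : ℝ) : ℂ)) = ((-(r ^ 2 / 2 * (σ2 z : ℝ)) : ℝ) : ℂ) by
      push_cast; ring]
    exact Complex.ofReal_re _
  rw [levyExponent, Complex.add_re, h3]
  have := mul_nonneg (by positivity : 0 ≤ r ^ 2 / 2) (σ2 z).coe_nonneg
  linarith

@[simp] theorem levyExponent_zero (z : Z) : levyExponent σ2 ρ 0 z = 0 := by
  simp [levyExponent]

theorem norm_levyExponent_sub_le (z : Z) (hz : ∫⁻ x, ENNReal.ofReal (x ^ 2) ∂(ρ z) < ∞)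
    (r s : ℝ) : ‖levyExponent σ2 ρ r z - levyExponent σ2 ρ s z‖ ≤
      max |r| |s| * |r - s| * (levyVariance σ2 ρ z).toReal := by
  have hsq := integrable_sq_of_lintegral_lt_top hz
  have hr := integrable_levyFun_of_lintegral_lt_top hz r
  have hs := integrable_levyFun_of_lintegral_lt_top hz s
  have h1 : levyExponent σ2 ρ r z - levyExponent σ2 ρ s z =
      ((-((r ^ 2 - s ^ 2) / 2 * (σ2 z : ℝ)) : ℝ) : ℂ) + ∫ x, (levyFun r x - levyFun s x) ∂(ρ z) := by
    rw [integral_sub hr hs, levyExponent, levyExponent]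
    push_cast
    ring
  have h2 : ‖∫ x, (levyFun r x - levyFun s x) ∂(ρ z)‖ ≤
      max |r| |s| * |r - s| * ∫ x, x ^ 2 ∂(ρ z) := by
    rw [← integral_const_mul]
    exact norm_integral_le_of_norm_le (hsq.const_mul _)
      (.of_forall fun x => norm_levyFun_sub_le r s x)
  have h3 : |(r ^ 2 - s ^ 2) / 2| ≤ max |r| |s| * |r - s| := by
    rw [show (r ^ 2 - s ^ 2) / 2 = (r + s) / 2 * (r - s) by ring, abs_mul]
    refine mul_le_mul_of_nonneg_right ?_ (abs_nonneg _)
    rw [abs_div, abs_two, div_le_iff₀ two_pos]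
    have := abs_add_le r s
    have h4 := le_max_left |r| |s|
    have h5 := le_max_right |r| |s|
    linarith
  have h6 : (levyVariance σ2 ρ z).toReal = (σ2 z : ℝ) + ∫ x, x ^ 2 ∂(ρ z) := by
    rw [levyVariance, ENNReal.toReal_add ENNReal.coe_ne_top hz.ne,
      integral_eq_lintegral_of_nonneg_ae (.of_forall fun x => sq_nonneg x) hsq.1]
    rfl
  rw [h1, h6, mul_add]
  refine (norm_add_le _ _).trans (add_le_add ?_ h2)
  rw [Complex.norm_real, norm_neg, norm_mul, Real.norm_eq_abs, Real.norm_eq_abs,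
    abs_of_nonneg (σ2 z).coe_nonneg]
  exact mul_le_mul_of_nonneg_right h3 (σ2 z).coe_nonneg

end ExponentBounds

/-! ### Consequences of the Lévy–Khintchine representation. -/

namespace IsLocalCharacteristics

variable {Ω Z : Type*} [MeasurableSpace Ω] [mZ : MeasurableSpace Z]
  {P : Measure Ω} [IsProbabilityMeasure P] {μ : Measure Z} {M : Set Z → Ω → ℝ}
  {σ2 : Z → ℝ≥0} {ρ : Kernel Z ℝ}

theorem lintegral_sq_bind_lt_top (h : IsLocalCharacteristics P μ M σ2 ρ) {B : Set Z}
    (hB : MeasurableSet B) (hB' : μ B < ∞) :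
    ∫⁻ x, ENNReal.ofReal (x ^ 2) ∂((μ.restrict B).bind ρ) < ∞ := by
  obtain ⟨-, -, h1, h2, -⟩ := h.pair B hB hB'
  have hm : MeasurableSet {x : ℝ | 1 ≤ |x|} := measurableSet_le measurable_const (by fun_prop)
  rw [← lintegral_add_compl _ hm]
  refine ENNReal.add_lt_top.2 ⟨h2, lt_of_le_of_lt ?_ h1⟩
  refine (setLIntegral_mono_ae (by fun_prop) (.of_forall fun x hx => ?_)).trans
    (setLIntegral_le_lintegral _ _)
  have hx' : |x| < 1 := not_le.1 hx
  have : x ^ 2 ≤ 1 := by rw [← sq_abs]; nlinarith [abs_nonneg x]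
  rw [min_eq_left this]

theorem integrableOn_levyExponent (h : IsLocalCharacteristics P μ M σ2 ρ) {B : Set Z}
    (hB : MeasurableSet B) (hB' : μ B < ∞) (r : ℝ) : IntegrableOn (levyExponent σ2 ρ r) B μ :=
  (integral_levyExponent h.measurable (h.pair B hB hB').1
    (h.lintegral_sq_bind_lt_top hB hB') r).1

theorem charInt_eq (h : IsLocalCharacteristics P μ M σ2 ρ) {B : Set Z}
    (hB : MeasurableSet B) (hB' : μ B < ∞) (r : ℝ) :
    charInt P (M B) r = Complex.exp (∫ z in B, levyExponent σ2 ρ r z ∂μ) := by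
  rw [(integral_levyExponent h.measurable (h.pair B hB hB').1
    (h.lintegral_sq_bind_lt_top hB hB') r).2]
  exact (h.pair B hB hB').2.2.2.2 r

variable [MeasurableSpace.CountablyGenerated Z] [MeasurableSpace.SeparatesPoints Z]
  [NullSingletonClass μ]

/-- The characteristics are an arbitrary choice, so their size is read off the characteristic
function near zero. If ψ is the exponent over B and C its second moment, ψ(r)/r² tends to -C/2,
while |exp ψ(r) - 1| ≤ r² μ(B) and ψ is quadratic. Hence C/2 ≤ μ(B); the factor 2 is not optimal but
harmless. -/
theorem setLIntegral_levyVariance_le (h : IsLocalCharacteristics P μ M σ2 ρ)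
    (hM : IsIndependentlyScattered P μ M) {B : Set Z} (hB : MeasurableSet B) (hB' : μ B < ∞) :
    ∫⁻ z in B, levyVariance σ2 ρ z ∂μ ≤ ∫⁻ _ in B, 2 ∂μ := by
  set c : ℝ≥0∞ := ∫⁻ z in B, (σ2 z : ℝ≥0∞) ∂μ with hc
  set ν : Measure ℝ := (μ.restrict B).bind ρ with hν
  have hc' : c < ∞ := (h.pair B hB hB').1
  have hν' := h.lintegral_sq_bind_lt_top hB hB'
  have hsq := integrable_sq_of_lintegral_lt_top hν'
  have hψ : ∀ r, ∫ z in B, levyExponent σ2 ρ r z ∂μ =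
      -((c.toReal : ℂ) * r ^ 2 / 2) + ∫ x, levyFun r x ∂ν := fun r =>
    (integral_levyExponent h.measurable hc' hν' r).2
  set ψ : ℝ → ℂ := fun r => ∫ z in B, levyExponent σ2 ρ r z ∂μ with hψdef
  set C : ℝ := c.toReal + ∫ x, x ^ 2 ∂ν with hC
  have hC0 : 0 ≤ C := add_nonneg ENNReal.toReal_nonneg (integral_nonneg fun x => sq_nonneg x)
  have hre : ∀ r, (ψ r).re ≤ 0 := by
    intro r
    have h2 := integral_re (h.integrableOn_levyExponent hB hB' r)
    rw [show (ψ r).re = RCLike.re (ψ r) from rfl, ← h2]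
    exact integral_nonpos fun x => levyExponent_re_nonpos r x
  have hψle : ∀ r, ‖ψ r‖ ≤ r ^ 2 * C := by
    intro r
    simp only [hψdef, hψ]
    have h1 : ‖∫ x, levyFun r x ∂ν‖ ≤ r ^ 2 * ∫ x, x ^ 2 ∂ν := by
      rw [← integral_const_mul]
      exact norm_integral_le_of_norm_le (hsq.const_mul _) (.of_forall fun x => norm_levyFun_le r x)
    have h2 : ‖-((c.toReal : ℂ) * r ^ 2 / 2)‖ ≤ r ^ 2 * c.toReal := by
      rw [show -((c.toReal : ℂ) * r ^ 2 / 2) = ((-(c.toReal * r ^ 2 / 2) : ℝ) : ℂ) by push_cast; ring,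
        Complex.norm_real, norm_neg, Real.norm_of_nonneg (by positivity)]
      have : 0 ≤ r ^ 2 * c.toReal := by positivity
      linarith
    rw [hC, mul_add]
    exact (norm_add_le _ _).trans (add_le_add h2 h1)
  -- The exponent differs from exp ψ - 1 by at most 4 |ψ|², which is of fourth order.
  have hmain : ∀ r : ℝ, r ≠ 0 → ‖ψ r / (r : ℂ) ^ 2‖ ≤ (μ B).toReal + 4 * C ^ 2 * r ^ 2 := by
    intro r hr
    have h1 := norm_exp_sub_one_sub_le (hre r)
    have h2 := hM.norm_charInt_sub_one_le hB hB' r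
    rw [h.charInt_eq hB hB'] at h2
    have h3 : ‖ψ r‖ ≤ ‖Complex.exp (ψ r) - 1‖ + ‖Complex.exp (ψ r) - 1 - ψ r‖ := by
      have := norm_sub_le (Complex.exp (ψ r) - 1) (Complex.exp (ψ r) - 1 - ψ r)
      rwa [sub_sub_cancel] at this
    have h4 : ‖ψ r‖ ^ 2 ≤ (r ^ 2 * C) ^ 2 := by gcongr; exact hψle r
    rw [norm_div, norm_pow, Complex.norm_real, Real.norm_eq_abs, sq_abs,
      div_le_iff₀ (by positivity)]
    calc ‖ψ r‖ ≤ r ^ 2 * (μ B).toReal + 4 * (r ^ 2 * C) ^ 2 := by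
          refine h3.trans (add_le_add h2 (h1.trans ?_))
          linarith
      _ = _ := by ring
  have hlimψ : Tendsto (fun r : ℝ => ψ r / (r : ℂ) ^ 2) (𝓝[≠] 0) (𝓝 ((-(C / 2) : ℝ) : ℂ)) := by
    have h1 : ∀ᶠ r : ℝ in 𝓝[≠] 0, -((c.toReal : ℂ) / 2) + ∫ x, levyQuotient x r ∂ν =
        ψ r / (r : ℂ) ^ 2 := by
      filter_upwards [self_mem_nhdsWithin] with r hr
      have hr' : (r : ℂ) ≠ 0 := by exact_mod_cast hr
      simp only [hψdef, hψ]
      have h2 : ∀ x, levyFun r x = (r : ℂ) ^ 2 * levyQuotient x r := fun x => by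
        rw [levyFun_comm, ← sq_mul_levyQuotient]; push_cast; ring
      simp only [h2]
      rw [integral_const_mul]
      field_simp
    refine Tendsto.congr' h1 ?_
    -- Dominated convergence with the dominating function x².
    have h3 : Tendsto (fun r : ℝ => ∫ x, levyQuotient x r ∂ν) (𝓝[≠] 0)
        (𝓝 (∫ x, levyQuotient x 0 ∂ν)) := by
      refine tendsto_integral_filter_of_dominated_convergence (fun x => x ^ 2)
        ?_ (.of_forall fun r => .of_forall fun x => norm_levyQuotient_le x r) hsq
        (.of_forall fun x => ((continuous_levyQuotient x).tendsto 0).mono_left nhdsWithin_le_nhds)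
      filter_upwards [self_mem_nhdsWithin] with r hr
      have h4 : (fun x => levyQuotient x r) = fun x => levyFun r x / (r : ℂ) ^ 2 := by
        ext x
        rw [levyQuotient, if_neg (show r ≠ 0 from hr), levyFun_comm]
      rw [h4]
      exact ((measurable_levyFun r).div_const _).aestronglyMeasurable
    have h5 : ∫ x, levyQuotient x 0 ∂ν = ((-((∫ x, x ^ 2 ∂ν) / 2) : ℝ) : ℂ) := by
      simp only [levyQuotient, if_true]
      rw [integral_neg, integral_div]
      push_cast
      rw [← integral_complex_ofReal]
      push_cast
      rfl
    rw [h5] at h3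
    convert h3.const_add (-((c.toReal : ℂ) / 2)) using 2
    rw [hC]
    push_cast
    ring
  have hfinal : C / 2 ≤ (μ B).toReal := by
    have h1 : Tendsto (fun r : ℝ => (μ B).toReal + 4 * C ^ 2 * r ^ 2) (𝓝[≠] 0)
        (𝓝 ((μ B).toReal + 4 * C ^ 2 * 0 ^ 2)) :=
      (Continuous.tendsto (by fun_prop) 0).mono_left nhdsWithin_le_nhds
    have h2 := le_of_tendsto_of_tendsto hlimψ.norm h1 (by
      filter_upwards [self_mem_nhdsWithin] with r hr using hmain r hr)
    rw [Complex.norm_real, norm_neg, Real.norm_of_nonneg (by positivity)] at h2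
    simpa using h2
  have hV : ∫⁻ z in B, levyVariance σ2 ρ z ∂μ = c + ∫⁻ x, ENNReal.ofReal (x ^ 2) ∂ν := by
    unfold levyVariance
    rw [lintegral_add_left h.measurable.coe_nnreal_ennreal, hν,
      Measure.lintegral_bind (Kernel.aemeasurable _) (by fun_prop)]
  rw [hV, setLIntegral_const, ← ENNReal.ofReal_toReal hc'.ne,
    ← ofReal_integral_eq_lintegral_ofReal hsq (.of_forall fun x => sq_nonneg x),
    ← ENNReal.ofReal_add ENNReal.toReal_nonneg (integral_nonneg fun x => sq_nonneg x),
    ← ENNReal.ofReal_toReal hB'.ne, ← ENNReal.ofReal_ofNat, ← ENNReal.ofReal_mul (by norm_num)]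
  exact ENNReal.ofReal_le_ofReal (by linarith)

theorem ae_levyVariance_le [SigmaFinite μ] (h : IsLocalCharacteristics P μ M σ2 ρ)
    (hM : IsIndependentlyScattered P μ M) : ∀ᵐ z ∂μ, levyVariance σ2 ρ z ≤ 2 :=
  ae_le_of_forall_setLIntegral_le_of_sigmaFinite (measurable_levyVariance h.measurable)
    fun _ hB hB' => h.setLIntegral_levyVariance_le hM hB hB'

theorem ae_norm_levyExponent_sub_le [SigmaFinite μ] (h : IsLocalCharacteristics P μ M σ2 ρ)
    (hM : IsIndependentlyScattered P μ M) : ∀ᵐ z ∂μ, ∀ r s : ℝ,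
      ‖levyExponent σ2 ρ r z - levyExponent σ2 ρ s z‖ ≤ 2 * (max |r| |s| * |r - s|) := by
  filter_upwards [h.ae_levyVariance_le hM] with z hz r s
  refine (norm_levyExponent_sub_le z (h.sq z) r s).trans ?_
  rw [mul_comm]
  refine mul_le_mul_of_nonneg_right ?_ (by positivity)
  exact ENNReal.toReal_le_of_le_ofReal (by norm_num) (by simpa using hz)

theorem integral_exp_sum_disjoint (h : IsLocalCharacteristics P μ M σ2 ρ)
    (hM : IsIndependentlyScattered P μ M) {κ : Type*} [Fintype κ] {D : κ → Set Z}
    (hD : ∀ k, MeasurableSet (D k)) (hD' : ∀ k, μ (D k) < ∞)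
    (hd : Pairwise fun k l => Disjoint (D k) (D l)) (a : κ → ℝ) :
    ∫ ω, Complex.exp (Complex.I * ((∑ k, a k * M (D k) ω : ℝ) : ℂ)) ∂P =
      Complex.exp (∫ z, levyExponent σ2 ρ
        (∑ k, a k * (D k).indicator (fun _ => (1 : ℝ)) z) z ∂μ) := by
  classical
  have hpt : ∀ z, levyExponent σ2 ρ (∑ k, a k * (D k).indicator (fun _ => (1 : ℝ)) z) z =
      ∑ k, (D k).indicator (levyExponent σ2 ρ (a k)) z := by
    intro z
    by_cases hz : ∃ k, z ∈ D k
    · obtain ⟨k, hk⟩ := hz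
      have hne : ∀ l, l ≠ k → z ∉ D l := fun l hl hzl => Set.disjoint_left.1 (hd hl) hzl hk
      rw [Finset.sum_eq_single k (fun l _ hl => by simp [hne l hl]) (by simp),
        Finset.sum_eq_single k (fun l _ hl => by simp [hne l hl]) (by simp)]
      simp [hk]
    · push Not at hz
      simp [hz]
  have hi : ∀ k, Integrable (fun z => (D k).indicator (levyExponent σ2 ρ (a k)) z) μ := fun k =>
    (integrable_indicator_iff (hD k)).2 (h.integrableOn_levyExponent (hD k) (hD' k) (a k))
  simp only [hpt]
  rw [hM.integral_exp_sum hD hD' hd, integral_finsetSum _ fun k _ => hi k, Complex.exp_sum]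
  refine Finset.prod_congr rfl fun k _ => ?_
  rw [integral_indicator (hD k), h.charInt_eq (hD k) (hD' k)]

/-- The sets may overlap: on the atoms of the family the coefficients add up, and this reduces to
the disjoint case. -/
theorem integral_exp_sum (h : IsLocalCharacteristics P μ M σ2 ρ)
    (hM : IsIndependentlyScattered P μ M) {ι : Type} [Fintype ι] {C : ι → Set Z}
    (hC : ∀ l, MeasurableSet (C l)) (hC' : ∀ l, μ (C l) < ∞) (a : ι → ℝ) :
    ∫ ω, Complex.exp (Complex.I * ((∑ l, a l * M (C l) ω : ℝ) : ℂ)) ∂P =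
      Complex.exp (∫ z, levyExponent σ2 ρ
        (∑ l, a l * (C l).indicator (fun _ => (1 : ℝ)) z) z ∂μ) := by
  classical
  obtain ⟨κ, _, _, D, T, hD, hd, -, hCT, hcov⟩ := exists_disjoint_atoms C hC
  have hD' : ∀ k, μ (D k) < ∞ := measure_atom_lt_top hC' hCT hcov
  have hswap : ∀ g : κ → ℝ, ∑ l, a l * ∑ k ∈ T l, g k =
      ∑ k, (∑ l, if k ∈ T l then a l else 0) * g k := by
    intro g
    simp only [Finset.mul_sum, Finset.sum_mul]
    rw [Finset.sum_comm]
    refine Finset.sum_congr rfl fun l _ => ?_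
    simp [ite_mul, Finset.sum_ite_mem]
  have h1 := h.integral_exp_sum_disjoint hM hD hD' hd fun k => ∑ l, if k ∈ T l then a l else 0
  have h2 : ∀ᵐ ω ∂P, ∀ l, M (C l) ω = ∑ k ∈ T l, M (D k) ω := by
    rw [ae_all_iff]
    intro l
    have := hM.ae_biUnion hD hD' hd (T l)
    rwa [← hCT l] at this
  simp only [indicator_eq_sum_atoms hd (hCT _), hswap]
  rw [← h1]
  refine integral_congr_ae ?_
  filter_upwards [h2] with ω hω
  simp only [hω, hswap]

end IsLocalCharacteristics

/-! ### Independence of completed fields and freezing. -/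

section CompletedIndependence

variable {Ω : Type*} {m m' : MeasurableSpace Ω} [mΩ : MeasurableSpace Ω] {P : Measure Ω}

theorem indep_completedField (h : Indep m m' P) :
    Indep (completedField P m) (completedField P m') P := by
  rw [Indep_iff] at h ⊢
  rintro s t ⟨-, s', hs', hss⟩ ⟨-, t', ht', htt⟩
  rw [measure_congr hss, measure_congr htt, measure_congr (hss.inter htt)]
  exact h s' t' hs' ht'

theorem comap_le_completedField_of_ae_eq {β : Type*} [MeasurableSpace β] {f g : Ω → β}
    (hf : Measurable f) (hm : m ≤ mΩ) (hg : Measurable[m] g) (h : f =ᵐ[P] g) :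
    MeasurableSpace.comap f inferInstance ≤ completedField P m :=
  (measurable_completedField_of_ae_eq hf (hg.mono (le_completedField hm) le_rfl) h).comap_le

/-- Freezing of the variables that are measurable with respect to the conditioning field. -/
theorem condExp_ae_eq_integral_of_indep [IsProbabilityMeasure P] {α β : Type*}
    [MeasurableSpace α] [MeasurableSpace β] (hm : m ≤ mΩ) {X : Ω → α} {Y : Ω → β}
    (hX : Measurable[m] X) (hY : Measurable Y)
    (hind : Indep m (MeasurableSpace.comap Y inferInstance) P) {g : α × β → ℂ}
    (hg : Measurable g) (hg1 : ∀ p, ‖g p‖ ≤ 1) :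
    P[fun ω => g (X ω, Y ω) | m] =ᵐ[P] fun ω => ∫ ω', g (X ω, Y ω') ∂P := by
  have hX' : Measurable X := hX.mono hm le_rfl
  have hint : Integrable (fun ω => g (X ω, Y ω)) P :=
    Integrable.of_bound (hg.comp (hX'.prodMk hY)).aestronglyMeasurable 1 (ae_of_all _ fun _ => hg1 _)
  have hG : StronglyMeasurable fun x => ∫ ω', g (x, Y ω') ∂P := by
    have : StronglyMeasurable (Function.uncurry fun (x : α) (ω : Ω) => g (x, Y ω)) :=
      (hg.comp (measurable_fst.prodMk (hY.comp measurable_snd))).stronglyMeasurable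
    exact this.integral_prod_right
  have hG1 : ∀ x, ‖∫ ω', g (x, Y ω') ∂P‖ ≤ 1 := fun x => by
    simpa using norm_integral_le_of_norm_le_const (μ := P) (f := fun ω' => g (x, Y ω'))
      (C := 1) (ae_of_all _ fun _ => hg1 _)
  symm
  refine ae_eq_condExp_of_forall_setIntegral_eq hm hint (fun s _ _ =>
    (Integrable.of_bound (hG.measurable.comp hX').aestronglyMeasurable 1
      (ae_of_all _ fun _ => hG1 _)).integrableOn) ?_
    (hG.comp_measurable hX).aestronglyMeasurable
  intro s hs _
  have hs' := hm s hs
  have hI : Measurable[m] (s.indicator fun _ => (1 : ℝ)) := measurable_const.indicator hs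
  have hI' : Measurable (s.indicator fun _ => (1 : ℝ)) := hI.mono hm le_rfl
  -- The conditioning event is carried along as an extra coordinate of X, so that a single product
  -- law with Y handles the integral over s.
  have hXI : Measurable[m] fun ω => (X ω, s.indicator (fun _ => (1 : ℝ)) ω) := hX.prodMk hI
  have hXI' : Measurable fun ω => (X ω, s.indicator (fun _ => (1 : ℝ)) ω) := hXI.mono hm le_rfl
  have hindf : IndepFun (fun ω => (X ω, s.indicator (fun _ => (1 : ℝ)) ω)) Y P :=
    indep_of_indep_of_le_left hind hXI.comap_le
  have hlaw := (indepFun_iff_map_prod_eq_prod_map_map hXI'.aemeasurable hY.aemeasurable).1 hindf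
  have hGm : Measurable fun p : (α × ℝ) × β => (p.1.2 : ℂ) * g (p.1.1, p.2) :=
    (Complex.measurable_ofReal.comp (measurable_snd.comp measurable_fst)).mul
      (hg.comp ((measurable_fst.comp measurable_fst).prodMk measurable_snd))
  have hP1 : IsProbabilityMeasure
      (P.map fun ω => (X ω, s.indicator (fun _ => (1 : ℝ)) ω)) :=
    Measure.isProbabilityMeasure_map hXI'.aemeasurable
  have hP2 : IsProbabilityMeasure (P.map Y) := Measure.isProbabilityMeasure_map hY.aemeasurable
  have hsi : ∀ F : Ω → ℂ, ∫ ω in s, F ω ∂P =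
      ∫ ω, ((s.indicator (fun _ => (1 : ℝ)) ω : ℝ) : ℂ) * F ω ∂P := fun F => by
    rw [← integral_indicator hs']
    refine integral_congr_ae (ae_of_all _ fun ω => ?_)
    by_cases h : ω ∈ s <;> simp [h]
  have hle1 : ∀ ω, ‖((s.indicator (fun _ => (1 : ℝ)) ω : ℝ) : ℂ)‖ ≤ 1 := fun ω => by
    by_cases h : ω ∈ s <;> simp [h]
  have hGi : Integrable (fun p : (α × ℝ) × β => (p.1.2 : ℂ) * g (p.1.1, p.2))
      ((P.map fun ω => (X ω, s.indicator (fun _ => (1 : ℝ)) ω)).prod (P.map Y)) := by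
    rw [← hlaw, integrable_map_measure hGm.aestronglyMeasurable (hXI'.prodMk hY).aemeasurable]
    refine Integrable.of_bound (hGm.comp (hXI'.prodMk hY)).aestronglyMeasurable 1
      (ae_of_all _ fun ω => ?_)
    simp only [Function.comp_apply, norm_mul]
    exact mul_le_one₀ (hle1 ω) (norm_nonneg _) (hg1 _)
  have hinner : StronglyMeasurable fun p : α × ℝ => ∫ y, (p.2 : ℂ) * g (p.1, y) ∂(P.map Y) :=
    StronglyMeasurable.integral_prod_right
      (f := fun (p : α × ℝ) (y : β) => (p.2 : ℂ) * g (p.1, y)) hGm.stronglyMeasurable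
  calc ∫ ω in s, ∫ ω', g (X ω, Y ω') ∂P ∂P
      = ∫ ω, ∫ y, ((s.indicator (fun _ => (1 : ℝ)) ω : ℝ) : ℂ) * g (X ω, y) ∂(P.map Y) ∂P := by
        rw [hsi]
        refine integral_congr_ae (ae_of_all _ fun ω => ?_)
        simp only
        have hgx : Measurable fun y => g (X ω, y) := hg.comp (measurable_const.prodMk measurable_id)
        rw [integral_const_mul, integral_map hY.aemeasurable hgx.aestronglyMeasurable]
    _ = ∫ p, ∫ y, (p.2 : ℂ) * g (p.1, y) ∂(P.map Y)
          ∂(P.map fun ω => (X ω, s.indicator (fun _ => (1 : ℝ)) ω)) := by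
        rw [integral_map hXI'.aemeasurable hinner.aestronglyMeasurable]
    _ = ∫ p, (p.1.2 : ℂ) * g (p.1.1, p.2)
          ∂((P.map fun ω => (X ω, s.indicator (fun _ => (1 : ℝ)) ω)).prod (P.map Y)) :=
        (integral_prod _ hGi).symm
    _ = ∫ ω in s, g (X ω, Y ω) ∂P := by
        rw [← hlaw, integral_map (hXI'.prodMk hY).aemeasurable hGm.aestronglyMeasurable, hsi]

end CompletedIndependence

/-! ### The filtration of the resolution and independence of the future. -/

section ResolutionField

variable {Ω Z : Type*} [mΩ : MeasurableSpace Ω] [MeasurableSpace Z]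
  {P : Measure Ω} [IsProbabilityMeasure P] {μ : Measure Z} [SigmaFinite μ] {M : Set Z → Ω → ℝ}
  {S : ℝ → Set Z}
  [MeasurableSpace.CountablyGenerated Z] [MeasurableSpace.SeparatesPoints Z]
  [NullSingletonClass μ]

theorem memLp_eval_zero {g : Z → ℝ} (hg : MemLp g 2 μ) :
    MemLp (fun z : Fin 1 → Z => g (z 0)) 2 (Measure.pi fun _ => μ) :=
  hg.comp_measurePreserving (measurePreserving_funUnique μ (Fin 1))

theorem isMultipleIntegral_isoField (hM : IsIndependentlyScattered P μ M)
    (hS : IsSetResolution μ S) {g : Z → ℝ} (hg : MemLp g 2 μ) :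
    IsMultipleIntegral P μ M 1 (fun z => g (z 0)) (isoField P μ M g) :=
  isMultipleIntegral_multipleIntegral_of_symm (m := 0) hM hS (memLp_eval_zero hg)
    fun σ z => congrArg (fun i => g (z i)) (Subsingleton.elim (α := Fin 1) (σ 0) 0)

theorem symIndicator_one (B : Fin 1 → Set Z) :
    symIndicator B = fun z => (B 0).indicator (fun _ => (1 : ℝ)) (z 0) := by
  ext z
  simp [symIndicator]

theorem mem_elementaryGraph_one {B : Set Z} (hB : MeasurableSet B) (hB' : μ B < ∞) :
    ((fun z => B.indicator (fun _ => (1 : ℝ)) (z 0), M B) :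
      ((Fin 1 → Z) → ℝ) × (Ω → ℝ)) ∈ elementaryGraph μ M 1 := by
  refine Submodule.subset_span ⟨fun _ => B, fun _ => hB, fun _ => hB',
    fun i j hij => absurd (Subsingleton.elim i j) hij, ?_⟩
  rw [symIndicator_one]
  simp

theorem isoField_indicator_ae_eq (hM : IsIndependentlyScattered P μ M)
    (hS : IsSetResolution μ S) {B : Set Z} (hB : MeasurableSet B) (hB' : μ B < ∞) :
    isoField P μ M (B.indicator fun _ => 1) =ᵐ[P] M B := by
  have hL : MemLp (B.indicator fun _ => (1 : ℝ)) 2 μ :=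
    memLp_indicator_const 2 hB 1 (Or.inr hB'.ne)
  exact (isMultipleIntegral_isoField hM hS hL).ae_eq hM
    (IsMultipleIntegral.of_mem_elementaryGraph hM (mem_elementaryGraph_one hB hB'))
    (memLp_eval_zero hL).1

theorem iSup_isoField_le (hM : IsIndependentlyScattered P μ M) (hS : IsSetResolution μ S) {q : ℝ}
    (hq : q ∈ Set.Icc (0 : ℝ) 1) :
    (⨆ (h : Z → ℝ) (_ : MemLp h 2 μ),
      MeasurableSpace.comap (isoField P μ M ((S q).indicator h)) inferInstance) ≤ mΩ :=
  iSup₂_le fun _ hh =>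
    (isMultipleIntegral_isoField hM hS (hh.indicator (hS.measurable q hq))).1.comap_le

theorem resolutionField_mono (hS : IsSetResolution μ S) {q q' : ℝ}
    (hq : q ∈ Set.Icc (0 : ℝ) 1) (hq' : q' ∈ Set.Icc (0 : ℝ) 1) (h : q ≤ q') :
    resolutionField P μ M S q ≤ resolutionField P μ M S q' := by
  refine completedField_mono (iSup₂_le fun g hg => ?_)
  have : (S q).indicator g = (S q').indicator ((S q).indicator g) := by
    rw [Set.indicator_indicator, Set.inter_eq_self_of_subset_right (hS.mono hq hq' h)]
  rw [this]
  exact le_iSup₂_of_le ((S q).indicator g) (hg.indicator (hS.measurable q hq)) le_rfl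

theorem measurable_resolutionField (hM : IsIndependentlyScattered P μ M)
    (hS : IsSetResolution μ S) {q : ℝ} (hq : q ∈ Set.Icc (0 : ℝ) 1) {B : Set Z}
    (hB : MeasurableSet B) (hB' : μ B < ∞) (hBS : B ⊆ S q) :
    Measurable[resolutionField P μ M S q] (M B) := by
  have hL : MemLp (B.indicator fun _ => (1 : ℝ)) 2 μ :=
    memLp_indicator_const 2 hB 1 (Or.inr hB'.ne)
  have h1 : (S q).indicator (B.indicator fun _ => (1 : ℝ)) = B.indicator fun _ => 1 := by
    rw [Set.indicator_indicator, Set.inter_eq_self_of_subset_right hBS]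
  refine measurable_completedField_of_ae_eq (hM.measurable B hB hB') ?_
    (isoField_indicator_ae_eq hM hS hB hB').symm
  rw [← h1]
  refine Measurable.mono (Measurable.of_comap_le ?_)
    (le_completedField (iSup_isoField_le hM hS hq)) le_rfl
  exact le_iSup₂_of_le (B.indicator fun _ => (1 : ℝ)) hL le_rfl

/-- The field generated by the values of `M` inside a set. -/
@[reducible] def scatteredField (μ : Measure Z) (M : Set Z → Ω → ℝ) (A : Set Z) : MeasurableSpace Ω :=
  ⨆ (B : Set Z) (_ : MeasurableSet B ∧ μ B < ∞ ∧ B ⊆ A), MeasurableSpace.comap (M B) inferInstance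

theorem scatteredField_le (hM : IsIndependentlyScattered P μ M) (A : Set Z) :
    scatteredField μ M A ≤ mΩ :=
  iSup₂_le fun B hB => (hM.measurable B hB.1 hB.2.1).comap_le

/-- Intersecting the sets of an elementary kernel with A gives an integral that depends only on the
values of M inside A, with no completion involved. -/
theorem exists_elementaryGraph_indicator {A : Set Z} (hA : MeasurableSet A)
    {p : ((Fin 1 → Z) → ℝ) × (Ω → ℝ)} (hp : p ∈ elementaryGraph μ M 1) :
    ∃ F : Ω → ℝ, ((fun z => A.indicator (fun _ => (1 : ℝ)) (z 0) * p.1 z, F) :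
        ((Fin 1 → Z) → ℝ) × (Ω → ℝ)) ∈ elementaryGraph μ M 1 ∧
      Measurable[scatteredField μ M A] F := by
  induction hp using Submodule.span_induction with
  | mem p hp =>
    obtain ⟨B, hB, hB', -, rfl⟩ := hp
    have hlt : μ (A ∩ B 0) < ∞ := lt_of_le_of_lt (measure_mono Set.inter_subset_right) (hB' 0)
    refine ⟨M (A ∩ B 0), ?_, Measurable.of_comap_le ?_⟩
    · convert mem_elementaryGraph_one (M := M) (hA.inter (hB 0)) hlt using 2
      ext z
      simp only [symIndicator_one]
      by_cases h1 : z 0 ∈ A <;> by_cases h2 : z 0 ∈ B 0 <;> simp [h1, h2]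
    · exact le_iSup₂_of_le (A ∩ B 0) ⟨hA.inter (hB 0), hlt, Set.inter_subset_left⟩ le_rfl
  | zero =>
    refine ⟨0, ?_, measurable_const⟩
    convert Submodule.zero_mem (elementaryGraph μ M 1) using 1
    exact Prod.ext (funext fun z => by simp) rfl
  | add p p' _ _ ih ih' =>
    obtain ⟨F, h1, h2⟩ := ih
    obtain ⟨F', h1', h2'⟩ := ih'
    refine ⟨F + F', ?_, h2.add h2'⟩
    convert Submodule.add_mem _ h1 h1' using 1
    exact Prod.ext (funext fun z => by simp [mul_add]) rfl
  | smul a p _ ih =>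
    obtain ⟨F, h1, h2⟩ := ih
    refine ⟨a • F, ?_, h2.const_smul a⟩
    convert Submodule.smul_mem _ a h1 using 1
    exact Prod.ext (funext fun z => by simp; ring) rfl

/-- The integrand vanishes outside S q, so truncated approximants converge as well. A subsequence of
their integrals converges almost surely, and its upper limit is a version measurable for the field
of M inside S q. -/
theorem resolutionField_le_scatteredField (hM : IsIndependentlyScattered P μ M)
    (hS : IsSetResolution μ S) {q : ℝ} (hq : q ∈ Set.Icc (0 : ℝ) 1) :
    resolutionField P μ M S q ≤ completedField P (scatteredField μ M (S q)) := by
  refine le_trans (completedField_mono (iSup₂_le fun g hg => ?_)) completedField_completedField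
  have hSq := hS.measurable q hq
  have hgS := hg.indicator hSq
  have hI := isMultipleIntegral_isoField hM hS hgS
  obtain ⟨hIm, s, hs, hs1, -⟩ := id hI
  choose F hF hFm using fun k => exists_elementaryGraph_indicator (M := M) hSq (hs k)
  have hle : ∀ k, eLpNorm (fun z : Fin 1 → Z => (S q).indicator (fun _ => (1 : ℝ)) (z 0) *
      (s k).1 z - (S q).indicator g (z 0)) 2 (Measure.pi fun _ => μ) ≤
      eLpNorm (fun z => (s k).1 z - (S q).indicator g (z 0)) 2 (Measure.pi fun _ => μ) := by
    intro k
    refine eLpNorm_mono fun z => ?_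
    by_cases hz : z 0 ∈ S q <;> simp [hz]
  have hlim : Tendsto (fun k => eLpNorm (fun ω => F k ω -
      isoField P μ M ((S q).indicator g) ω) 2 P ^ 2) atTop (𝓝 0) := by
    have h0 := tendsto_of_tendsto_of_tendsto_of_le_of_le tendsto_const_nhds hs1
      (fun _ => zero_le) hle
    have h1 := ENNReal.Tendsto.pow (n := 2) h0
    rw [zero_pow two_ne_zero] at h1
    refine h1.congr fun k => ?_
    rw [(IsMultipleIntegral.of_mem_elementaryGraph hM (hF k)).eLpNorm_sub_sq hM hI
      (elementaryGraph_properties hM (hF k)).2.1.1 (memLp_eval_zero hgS).1]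
    simp
  have hlim' : Tendsto (fun k => eLpNorm (F k - isoField P μ M ((S q).indicator g)) 2 P)
      atTop (𝓝 0) := by
    have := (ENNReal.continuous_rpow_const (y := 2⁻¹)).tendsto (0 : ℝ≥0∞) |>.comp hlim
    rw [ENNReal.zero_rpow_of_pos (by norm_num)] at this
    refine this.congr fun k => ?_
    simp only [Function.comp_apply]
    rw [← ENNReal.rpow_natCast, ← ENNReal.rpow_mul]
    norm_num
    rfl
  have hGle := scatteredField_le hM (S q)
  have hFm' : ∀ k, Measurable (F k) := fun k => (hFm k).mono hGle le_rfl
  have hmeas := tendstoInMeasure_of_tendsto_eLpNorm (by norm_num)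
    (fun k => (hFm' k).aestronglyMeasurable) hIm.aestronglyMeasurable hlim'
  obtain ⟨ns, -, hns⟩ := hmeas.exists_seq_tendsto_ae
  refine comap_le_completedField_of_ae_eq (g := fun ω => limsup (fun k => F (ns k) ω) atTop)
    hIm hGle (Measurable.limsup fun k => hFm (ns k)) ?_
  filter_upwards [hns] with ω hω using hω.limsup_eq.symm

/-- Disjoint finite families generate independent fields. -/
theorem indep_iSup_comap (hM : IsIndependentlyScattered P μ M) {ι κ : Type} [Fintype ι]
    [Fintype κ] {B : ι → Set Z} {C : κ → Set Z}
    (hB : ∀ i, MeasurableSet (B i)) (hB' : ∀ i, μ (B i) < ∞)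
    (hC : ∀ i, MeasurableSet (C i)) (hC' : ∀ i, μ (C i) < ∞)
    (hBC : ∀ i j, Disjoint (B i) (C j)) :
    Indep (⨆ i, MeasurableSpace.comap (M (B i)) inferInstance)
      (⨆ j, MeasurableSpace.comap (M (C j)) inferInstance) P := by
  have hE : ∀ i, MeasurableSet (Sum.elim B C i) := by rintro (i | i); exacts [hB i, hC i]
  have hE' : ∀ i, μ (Sum.elim B C i) < ∞ := by rintro (i | i); exacts [hB' i, hC' i]
  obtain ⟨α, _, _, D, T, hD, hd, hne, hT, hcov⟩ := exists_disjoint_atoms (Sum.elim B C) hE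
  have hD' := fun k => measure_atom_lt_top hE' hT hcov k
  have hind := (hM.iIndepFun_of_disjoint hD hD' hd).iIndep
  have hle : ∀ k, MeasurableSpace.comap (M (D k)) inferInstance ≤ mΩ := fun k =>
    (hM.measurable _ (hD k) (hD' k)).comap_le
  -- A shared label would give a point common to both families, because atoms are nonempty.
  have hdisj : Disjoint {k | ∃ i, k ∈ T (Sum.inl i)} {k | ∃ j, k ∈ T (Sum.inr j)} := by
    rw [Set.disjoint_left]
    rintro k ⟨i, hi⟩ ⟨j, hj⟩
    obtain ⟨z, hz⟩ := hne k
    have h1 : z ∈ Sum.elim B C (Sum.inl i) := by rw [hT]; exact Set.mem_biUnion hi hz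
    have h2 : z ∈ Sum.elim B C (Sum.inr j) := by rw [hT]; exact Set.mem_biUnion hj hz
    exact Set.disjoint_left.1 (hBC i j) h1 h2
  have key : ∀ (A : Set α) (x : ι ⊕ κ), (∀ k ∈ T x, k ∈ A) →
      MeasurableSpace.comap (M (Sum.elim B C x)) inferInstance ≤
        completedField P (⨆ k ∈ A, MeasurableSpace.comap (M (D k)) inferInstance) := by
    intro A x hx
    have hae := hM.ae_biUnion hD hD' hd (T x)
    rw [← hT x] at hae
    refine comap_le_completedField_of_ae_eq (hM.measurable _ (hE x) (hE' x))
      (iSup₂_le fun k _ => hle k) (Finset.measurable_sum _ fun k hk => ?_) hae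
    exact Measurable.of_comap_le (le_iSup₂_of_le k (hx k hk) le_rfl)
  exact indep_of_indep_of_le (indep_completedField (indep_iSup_of_disjoint hle hind hdisj))
    (iSup_le fun i => key _ (Sum.inl i) fun k hk => ⟨i, hk⟩)
    (iSup_le fun i => key _ (Sum.inr i) fun k hk => ⟨i, hk⟩)

/-- The field of A is the directed supremum of the fields of finite subfamilies, and independence
passes to such suprema. -/
theorem indep_scatteredField (hM : IsIndependentlyScattered P μ M) {A : Set Z} {κ : Type}
    [Fintype κ] {C : κ → Set Z} (hC : ∀ i, MeasurableSet (C i)) (hC' : ∀ i, μ (C i) < ∞)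
    (hAC : ∀ j, Disjoint A (C j)) :
    Indep (scatteredField μ M A) (⨆ j, MeasurableSpace.comap (M (C j)) inferInstance) P := by
  classical
  have hle' : (⨆ j, MeasurableSpace.comap (M (C j)) inferInstance) ≤ mΩ :=
    iSup_le fun j => (hM.measurable _ (hC j) (hC' j)).comap_le
  let I := {B : Set Z // MeasurableSet B ∧ μ B < ∞ ∧ B ⊆ A}
  let G : Finset I → MeasurableSpace Ω := fun s =>
    ⨆ i : Fin s.card, MeasurableSpace.comap (M (s.equivFin.symm i).1.1) inferInstance
  have hGmem : ∀ (s : Finset I) (B : I), B ∈ s →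
      MeasurableSpace.comap (M B.1) inferInstance ≤ G s := fun s B hB => by
    refine le_iSup_of_le (s.equivFin ⟨B, hB⟩) ?_
    rw [Equiv.symm_apply_apply]
  have hGle : ∀ s, G s ≤ mΩ := fun s => iSup_le fun i =>
    (hM.measurable _ (s.equivFin.symm i).1.2.1 (s.equivFin.symm i).1.2.2.1).comap_le
  have hind : ∀ s, Indep (G s) (⨆ j, MeasurableSpace.comap (M (C j)) inferInstance) P :=
    fun s => indep_iSup_comap hM (fun i => (s.equivFin.symm i).1.2.1)
      (fun i => (s.equivFin.symm i).1.2.2.1) hC hC'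
      fun i j => (hAC j).mono_left (s.equivFin.symm i).1.2.2.2
  have hmono : Monotone G := fun s s' hss => iSup_le fun i =>
    hGmem s' _ (hss (s.equivFin.symm i).2)
  refine indep_of_indep_of_le_left
    (indep_iSup_of_directed_le hind hGle hle' hmono.directed_le) ?_
  exact iSup₂_le fun B hB => le_iSup_of_le {⟨B, hB⟩} (hGmem _ ⟨B, hB⟩ (Finset.mem_singleton_self _))

theorem indep_resolutionField (hM : IsIndependentlyScattered P μ M) (hS : IsSetResolution μ S)
    {q : ℝ} (hq : q ∈ Set.Icc (0 : ℝ) 1) {κ : Type} [Fintype κ] {C : κ → Set Z}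
    (hC : ∀ i, MeasurableSet (C i)) (hC' : ∀ i, μ (C i) < ∞)
    (hSC : ∀ j, Disjoint (S q) (C j)) :
    Indep (resolutionField P μ M S q)
      (MeasurableSpace.comap (fun ω j => M (C j) ω) MeasurableSpace.pi) P := by
  refine indep_of_indep_of_le (indep_completedField (indep_scatteredField hM hC hC' hSC))
    (resolutionField_le_scatteredField hM hS hq) ?_
  rw [MeasurableSpace.comap_process_pi fun j => M (C j)]
  exact le_completedField (iSup_le fun j => (hM.measurable _ (hC j) (hC' j)).comap_le)

/-- Conditional characteristic function of an integral of a simple integrand over sets lying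
after time `q`. -/
theorem condExp_exp_sum {σ2 : Z → ℝ≥0} {ρ : Kernel Z ℝ} (hM : IsIndependentlyScattered P μ M)
    (hS : IsSetResolution μ S) (h : IsLocalCharacteristics P μ M σ2 ρ)
    {q : ℝ} (hq : q ∈ Set.Icc (0 : ℝ) 1) {κ : Type} [Fintype κ] {C : κ → Set Z}
    (hC : ∀ i, MeasurableSet (C i)) (hC' : ∀ i, μ (C i) < ∞)
    (hSC : ∀ j, Disjoint (S q) (C j)) {ξ : κ → Ω → ℝ}
    (hξ : ∀ j, Measurable[resolutionField P μ M S q] (ξ j)) :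
    Measurable[resolutionField P μ M S q] (fun ω => Complex.exp
      (∫ z, levyExponent σ2 ρ (∑ l, ξ l ω * (C l).indicator (fun _ => 1) z) z ∂μ)) ∧
    P[fun ω => Complex.exp (Complex.I * ((∑ l, ξ l ω * M (C l) ω : ℝ) : ℂ)) |
      resolutionField P μ M S q] =ᵐ[P] fun ω => Complex.exp
      (∫ z, levyExponent σ2 ρ (∑ l, ξ l ω * (C l).indicator (fun _ => 1) z) z ∂μ) := by
  let g : (κ → ℝ) × (κ → ℝ) → ℂ := fun p =>
    Complex.exp (Complex.I * ((∑ l, p.1 l * p.2 l : ℝ) : ℂ))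
  have hg : Measurable g := by
    refine Complex.measurable_exp.comp (measurable_const.mul (Complex.measurable_ofReal.comp ?_))
    exact Finset.measurable_sum _ fun l _ =>
      ((measurable_pi_apply l).comp measurable_fst).mul ((measurable_pi_apply l).comp measurable_snd)
  have hg1 : ∀ p, ‖g p‖ ≤ 1 := fun p => by
    simp only [g]
    rw [mul_comm, Complex.norm_exp_ofReal_mul_I]
  have hY : Measurable fun ω j => M (C j) ω :=
    measurable_pi_iff.2 fun j => hM.measurable _ (hC j) (hC' j)
  have hX : Measurable[resolutionField P μ M S q] fun ω j => ξ j ω :=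
    (@measurable_pi_iff Ω κ (fun _ => ℝ) (resolutionField P μ M S q) _ _).2 hξ
  have heq : ∀ ω, ∫ ω', g (fun j => ξ j ω, fun j => M (C j) ω') ∂P = Complex.exp
      (∫ z, levyExponent σ2 ρ (∑ l, ξ l ω * (C l).indicator (fun _ => 1) z) z ∂μ) :=
    fun ω => h.integral_exp_sum hM hC hC' fun l => ξ l ω
  have hG : StronglyMeasurable fun x => ∫ ω', g (x, fun j => M (C j) ω') ∂P := by
    have : StronglyMeasurable (Function.uncurry fun (x : κ → ℝ) (ω : Ω) =>
        g (x, fun j => M (C j) ω)) :=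
      (hg.comp (measurable_fst.prodMk (hY.comp measurable_snd))).stronglyMeasurable
    exact this.integral_prod_right
  constructor
  · have := hG.measurable.comp hX
    simpa only [Function.comp_def, heq] using this
  · have := condExp_ae_eq_integral_of_indep completedField_le hX hY
      (indep_resolutionField hM hS hq hC hC' hSC) hg hg1
    exact this.trans (ae_of_all _ heq)

end ResolutionField

/-- The points of a finite subset of `[a, b]` are values of a finite increasing sequence from `a`
to `b`. -/
theorem exists_monotone_enumeration {a b : ℝ} (hab : a ≤ b) (s : Finset ℝ)
    (hs : ∀ x ∈ s, x ∈ Set.Icc a b) : ∃ (L : ℕ) (τ : ℕ → ℝ), Monotone τ ∧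
      (∀ j, τ j ∈ Set.Icc a b) ∧ τ 0 = a ∧ τ L = b ∧ ∀ x ∈ s, ∃ j, τ j = x := by
  classical
  set Q := insert a s with hQ
  have hQI : ∀ x ∈ Q, x ∈ Set.Icc a b := by
    intro x hx
    rcases Finset.mem_insert.1 hx with rfl | hx
    exacts [⟨le_rfl, hab⟩, hs x hx]
  have hpos : 0 < Q.card := Finset.card_pos.2 ⟨a, Finset.mem_insert_self _ _⟩
  set e := Q.orderEmbOfFin rfl with he
  have heI : ∀ i, e i ∈ Set.Icc a b := fun i => hQI _ (Q.orderEmbOfFin_mem rfl i)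
  -- Inserting a makes it the minimum, hence the first value; after the list is exhausted the
  -- sequence stays at b.
  refine ⟨Q.card, fun j => if h : j < Q.card then e ⟨j, h⟩ else b, ?_, ?_, ?_, ?_, ?_⟩
  · intro i j hij
    by_cases hj : j < Q.card
    · simp only [hj, hij.trans_lt hj, dite_true]
      exact e.monotone hij
    · simp only [hj, dite_false]
      split_ifs with hi
      exacts [(heI _).2, le_rfl]
  · intro j
    dsimp only
    split_ifs
    exacts [heI _, ⟨hab, le_rfl⟩]
  · simp only [hpos, dite_true, he, Finset.orderEmbOfFin_zero rfl hpos]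
    exact le_antisymm (Finset.min'_le _ _ (Finset.mem_insert_self _ _))
      (hQI _ (Finset.min'_mem _ _)).1
  · simp
  · intro x hx
    have : x ∈ Set.range e := by
      rw [he, Finset.range_orderEmbOfFin]; exact Finset.mem_insert_of_mem hx
    obtain ⟨i, hi⟩ := this
    exact ⟨i, by simpa using hi⟩

/-! ### The quotient for simple adapted integrands. -/

section Exponent

variable {Ω Z : Type*} [mΩ : MeasurableSpace Ω] [MeasurableSpace Z]
  {P : Measure Ω} [IsProbabilityMeasure P] {μ : Measure Z} [SigmaFinite μ] {M : Set Z → Ω → ℝ}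
  {S : ℝ → Set Z} {σ2 : Z → ℝ≥0} {ρ : Kernel Z ℝ}
  [MeasurableSpace.CountablyGenerated Z] [MeasurableSpace.SeparatesPoints Z]
  [NullSingletonClass μ]

namespace IsLocalCharacteristics

/-- A Carathéodory function: continuous in the frequency by the Lipschitz bound, measurable in the
point. -/
theorem measurable_levyExponent (h : IsLocalCharacteristics P μ M σ2 ρ) :
    Measurable (Function.uncurry (levyExponent σ2 ρ)) := by
  refine (stronglyMeasurable_uncurry_of_continuous_of_stronglyMeasurable (fun z => ?_)
    fun r => (measurable_levyExponent_left h.measurable r).stronglyMeasurable).measurable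
  refine continuous_iff_continuousAt.2 fun s => ?_
  refine tendsto_iff_norm_sub_tendsto_zero.2 (squeeze_zero (fun _ => norm_nonneg _)
    (fun r => norm_levyExponent_sub_le z (h.sq z) r s) ?_)
  have hc : Continuous fun r : ℝ => max |r| |s| * |r - s| * (levyVariance σ2 ρ z).toReal := by
    fun_prop
  simpa using hc.tendsto s

theorem ae_norm_levyExponent_le (h : IsLocalCharacteristics P μ M σ2 ρ)
    (hM : IsIndependentlyScattered P μ M) :
    ∀ᵐ z ∂μ, ∀ r : ℝ, ‖levyExponent σ2 ρ r z‖ ≤ 2 * r ^ 2 := by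
  filter_upwards [h.ae_norm_levyExponent_sub_le hM] with z hz r
  have h0 := hz r 0
  rw [levyExponent_zero, sub_zero, sub_zero, abs_zero, max_eq_left (abs_nonneg r),
    ← pow_two, sq_abs] at h0
  exact h0

theorem integrable_levyExponent_comp (h : IsLocalCharacteristics P μ M σ2 ρ)
    (hM : IsIndependentlyScattered P μ M) {G : Z → ℝ} (hG : MemLp G 2 μ) :
    Integrable (fun z => levyExponent σ2 ρ (G z) z) μ := by
  refine Integrable.mono' (hG.integrable_sq.const_mul 2)
    (h.measurable_levyExponent.comp_aemeasurable
      (hG.1.aemeasurable.prodMk aemeasurable_id)).aestronglyMeasurable ?_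
  filter_upwards [h.ae_norm_levyExponent_le hM] with z hz using hz _

end IsLocalCharacteristics

theorem memLp_sum_indicator {ι : Type*} [Fintype ι] {C : ι → Set Z}
    (hC : ∀ l, MeasurableSet (C l)) (hC' : ∀ l, μ (C l) < ∞) (x : ι → ℝ) :
    MemLp (fun z => ∑ l, x l * (C l).indicator (fun _ => (1 : ℝ)) z) 2 μ :=
  memLp_finsetSum _ fun l _ =>
    (memLp_indicator_const 2 (hC l) (1 : ℝ) (Or.inr (hC' l).ne)).const_mul (x l)

/-- A simple adapted integrand living after time `t`: the Fourier transform of its integral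
divided by its conditional predictor is a bounded ratio of conditional mean one. -/
theorem exists_ratio_of_simple (hM : IsIndependentlyScattered P μ M) (hS : IsSetResolution μ S)
    (h : IsLocalCharacteristics P μ M σ2 ρ) {t : ℝ} (ht : t ∈ Set.Icc (0 : ℝ) 1)
    {ι : Type} [Fintype ι] {C : ι → Set Z} (hC : ∀ l, MeasurableSet (C l))
    (hC' : ∀ l, μ (C l) < ∞) {q : ι → ℝ} (hq : ∀ l, q l ∈ Set.Icc t 1)
    (hqC : ∀ l, Disjoint (S (q l)) (C l)) {ξ : ι → Ω → ℝ}
    (hξ : ∀ l, Measurable[resolutionField P μ M S (q l)] (ξ l)) :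
    ∃ V : Ω → ℂ, Measurable V ∧ (∀ ω, ‖V ω‖ ≤ 1) ∧
      (V =ᵐ[P] fun ω => Complex.exp (Complex.I * ((∑ l, ξ l ω * M (C l) ω : ℝ) : ℂ))) ∧
      (Measurable fun ω => Complex.exp
        (∫ z, levyExponent σ2 ρ (∑ l, ξ l ω * (C l).indicator (fun _ => 1) z) z ∂μ)) ∧
      ∀ ε : ℝ, 0 < ε → ε ≤ 1 → ∃ w : Ω → ℂ, Measurable w ∧ (∀ ω, ‖w ω‖ ≤ 1 / ε) ∧
        P[w | resolutionField P μ M S t] =ᵐ[P] (fun _ => 1) ∧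
        ∀ ω, ε ≤ ‖Complex.exp
            (∫ z, levyExponent σ2 ρ (∑ l, ξ l ω * (C l).indicator (fun _ => 1) z) z ∂μ)‖ →
          w ω * Complex.exp
            (∫ z, levyExponent σ2 ρ (∑ l, ξ l ω * (C l).indicator (fun _ => 1) z) z ∂μ) =
            V ω := by
  classical
  -- The time grid contains every time q l, so that within a slice no coefficient changes from
  -- unknown to known.
  obtain ⟨L, τ, hτ, hτI', hτ0, hτL, hτq⟩ := exists_monotone_enumeration ht.2
    (Finset.univ.image q) (by simpa using hq)
  have hτI : ∀ j, τ j ∈ Set.Icc (0 : ℝ) 1 := fun j => ⟨ht.1.trans (hτI' j).1, (hτI' j).2⟩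
  have hqI : ∀ l, q l ∈ Set.Icc (0 : ℝ) 1 := fun l => ⟨ht.1.trans (hq l).1, (hq l).2⟩
  have hSm : ∀ j, MeasurableSet (S (τ j)) := fun j => hS.measurable _ (hτI j)
  have hSmono : ∀ {i j}, i ≤ j → S (τ i) ⊆ S (τ j) := fun hij => hS.subset (hτI _) (hτI _) (hτ hij)
  let Δ : ℕ → Set Z := fun j => S (τ (j + 1)) \ S (τ j)
  have hΔ : ∀ j, MeasurableSet (Δ j) := fun j => (hSm _).diff (hSm _)
  have hΔd : Pairwise fun i j => Disjoint (Δ i) (Δ j) := by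
    refine (symm_disjoint.pairwise_on _).2 fun i j hij => Set.disjoint_left.2 ?_
    rintro z ⟨hz, -⟩ ⟨-, hz'⟩
    exact hz' (hSmono hij hz)
  have hΔex : ∀ (z : Z) (n : ℕ), z ∉ S (τ 0) → z ∈ S (τ n) → ∃ j < n, z ∈ Δ j := by
    intro z n h0
    induction n with
    | zero => exact fun hz => absurd hz h0
    | succ n ih =>
      intro hz
      by_cases hz' : z ∈ S (τ n)
      · obtain ⟨j, hj, hzj⟩ := ih hz'
        exact ⟨j, hj.trans n.lt_succ_self, hzj⟩
      · exact ⟨n, n.lt_succ_self, hz, hz'⟩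
  -- If C l meets a slice, its coefficient is known at the start of the slice: otherwise the grid
  -- point q l would be at or after the end of the slice, and C l lies after q l.
  have hCΔ : ∀ l j z, z ∈ C l → z ∈ Δ j → q l ≤ τ j := by
    rintro l j z hz ⟨hzj, -⟩
    by_contra hlt
    obtain ⟨i, hi⟩ := hτq (q l) (Finset.mem_image_of_mem _ (Finset.mem_univ l))
    have hij : j + 1 ≤ i := by
      by_contra hij
      exact hlt (hi ▸ hτ (by omega))
    exact Set.disjoint_left.1 (hqC l) (hi ▸ hSmono hij hzj) hz
  have hCt : ∀ l z, z ∈ C l → z ∉ S (τ 0) := fun l z hz hz' => by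
    rw [hτ0] at hz'
    exact Set.disjoint_left.1 (hqC l) (hS.subset ht (hqI l) (hq l).1 hz') hz
  have hSL : ∀ z, z ∈ S (τ L) := fun z => by rw [hτL, hS.one]; trivial
  -- Coefficients not yet known are set to zero; their sets do not meet the slice, so nothing is
  -- lost.
  let ξ' : ℕ → ι → Ω → ℝ := fun j l => if q l ≤ τ j then ξ l else 0
  let C' : ℕ → ι → Set Z := fun j l => C l ∩ Δ j
  have hCm : ∀ j l, MeasurableSet (C' j l) := fun j l => (hC l).inter (hΔ j)
  have hCf : ∀ j l, μ (C' j l) < ∞ := fun j l =>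
    lt_of_le_of_lt (measure_mono Set.inter_subset_left) (hC' l)
  have hξm : ∀ j l, Measurable[resolutionField P μ M S (τ j)] (ξ' j l) := by
    intro j l
    simp only [ξ']
    split_ifs with hl
    · exact (hξ l).mono (resolutionField_mono hS (hqI l) (hτI j) hl) le_rfl
    · exact measurable_const
  have hcond := fun j => condExp_exp_sum hM hS h (hτI j) (hCm j) (hCf j)
    (fun l => Set.disjoint_left.2 fun z hz hz' => hz'.2.2 hz) (hξm j)
  let u : ℕ → Ω → ℂ := fun j ω =>
    Complex.exp (Complex.I * ((∑ l, ξ' j l ω * M (C' j l) ω : ℝ) : ℂ))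
  let a : ℕ → Ω → ℂ := fun j ω => Complex.exp
    (∫ z, levyExponent σ2 ρ (∑ l, ξ' j l ω * (C' j l).indicator (fun _ => 1) z) z ∂μ)
  have hu : ∀ j, Measurable[resolutionField P μ M S (τ (j + 1))] (u j) := by
    intro j
    have hsum : Measurable[resolutionField P μ M S (τ (j + 1))]
        fun ω => ∑ l, ξ' j l ω * M (C' j l) ω := by
      refine Finset.measurable_sum _ fun l _ => Measurable.mul ?_ ?_
      · exact (hξm j l).mono (resolutionField_mono hS (hτI _) (hτI _) (hτ j.le_succ)) le_rfl
      · exact measurable_resolutionField hM hS (hτI _) (hCm j l) (hCf j l) fun z hz => hz.2.1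
    exact Complex.measurable_exp.comp
      (measurable_const.mul (Complex.measurable_ofReal.comp hsum))
  have hu1 : ∀ j ω, ‖u j ω‖ = 1 := fun j ω => by
    simp only [u]
    rw [mul_comm, Complex.norm_exp_ofReal_mul_I]
  have ha1 : ∀ j ω, ‖a j ω‖ ≤ 1 := by
    intro j ω
    refine norm_exp_le_one_of_re_nonpos ?_
    have hi := h.integrable_levyExponent_comp hM (memLp_sum_indicator (hCm j) (hCf j)
      fun l => ξ' j l ω)
    rw [← RCLike.re_eq_complex_re, ← integral_re hi]
    exact integral_nonpos fun z => levyExponent_re_nonpos _ z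
  -- The slices are disjoint and cover all the sets C l, so the predictor factorises exactly, for
  -- every ω. The Fourier factor factorises only almost surely, through additivity of M.
  have hR : ∀ ω, Complex.exp
      (∫ z, levyExponent σ2 ρ (∑ l, ξ l ω * (C l).indicator (fun _ => 1) z) z ∂μ) =
      ∏ j ∈ Finset.range L, a j ω := by
    intro ω
    simp only [a]
    rw [← Complex.exp_sum]
    congr 1
    set G : Z → ℝ := fun z => ∑ l, ξ l ω * (C l).indicator (fun _ => 1) z with hGdef
    have hGi := h.integrable_levyExponent_comp hM (memLp_sum_indicator hC hC' fun l => ξ l ω)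
    have hpiece : ∀ j, ∫ z, levyExponent σ2 ρ
        (∑ l, ξ' j l ω * (C' j l).indicator (fun _ => 1) z) z ∂μ =
        ∫ z in Δ j, levyExponent σ2 ρ (G z) z ∂μ := by
      intro j
      rw [← integral_indicator (hΔ j)]
      refine integral_congr_ae (ae_of_all _ fun z => ?_)
      by_cases hz : z ∈ Δ j
      · simp only [hz, Set.indicator_of_mem, hGdef]
        congr 1
        refine Finset.sum_congr rfl fun l _ => ?_
        by_cases hzl : z ∈ C l
        · have h2 : z ∈ C' j l := ⟨hzl, hz⟩
          simp [hzl, h2, ξ', hCΔ l j z hzl hz]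
        · have h2 : z ∉ C' j l := fun h2 => hzl h2.1
          simp [hzl, h2]
      · have h2 : ∀ l, z ∉ C' j l := fun l h2 => hz h2.2
        simp [hz, h2]
    simp_rw [hpiece]
    rw [← integral_biUnion_finset _ (fun j _ => hΔ j) (fun i _ j _ hij => hΔd hij)
      fun j _ => hGi.integrableOn]
    symm
    refine setIntegral_eq_integral_of_forall_compl_eq_zero fun z hz => ?_
    have h0 : ∀ l, z ∉ C l := by
      intro l hzl
      obtain ⟨j, hj, hzj⟩ := hΔex z L (hCt l z hzl) (hSL z)
      exact hz (Set.mem_biUnion (Finset.mem_coe.2 (Finset.mem_range.2 hj)) hzj)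
    simp [h0]
  have hV : (fun ω => ∏ j ∈ Finset.range L, u j ω) =ᵐ[P]
      fun ω => Complex.exp (Complex.I * ((∑ l, ξ l ω * M (C l) ω : ℝ) : ℂ)) := by
    have h1 : ∀ l, M (C l) =ᵐ[P] fun ω => ∑ j ∈ Finset.range L, M (C' j l) ω := by
      intro l
      have := hM.ae_biUnion (D := fun j => C' j l) (fun j => hCm j l) (fun j => hCf j l)
        (fun i j hij => (hΔd hij).mono Set.inter_subset_right Set.inter_subset_right)
        (Finset.range L)
      have hU : ⋃ j ∈ Finset.range L, C' j l = C l := by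
        refine Set.Subset.antisymm (Set.iUnion₂_subset fun j _ => Set.inter_subset_left) ?_
        intro z hz
        obtain ⟨j, hj, hzj⟩ := hΔex z L (hCt l z hz) (hSL z)
        exact Set.mem_biUnion (Finset.mem_coe.2 (Finset.mem_range.2 hj)) ⟨hz, hzj⟩
      rwa [hU] at this
    have h2 : ∀ j l, (fun ω => ξ' j l ω * M (C' j l) ω) =ᵐ[P]
        fun ω => ξ l ω * M (C' j l) ω := by
      intro j l
      by_cases hl : q l ≤ τ j
      · simp [ξ', hl]
      · have hempty : C' j l = ∅ :=
          Set.eq_empty_of_forall_notMem fun z hz => hl (hCΔ l j z hz.1 hz.2)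
        filter_upwards [hM.ae_empty] with ω hω
        rw [hempty, hω, mul_zero, mul_zero]
    filter_upwards [ae_all_iff.2 h1, ae_all_iff.2 fun j => ae_all_iff.2 (h2 j)] with ω h1 h2
    simp only [u, h1, h2]
    rw [← Complex.exp_sum, ← Finset.mul_sum, ← Complex.ofReal_sum, Finset.sum_comm]
    simp_rw [Finset.mul_sum]
  refine ⟨fun ω => ∏ j ∈ Finset.range L, u j ω, ?_, ?_, hV, ?_, ?_⟩
  · exact Finset.measurable_prod _ fun j _ => (hu j).mono completedField_le le_rfl
  · exact fun ω => by rw [norm_prod]; simp [hu1]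
  · simp_rw [hR]
    exact Finset.measurable_prod _ fun j _ => ((hcond j).1).mono completedField_le le_rfl
  · intro ε hε hε1
    obtain ⟨w, hw1, hw2, hw3, hw4⟩ := exists_ratio_of_condExp L
      (fun j => resolutionField P μ M S (τ j))
      (fun i j hij => resolutionField_mono hS (hτI i) (hτI j) (hτ hij))
      (fun j => completedField_le) u a (fun j => (hu j).stronglyMeasurable)
      (fun j => ((hcond j).1).stronglyMeasurable) hu1 (fun j ω => Complex.exp_ne_zero _) ha1
      (fun j => (hcond j).2) hε hε1
    rw [hτ0] at hw3
    simp_rw [hR]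
    exact ⟨w, hw1, hw2, hw3, hw4⟩

theorem exists_simple_of_adaptedGraph (hM : IsIndependentlyScattered P μ M)
    (hS : IsSetResolution μ S) {t : ℝ} (ht : t ∈ Set.Icc (0 : ℝ) 1) {m : ℕ}
    {p : ((Fin (m + 1) → Z) → ℝ) × (Ω → ℝ) × (Ω → Z → ℝ)} (hp : p ∈ adaptedGraph μ M S t m) :
    ∃ (ι : Type) (_ : Fintype ι) (C : ι → Set Z) (q : ι → ℝ) (ξ : ι → Ω → ℝ),
      (∀ l, MeasurableSet (C l)) ∧ (∀ l, μ (C l) < ∞) ∧ (∀ l, q l ∈ Set.Icc t 1) ∧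
      (∀ l, Disjoint (S (q l)) (C l)) ∧
      (∀ l, Measurable[resolutionField P μ M S (q l)] (ξ l)) ∧
      (∀ ω, p.2.1 ω = ∑ l, ξ l ω * M (C l) ω) ∧
      ∀ ω z, p.2.2 ω z = ∑ l, ξ l ω * (C l).indicator (fun _ => (1 : ℝ)) z := by
  induction hp using Submodule.span_induction with
  | mem p hp =>
    obtain ⟨B, hB, rfl⟩ := hp
    obtain ⟨q, h0, h1, h2, h3⟩ := hB.sep
    have hqI := IsSetResolution.rat_mem_Icc h0 h1
    -- The set `B 0` lies after both t and q; at the later of the two the product over the other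
    -- sets is known.
    have hmI : max t (q : ℝ) ∈ Set.Icc (0 : ℝ) 1 :=
      ⟨ht.1.trans (le_max_left _ _), max_le ht.2 hqI.2⟩
    refine ⟨Unit, inferInstance, fun _ => B 0, fun _ => max t (q : ℝ),
      fun _ ω => ((m + 1).factorial : ℝ) * ∏ i : Fin m, M (B i.succ) ω,
      fun _ => hB.measurable 0, fun _ => hB.lt_top 0, fun _ => ⟨le_max_left _ _, hmI.2⟩,
      fun _ => ?_, fun _ => ?_, fun ω => ?_, fun ω z => by simp⟩
    · rcases max_choice t (q : ℝ) with h | h <;> rw [h]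
      exacts [hB.disjoint_zero.symm, h2.symm]
    · refine Measurable.const_mul (Finset.measurable_prod _ fun i _ => ?_) _
      exact measurable_resolutionField hM hS hmI (hB.measurable _) (hB.lt_top _)
        ((h3 i).trans (hS.subset hqI hmI (le_max_right _ _)))
    · simp only [Finset.univ_unique, Finset.sum_singleton, Fin.prod_univ_succ]
      ring
  | zero =>
    exact ⟨Empty, inferInstance, Empty.elim, Empty.elim, Empty.elim, by simp, by simp, by simp,
      by simp, by simp, by simp, by simp⟩
  | add p p' _ _ ih ih' =>
    obtain ⟨ι, _, C, q, ξ, h1, h2, h3, h4, h5, h6, h7⟩ := ih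
    obtain ⟨ι', _, C', q', ξ', h1', h2', h3', h4', h5', h6', h7'⟩ := ih'
    refine ⟨ι ⊕ ι', inferInstance, Sum.elim C C', Sum.elim q q', Sum.elim ξ ξ',
      ?_, ?_, ?_, ?_, ?_, fun ω => ?_, fun ω z => ?_⟩
    · rintro (l | l); exacts [h1 l, h1' l]
    · rintro (l | l); exacts [h2 l, h2' l]
    · rintro (l | l); exacts [h3 l, h3' l]
    · rintro (l | l); exacts [h4 l, h4' l]
    · rintro (l | l); exacts [h5 l, h5' l]
    · simp [h6, h6']
    · simp [h7, h7']
  | smul a p _ ih =>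
    obtain ⟨ι, _, C, q, ξ, h1, h2, h3, h4, h5, h6, h7⟩ := ih
    refine ⟨ι, inferInstance, C, q, fun l ω => a * ξ l ω, h1, h2, h3, h4,
      fun l => (h5 l).const_mul a, fun ω => ?_, fun ω z => ?_⟩
    · simp [h6, Finset.mul_sum, mul_assoc]
    · simp [h7, Finset.mul_sum, mul_assoc]

end Exponent

theorem norm_exp_sub_exp_le {a b : ℂ} (ha : a.re ≤ 0) (hb : b.re ≤ 0) :
    ‖Complex.exp a - Complex.exp b‖ ≤ ‖a - b‖ := by
  have := Convex.norm_image_sub_le_of_norm_deriv_le (𝕜 := ℂ) (f := Complex.exp)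
    (s := {w : ℂ | w.re ≤ 0}) (C := 1) (x := b) (y := a)
    (fun w _ => Complex.differentiableAt_exp)
    (fun w hw => by rw [Complex.deriv_exp]; exact norm_exp_le_one_of_re_nonpos hw)
    (convex_halfSpace_re_le 0) hb ha
  simpa using this

theorem enorm_exp_I_mul_sub_le (r x y : ℝ) :
    ‖Complex.exp (Complex.I * r * x) - Complex.exp (Complex.I * r * y)‖ₑ ≤
      ‖r‖ₑ * ‖x - y‖ₑ := by
  rw [← enorm_mul, enorm_le_iff_norm_le]
  refine (norm_exp_sub_exp_le (by simp) (by simp)).trans (le_of_eq ?_)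
  rw [← mul_sub, ← Complex.ofReal_sub, mul_assoc, ← Complex.ofReal_mul, norm_mul, Complex.norm_I,
    one_mul, Complex.norm_real]

theorem tendstoInMeasure_of_tendsto_integral_norm_sub {Ω E : Type*} [MeasurableSpace Ω]
    {P : Measure Ω} [NormedAddCommGroup E] {F : ℕ → Ω → E} {g : Ω → E}
    (hF : ∀ n, Integrable (F n) P) (hg : Integrable g P)
    (h : Tendsto (fun n => ∫ ω, ‖F n ω - g ω‖ ∂P) atTop (𝓝 0)) :
    TendstoInMeasure P F atTop g := by
  refine tendstoInMeasure_of_tendsto_eLpNorm one_ne_zero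
    (fun n => (hF n).aestronglyMeasurable) hg.aestronglyMeasurable ?_
  have h1 := ENNReal.tendsto_ofReal h
  rw [ENNReal.ofReal_zero] at h1
  refine h1.congr fun n => ?_
  rw [eLpNorm_one_eq_lintegral_enorm]
  exact ofReal_integral_norm_eq_lintegral_enorm ((hF n).sub hg)

/-! ### Comparing a multiple integral and its predictor with simple ones. -/

section Comparison

variable {Ω Z : Type*} [mΩ : MeasurableSpace Ω] [MeasurableSpace Z]
  {P : Measure Ω} [IsProbabilityMeasure P] {μ : Measure Z} [SigmaFinite μ] {M : Set Z → Ω → ℝ}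
  {S : ℝ → Set Z} {σ2 : Z → ℝ≥0} {ρ : Kernel Z ℝ}

theorem integral_levyExponent_re_nonpos (G : Z → ℝ) :
    (∫ z, levyExponent σ2 ρ (G z) z ∂μ).re ≤ 0 := by
  by_cases hi : Integrable (fun z => levyExponent σ2 ρ (G z) z) μ
  · rw [← RCLike.re_eq_complex_re, ← integral_re hi]
    exact integral_nonpos fun z => levyExponent_re_nonpos _ z
  · rw [integral_undef hi, Complex.zero_re]

/-- On A the process K vanishes and the integrand is 2 |H|². Off A, Cauchy–Schwarz bounds the two
summands by the norm of H times δ and by δ². -/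
theorem lintegral_lintegral_mul_le {H K : Ω → Z → ℝ}
    (hH : AEMeasurable (Function.uncurry H) (P.prod μ)) (hK : Measurable (Function.uncurry K))
    {A : Set Z} (hA : MeasurableSet A) (hK0 : ∀ z ∈ A, ∀ ω, K ω z = 0) {δ : ℝ≥0∞}
    (hδ : ∫⁻ z in Aᶜ, eLpNorm (fun ω => H ω z - K ω z) 2 P ^ 2 ∂μ ≤ δ ^ 2) :
    ∫⁻ ω, ∫⁻ z, (‖H ω z‖ₑ + ‖H ω z - K ω z‖ₑ) * ‖H ω z - K ω z‖ₑ ∂μ ∂P ≤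
      2 * ∫⁻ z in A, eLpNorm (fun ω => H ω z) 2 P ^ 2 ∂μ +
        ((∫⁻ z, eLpNorm (fun ω => H ω z) 2 P ^ 2 ∂μ) ^ (1 / 2 : ℝ) + δ) * δ := by
  have hD : AEMeasurable (Function.uncurry fun ω z => H ω z - K ω z) (P.prod μ) :=
    hH.sub hK.aemeasurable
  have hac : ∀ B : Set Z, P.prod (μ.restrict B) ≪ P.prod μ := fun B =>
    Measure.AbsolutelyContinuous.rfl.prod Measure.restrict_le_self.absolutelyContinuous
  have hb : AEMeasurable (fun p : Ω × Z => (‖H p.1 p.2‖ₑ + ‖H p.1 p.2 - K p.1 p.2‖ₑ) *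
      ‖H p.1 p.2 - K p.1 p.2‖ₑ) (P.prod μ) :=
    (hH.enorm.add hD.enorm).mul hD.enorm
  have hsq : ∀ (ν : Measure Z) [SigmaFinite ν] {F : Ω → Z → ℝ},
      AEMeasurable (Function.uncurry F) (P.prod ν) →
      (∫⁻ p, ‖F p.1 p.2‖ₑ ^ (2 : ℝ) ∂(P.prod ν)) ^ (1 / 2 : ℝ) =
        (∫⁻ z, eLpNorm (fun ω => F ω z) 2 P ^ 2 ∂ν) ^ (1 / 2 : ℝ) := by
    intro ν _ F hF
    rw [lintegral_eLpNorm_section hF.aestronglyMeasurable, eLpNorm_two_sq]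
    simp only [ENNReal.rpow_two]
    rfl
  have hHc := hH.mono_ac (hac Aᶜ)
  have hDc := hD.mono_ac (hac Aᶜ)
  have hDδ : (∫⁻ p, ‖H p.1 p.2 - K p.1 p.2‖ₑ ^ (2 : ℝ) ∂(P.prod (μ.restrict Aᶜ))) ^
      (1 / 2 : ℝ) ≤ δ := by
    rw [hsq (μ.restrict Aᶜ) (F := fun ω z => H ω z - K ω z) hDc]
    refine (ENNReal.rpow_le_rpow hδ (by norm_num)).trans (le_of_eq ?_)
    rw [← ENNReal.rpow_natCast, ← ENNReal.rpow_mul]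
    norm_num
  have hHA : (∫⁻ p, ‖H p.1 p.2‖ₑ ^ (2 : ℝ) ∂(P.prod (μ.restrict Aᶜ))) ^ (1 / 2 : ℝ) ≤
      (∫⁻ z, eLpNorm (fun ω => H ω z) 2 P ^ 2 ∂μ) ^ (1 / 2 : ℝ) := by
    rw [hsq (μ.restrict Aᶜ) hHc]
    exact ENNReal.rpow_le_rpow (setLIntegral_le_lintegral _ _) (by norm_num)
  rw [← lintegral_prod _ hb, ← Measure.restrict_add_restrict_compl (μ := μ) hA,
    Measure.prod_add, lintegral_add_measure, Measure.restrict_add_restrict_compl hA]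
  refine add_le_add ?_ ?_
  · rw [lintegral_prod_symm _ (hb.mono_ac (hac A)), ← lintegral_const_mul' _ _ (by norm_num)]
    refine setLIntegral_mono_ae' hA (ae_of_all _ fun z hz => ?_)
    simp only [hK0 z hz, sub_zero, eLpNorm_two_sq]
    rw [← lintegral_const_mul' _ _ (by norm_num)]
    exact le_of_eq (lintegral_congr fun ω => by ring)
  · simp_rw [add_mul]
    refine (lintegral_add_left'
      (f := fun p : Ω × Z => ‖H p.1 p.2‖ₑ * ‖H p.1 p.2 - K p.1 p.2‖ₑ)
      (hHc.enorm.mul hDc.enorm) _).le.trans ?_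
    have hconj : (2 : ℝ).HolderConjugate 2 := Real.HolderConjugate.two_two
    refine add_le_add ?_ ?_
    · exact (ENNReal.lintegral_mul_le_Lp_mul_Lq _ hconj hHc.enorm hDc.enorm).trans
        (mul_le_mul' hHA hDδ)
    · exact (ENNReal.lintegral_mul_le_Lp_mul_Lq _ hconj hDc.enorm hDc.enorm).trans
        (mul_le_mul' hDδ hDδ)

variable [MeasurableSpace.CountablyGenerated Z] [MeasurableSpace.SeparatesPoints Z]
  [NullSingletonClass μ]

/-- The exponential is a contraction on the left half-plane, where the exponents lie, and the
exponent is Lipschitz with constant proportional to the larger frequency; |K| is then bounded by |G|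
+ |G - K|. -/
theorem IsLocalCharacteristics.enorm_exp_integral_sub_le
    (h : IsLocalCharacteristics P μ M σ2 ρ) (hM : IsIndependentlyScattered P μ M) {G K : Z → ℝ}
    (hG : MemLp G 2 μ) (hK : MemLp K 2 μ) (r : ℝ) :
    ‖Complex.exp (∫ z, levyExponent σ2 ρ (r * G z) z ∂μ) -
      Complex.exp (∫ z, levyExponent σ2 ρ (r * K z) z ∂μ)‖ₑ ≤
      2 * ‖r‖ₑ ^ 2 * ∫⁻ z, (‖G z‖ₑ + ‖G z - K z‖ₑ) * ‖G z - K z‖ₑ ∂μ := by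
  calc _ ≤ ‖(∫ z, levyExponent σ2 ρ (r * G z) z ∂μ) -
        ∫ z, levyExponent σ2 ρ (r * K z) z ∂μ‖ₑ :=
        enorm_le_iff_norm_le.2 (norm_exp_sub_exp_le (integral_levyExponent_re_nonpos _)
          (integral_levyExponent_re_nonpos _))
    _ = ‖∫ z, (levyExponent σ2 ρ (r * G z) z - levyExponent σ2 ρ (r * K z) z) ∂μ‖ₑ := by
        rw [integral_sub (h.integrable_levyExponent_comp hM (hG.const_mul r))
          (h.integrable_levyExponent_comp hM (hK.const_mul r))]
    _ ≤ ∫⁻ z, ‖levyExponent σ2 ρ (r * G z) z - levyExponent σ2 ρ (r * K z) z‖ₑ ∂μ :=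
        enorm_integral_le_lintegral_enorm _
    _ ≤ ∫⁻ z, 2 * ‖r‖ₑ ^ 2 * ((‖G z‖ₑ + ‖G z - K z‖ₑ) * ‖G z - K z‖ₑ) ∂μ := by
        refine lintegral_mono_ae ?_
        filter_upwards [h.ae_norm_levyExponent_sub_le hM] with z hz
        have h1 : ‖levyExponent σ2 ρ (r * G z) z - levyExponent σ2 ρ (r * K z) z‖ ≤
            2 * |r| ^ 2 * ((|G z| + |G z - K z|) * |G z - K z|) := by
          refine (hz _ _).trans ?_
          have h2 : max |r * G z| |r * K z| ≤ |r| * (|G z| + |G z - K z|) := by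
            rw [abs_mul, abs_mul]
            refine max_le (mul_le_mul_of_nonneg_left (by linarith [abs_nonneg (G z - K z)])
              (abs_nonneg r)) (mul_le_mul_of_nonneg_left ?_ (abs_nonneg r))
            have := abs_sub_abs_le_abs_sub (K z) (G z)
            rw [abs_sub_comm] at this
            linarith
          have h3 : |r * G z - r * K z| = |r| * |G z - K z| := by rw [← mul_sub, abs_mul]
          rw [h3]
          calc 2 * (max |r * G z| |r * K z| * (|r| * |G z - K z|))
              ≤ 2 * (|r| * (|G z| + |G z - K z|) * (|r| * |G z - K z|)) := by gcongr
            _ = _ := by ring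
        rw [← ofReal_norm]
        refine (ENNReal.ofReal_le_ofReal h1).trans (le_of_eq ?_)
        rw [ENNReal.ofReal_mul (by positivity), ENNReal.ofReal_mul (by positivity),
          ENNReal.ofReal_mul (by positivity), ENNReal.ofReal_add (by positivity) (by positivity),
          ENNReal.ofReal_pow (by positivity)]
        simp only [← Real.enorm_eq_ofReal_abs]
        norm_num
    _ = _ := lintegral_const_mul' _ _ (by finiteness)

variable {m : ℕ} {f : (Fin (m + 1) → Z) → ℝ}

/-- Approximation of the Fourier transform of a multiple integral, and of its predictor, by a pair
whose ratio is bounded and has conditional mean one. -/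
theorem exists_ratio_approximation (hM : IsIndependentlyScattered P μ M)
    (hS : IsSetResolution μ S) (h : IsLocalCharacteristics P μ M σ2 ρ) (hf : IsSymmKernel μ f)
    {t : ℝ} (ht : t ∈ Set.Icc (0 : ℝ) 1) (r : ℝ) {E : ℝ≥0∞}
    (hE : E = (m + 1).factorial * eLpNorm ((Set.univ.pi fun _ => S t).indicator f) 2
      (Measure.pi fun _ => μ) ^ 2) {δ : ℝ≥0∞} (hδ : 0 < δ) :
    ∃ V R : Ω → ℂ, Measurable V ∧ (∀ ω, ‖V ω‖ ≤ 1) ∧ Measurable R ∧ (∀ ω, ‖R ω‖ ≤ 1) ∧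
      (∀ ε : ℝ, 0 < ε → ε ≤ 1 → ∃ w : Ω → ℂ, Measurable w ∧ (∀ ω, ‖w ω‖ ≤ 1 / ε) ∧
        P[w | resolutionField P μ M S t] =ᵐ[P] (fun _ => 1) ∧
        ∀ ω, ε ≤ ‖R ω‖ → w ω * R ω = V ω) ∧
      ∫⁻ ω, ‖Complex.exp (Complex.I * r * multipleIntegral P μ M (m + 1) f ω) - V ω‖ₑ ∂P ≤
        ‖r‖ₑ * (E ^ (1 / 2 : ℝ) + δ) ∧
      ∫⁻ ω, ‖Complex.exp (∫ z, levyExponent σ2 ρ (r * adaptedIntegrand P μ M S m f ω z) z ∂μ) -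
        R ω‖ₑ ∂P ≤ 2 * ‖r‖ₑ ^ 2 * (2 * E + δ) := by
  set N := (∫⁻ z, eLpNorm (fun ω => adaptedIntegrand P μ M S m f ω z) 2 P ^ 2 ∂μ) ^ (1 / 2 : ℝ)
    with hN
  have hNlt := lintegral_adaptedIntegrand_lt_top hM hS hf
  have hN' : N < ∞ := ENNReal.rpow_lt_top_of_nonneg (by norm_num) hNlt.ne
  have hN1 : N + 1 ≠ ∞ := by finiteness
  -- Each bound has a use: η ≤ δ for the integral, while η ≤ 1 and η ≤ δ/(N + 1) give (N + η) η ≤ δ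
  -- for the predictor.
  set η := min δ (min 1 (δ / (N + 1))) with hη
  have hη0 : 0 < η :=
    lt_min hδ (lt_min zero_lt_one (ENNReal.div_pos hδ.ne' hN1))
  have hηN : (N + η) * η ≤ δ := calc
    (N + η) * η ≤ (N + 1) * (δ / (N + 1)) :=
      mul_le_mul' (add_le_add le_rfl ((min_le_right _ _).trans (min_le_left _ _)))
        ((min_le_right _ _).trans (min_le_right _ _))
    _ = δ := ENNReal.mul_div_cancel (by simp) hN1
  obtain ⟨p, hp, hp1, hp2⟩ := exists_adaptedGraph_approximation hM hS hf ht hη0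
  obtain ⟨ι, _, C, q, ξ, hC, hC', hq, hqC, hξ, hpI, hpH⟩ := exists_simple_of_adaptedGraph hM hS ht hp
  -- The frequency r is absorbed in the coefficients.
  obtain ⟨V, hV, hV1, hVp, hR, hw⟩ := exists_ratio_of_simple hM hS h ht hC hC' hq hqC
    (ξ := fun l ω => r * ξ l ω) fun l => (hξ l).const_mul r
  obtain ⟨hHm, -⟩ := adaptedIntegrand_spec hM hS hf
  obtain ⟨hpm, hp0⟩ := adaptedGraph_measurable hM hp
  have hI := isMultipleIntegral_multipleIntegral_of_symm hM hS hf.memLp hf.symm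
  have hpe := (elementaryGraph_properties hM (adaptedGraph_elementary hp)).2.2.1
  have hsum : ∀ ω z, ∑ l, r * ξ l ω * (C l).indicator (fun _ => (1 : ℝ)) z = r * p.2.2 ω z := by
    intro ω z
    rw [hpH, Finset.mul_sum]
    exact Finset.sum_congr rfl fun l _ => mul_assoc _ _ _
  simp_rw [hsum] at hR hw
  refine ⟨V, _, hV, hV1, hR, fun ω => norm_exp_le_one_of_re_nonpos
    (integral_levyExponent_re_nonpos _), hw, ?_, ?_⟩
  · calc ∫⁻ ω, ‖Complex.exp (Complex.I * r * multipleIntegral P μ M (m + 1) f ω) - V ω‖ₑ ∂P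
        ≤ ∫⁻ ω, ‖r‖ₑ * ‖multipleIntegral P μ M (m + 1) f ω - p.2.1 ω‖ₑ ∂P := by
          refine lintegral_mono_ae ?_
          filter_upwards [hVp] with ω hω
          have : ∑ l, r * ξ l ω * M (C l) ω = r * p.2.1 ω := by
            rw [hpI, Finset.mul_sum]
            exact Finset.sum_congr rfl fun l _ => mul_assoc _ _ _
          rw [hω, this, Complex.ofReal_mul, ← mul_assoc]
          exact enorm_exp_I_mul_sub_le _ _ _
      _ = ‖r‖ₑ * eLpNorm (fun ω => multipleIntegral P μ M (m + 1) f ω - p.2.1 ω) 1 P := by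
          rw [lintegral_const_mul' _ _ (by finiteness), eLpNorm_one_eq_lintegral_enorm]
      _ ≤ ‖r‖ₑ * eLpNorm (fun ω => multipleIntegral P μ M (m + 1) f ω - p.2.1 ω) 2 P := by
          gcongr
          exact eLpNorm_le_eLpNorm_of_exponent_le (by norm_num)
            (hI.1.sub hpe).aestronglyMeasurable
      _ ≤ ‖r‖ₑ * (E ^ (1 / 2 : ℝ) + δ) := by
          gcongr
          rw [hE]
          exact hp1.trans (add_le_add le_rfl (min_le_left _ _))
  -- Finite total energy gives, by Fubini, square integrable paths, as the pathwise comparison of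
  -- exponents requires.
  · have hHL : ∀ᵐ ω ∂P, MemLp (fun z => adaptedIntegrand P μ M S m f ω z) 2 μ := by
      have h1 : ∫⁻ ω, ∫⁻ z, ‖adaptedIntegrand P μ M S m f ω z‖ₑ ^ 2 ∂μ ∂P < ∞ := by
        rw [lintegral_lintegral_swap (hHm.enorm.pow_const 2)]
        simp_rw [← eLpNorm_two_sq]
        exact hNlt
      filter_upwards [hHm.aestronglyMeasurable.prodMk_left,
        ae_lt_top' (hHm.enorm.pow_const 2).lintegral_prod_right' h1.ne] with ω h2 h3
      refine ⟨h2, ?_⟩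
      have h4 : eLpNorm (fun z => adaptedIntegrand P μ M S m f ω z) 2 μ ^ 2 < ∞ := by
        rw [eLpNorm_two_sq]
        exact h3
      exact (ENNReal.pow_lt_top_iff.1 h4).resolve_right (by norm_num)
    have hpL : ∀ ω, MemLp (fun z => p.2.2 ω z) 2 μ := fun ω => by
      simp_rw [hpH]
      exact memLp_sum_indicator hC hC' fun l => ξ l ω
    calc _ ≤ ∫⁻ ω, 2 * ‖r‖ₑ ^ 2 * ∫⁻ z, (‖adaptedIntegrand P μ M S m f ω z‖ₑ +
            ‖adaptedIntegrand P μ M S m f ω z - p.2.2 ω z‖ₑ) *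
            ‖adaptedIntegrand P μ M S m f ω z - p.2.2 ω z‖ₑ ∂μ ∂P := by
          refine lintegral_mono_ae ?_
          filter_upwards [hHL] with ω hω
          exact h.enorm_exp_integral_sub_le hM hω (hpL ω) r
      _ ≤ 2 * ‖r‖ₑ ^ 2 * (2 * ∫⁻ z in S t,
            eLpNorm (fun ω => adaptedIntegrand P μ M S m f ω z) 2 P ^ 2 ∂μ + (N + η) * η) := by
          rw [lintegral_const_mul' _ _ (by finiteness)]
          gcongr
          exact lintegral_lintegral_mul_le hHm hpm (hS.measurable t ht) hp0 hp2
      _ ≤ 2 * ‖r‖ₑ ^ 2 * (2 * E + δ) := by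
          gcongr
          rw [hE]
          exact setLIntegral_adaptedIntegrand_le hM hS hf ht

theorem isLocalCharacteristics_localCharacteristics (hM : IsIndependentlyScattered P μ M) :
    IsLocalCharacteristics P μ M (localCharacteristics P μ M).1 (localCharacteristics P μ M).2 := by
  have h := hM.exists_isLocalCharacteristics
  rw [localCharacteristics, dif_pos h]
  exact h.choose_spec

/-- The predictor of the Fourier transform is a random variable. -/
theorem aestronglyMeasurable_exp_integral (hM : IsIndependentlyScattered P μ M)
    (hS : IsSetResolution μ S) (h : IsLocalCharacteristics P μ M σ2 ρ) (hf : IsSymmKernel μ f)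
    (r : ℝ) : AEStronglyMeasurable (fun ω => Complex.exp
      (∫ z, levyExponent σ2 ρ (r * adaptedIntegrand P μ M S m f ω z) z ∂μ)) P := by
  refine Complex.continuous_exp.comp_aestronglyMeasurable ?_
  refine AEStronglyMeasurable.integral_prod_right' (ν := μ)
    (f := fun p : Ω × Z => levyExponent σ2 ρ (r * adaptedIntegrand P μ M S m f p.1 p.2) p.2) ?_
  exact (h.measurable_levyExponent.comp_aemeasurable
    (((adaptedIntegrand_spec hM hS hf).1.const_mul r).prodMk
      measurable_snd.aemeasurable)).aestronglyMeasurable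

end Comparison

end

/-! ### The main theorem. -/

theorem theorem15 {Ω : Type*} [MeasurableSpace Ω] (P : Measure Ω) [IsProbabilityMeasure P]
    (Z : ℕ → Type*) [∀ n, MeasurableSpace (Z n)] [∀ n, StandardBorelSpace (Z n)]
    (μ : ∀ n, Measure (Z n)) [∀ n, SigmaFinite (μ n)] [∀ n, NullSingletonClass (μ n)]
    (M : ∀ n, Set (Z n) → Ω → ℝ) (hM : ∀ n, IsIndependentlyScattered P (μ n) (M n))
    (S : ∀ n, ℝ → Set (Z n)) (hS : ∀ n, IsSetResolution (μ n) (S n))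
    -- the order of the integral is `d n = m n + 1`
    (m : ℕ → ℕ) (f : ∀ n, (Fin (m n + 1) → Z n) → ℝ) (hf : ∀ n, IsSymmKernel (μ n) (f n))
    (t : ℕ → ℝ) (ht : ∀ n, t n ∈ Set.Icc (0 : ℝ) 1)
    (U : ℕ → MeasurableSpace Ω)
    (hvanish : Tendsto (fun n => (Nat.factorial (m n + 1) : ℝ≥0∞) *
      eLpNorm ((Set.univ.pi fun _ => S n (t n)).indicator (f n)) 2
        (Measure.pi fun _ => μ n) ^ 2) atTop (𝓝 0))
    (hnest : ∀ n, U n ≤ U (n + 1) ⊓ resolutionField P (μ n) (M n) (S n) (t n))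
    (φ : ℝ → Ω → ℂ) (ν : Ω → Measure ℝ) (hφ : IsNonvanishingRandomCharFun P φ ν)
    (hφU : ∀ r : ℝ, Measurable[completedField P (⨆ n, U n)] (φ r))
    (hconv : ∀ r : ℝ, TendstoInMeasure P
      (fun n ω => Complex.exp (∫ z, localExponent P (μ n) (M n)
        (r * adaptedIntegrand P (μ n) (M n) (S n) (m n) (f n) ω z) z ∂(μ n)))
      atTop (φ r)) :
    (∀ r : ℝ, TendstoInMeasure P
      (fun n => P[fun ω => Complex.exp
          (Complex.I * r * multipleIntegral P (μ n) (M n) (m n + 1) (f n) ω) |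
        resolutionField P (μ n) (M n) (S n) (t n)])
      atTop (φ r)) ∧
    StablyConverges P (completedField P (⨆ n, U n))
      (fun n => multipleIntegral P (μ n) (M n) (m n + 1) (f n)) ν := by
  have hU : Monotone U := monotone_nat_of_le_succ fun n => (hnest n).trans inf_le_left
  have hUF : ∀ n, U n ≤ resolutionField P (μ n) (M n) (S n) (t n) :=
    fun n => (hnest n).trans inf_le_right
  have hF : ∀ n, resolutionField P (μ n) (M n) (S n) (t n) ≤ ‹MeasurableSpace Ω› :=
    fun n => completedField_le
  have hφm : ∀ r, Measurable (φ r) := fun r => hφ.measurable.comp measurable_prodMk_left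
  have hφ1 : ∀ r, ∀ᵐ ω ∂P, ‖φ r ω‖ ≤ 1 := by
    intro r
    filter_upwards [hφ.eq_fourier, hφ.randomProbability.2] with ω hω hν
    rw [hω r]
    simpa using norm_integral_le_of_norm_le_const (μ := ν ω)
      (f := fun x : ℝ => Complex.exp (Complex.I * r * x)) (C := 1)
      (ae_of_all _ fun x => (norm_exp_I_mul_mul r x).le)
  have hφ0 : ∀ r, ∀ᵐ ω ∂P, φ r ω ≠ 0 := fun r => hφ.ne_zero.mono fun ω hω => hω r
  have hφi : ∀ r, Integrable (φ r) P := fun r =>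
    .of_bound (hφm r).aestronglyMeasurable 1 (hφ1 r)
  set W : ℝ → ℕ → Ω → ℂ := fun r n ω =>
    Complex.exp (Complex.I * r * multipleIntegral P (μ n) (M n) (m n + 1) (f n) ω) with hW
  have hWm : ∀ r n, Measurable (W r n) := fun r n =>
    Complex.measurable_exp.comp (measurable_const.mul (Complex.measurable_ofReal.comp
      (isMultipleIntegral_multipleIntegral_of_symm (hM n) (hS n) (hf n).memLp (hf n).symm).1))
  have hW1 : ∀ r n ω, ‖W r n ω‖ ≤ 1 := fun r n ω => (norm_exp_I_mul_mul _ _).le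
  have hWi : ∀ r n, Integrable (W r n) P := fun r n =>
    .of_bound (hWm r n).aestronglyMeasurable 1 (ae_of_all _ (hW1 r n))
  -- Convergence of the conditional Fourier transforms holds even in L¹, and both conclusions are
  -- read off from it.
  have key : ∀ r, Tendsto (fun n => ∫ ω, ‖(P[W r n |
      resolutionField P (μ n) (M n) (S n) (t n)]) ω - φ r ω‖ ∂P) atTop (𝓝 0) := by
    intro r
    have hloc := fun n => isLocalCharacteristics_localCharacteristics (hM n)
    set X : ℕ → Ω → ℂ := fun n ω => Complex.exp (∫ z, levyExponent
      (localCharacteristics P (μ n) (M n)).1 (localCharacteristics P (μ n) (M n)).2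
      (r * adaptedIntegrand P (μ n) (M n) (S n) (m n) (f n) ω z) z ∂(μ n)) with hX
    have hXm : ∀ n, AEStronglyMeasurable (X n) P := fun n =>
      aestronglyMeasurable_exp_integral (hM n) (hS n) (hloc n) (hf n) r
    have hX1 : ∀ n ω, ‖X n ω‖ ≤ 1 := fun n ω =>
      norm_exp_le_one_of_re_nonpos (integral_levyExponent_re_nonpos _)
    have hXi : ∀ n, Integrable (X n) P := fun n => .of_bound (hXm n) 1 (ae_of_all _ (hX1 n))
    have hδ : Tendsto (fun n : ℕ => (((n : ℝ≥0∞) + 1)⁻¹)) atTop (𝓝 0) :=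
      tendsto_of_tendsto_of_tendsto_of_le_of_le tendsto_const_nhds
        ENNReal.tendsto_inv_nat_nhds_zero (fun _ => zero_le)
        fun n => ENNReal.inv_le_inv.2 le_self_add
    -- The accuracy 1/(n + 1) tends to zero with n; what remains of the error is governed by the
    -- vanishing energy of the kernel before t n.
    choose V R hV hV1 hR hR1 hw hWV hXR using fun n =>
      exists_ratio_approximation (hM n) (hS n) (hloc n) (hf n) (ht n) r rfl
        (δ := ((n : ℝ≥0∞) + 1)⁻¹) (ENNReal.inv_pos.2 (by finiteness))
    have hVi : ∀ n, Integrable (V n) P := fun n =>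
      .of_bound (hV n).aestronglyMeasurable 1 (ae_of_all _ (hV1 n))
    have hRi : ∀ n, Integrable (R n) P := fun n =>
      .of_bound (hR n).aestronglyMeasurable 1 (ae_of_all _ (hR1 n))
    have hWV' : Tendsto (fun n => ∫ ω, ‖W r n ω - V n ω‖ ∂P) atTop (𝓝 0) := by
      have hlim := ENNReal.Tendsto.const_mul (a := ‖r‖ₑ)
        ((hvanish.ennrpow_const (1 / 2 : ℝ)).add hδ) (Or.inr (by finiteness))
      rw [ENNReal.zero_rpow_of_pos (by norm_num), add_zero, mul_zero] at hlim
      have := tendsto_of_tendsto_of_tendsto_of_le_of_le tendsto_const_nhds hlim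
        (fun _ => zero_le) hWV
      refine ((ENNReal.tendsto_toReal ENNReal.zero_ne_top).comp this).congr fun n => ?_
      exact (integral_norm_eq_lintegral_enorm
        ((hWi r n).sub (hVi n)).aestronglyMeasurable).symm
    have hXR' : Tendsto (fun n => ∫ ω, ‖R n ω - X n ω‖ ∂P) atTop (𝓝 0) := by
      have hlim := ENNReal.Tendsto.const_mul (a := 2 * ‖r‖ₑ ^ 2)
        ((ENNReal.Tendsto.const_mul (a := 2) hvanish (Or.inr (by finiteness))).add hδ)
        (Or.inr (by finiteness))
      rw [mul_zero, add_zero, mul_zero] at hlim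
      have := tendsto_of_tendsto_of_tendsto_of_le_of_le tendsto_const_nhds hlim
        (fun _ => zero_le) hXR
      refine ((ENNReal.tendsto_toReal ENNReal.zero_ne_top).comp this).congr fun n => ?_
      simp_rw [norm_sub_rev (R n _)]
      exact (integral_norm_eq_lintegral_enorm ((hXi n).sub (hRi n)).aestronglyMeasurable).symm
    have hXφ := tendsto_integral_norm_sub_of_tendstoInMeasure hXm (hφm r).aestronglyMeasurable
      (fun n => ae_of_all _ (hX1 n)) (hφ1 r) (hconv r)
    have hRφ : TendstoInMeasure P R atTop (φ r) := by
      have h1 : Tendsto (fun n => ∫ ω, ‖R n ω - φ r ω‖ ∂P) atTop (𝓝 0) := by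
        have h2 := hXR'.add hXφ
        rw [add_zero] at h2
        exact squeeze_zero (fun n => integral_nonneg fun _ => norm_nonneg _)
          (fun n => integral_norm_sub_le_add (hRi n) (hXi n) (hφi r)) h2
      exact tendstoInMeasure_of_tendsto_integral_norm_sub hRi (hφi r) h1
    have hVφ := tendsto_integral_norm_condExp_sub_limit hU hUF hF (hφm r) (hφU r) (hφ1 r) (hφ0 r)
      hV hV1 hR hR1 hw hRφ
    have h2 := hWV'.add hVφ
    rw [add_zero] at h2
    refine squeeze_zero (fun n => integral_nonneg fun _ => norm_nonneg _) (fun n => ?_) h2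
    -- Conditional expectation contracts L¹, so replacing W by V costs at most their L¹ distance.
    refine (integral_norm_sub_le_add integrable_condExp integrable_condExp (hφi r)).trans
      (add_le_add_left ?_ _)
    refine le_trans (le_of_eq ?_) (integral_norm_condExp_le (m := resolutionField P (μ n) (M n)
      (S n) (t n)) fun ω => W r n ω - V n ω)
    refine integral_congr_ae ?_
    filter_upwards [condExp_sub (hWi r n) (hVi n)
      (resolutionField P (μ n) (M n) (S n) (t n))] with ω hω
    exact congrArg norm hω.symm
  refine ⟨fun r => tendstoInMeasure_of_tendsto_integral_norm_sub
    (fun n => integrable_condExp) (hφi r) (key r), ?_⟩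
  rintro r Y hY ⟨C, hC⟩
  have hlim := tendsto_integral_mul_of_tendsto_condExp hU hUF hF (hφi r) (hWm r) (hW1 r) (key r)
    (Complex.measurable_ofReal.comp hY) (C := C) fun ω => by simpa using hC ω
  have hYφ : ∫ ω, (Y ω : ℂ) * (∫ x : ℝ, Complex.exp (Complex.I * r * x) ∂(ν ω)) ∂P =
      ∫ ω, (Complex.ofReal ∘ Y) ω * φ r ω ∂P := by
    refine integral_congr_ae ?_
    filter_upwards [hφ.eq_fourier] with ω hω
    rw [Function.comp_apply, hω r]
  rw [hYφ]
  exact hlim
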